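/- **Setting.** Names form a countably infinite set $\mathcal N$. A nominal set is a set with an action of name permutations in which every element $X$ has a finite support $n(X)$; $a\# X$ means $a\notin n(X)$. A *psi-calculus* consists of nominal sets $\mathbf T$ (terms, containing the names), $\mathbf C$ (conditions), $\mathbf A$ (assertions), equivariant operators $\dot\leftrightarrow:\mathbf T\times\mathbf T\to\mathbf C$, $\otimes:\mathbf A\times\mathbf A\to\mathbf A$, $\mathbf 1\in\mathbf A$, $\vdash\;\subseteq\mathbf A\times\mathbf C$, and on each of the three sets a substitution function $X\mapsto X\sigma$, for $\sigma:\mathcal N\to\mathbf T$ equal to the identity outside a finite set. Write $\Psi\simeq\Psi'$ if $\Psi,\Psi'$ entail the same conditions. The requisites are: $\Psi\vdash M\dot\leftrightarrow N$ is symmetric and transitive in $M,N$; weakening: $\Psi\vdash\varphi$ implies $\Psi\otimes\Psi'\vdash\varphi$; $\otimes$ respects $\simeq$ and is, up to $\simeq$, associative and commutative with unit $\mathbf 1$. Substitution is a lawful one: it is equivariant, $X\,\mathrm{id}=X$, $X\sigma$ depends only on the restriction of $\sigma$ to $n(X)$, $(X\sigma)\tau=X(\sigma\tau)$ with $(\sigma\tau)(a)=\sigma(a)\tau$,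 $X[b/a]=(a\;b)\cdot X$ if $b\# X$, $n(\sigma(a))\subseteq n(X\sigma)$ if $a\in n(X)$, $a\sigma=\sigma(a)$ for names $a$, and it commutes with $\dot\leftrightarrow,\otimes,\mathbf 1$. A *nominal data type* is any nominal set with a substitution function satisfying the first six laws. **Agents**, up to alpha-equivalence: $P::=\overline M N.P\mid \underline M(x).P\mid \mathbf{case}\ \varphi_1:P_1[]\cdots[]\varphi_n:P_n\mid(\nu a)P\mid P|Q\mid\,!P\mid(\!|\Psi|\!)$, where $x$ and $a$ bind in $P$, and where no assertion that is not below an input or output prefix occurs in the body of a replication or in a branch of a **case**. $P\sigma$ is capture-avoiding. *Frames* are expressions $(\nu\tilde b)\Psi$ up to alpha-equivalence; $\mathcal F(P|Q)=\mathcal F(P)\otimes\mathcal F(Q)$ (extruding scopes), $\mathcal F((\nu b)P)=(\nu b)\mathcal F(P)$, $\mathcal F((\!|\Psi|\!))=\Psi$, and $\mathcal F(P)=\mathbf 1$ for the other forms. $F\vdash\varphi$ iff $F=(\nu\tilde b)\Psi$ for some $\tilde b\#\varphi$ and $\Psi\vdash\varphi$; $F\simeq G$ iff $F,G$ entail the same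 conditions. Below $\mathcal F(P)=(\nu\tilde b_P)\Psi_P$ and $\mathcal F(Q)=(\nu\tilde b_Q)\Psi_Q$. **Concrete (late) transitions** $\Psi\rhd P\xrightarrow{\alpha}P'$, with actions $\overline M(\nu\tilde a)N$, $\underline M(x)$, $\tau$ (bound names $\mathrm{bn}(\alpha)=\tilde a,\{x\},\emptyset$; $M$ is the subject), identified up to renaming of $\mathrm{bn}(\alpha)$ in object and derivative, are generated by: - In: $\underline M(x).P\xrightarrow{\underline K(x)}P$ and Out: $\overline MN.P\xrightarrow{\overline KN}P$, if $\Psi\vdash M\dot\leftrightarrow K$. - Case: an action of $P_i$, if $\Psi\vdash\varphi_i$. - Par: if $\Psi_Q\otimes\Psi\rhd P\xrightarrow{\alpha}P'$, $\mathrm{bn}(\alpha)\# Q$ and $\tilde b_Q\#\Psi,P,\alpha$, then $\Psi\rhd P|Q\xrightarrow{\alpha}P'|Q$. - Com: if $\Psi_Q\otimes\Psi\rhd P\xrightarrow{\overline M(\nu\tilde a)N}P'$, $\Psi_P\otimes\Psi\rhd Q\xrightarrow{\underline K(x)}Q'$, $\Psi\otimes\Psi_P\otimes\Psi_Q\vdash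 M\dot\leftrightarrow K$, $\tilde a\# Q$, $\tilde b_P\#\Psi,\tilde b_Q,Q,M,P$ and $\tilde b_Q\#\Psi,\tilde b_P,P,K,Q$, then $\Psi\rhd P|Q\xrightarrow{\tau}(\nu\tilde a)(P'|Q'[N/x])$. - Scope: if $\Psi\rhd P\xrightarrow{\alpha}P'$ and $b\#\alpha,\Psi$, then $\Psi\rhd(\nu b)P\xrightarrow{\alpha}(\nu b)P'$. - Open: if $\Psi\rhd P\xrightarrow{\overline M(\nu\tilde a)N}P'$, $b\in n(N)$ and $b\#\tilde a,\Psi,M$, then $\Psi\rhd(\nu b)P\xrightarrow{\overline M(\nu\tilde a\cup\{b\})N}P'$ ($b$ inserted anywhere in $\tilde a$). - Rep: an action of $P|!P$ is one of $!P$. The symmetric versions of Par and Com are included. A *concrete (early) bisimulation* is a set $\mathcal R$ of triples (assertion, agent, agent) such that $(\Psi,P,Q)\in\mathcal R$ implies: (1) $\Psi\otimes\mathcal F(P)\simeq\Psi\otimes\mathcal F(Q)$; (2) $(\Psi,Q,P)\in\mathcal R$; (3) $(\Psi\otimes\Psi',P,Q)\in\mathcal R$ for all $\Psi'$; (4) if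 $\Psi\rhd P\xrightarrow{\alpha}P'$ and $\mathrm{bn}(\alpha)\#\Psi,Q$, then, for $\alpha=\underline M(x)$, for every term $L$ there is $Q'$ with $\Psi\rhd Q\xrightarrow{\alpha}Q'$ and $(\Psi,P'[L/x],Q'[L/x])\in\mathcal R$, and, for other $\alpha$, there is $Q'$ with $\Psi\rhd Q\xrightarrow{\alpha}Q'$ and $(\Psi,P',Q')\in\mathcal R$. **Constraints** are finite conjunctions ($\wedge$ associative) of atomic constraints $(\nu\tilde a)[\![\Psi\vdash\varphi]\!]$ (up to alpha-equivalence), $[\![M=N]\!]$, and $[\![a\#X]\!]$ with $X$ an agent or an element of a nominal data type. Solutions are pairs $(\sigma,\Psi')$: of $(\nu\tilde a)[\![\Psi\vdash\varphi]\!]$ if, for an alpha-variant with $\tilde a\#\sigma,\Psi'$, $\Psi\sigma\otimes\Psi'\vdash\varphi\sigma$; of $[\![M=N]\!]$ if $M\sigma=N\sigma$; of $[\![a\#X]\!]$ if $a\# X\sigma$; of a conjunction if of all conjuncts. Write $(\sigma,\Psi)\models C$. $C\Rightarrow D$ means that all solutions of $C$ are solutions of $D$; $C\Rightarrow\bigvee\widehat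 C$ that every solution of $C$ is one of some member of $\widehat C$. $(\nu\tilde a)$ distributes over $\wedge$. **Symbolic transitions** $\Psi\rhd P\xrightarrow[C]{\alpha}P'$ have names $y$ as subjects and conjunctions $C$ of atomic constraints. They are identified up to renaming of $\mathrm{bn}(\alpha)$ in object and derivative, and are generated by: - In: $\underline M(x).P\xrightarrow{\underline y(x)}P$ with $C=[\![\Psi\vdash M\dot\leftrightarrow y]\!]$, $y\#\Psi,M,P,x$; Out: $\overline MN.P\xrightarrow{\overline yN}P$ with the same $C$, $y\#\Psi,M,N,P$. - Case: an action of $P_i$ with constraint $C$ gives one of the **case** agent with constraint $C\wedge[\![\Psi\vdash\varphi_i]\!]$. - Par: from $P$'s transition in $\Psi\otimes\Psi_Q$ with constraint $C$, if $\mathrm{bn}(\alpha)$ and the subject are fresh for $Q$ and $\tilde b_Q\#\Psi,P,\alpha$: $P|Q\xrightarrow{\alpha}P'|Q$ with $(\nu\tilde b_Q)C$. - Com: from $\Psi\otimes\Psi_Q\rhd P\xrightarrow{\overline y(\nu\tilde a)N}P'$ with constraint $(\nu\tilde c_P)[\![\Psi'\vdash M_P\dot\leftrightarrow y]\!]\wedge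 C_P$ and $\Psi\otimes\Psi_P\rhd Q\xrightarrow{\underline z(x)}Q'$ with constraint $(\nu\tilde c_Q)[\![\Psi'\vdash M_Q\dot\leftrightarrow z]\!]\wedge C_Q$, where $\Psi'=\Psi\otimes\Psi_P\otimes\Psi_Q$ and in the premises $\Psi'$ is read up to the abelian monoid laws of $\otimes,\mathbf 1$: $\Psi\rhd P|Q\xrightarrow{\tau}(\nu\tilde a)(P'|Q'[N/x])$ with constraint $(\nu\tilde c_P\tilde c_Q)\big([\![\Psi'\vdash M_P\dot\leftrightarrow M_Q]\!]\wedge C_P\wedge C_Q\big)$. Side conditions: $\tilde a\# Q$; $\tilde b_P\subseteq\tilde c_P$, $\tilde b_Q\subseteq\tilde c_Q$; $\tilde c_P\#\Psi,P,Q,\tilde b_Q,\tilde c_Q,M_Q$ and $\tilde c_Q\#\Psi,P,Q,\tilde b_P,\tilde c_P,M_P$; $y\neq z$ and $y,z\#N,\tilde a,\Psi,P,Q,\tilde b_P,\tilde b_Q,\tilde c_P,\tilde c_Q,M_P,M_Q$. - Scope: as before with $a\#\alpha,\Psi$ and constraint $(\nu a)C$; Open: as before with $a\in n(N)$, $a\#\tilde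 a,\Psi,y$ and constraint $(\nu a)C$; Rep: as before. The symmetric versions of Par and Com are included. A *symbolic bisimulation* is a set $\mathcal S$ of triples (constraint, agent, agent) such that $(C,P,Q)\in\mathcal S$ implies: (1) $\Psi\otimes\mathcal F(P)\sigma\simeq\Psi\otimes\mathcal F(Q)\sigma$ for all $(\sigma,\Psi)\models C$; (2) $(C,Q,P)\in\mathcal S$; (3) if $\mathbf 1\rhd P\xrightarrow[C_P]{\alpha}P'$, with $\mathrm{bn}(\alpha)$ fresh for $P,Q,C,C_P$ and the subject of $\alpha$, and the subject of $\alpha$ fresh for $P,Q,C$, then there is a set $\widehat C$ of constraints with $C\wedge C_P\Rightarrow\bigvee\widehat C$ such that for every $C'\in\widehat C$ there are $Q',\alpha',C_Q$ with $\mathbf 1\rhd Q\xrightarrow[C_Q]{\alpha'}Q'$, $C'\Rightarrow C_Q$, and: if $\alpha=\overline y(\nu\tilde a)N$ then $\alpha'=\overline y(\nu\tilde a)N'$ for some $N'$ with $C'\Rightarrow[\![N=N']\!]$ and $(C'\wedge[\![\tilde a\#P,Q]\!],P',Q')\in\mathcal S$; otherwise $\alpha'=\alpha$ and $(C',P',Q')\in\mathcal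 S$. **Theorem (Soundness).** Let $\mathcal S$ be a symbolic bisimulation of a psi-calculus, and let $$\mathcal R=\{(\Psi,P\sigma,Q\sigma):\ \exists C.\ (\sigma,\Psi)\models C\ \text{and}\ (C,P,Q)\in\mathcal S\}.$$ Then $\mathcal R$ is a concrete (early) bisimulation. -/

import Mathlib

universe u

namespace SymPsi

/-! ## Names, nominal sets, substitutions -/

/-- The countably infinite set of atomic names. -/
def Name : Type := ℕ

instance : DecidableEq Name := inferInstanceAs (DecidableEq ℕ)
instance : Infinite Name := inferInstanceAs (Infinite ℕ)
instance : Countable Name := inferInstanceAs (Countable ℕ)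
instance : Nonempty Name := inferInstanceAs (Nonempty ℕ)

/-- Nominal sets: permutations of names act (`Equiv.swap a b • x` is the swapping `(a b) · x`) and
every element has a finite support. -/
class Nominal (X : Type u) extends MulAction (Equiv.Perm Name) X where
  exists_supports : ∀ x : X, ∃ s : Finset Name,
    MulAction.Supports (Equiv.Perm Name) (s : Set Name) x

/-- The support `n(x)`: the least set of names supporting `x`. -/
def supp {X : Type u} [Nominal X] (x : X) : Set Name :=
  {a | ∀ s : Finset Name, MulAction.Supports (Equiv.Perm Name) (s : Set Name) x → a ∈ s}

theorem supports_smul {X : Type u} [Nominal X] (π : Equiv.Perm Name) {s : Finset Name} {x : X}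
    (h : MulAction.Supports (Equiv.Perm Name) (s : Set Name) x) :
    MulAction.Supports (Equiv.Perm Name) ((s.image π : Finset Name) : Set Name) (π • x) := by
  intro g hg
  have h1 : (π⁻¹ * g * π) • x = x := by
    apply h
    intro a ha
    have h2 : g (π a) = π a := hg (a := π a) (by
      simp only [Finset.coe_image]; exact Set.mem_image_of_mem _ ha)
    change (π⁻¹ * g * π) a = a
    simp [Equiv.Perm.mul_apply, h2]
  have h3 : g • π • x = π • (π⁻¹ * g * π) • x := by
    simp only [← mul_smul]; congr 1; group
  rw [h3, h1]

theorem mem_supp_smul {X : Type u} [Nominal X] {π : Equiv.Perm Name} {x : X} {a : Name}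
    (h : a ∈ supp x) : π a ∈ supp (π • x) := by
  intro s hs
  have h1 := supports_smul π⁻¹ hs
  rw [inv_smul_smul] at h1
  have h2 := h _ h1
  rw [Finset.mem_image] at h2
  obtain ⟨b, hb, hba⟩ := h2
  rw [← hba]
  simpa using hb

theorem mem_supp_smul_iff {X : Type u} [Nominal X] {π : Equiv.Perm Name} {x : X} {a : Name} :
    a ∈ supp (π • x) ↔ π⁻¹ a ∈ supp x := by
  constructor
  · intro h
    have h1 := mem_supp_smul (π := π⁻¹) h
    rwa [inv_smul_smul] at h1
  · intro h
    have h1 := mem_supp_smul (π := π) h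
    simpa using h1

theorem supp_finite {X : Type u} [Nominal X] (x : X) : (supp x).Finite := by
  obtain ⟨s, hs⟩ := Nominal.exists_supports x
  exact s.finite_toSet.subset fun a ha => ha s hs

instance {X Y : Type u} [Nominal X] [Nominal Y] : Nominal (X × Y) where
  exists_supports := by
    rintro ⟨x, y⟩
    obtain ⟨s, hs⟩ := Nominal.exists_supports x
    obtain ⟨t, ht⟩ := Nominal.exists_supports y
    refine ⟨s ∪ t, fun g hg => ?_⟩
    have h1 : g • x = x := hs g fun a ha => hg (by simp at ha ⊢; exact Or.inl ha)
    have h2 : g • y = y := ht g fun a ha => hg (by simp at ha ⊢; exact Or.inr ha)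
    simp [h1, h2]

/-- A nominal set containing the names. -/
class NameTerm (T : Type u) extends Nominal T where
  ofName : Name → T
  ofName_injective : Function.Injective ofName
  smul_ofName : ∀ (π : Equiv.Perm Name) (a : Name), π • ofName a = ofName (π a)

/-- A (simultaneous, finite) substitution of terms for names: `[Y₁,…,Yₙ / a₁,…,aₙ]` is the function
sending `aᵢ` to `Yᵢ` and every other name to itself. -/
@[ext]
structure Subst (T : Type u) [NameTerm T] where
  toFun : Name → T
  finite_dom : {a | toFun a ≠ NameTerm.ofName a}.Finite

namespace Subst

variable {T : Type u} [NameTerm T]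

instance : CoeFun (Subst T) (fun _ => Name → T) := ⟨Subst.toFun⟩

/-- The identity substitution. -/
protected def id : Subst T := ⟨NameTerm.ofName, by simp⟩

/-- `σ` with the value at `a` changed to `M`. -/
def update (σ : Subst T) (a : Name) (M : T) : Subst T :=
  ⟨Function.update σ.toFun a M, (σ.finite_dom.insert a).subset (by
    intro b hb
    by_cases h : b = a
    · exact Or.inl h
    · right
      simpa [Function.update_of_ne h] using hb)⟩

/-- The substitution `[M / a]`. -/
def single (a : Name) (M : T) : Subst T := Subst.id.update a M

/-- Name permutation on substitutions. -/
def perm (π : Equiv.Perm Name) (σ : Subst T) : Subst T :=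
  ⟨fun a => π • σ (π⁻¹ a), (σ.finite_dom.image π).subset (by
    intro a ha
    refine ⟨π⁻¹ a, fun h => ha ?_, by simp⟩
    rw [h, NameTerm.smul_ofName]
    simp)⟩

/-- Precomposition of a substitution with a swapping. -/
def precompSwap (a b : Name) (σ : Subst T) : Subst T :=
  ⟨fun x => σ (Equiv.swap a b x), (σ.finite_dom.union (Set.toFinite {a, b})).subset (by
    intro x hx
    by_cases ha : x = a
    · right; simp [ha]
    by_cases hb : x = b
    · right; simp [hb]
    left
    simpa [Equiv.swap_apply_of_ne_of_ne ha hb] using hx)⟩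

/-- The support `n(σ)` of a substitution. -/
def support (σ : Subst T) : Set Name :=
  {a | σ a ≠ NameTerm.ofName a} ∪ {b | ∃ a, σ a ≠ NameTerm.ofName a ∧ b ∈ supp (σ a)}

end Subst

/-- `X` has a substitution function, of terms in `T` for names. -/
class HasSubst (T : Type u) [NameTerm T] (X : Type u) where
  subst : X → Subst T → X

/-- The laws of substitution: equivariance, identity, dependence only on the names that occur,
composition, agreement of substituting a fresh name with renaming, and the law that the names of
the terms substituted for names that occur in `x` occur in the result. -/
class LawfulSubst (T : Type u) [NameTerm T] [HasSubst T T]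
    (X : Type u) [Nominal X] [HasSubst T X] : Prop where
  smul_subst : ∀ (π : Equiv.Perm Name) (x : X) (σ : Subst T),
    π • HasSubst.subst x σ = HasSubst.subst (π • x) (σ.perm π)
  subst_id : ∀ x : X, HasSubst.subst x (Subst.id : Subst T) = x
  subst_congr : ∀ (x : X) (σ τ : Subst T), (∀ a ∈ supp x, σ a = τ a) →
    HasSubst.subst x σ = HasSubst.subst x τ
  subst_subst : ∀ (x : X) (σ τ ρ : Subst T), (∀ a, ρ a = HasSubst.subst (σ a) τ) →
    HasSubst.subst (HasSubst.subst x σ) τ = HasSubst.subst x ρ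
  subst_rename : ∀ (x : X) (a b : Name), b ∉ supp x →
    HasSubst.subst x (Subst.single a (NameTerm.ofName b) : Subst T) = Equiv.swap a b • x
  supp_subset : ∀ (x : X) (σ : Subst T) (a : Name), a ∈ supp x →
    supp (σ a) ⊆ supp (HasSubst.subst x σ)

/-! ## Psi-calculus parameters -/

/-- A psi-calculus: three nominal data types (names being terms), the four equivariant operators,
which commute with substitution (`⊢` being a relation, only the three functions), and the
requisites. -/
structure PsiCalculus where
  Term : Type u
  Cond : Type u
  Assn : Type u
  [termName : NameTerm Term]
  [condNominal : Nominal Cond]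
  [assnNominal : Nominal Assn]
  [termSubst : HasSubst Term Term]
  [condSubst : HasSubst Term Cond]
  [assnSubst : HasSubst Term Assn]
  [termLawful : LawfulSubst Term Term]
  [condLawful : LawfulSubst Term Cond]
  [assnLawful : LawfulSubst Term Assn]
  /-- channel equivalence -/
  chanEq : Term → Term → Cond
  /-- composition -/
  comp : Assn → Assn → Assn
  /-- unit -/
  unit : Assn
  /-- entailment -/
  entails : Assn → Cond → Prop
  smul_chanEq : ∀ (π : Equiv.Perm Name) (M N : Term), π • chanEq M N = chanEq (π • M) (π • N)
  smul_comp : ∀ (π : Equiv.Perm Name) (Ψ Ψ' : Assn), π • comp Ψ Ψ' = comp (π • Ψ) (π • Ψ')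
  smul_unit : ∀ π : Equiv.Perm Name, π • unit = unit
  smul_entails : ∀ (π : Equiv.Perm Name) (Ψ : Assn) (φ : Cond),
    entails Ψ φ → entails (π • Ψ) (π • φ)
  subst_ofName : ∀ (a : Name) (σ : Subst Term),
    HasSubst.subst (NameTerm.ofName a : Term) σ = σ a
  subst_chanEq : ∀ (M N : Term) (σ : Subst Term), HasSubst.subst (chanEq M N) σ =
    chanEq (HasSubst.subst M σ) (HasSubst.subst N σ)
  subst_comp : ∀ (Ψ Ψ' : Assn) (σ : Subst Term), HasSubst.subst (comp Ψ Ψ') σ =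
    comp (HasSubst.subst Ψ σ) (HasSubst.subst Ψ' σ)
  subst_unit : ∀ σ : Subst Term, HasSubst.subst unit σ = unit
  chan_symm : ∀ (Ψ : Assn) (M N : Term), entails Ψ (chanEq M N) → entails Ψ (chanEq N M)
  chan_trans : ∀ (Ψ : Assn) (M N L : Term), entails Ψ (chanEq M N) → entails Ψ (chanEq N L) →
    entails Ψ (chanEq M L)
  weakening : ∀ (Ψ Ψ' : Assn) (φ : Cond), entails Ψ φ → entails (comp Ψ Ψ') φ
  composition : ∀ Ψ Ψ' Ψ'' : Assn, (∀ φ, entails Ψ φ ↔ entails Ψ' φ) →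
    ∀ φ, entails (comp Ψ Ψ'') φ ↔ entails (comp Ψ' Ψ'') φ
  identity : ∀ (Ψ : Assn) (φ : Cond), entails (comp Ψ unit) φ ↔ entails Ψ φ
  associativity : ∀ (Ψ Ψ' Ψ'' : Assn) (φ : Cond),
    entails (comp (comp Ψ Ψ') Ψ'') φ ↔ entails (comp Ψ (comp Ψ' Ψ'')) φ
  commutativity : ∀ (Ψ Ψ' : Assn) (φ : Cond), entails (comp Ψ Ψ') φ ↔ entails (comp Ψ' Ψ) φ

attribute [instance] PsiCalculus.termName PsiCalculus.condNominal PsiCalculus.assnNominal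
  PsiCalculus.termSubst PsiCalculus.condSubst PsiCalculus.assnSubst
  PsiCalculus.termLawful PsiCalculus.condLawful PsiCalculus.assnLawful

/-! ## Agents up to alpha-equivalence -/

/-- Agents before identification of alpha-variants. -/
inductive Raw (𝔓 : PsiCalculus.{u}) : Type u
  | out (M N : 𝔓.Term) (P : Raw 𝔓)
  | inp (M : 𝔓.Term) (x : Name) (P : Raw 𝔓)
  | case (n : ℕ) (φ : Fin n → 𝔓.Cond) (P : Fin n → Raw 𝔓)
  | res (a : Name) (P : Raw 𝔓)
  | par (P Q : Raw 𝔓)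
  | rep (P : Raw 𝔓)
  | ass (Ψ : 𝔓.Assn)

/-- A name fresh for a finite set of names, depending only on that set. -/
noncomputable def freshName (s : Set Name) : Name := Classical.epsilon fun z => z ∉ s

namespace Raw

variable {𝔓 : PsiCalculus.{u}}

/-- Name permutation distributes over all constructors. -/
def perm (π : Equiv.Perm Name) : Raw 𝔓 → Raw 𝔓
  | out M N P => out (π • M) (π • N) (P.perm π)
  | inp M x P => inp (π • M) (π x) (P.perm π)
  | case n φ P => case n (fun i => π • φ i) (fun i => (P i).perm π)
  | res a P => res (π a) (P.perm π)
  | par P Q => par (P.perm π) (Q.perm π)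
  | rep P => rep (P.perm π)
  | ass Ψ => ass (π • Ψ)

/-- The names with a free occurrence. -/
def fn : Raw 𝔓 → Set Name
  | out M N P => supp M ∪ supp N ∪ P.fn
  | inp M x P => supp M ∪ (P.fn \ {x})
  | case _ φ P => ⋃ i, supp (φ i) ∪ (P i).fn
  | res a P => P.fn \ {a}
  | par P Q => P.fn ∪ Q.fn
  | rep P => P.fn
  | ass Ψ => supp Ψ

/-- Capture-avoiding simultaneous substitution: a binder `a` over `P` is renamed to a name `z` that
is fresh for all terms substituted for the other free names of `P`. -/
noncomputable def subst : Raw 𝔓 → Subst 𝔓.Term → Raw 𝔓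
  | out M N P, σ => out (HasSubst.subst M σ) (HasSubst.subst N σ) (P.subst σ)
  | inp M x P, σ =>
      let z := freshName (⋃ b ∈ P.fn \ {x}, supp (σ b))
      inp (HasSubst.subst M σ) z (P.subst (σ.update x (NameTerm.ofName z)))
  | case n φ P, σ => case n (fun i => HasSubst.subst (φ i) σ) (fun i => (P i).subst σ)
  | res a P, σ =>
      let z := freshName (⋃ b ∈ P.fn \ {a}, supp (σ b))
      res z (P.subst (σ.update a (NameTerm.ofName z)))
  | par P Q, σ => par (P.subst σ) (Q.subst σ)
  | rep P, σ => rep (P.subst σ)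
  | ass Ψ, σ => ass (HasSubst.subst Ψ σ)

/-- No unguarded assertions: every assertion is below an input or an output. -/
def Guarded : Raw 𝔓 → Prop
  | out _ _ _ => True
  | inp _ _ _ => True
  | case _ _ P => ∀ i, (P i).Guarded
  | res _ P => P.Guarded
  | par P Q => P.Guarded ∧ Q.Guarded
  | rep P => P.Guarded
  | ass _ => False

/-- Well-formedness: no unguarded assertions below a replication or in a case branch. -/
def WF : Raw 𝔓 → Prop
  | out _ _ P => P.WF
  | inp _ _ P => P.WF
  | case _ _ P => ∀ i, (P i).WF ∧ (P i).Guarded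
  | res _ P => P.WF
  | par P Q => P.WF ∧ Q.WF
  | rep P => P.WF ∧ P.Guarded
  | ass _ => True

/-- Alpha-equivalence: the least congruence that allows to rename a binder to a fresh name. -/
inductive Alpha : Raw 𝔓 → Raw 𝔓 → Prop
  | refl (P) : Alpha P P
  | symm {P Q} : Alpha P Q → Alpha Q P
  | trans {P Q R} : Alpha P Q → Alpha Q R → Alpha P R
  | out (M N) {P P'} : Alpha P P' → Alpha (out M N P) (out M N P')
  | inp (M x) {P P'} : Alpha P P' → Alpha (inp M x P) (inp M x P')
  | case (n φ) {P P'} : (∀ i, Alpha (P i) (P' i)) → Alpha (case n φ P) (case n φ P')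
  | res (a) {P P'} : Alpha P P' → Alpha (res a P) (res a P')
  | par {P P' Q Q'} : Alpha P P' → Alpha Q Q' → Alpha (par P Q) (par P' Q')
  | rep {P P'} : Alpha P P' → Alpha (rep P) (rep P')
  | inp_rename (M x y P) : y ∉ P.fn → Alpha (inp M x P) (inp M y (P.perm (Equiv.swap x y)))
  | res_rename (a b P) : b ∉ P.fn → Alpha (res a P) (res b (P.perm (Equiv.swap a b)))

theorem mem_fn_perm (π : Equiv.Perm Name) (P : Raw 𝔓) (a : Name) :
    a ∈ (P.perm π).fn ↔ π⁻¹ a ∈ P.fn := by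
  have key : ∀ x : Name, a = π x ↔ π⁻¹ a = x := fun x => (Equiv.Perm.inv_eq_iff_eq).symm
  induction P with
  | out M N P ih => simp [perm, fn, ih, mem_supp_smul_iff]
  | inp M x P ih => simp [perm, fn, ih, mem_supp_smul_iff, key]
  | case n φ P ih => simp [perm, fn, ih, mem_supp_smul_iff]
  | res b P ih => simp [perm, fn, ih, key]
  | par P Q ihP ihQ => simp [perm, fn, ihP, ihQ]
  | rep P ih => simp [perm, fn, ih]
  | ass Ψ => simp [perm, fn, mem_supp_smul_iff]

theorem perm_perm (π ρ : Equiv.Perm Name) (P : Raw 𝔓) :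
    (P.perm ρ).perm π = P.perm (π * ρ) := by
  induction P <;> simp_all [perm, mul_smul]

theorem fn_rename {a b : Name} {P : Raw 𝔓} (h : b ∉ P.fn) :
    (P.perm (Equiv.swap a b)).fn \ {b} = P.fn \ {a} := by
  ext c
  simp only [Set.mem_sdiff, mem_fn_perm, Equiv.swap_inv, Set.mem_singleton_iff]
  by_cases hca : c = a
  · subst hca; simp [h]
  by_cases hcb : c = b
  · subst hcb; simp [h]
  simp [Equiv.swap_apply_of_ne_of_ne hca hcb, hca, hcb]

theorem Alpha.fn_eq {P Q : Raw 𝔓} (h : Alpha P Q) : P.fn = Q.fn := by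
  induction h with
  | refl => rfl
  | symm _ ih => exact ih.symm
  | trans _ _ ih1 ih2 => exact ih1.trans ih2
  | inp_rename M x y P h => simp [fn, fn_rename h]
  | res_rename a b P h => simp [fn, fn_rename h]
  | _ => simp_all [fn]

theorem Alpha.perm (π : Equiv.Perm Name) {P Q : Raw 𝔓} (h : Alpha P Q) :
    Alpha (P.perm π) (Q.perm π) := by
  have key : ∀ (a b : Name) (P : Raw 𝔓), (P.perm (Equiv.swap a b)).perm π =
      (P.perm π).perm (Equiv.swap (π a) (π b)) := fun a b P => by
    rw [perm_perm, perm_perm, Equiv.mul_swap_eq_swap_mul]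
  induction h with
  | refl => exact .refl _
  | symm _ ih => exact ih.symm
  | trans _ _ ih1 ih2 => exact ih1.trans ih2
  | out M N _ ih => exact .out _ _ ih
  | inp M x _ ih => exact .inp _ _ ih
  | case n φ _ ih => exact .case _ _ ih
  | res a _ ih => exact .res _ ih
  | par _ _ ih1 ih2 => exact .par ih1 ih2
  | rep _ ih => exact .rep ih
  | inp_rename M x y P h =>
    simp only [Raw.perm, key]
    exact .inp_rename _ _ _ _ (by simpa [mem_fn_perm] using h)
  | res_rename a b P h =>
    simp only [Raw.perm, key]
    exact .res_rename _ _ _ (by simpa [mem_fn_perm] using h)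

theorem guarded_perm (π : Equiv.Perm Name) (P : Raw 𝔓) : (P.perm π).Guarded ↔ P.Guarded := by
  induction P <;> simp_all [perm, Guarded]

theorem wf_perm (π : Equiv.Perm Name) (P : Raw 𝔓) : (P.perm π).WF ↔ P.WF := by
  induction P <;> simp_all [perm, WF, guarded_perm]

theorem Alpha.guarded_iff {P Q : Raw 𝔓} (h : Alpha P Q) : P.Guarded ↔ Q.Guarded := by
  induction h <;> simp_all [Guarded, guarded_perm]

theorem Alpha.wf_iff {P Q : Raw 𝔓} (h : Alpha P Q) : P.WF ↔ Q.WF := by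
  induction h with
  | case n φ h ih => simp [WF, ih, fun i => (h i).guarded_iff]
  | rep h ih => simp [WF, ih, h.guarded_iff]
  | _ => simp_all [WF, wf_perm]

/-- Substituting after a swapping. -/
theorem subst_swap_data {X : Type u} [Nominal X] [HasSubst 𝔓.Term X] [LawfulSubst 𝔓.Term X]
    (a b : Name) (x : X) (σ : Subst 𝔓.Term) :
    HasSubst.subst (Equiv.swap a b • x) σ = HasSubst.subst x (σ.precompSwap a b) := by
  classical
  have step : ∀ (y : X) (d e : Name) (τ : Subst 𝔓.Term), e ∉ supp y →
      HasSubst.subst (Equiv.swap d e • y) τ = HasSubst.subst y (τ.update d (τ e)) := by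
    intro y d e τ he
    rw [← LawfulSubst.subst_rename (T := 𝔓.Term) y d e he]
    apply LawfulSubst.subst_subst
    intro c
    by_cases h : c = d
    · subst h; simp [Subst.single, Subst.update, 𝔓.subst_ofName]
    · simp [Subst.single, Subst.update, h, Subst.id, 𝔓.subst_ofName]
  by_cases hab : a = b
  · subst hab
    simp only [Equiv.swap_self, Subst.precompSwap]
    congr 1
    exact one_smul _ _
  obtain ⟨c, hc⟩ := ((supp_finite x).union (Set.toFinite {a, b})).exists_notMem
  have hcx : c ∉ supp x := fun h => hc (Or.inl h)
  have hca : c ≠ a := fun h => hc (Or.inr (by simp [h]))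
  have hcb : c ≠ b := fun h => hc (Or.inr (by simp [h]))
  have hp : Equiv.swap a b = Equiv.swap c b * (Equiv.swap b a * Equiv.swap a c) := by
    ext d
    simp only [Equiv.Perm.mul_apply, Equiv.swap_apply_def]
    split_ifs <;> simp_all
  rw [hp, mul_smul, mul_smul, step, step, step]
  · apply LawfulSubst.subst_congr
    intro d hd
    have hdc : d ≠ c := fun h => hcx (h ▸ hd)
    simp only [Subst.update, Subst.precompSwap, Function.update_apply, Equiv.swap_apply_def]
    split_ifs <;> simp_all
  · exact hcx
  · rw [mem_supp_smul_iff]; simpa using hcx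
  · rw [mem_supp_smul_iff, mem_supp_smul_iff]
    simp [hcx]

theorem subst_congr (P : Raw 𝔓) : ∀ σ τ : Subst 𝔓.Term, (∀ a ∈ P.fn, σ a = τ a) →
    P.subst σ = P.subst τ := by
  have aux : ∀ (P : Raw 𝔓) (x : Name) (σ τ : Subst 𝔓.Term), (∀ a ∈ P.fn \ {x}, σ a = τ a) →
      (⋃ b ∈ P.fn \ {x}, supp (σ b)) = ⋃ b ∈ P.fn \ {x}, supp (τ b) := by
    intro P x σ τ h
    exact Set.iUnion₂_congr fun b hb => by rw [h b hb]
  have aux2 : ∀ (P : Raw 𝔓) (x z : Name) (σ τ : Subst 𝔓.Term),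
      (∀ a ∈ P.fn \ {x}, σ a = τ a) → ∀ a ∈ P.fn,
      σ.update x (NameTerm.ofName z) a = τ.update x (NameTerm.ofName z) a := by
    intro P x z σ τ h a ha
    by_cases hax : a = x
    · subst hax; simp [Subst.update]
    · simpa [Subst.update, hax] using h a ⟨ha, hax⟩
  induction P with
  | out M N P ih =>
    intro σ τ h
    simp only [subst]
    rw [ih σ τ fun a ha => h a (by simp [fn, ha]),
      LawfulSubst.subst_congr M σ τ fun a ha => h a (by simp [fn, ha]),
      LawfulSubst.subst_congr N σ τ fun a ha => h a (by simp [fn, ha])]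
  | inp M x P ih =>
    intro σ τ h
    have h' : ∀ a ∈ P.fn \ {x}, σ a = τ a := fun a ha => h a (Or.inr ha)
    simp only [subst]
    rw [LawfulSubst.subst_congr M σ τ fun a ha => h a (by simp [fn, ha]), aux P x σ τ h',
      ih _ _ (aux2 P x _ σ τ h')]
  | case n φ P ih =>
    intro σ τ h
    simp only [subst]
    congr 1
    · funext i
      exact LawfulSubst.subst_congr _ σ τ fun a ha => h a (by
        simp only [fn, Set.mem_iUnion]; exact ⟨i, Or.inl ha⟩)
    · funext i
      exact ih i σ τ fun a ha => h a (by simp only [fn, Set.mem_iUnion]; exact ⟨i, Or.inr ha⟩)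
  | res x P ih =>
    intro σ τ h
    simp only [subst]
    rw [aux P x σ τ h, ih _ _ (aux2 P x _ σ τ h)]
  | par P Q ihP ihQ =>
    intro σ τ h
    simp only [subst]
    rw [ihP σ τ fun a ha => h a (Or.inl ha), ihQ σ τ fun a ha => h a (Or.inr ha)]
  | rep P ih =>
    intro σ τ h
    simp only [subst]
    rw [ih σ τ h]
  | ass Ψ =>
    intro σ τ h
    simp only [subst]
    rw [LawfulSubst.subst_congr Ψ σ τ h]

theorem subst_perm_swap (a b : Name) (P : Raw 𝔓) : ∀ σ : Subst 𝔓.Term,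
    (P.perm (Equiv.swap a b)).subst σ = P.subst (σ.precompSwap a b) := by
  have aux : ∀ (P : Raw 𝔓) (x : Name) (σ : Subst 𝔓.Term),
      (⋃ c ∈ (P.perm (Equiv.swap a b)).fn \ {Equiv.swap a b x}, supp (σ c)) =
        ⋃ c ∈ P.fn \ {x}, supp (σ.precompSwap a b c) := by
    intro P x σ
    ext d
    simp only [Set.mem_iUnion, exists_prop, Set.mem_sdiff, mem_fn_perm, Equiv.swap_inv,
      Set.mem_singleton_iff]
    constructor
    · rintro ⟨c, ⟨h1, h2⟩, h3⟩
      exact ⟨Equiv.swap a b c, ⟨h1, fun h => h2 (by rw [← h, Equiv.swap_apply_self])⟩,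
        by simpa [Subst.precompSwap] using h3⟩
    · rintro ⟨c, ⟨h1, h2⟩, h3⟩
      exact ⟨Equiv.swap a b c, ⟨by simpa using h1, fun h => h2 ((Equiv.injective _) h)⟩, h3⟩
  have aux2 : ∀ (x z : Name) (σ : Subst 𝔓.Term),
      (σ.update (Equiv.swap a b x) (NameTerm.ofName z)).precompSwap a b =
        (σ.precompSwap a b).update x (NameTerm.ofName z) := by
    intro x z σ
    ext c
    by_cases h : c = x
    · subst h; simp [Subst.update, Subst.precompSwap]
    · simp [Subst.update, Subst.precompSwap, h]
  induction P with
  | out M N P ih => intro σ; simp [subst, perm, ih, subst_swap_data]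
  | inp M x P ih => intro σ; simp only [subst, perm, ih, subst_swap_data, aux, aux2]
  | case n φ P ih => intro σ; simp [subst, perm, ih, subst_swap_data]
  | res x P ih => intro σ; simp only [subst, perm, ih, aux, aux2]
  | par P Q ihP ihQ => intro σ; simp [subst, perm, ihP, ihQ]
  | rep P ih => intro σ; simp [subst, perm, ih]
  | ass Ψ => intro σ; simp [subst, perm, subst_swap_data]

/-- Alpha-equivalent agents have equal substitution instances. -/
theorem Alpha.subst_eq {P Q : Raw 𝔓} (h : Alpha P Q) : ∀ σ, P.subst σ = Q.subst σ := by
  have aux : ∀ (P : Raw 𝔓) (a b z : Name) (σ : Subst 𝔓.Term), b ∉ P.fn →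
      (P.perm (Equiv.swap a b)).subst (σ.update b (NameTerm.ofName z)) =
        P.subst (σ.update a (NameTerm.ofName z)) := by
    intro P a b z σ hb
    rw [subst_perm_swap]
    apply subst_congr
    intro c hc
    have hcb : c ≠ b := fun h => hb (h ▸ hc)
    by_cases hca : c = a
    · subst hca; simp [Subst.update, Subst.precompSwap]
    · simp [Subst.update, Subst.precompSwap, Equiv.swap_apply_of_ne_of_ne hca hcb, hca, hcb]
  induction h with
  | refl => intro σ; rfl
  | symm _ ih => intro σ; exact (ih σ).symm
  | trans _ _ ih1 ih2 => intro σ; exact (ih1 σ).trans (ih2 σ)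
  | inp M x h ih => intro σ; simp only [subst, ih, h.fn_eq]
  | res a h ih => intro σ; simp only [subst, ih, h.fn_eq]
  | inp_rename M x y P h => intro σ; simp only [subst, fn_rename h, aux P x y _ σ h]
  | res_rename a b P h => intro σ; simp only [subst, fn_rename h, aux P a b _ σ h]
  | _ => intro σ; simp_all [subst]

instance setoid (𝔓 : PsiCalculus.{u}) : Setoid (Raw 𝔓) :=
  ⟨Alpha, ⟨.refl, .symm, .trans⟩⟩

end Raw

/-- Agents: alpha-equivalence classes. Only the well-formed ones (`Agent.WF`) are related by
bisimulations. -/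
def Agent (𝔓 : PsiCalculus.{u}) : Type u := Quotient (Raw.setoid 𝔓)

namespace Agent

variable {𝔓 : PsiCalculus.{u}}

/-- Output `M̅ N . P`. -/
def out (M N : 𝔓.Term) (P : Agent 𝔓) : Agent 𝔓 :=
  Quotient.map (Raw.out M N) (fun _ _ h => Raw.Alpha.out M N h) P

/-- Input `M(x) . P`. -/
def inp (M : 𝔓.Term) (x : Name) (P : Agent 𝔓) : Agent 𝔓 :=
  Quotient.map (Raw.inp M x) (fun _ _ h => Raw.Alpha.inp M x h) P

/-- `case φ₁ : P₁ [] ⋯ [] φₙ : Pₙ`. -/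
noncomputable def case (n : ℕ) (φ : Fin n → 𝔓.Cond) (P : Fin n → Agent 𝔓) : Agent 𝔓 :=
  Quotient.mk _ (Raw.case n φ fun i => Quotient.out (P i))

/-- Restriction `(νa)P`. -/
def res (a : Name) (P : Agent 𝔓) : Agent 𝔓 :=
  Quotient.map (Raw.res a) (fun _ _ h => Raw.Alpha.res a h) P

/-- `(νa₁)⋯(νaₙ)P`. -/
def resList (as : List Name) (P : Agent 𝔓) : Agent 𝔓 := as.foldr res P

/-- Parallel composition. -/
def par (P Q : Agent 𝔓) : Agent 𝔓 :=
  Quotient.map₂ Raw.par (fun _ _ h _ _ h' => Raw.Alpha.par h h') P Q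

/-- Replication `!P`. -/
def rep (P : Agent 𝔓) : Agent 𝔓 := Quotient.map Raw.rep (fun _ _ h => Raw.Alpha.rep h) P

/-- The assertion agent. -/
def ass (Ψ : 𝔓.Assn) : Agent 𝔓 := Quotient.mk _ (Raw.ass Ψ)

/-- Name permutation. -/
def perm (π : Equiv.Perm Name) (P : Agent 𝔓) : Agent 𝔓 :=
  Quotient.map (Raw.perm π) (fun _ _ h => Raw.Alpha.perm π h) P

/-- The support `n(P)`: the names with a free occurrence. -/
def fn (P : Agent 𝔓) : Set Name := Quotient.lift Raw.fn (fun _ _ h => Raw.Alpha.fn_eq h) P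

/-- Well-formedness: no unguarded assertions below a replication or in a case branch. -/
def WF (P : Agent 𝔓) : Prop :=
  Quotient.lift Raw.WF (fun _ _ h => propext (Raw.Alpha.wf_iff h)) P

/-- Capture-avoiding substitution `Pσ`. -/
noncomputable def subst (P : Agent 𝔓) (σ : Subst 𝔓.Term) : Agent 𝔓 :=
  Quotient.mk _ (Quotient.lift (fun r : Raw 𝔓 => r.subst σ)
    (fun _ _ h => Raw.Alpha.subst_eq h σ) P)

end Agent

/-! ## Binding of name sequences, frames -/

/-- Renaming of one binder `a` of `(ν pre a post)x` to a name `c` that is fresh for its scope. -/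
inductive BindStep {X : Type u} [Nominal X] : List Name × X → List Name × X → Prop
  | mk (pre post : List Name) (a c : Name) (x : X) : c ∉ post → c ∉ supp x →
      BindStep (pre ++ a :: post, x)
        (pre ++ c :: post.map (Equiv.swap a c), Equiv.swap a c • x)

/-- A frame, as an alpha-equivalence class: the set of all pairs `(b̃, Ψ)` such that the frame is
`(νb̃)Ψ`. -/
abbrev Frame (𝔓 : PsiCalculus.{u}) : Type u := Set (List Name × 𝔓.Assn)

/-- The alpha-variants of `(νb̃)Ψ`. -/
def Frame.mk {𝔓 : PsiCalculus.{u}} (b : List Name) (Ψ : 𝔓.Assn) : Frame 𝔓 :=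
  {p | Relation.EqvGen BindStep (b, Ψ) p}

/-- `(νb̃₁)Ψ₁ ⊗ (νb̃₂)Ψ₂ = (νb̃₁b̃₂)(Ψ₁ ⊗ Ψ₂)` if `b̃₁ # b̃₂, Ψ₂` and `b̃₂ # b̃₁, Ψ₁`. -/
def Frame.comp {𝔓 : PsiCalculus.{u}} (F G : Frame 𝔓) : Frame 𝔓 :=
  {p | ∃ b₁ Ψ₁ b₂ Ψ₂, (b₁, Ψ₁) ∈ F ∧ (b₂, Ψ₂) ∈ G ∧
    (∀ a ∈ b₁, a ∉ b₂ ∧ a ∉ supp Ψ₂) ∧ (∀ a ∈ b₂, a ∉ b₁ ∧ a ∉ supp Ψ₁) ∧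
    p ∈ Frame.mk (b₁ ++ b₂) (𝔓.comp Ψ₁ Ψ₂)}

/-- `(νc)(νb̃)Ψ = (νcb̃)Ψ`. -/
def Frame.new {𝔓 : PsiCalculus.{u}} (c : Name) (F : Frame 𝔓) : Frame 𝔓 :=
  {p | ∃ b Ψ, (b, Ψ) ∈ F ∧ p ∈ Frame.mk (c :: b) Ψ}

/-- `((νb̃)Ψ)σ = (νb̃)(Ψσ)` if `b̃ # σ`. -/
def Frame.subst {𝔓 : PsiCalculus.{u}} (F : Frame 𝔓) (σ : Subst 𝔓.Term) : Frame 𝔓 :=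
  {p | ∃ b Ψ, (b, Ψ) ∈ F ∧ (∀ a ∈ b, a ∉ σ.support) ∧ p ∈ Frame.mk b (HasSubst.subst Ψ σ)}

/-- Entailment by a frame. -/
def Frame.Entails {𝔓 : PsiCalculus.{u}} (F : Frame 𝔓) (φ : 𝔓.Cond) : Prop :=
  ∃ b Ψ, (b, Ψ) ∈ F ∧ (∀ a ∈ b, a ∉ supp φ) ∧ 𝔓.entails Ψ φ

/-- Equivalence of frames. -/
def Frame.Equivalent {𝔓 : PsiCalculus.{u}} (F G : Frame 𝔓) : Prop :=
  ∀ φ, F.Entails φ ↔ G.Entails φ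

/-- The frame of a raw agent. -/
def Raw.frame {𝔓 : PsiCalculus.{u}} : Raw 𝔓 → Frame 𝔓
  | .out _ _ _ => Frame.mk [] 𝔓.unit
  | .inp _ _ _ => Frame.mk [] 𝔓.unit
  | .case _ _ _ => Frame.mk [] 𝔓.unit
  | .rep _ => Frame.mk [] 𝔓.unit
  | .ass Ψ => Frame.mk [] Ψ
  | .par P Q => P.frame.comp Q.frame
  | .res b P => P.frame.new b

/-- The frame `F(P)` of an agent. (Alpha-equivalent raw agents have the same frame.) -/
def Agent.frame {𝔓 : PsiCalculus.{u}} (P : Agent 𝔓) : Frame 𝔓 :=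
  {p | ∃ r : Raw 𝔓, Quotient.mk _ r = P ∧ p ∈ r.frame}

/-! ## Actions and the concrete (late) semantics -/

/-- Actions with subjects in `S` (terms for concrete actions, names for symbolic ones) and objects
in `T`: output `M̅(νã)N`, input `M(x)`, silent `τ`. -/
inductive Action (S : Type*) (T : Type*)
  | out (M : S) (as : List Name) (N : T)
  | inp (M : S) (x : Name)
  | tau

/-- The binding names `bn(α)`. -/
def Action.bn {S T : Type*} : Action S T → Set Name
  | .out _ as _ => {a | a ∈ as}
  | .inp _ x => {x}
  | .tau => ∅

/-- The names of a concrete action. -/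
def Action.names {T : Type u} [Nominal T] : Action T T → Set Name
  | .out M as N => supp M ∪ {a | a ∈ as} ∪ supp N
  | .inp M x => supp M ∪ {x}
  | .tau => ∅

/-- The names of a symbolic action. -/
def Action.symNames {T : Type u} [Nominal T] : Action Name T → Set Name
  | .out y as N => {y} ∪ {a | a ∈ as} ∪ supp N
  | .inp y x => {y, x}
  | .tau => ∅

/-- The subject of a symbolic action, as a set with at most one element. -/
def Action.symSubj {T : Type*} : Action Name T → Set Name
  | .out y _ _ => {y}
  | .inp y _ => {y}
  | .tau => ∅

/-- The substitution `[M / x]` applied to an agent. -/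
noncomputable def Agent.subst1 {𝔓 : PsiCalculus.{u}} (P : Agent 𝔓) (M : 𝔓.Term) (x : Name) :
    Agent 𝔓 := P.subst (Subst.single x M)

/-- The concrete transitions `Ψ ▷ P —α→ P'`. The last two rules identify transitions up to renaming
of the names `bn(α)`, which bind into the action object and the derivative. -/
inductive Trans {𝔓 : PsiCalculus.{u}} :
    𝔓.Assn → Agent 𝔓 → Action 𝔓.Term 𝔓.Term → Agent 𝔓 → Prop
  | inp (Ψ : 𝔓.Assn) (M K : 𝔓.Term) (x : Name) (P : Agent 𝔓) :
      𝔓.entails Ψ (𝔓.chanEq M K) →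
      Trans Ψ (Agent.inp M x P) (.inp K x) P
  | out (Ψ : 𝔓.Assn) (M K N : 𝔓.Term) (P : Agent 𝔓) : 𝔓.entails Ψ (𝔓.chanEq M K) →
      Trans Ψ (Agent.out M N P) (.out K [] N) P
  | case (Ψ : 𝔓.Assn) (n : ℕ) (φ : Fin n → 𝔓.Cond) (P : Fin n → Agent 𝔓) (i : Fin n)
      {α : Action 𝔓.Term 𝔓.Term} {P' : Agent 𝔓} :
      Trans Ψ (P i) α P' → 𝔓.entails Ψ (φ i) →
      Trans Ψ (Agent.case n φ P) α P'
  | comL (Ψ : 𝔓.Assn) (P Q : Agent 𝔓) {bP bQ : List Name} {ΨP ΨQ : 𝔓.Assn}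
      {M K N : 𝔓.Term} {as : List Name} {x : Name} {P' Q' : Agent 𝔓} :
      (bP, ΨP) ∈ P.frame → (bQ, ΨQ) ∈ Q.frame →
      (∀ b ∈ bP, b ∉ supp Ψ ∧ b ∉ bQ ∧ b ∉ Q.fn ∧ b ∉ supp M ∧ b ∉ P.fn) →
      (∀ b ∈ bQ, b ∉ supp Ψ ∧ b ∉ bP ∧ b ∉ P.fn ∧ b ∉ supp K ∧ b ∉ Q.fn) →
      Trans (𝔓.comp ΨQ Ψ) P (.out M as N) P' → Trans (𝔓.comp ΨP Ψ) Q (.inp K x) Q' →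
      𝔓.entails (𝔓.comp (𝔓.comp Ψ ΨP) ΨQ) (𝔓.chanEq M K) →
      (∀ a ∈ as, a ∉ Q.fn) →
      Trans Ψ (P.par Q) .tau (Agent.resList as (P'.par (Q'.subst1 N x)))
  | comR (Ψ : 𝔓.Assn) (P Q : Agent 𝔓) {bP bQ : List Name} {ΨP ΨQ : 𝔓.Assn}
      {M K N : 𝔓.Term} {as : List Name} {x : Name} {P' Q' : Agent 𝔓} :
      (bP, ΨP) ∈ P.frame → (bQ, ΨQ) ∈ Q.frame →
      (∀ b ∈ bP, b ∉ supp Ψ ∧ b ∉ bQ ∧ b ∉ Q.fn ∧ b ∉ supp K ∧ b ∉ P.fn) →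
      (∀ b ∈ bQ, b ∉ supp Ψ ∧ b ∉ bP ∧ b ∉ P.fn ∧ b ∉ supp M ∧ b ∉ Q.fn) →
      Trans (𝔓.comp ΨQ Ψ) P (.inp K x) P' → Trans (𝔓.comp ΨP Ψ) Q (.out M as N) Q' →
      𝔓.entails (𝔓.comp (𝔓.comp Ψ ΨP) ΨQ) (𝔓.chanEq M K) →
      (∀ a ∈ as, a ∉ P.fn) →
      Trans Ψ (P.par Q) .tau (Agent.resList as ((P'.subst1 N x).par Q'))
  | parL (Ψ : 𝔓.Assn) (P Q : Agent 𝔓) {bQ : List Name} {ΨQ : 𝔓.Assn}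
      {α : Action 𝔓.Term 𝔓.Term} {P' : Agent 𝔓} : (bQ, ΨQ) ∈ Q.frame →
      (∀ b ∈ bQ, b ∉ supp Ψ ∧ b ∉ P.fn ∧ b ∉ α.names) →
      Trans (𝔓.comp ΨQ Ψ) P α P' → (∀ a ∈ α.bn, a ∉ Q.fn) →
      Trans Ψ (P.par Q) α (P'.par Q)
  | parR (Ψ : 𝔓.Assn) (P Q : Agent 𝔓) {bP : List Name} {ΨP : 𝔓.Assn}
      {α : Action 𝔓.Term 𝔓.Term} {Q' : Agent 𝔓} : (bP, ΨP) ∈ P.frame →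
      (∀ b ∈ bP, b ∉ supp Ψ ∧ b ∉ Q.fn ∧ b ∉ α.names) →
      Trans (𝔓.comp ΨP Ψ) Q α Q' → (∀ a ∈ α.bn, a ∉ P.fn) →
      Trans Ψ (P.par Q) α (P.par Q')
  | scope (Ψ : 𝔓.Assn) (b : Name) (P : Agent 𝔓)
      {α : Action 𝔓.Term 𝔓.Term} {P' : Agent 𝔓} :
      Trans Ψ P α P' → b ∉ α.names → b ∉ supp Ψ →
      Trans Ψ (Agent.res b P) α (Agent.res b P')
  | opn (Ψ : 𝔓.Assn) (b : Name) (P : Agent 𝔓)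
      {M N : 𝔓.Term} {as₁ as₂ : List Name} {P' : Agent 𝔓} :
      Trans Ψ P (.out M (as₁ ++ as₂) N) P' →
      b ∉ as₁ ++ as₂ → b ∉ supp Ψ → b ∉ supp M → b ∈ supp N →
      Trans Ψ (Agent.res b P) (.out M (as₁ ++ b :: as₂) N) P'
  | rep (Ψ : 𝔓.Assn) (P : Agent 𝔓)
      {α : Action 𝔓.Term 𝔓.Term} {P' : Agent 𝔓} :
      Trans Ψ (P.par P.rep) α P' → Trans Ψ P.rep α P'
  | alphaOut {Ψ P M as N P'} (a c : Name) : Trans Ψ P (.out M as N) P' →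
      a ∈ as → c ∉ as → c ∉ supp N → c ∉ P'.fn →
      Trans Ψ P (.out M (as.map (Equiv.swap a c)) (Equiv.swap a c • N)) (P'.perm (Equiv.swap a c))
  | alphaInp {Ψ P M x P'} (c : Name) : Trans Ψ P (.inp M x) P' → c ∉ P'.fn →
      Trans Ψ P (.inp M c) (P'.perm (Equiv.swap x c))

/-- Early bisimulation. -/
def IsBisimulation {𝔓 : PsiCalculus.{u}} (R : 𝔓.Assn → Agent 𝔓 → Agent 𝔓 → Prop) : Prop :=
  ∀ Ψ P Q, R Ψ P Q →
    -- it relates (well-formed) agents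
    P.WF ∧ Q.WF ∧
    -- static equivalence
    ((Frame.mk [] Ψ).comp P.frame).Equivalent ((Frame.mk [] Ψ).comp Q.frame) ∧
    -- symmetry
    R Ψ Q P ∧
    -- extension of arbitrary assertion
    (∀ Ψ', R (𝔓.comp Ψ Ψ') P Q) ∧
    -- simulation
    ∀ α P', (∀ a ∈ α.bn, a ∉ supp Ψ ∧ a ∉ Q.fn) → Trans Ψ P α P' →
      match α with
      | .inp _ x => ∀ L, ∃ Q', Trans Ψ Q α Q' ∧ R Ψ (P'.subst1 L x) (Q'.subst1 L x)
      | _ => ∃ Q', Trans Ψ Q α Q' ∧ R Ψ P' Q'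

/-! ## Constraints -/

/-- Atomic constraints `(νã)⟦Ψ ⊢ φ⟧`, up to alpha-equivalence. -/
def Atom (𝔓 : PsiCalculus.{u}) : Type u := Quot (BindStep (X := 𝔓.Assn × 𝔓.Cond))

namespace Atom

variable {𝔓 : PsiCalculus.{u}}

/-- `(νb̃)⟦Ψ ⊢ φ⟧`. -/
def mk (b : List Name) (Ψ : 𝔓.Assn) (φ : 𝔓.Cond) : Atom 𝔓 := Quot.mk _ (b, (Ψ, φ))

/-- `(νã)(νb̃)⟦Ψ ⊢ φ⟧ = (νãb̃)⟦Ψ ⊢ φ⟧`. -/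
def new (as : List Name) (A : Atom 𝔓) : Atom 𝔓 :=
  Quot.map (fun p => (as ++ p.1, p.2)) (by
    rintro _ _ ⟨pre, post, a, c, x, h1, h2⟩
    have := BindStep.mk (as ++ pre) post a c x h1 h2
    simpa using this) A

/-- The names with a free occurrence. -/
def fn (A : Atom 𝔓) : Set Name :=
  Quot.lift (fun p => {a | a ∈ supp p.2 ∧ a ∉ p.1}) (by
    rintro _ _ ⟨pre, post, a, c, x, h1, h2⟩
    ext d
    have hmap : ∀ e, e ∈ post.map (Equiv.swap a c) ↔ Equiv.swap a c e ∈ post := by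
      intro e
      simp only [List.mem_map]
      constructor
      · rintro ⟨f, hf, rfl⟩; simpa using hf
      · intro h; exact ⟨_, h, by simp⟩
    simp only [Set.mem_ofPred_eq, List.mem_append, List.mem_cons, hmap, mem_supp_smul_iff,
      Equiv.swap_inv]
    by_cases hda : d = a
    · subst hda; simp [h2]
    by_cases hdc : d = c
    · subst hdc; simp [h2]
    simp [Equiv.swap_apply_of_ne_of_ne hda hdc, hda, hdc]) A

/-- `(σ, Ψ') ⊨ (νb̃)⟦Ψ ⊢ φ⟧`, for an alpha-variant with `b̃ # σ, Ψ'`. -/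
def Sat (σ : Subst 𝔓.Term) (Ψ' : 𝔓.Assn) (A : Atom 𝔓) : Prop :=
  ∃ b Ψ φ, A = mk b Ψ φ ∧ (∀ a ∈ b, a ∉ σ.support ∧ a ∉ supp Ψ') ∧
    𝔓.entails (𝔓.comp (HasSubst.subst Ψ σ) Ψ') (HasSubst.subst φ σ)

end Atom

/-- Transition constraints: conjunctions of atomic constraints. -/
abbrev TransConstraint (𝔓 : PsiCalculus.{u}) : Type u := List (Atom 𝔓)

/-- `(νã)(C ∧ C') = (νã)C ∧ (νã)C'`. -/
def TransConstraint.new {𝔓 : PsiCalculus.{u}} (as : List Name) (C : TransConstraint 𝔓) :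
    TransConstraint 𝔓 := C.map (Atom.new as)

/-- The conjuncts of constraints: atomic constraints, `⟦M = N⟧`, and `⟦a # x⟧` for `x` in an
arbitrary nominal data type or an agent. -/
inductive BasicConstraint (𝔓 : PsiCalculus.{u}) : Type (u + 1)
  | atom (A : Atom 𝔓)
  | eq (M N : 𝔓.Term)
  | fresh (a : Name) (X : Type u) [Nominal X] [HasSubst 𝔓.Term X] [LawfulSubst 𝔓.Term X] (x : X)
  | freshAgent (a : Name) (P : Agent 𝔓)

/-- The names with a free occurrence. -/
def BasicConstraint.fn {𝔓 : PsiCalculus.{u}} : BasicConstraint 𝔓 → Set Name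
  | .atom A => A.fn
  | .eq M N => supp M ∪ supp N
  | @fresh _ a _ _ _ _ x => {a} ∪ supp x
  | .freshAgent a P => {a} ∪ P.fn

/-- `(σ, Ψ)` is a solution. -/
def BasicConstraint.Sat {𝔓 : PsiCalculus.{u}} (σ : Subst 𝔓.Term) (Ψ : 𝔓.Assn) :
    BasicConstraint 𝔓 → Prop
  | .atom A => A.Sat σ Ψ
  | .eq M N => HasSubst.subst M σ = HasSubst.subst N σ
  | @fresh _ a _ _ _ _ x => a ∉ supp (HasSubst.subst x σ)
  | .freshAgent a P => a ∉ (P.subst σ).fn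

/-- Constraints: conjunctions of basic ones; `C ∧ C'` is `C ++ C'`. -/
abbrev Constraint (𝔓 : PsiCalculus.{u}) : Type (u + 1) := List (BasicConstraint 𝔓)

namespace Constraint

variable {𝔓 : PsiCalculus.{u}}

/-- A transition constraint as a constraint. -/
def ofTrans (C : TransConstraint 𝔓) : Constraint 𝔓 := C.map .atom

/-- `⟦ã # P, Q⟧`. -/
def freshAgents (as : List Name) (P Q : Agent 𝔓) : Constraint 𝔓 :=
  as.flatMap fun a => [.freshAgent a P, .freshAgent a Q]

/-- The names with a free occurrence. -/
def fn (C : Constraint 𝔓) : Set Name := {a | ∃ B ∈ C, a ∈ B.fn}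

/-- `(σ, Ψ) ⊨ C`. -/
def Sat (σ : Subst 𝔓.Term) (Ψ : 𝔓.Assn) (C : Constraint 𝔓) : Prop := ∀ B ∈ C, B.Sat σ Ψ

/-- `C ⇒ D`: every solution of `C` is a solution of `D`. -/
def Implies (C D : Constraint 𝔓) : Prop := ∀ σ Ψ, Sat σ Ψ C → Sat σ Ψ D

/-- `C ⇒ ⋁ D̂`: every solution of `C` is a solution of some element of `D̂`. -/
def ImpliesSup (C : Constraint 𝔓) (Ds : Set (Constraint 𝔓)) : Prop :=
  ∀ σ Ψ, Sat σ Ψ C → ∃ D ∈ Ds, Sat σ Ψ D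

end Constraint

/-! ## Symbolic semantics -/

/-- Identity of assertions up to the abelian monoid laws for `⊗` and `1`. -/
inductive AssnEq {𝔓 : PsiCalculus.{u}} : 𝔓.Assn → 𝔓.Assn → Prop
  | refl (Ψ) : AssnEq Ψ Ψ
  | symm {Ψ Ψ'} : AssnEq Ψ Ψ' → AssnEq Ψ' Ψ
  | trans {Ψ Ψ' Ψ''} : AssnEq Ψ Ψ' → AssnEq Ψ' Ψ'' → AssnEq Ψ Ψ''
  | comp {Ψ₁ Ψ₁' Ψ₂ Ψ₂'} : AssnEq Ψ₁ Ψ₁' → AssnEq Ψ₂ Ψ₂' →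
      AssnEq (𝔓.comp Ψ₁ Ψ₂) (𝔓.comp Ψ₁' Ψ₂')
  | ident (Ψ) : AssnEq (𝔓.comp Ψ 𝔓.unit) Ψ
  | assoc (Ψ Ψ' Ψ'') : AssnEq (𝔓.comp (𝔓.comp Ψ Ψ') Ψ'') (𝔓.comp Ψ (𝔓.comp Ψ' Ψ''))
  | comm (Ψ Ψ') : AssnEq (𝔓.comp Ψ Ψ') (𝔓.comp Ψ' Ψ)

/-- The atomic constraint `(νb̃)⟦Ψ ⊢ M ↔ N⟧`. -/
def chanAtom {𝔓 : PsiCalculus.{u}} (b : List Name) (Ψ : 𝔓.Assn) (M N : 𝔓.Term) : Atom 𝔓 :=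
  Atom.mk b Ψ (𝔓.chanEq M N)

/-- The freshness side conditions of the symbolic communication rule that concern one of the two
partners, `P`, with the bound names `bP` of its frame, the bound names `cP` of its subject
constraint, the term `MP` of that constraint and the symbolic subject `y`. The data of the other
partner are `Q`, `bQ`, `cQ`, `MQ`; `as` and `N` belong to the output. -/
def ComFresh {𝔓 : PsiCalculus.{u}} (Ψ : 𝔓.Assn) (P Q : Agent 𝔓) (bP bQ cP cQ : List Name)
    (MP MQ : 𝔓.Term) (y : Name) (as : List Name) (N : 𝔓.Term) : Prop :=
  -- the names bound in the frame are bound in the subject constraint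
  (∀ b ∈ bP, b ∈ cP) ∧
  -- the bound names are fresh
  (∀ b ∈ cP, b ∉ supp Ψ ∧ b ∉ P.fn ∧ b ∉ Q.fn ∧ b ∉ bQ ∧ b ∉ cQ ∧ b ∉ supp MQ) ∧
  -- the symbolic subject is fresh
  y ∉ supp Ψ ∧ y ∉ P.fn ∧ y ∉ Q.fn ∧ y ∉ bP ∧ y ∉ bQ ∧ y ∉ cP ∧ y ∉ cQ ∧
  y ∉ supp MP ∧ y ∉ supp MQ ∧ y ∉ as ∧ y ∉ supp N

/-- The symbolic transitions `Ψ ▷ P —α,C→ P'`. The last two rules identify transitions up to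
renaming of the names `bn(α)`, which bind into the action object and the derivative. -/
inductive SymTrans {𝔓 : PsiCalculus.{u}} :
    𝔓.Assn → Agent 𝔓 → Action Name 𝔓.Term → TransConstraint 𝔓 → Agent 𝔓 → Prop
  | inp (Ψ : 𝔓.Assn) (M : 𝔓.Term) (x : Name) (P : Agent 𝔓) (y : Name) :
      y ∉ supp Ψ → y ∉ supp M → y ∉ P.fn → y ≠ x →
      SymTrans Ψ (Agent.inp M x P) (.inp y x) [chanAtom [] Ψ M (NameTerm.ofName y)] P
  | out (Ψ : 𝔓.Assn) (M N : 𝔓.Term) (P : Agent 𝔓) (y : Name) :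
      y ∉ supp Ψ → y ∉ supp M → y ∉ supp N → y ∉ P.fn →
      SymTrans Ψ (Agent.out M N P) (.out y [] N) [chanAtom [] Ψ M (NameTerm.ofName y)] P
  | case (Ψ : 𝔓.Assn) (n : ℕ) (φ : Fin n → 𝔓.Cond) (P : Fin n → Agent 𝔓) (i : Fin n)
      {α : Action Name 𝔓.Term} {C : TransConstraint 𝔓} {P' : Agent 𝔓} :
      SymTrans Ψ (P i) α C P' →
      SymTrans Ψ (Agent.case n φ P) α (C ++ [Atom.mk [] Ψ (φ i)]) P'
  | comL (Ψ : 𝔓.Assn) (P Q : Agent 𝔓) {bP bQ cP cQ : List Name}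
      {ΨP ΨQ Ψ₁ Ψ₂ : 𝔓.Assn} {MP MQ N : 𝔓.Term} {as : List Name} {x y z : Name}
      {CP CQ : TransConstraint 𝔓} {P' Q' : Agent 𝔓} :
      (bP, ΨP) ∈ P.frame → (bQ, ΨQ) ∈ Q.frame →
      SymTrans (𝔓.comp Ψ ΨQ) P (.out y as N)
        (chanAtom cP Ψ₁ MP (NameTerm.ofName y) :: CP) P' →
      SymTrans (𝔓.comp Ψ ΨP) Q (.inp z x)
        (chanAtom cQ Ψ₂ MQ (NameTerm.ofName z) :: CQ) Q' →
      AssnEq Ψ₁ (𝔓.comp (𝔓.comp Ψ ΨP) ΨQ) → AssnEq Ψ₂ (𝔓.comp (𝔓.comp Ψ ΨP) ΨQ) →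
      ComFresh Ψ P Q bP bQ cP cQ MP MQ y as N → ComFresh Ψ Q P bQ bP cQ cP MQ MP z as N →
      y ≠ z → (∀ a ∈ as, a ∉ Q.fn) →
      SymTrans Ψ (P.par Q) .tau
        (TransConstraint.new (cP ++ cQ)
          (chanAtom [] (𝔓.comp (𝔓.comp Ψ ΨP) ΨQ) MP MQ :: (CP ++ CQ)))
        (Agent.resList as (P'.par (Q'.subst1 N x)))
  | comR (Ψ : 𝔓.Assn) (P Q : Agent 𝔓) {bP bQ cP cQ : List Name}
      {ΨP ΨQ Ψ₁ Ψ₂ : 𝔓.Assn} {MP MQ N : 𝔓.Term} {as : List Name} {x y z : Name}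
      {CP CQ : TransConstraint 𝔓} {P' Q' : Agent 𝔓} :
      (bP, ΨP) ∈ P.frame → (bQ, ΨQ) ∈ Q.frame →
      SymTrans (𝔓.comp Ψ ΨQ) P (.inp z x)
        (chanAtom cP Ψ₁ MP (NameTerm.ofName z) :: CP) P' →
      SymTrans (𝔓.comp Ψ ΨP) Q (.out y as N)
        (chanAtom cQ Ψ₂ MQ (NameTerm.ofName y) :: CQ) Q' →
      AssnEq Ψ₁ (𝔓.comp (𝔓.comp Ψ ΨP) ΨQ) → AssnEq Ψ₂ (𝔓.comp (𝔓.comp Ψ ΨP) ΨQ) →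
      ComFresh Ψ P Q bP bQ cP cQ MP MQ z as N → ComFresh Ψ Q P bQ bP cQ cP MQ MP y as N →
      y ≠ z → (∀ a ∈ as, a ∉ P.fn) →
      SymTrans Ψ (P.par Q) .tau
        (TransConstraint.new (cP ++ cQ)
          (chanAtom [] (𝔓.comp (𝔓.comp Ψ ΨP) ΨQ) MP MQ :: (CP ++ CQ)))
        (Agent.resList as ((P'.subst1 N x).par Q'))
  | parL (Ψ : 𝔓.Assn) (P Q : Agent 𝔓) {bQ : List Name} {ΨQ : 𝔓.Assn}
      {α : Action Name 𝔓.Term} {C : TransConstraint 𝔓} {P' : Agent 𝔓} : (bQ, ΨQ) ∈ Q.frame →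
      (∀ b ∈ bQ, b ∉ supp Ψ ∧ b ∉ P.fn ∧ b ∉ α.symNames) →
      SymTrans (𝔓.comp Ψ ΨQ) P α C P' → (∀ a ∈ α.bn, a ∉ Q.fn) →
      (∀ a ∈ α.symSubj, a ∉ Q.fn) →
      SymTrans Ψ (P.par Q) α (TransConstraint.new bQ C) (P'.par Q)
  | parR (Ψ : 𝔓.Assn) (P Q : Agent 𝔓) {bP : List Name} {ΨP : 𝔓.Assn}
      {α : Action Name 𝔓.Term} {C : TransConstraint 𝔓} {Q' : Agent 𝔓} : (bP, ΨP) ∈ P.frame →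
      (∀ b ∈ bP, b ∉ supp Ψ ∧ b ∉ Q.fn ∧ b ∉ α.symNames) →
      SymTrans (𝔓.comp Ψ ΨP) Q α C Q' → (∀ a ∈ α.bn, a ∉ P.fn) →
      (∀ a ∈ α.symSubj, a ∉ P.fn) →
      SymTrans Ψ (P.par Q) α (TransConstraint.new bP C) (P.par Q')
  | scope (Ψ : 𝔓.Assn) (a : Name) (P : Agent 𝔓)
      {α : Action Name 𝔓.Term} {C : TransConstraint 𝔓} {P' : Agent 𝔓} :
      SymTrans Ψ P α C P' → a ∉ α.symNames → a ∉ supp Ψ →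
      SymTrans Ψ (Agent.res a P) α (TransConstraint.new [a] C) (Agent.res a P')
  | opn (Ψ : 𝔓.Assn) (a : Name) (P : Agent 𝔓) {y : Name} {as₁ as₂ : List Name} {N : 𝔓.Term}
      {C : TransConstraint 𝔓} {P' : Agent 𝔓} : SymTrans Ψ P (.out y (as₁ ++ as₂) N) C P' →
      a ∈ supp N → a ∉ as₁ ++ as₂ → a ∉ supp Ψ → a ≠ y →
      SymTrans Ψ (Agent.res a P) (.out y (as₁ ++ a :: as₂) N) (TransConstraint.new [a] C) P'
  | rep (Ψ : 𝔓.Assn) (P : Agent 𝔓)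
      {α : Action Name 𝔓.Term} {C : TransConstraint 𝔓} {P' : Agent 𝔓} :
      SymTrans Ψ (P.par P.rep) α C P' → SymTrans Ψ P.rep α C P'
  | alphaOut {Ψ P y as N C P'} (a c : Name) : SymTrans Ψ P (.out y as N) C P' →
      a ∈ as → c ∉ as → c ∉ supp N → c ∉ P'.fn →
      SymTrans Ψ P (.out y (as.map (Equiv.swap a c)) (Equiv.swap a c • N)) C
        (P'.perm (Equiv.swap a c))
  | alphaInp {Ψ P y x C P'} (c : Name) : SymTrans Ψ P (.inp y x) C P' → c ∉ P'.fn →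
      SymTrans Ψ P (.inp y c) C (P'.perm (Equiv.swap x c))

/-- Symbolic static equivalence for `C`. -/
def SymStaticEq {𝔓 : PsiCalculus.{u}} (C : Constraint 𝔓) (P Q : Agent 𝔓) : Prop :=
  ∀ σ Ψ, C.Sat σ Ψ →
    ((Frame.mk [] Ψ).comp (P.frame.subst σ)).Equivalent
      ((Frame.mk [] Ψ).comp (Q.frame.subst σ))

/-- (Early) symbolic bisimulation. -/
def IsSymbolicBisimulation {𝔓 : PsiCalculus.{u}}
    (S : Constraint 𝔓 → Agent 𝔓 → Agent 𝔓 → Prop) : Prop :=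
  ∀ C P Q, S C P Q →
    -- it relates (well-formed) agents
    P.WF ∧ Q.WF ∧
    SymStaticEq C P Q ∧
    S C Q P ∧
    ∀ α CP P', SymTrans 𝔓.unit P α CP P' →
      (∀ a ∈ α.bn, a ∉ P.fn ∧ a ∉ Q.fn ∧ a ∉ C.fn ∧ a ∉ (Constraint.ofTrans CP).fn ∧
        a ∉ α.symSubj) →
      (∀ a ∈ α.symSubj, a ∉ P.fn ∧ a ∉ Q.fn ∧ a ∉ C.fn) →
      ∃ Cs : Set (Constraint 𝔓), Constraint.ImpliesSup (C ++ Constraint.ofTrans CP) Cs ∧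
        ∀ C' ∈ Cs, ∃ Q' α' CQ, SymTrans 𝔓.unit Q α' CQ Q' ∧
          C'.Implies (Constraint.ofTrans CQ) ∧
          match α with
          | .out y as N => ∃ N', α' = .out y as N' ∧ C'.Implies [.eq N N'] ∧
              S (C' ++ Constraint.freshAgents as P Q) P' Q'
          | _ => α' = α ∧ S C' P' Q'

end SymPsi

/-! A solution (σ, Ψ) of C turns each clause of symbolic bisimilarity of P and Q into the
corresponding clause for Pσ and Qσ. Static equivalence transfers because taking frames commutes with
substitution (`Agent.frame_subst`). Extension by assertions transfers because solutions survive
weakening (`Constraint.Sat.weaken`). Simulation rests on a correspondence between the transitions of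
Pσ and the solved symbolic transitions of P.

In one direction, `Trans.hasLifts`, a transition of Pσ in Ψ is an instance of a symbolic transition
of P in the unit assertion. Its constraint is solved by (σ', Ψ), where σ' differs from σ only at the
fresh symbolic subject y, which it sends to the actual subject. In the other direction,
`SymTrans.instantiable`, every solution of the constraint of a symbolic transition yields a concrete
one; `SymTrans.exists_trans` then renames its bound names as required.

To simulate, lift the transition of Pσ and let σ'' be σ' changed at the symbolic bound names only:
they go to the concrete bound names for an output, and to the received term L for an input. These
names are fresh for C and C_P, so σ'' still solves C ∧ C_P and hence some D in the disjunction. The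
matching transition of Q has a constraint implied by D, and is instantiated. For outputs, D forces
the objects to agree; the added freshness constraints hold because the symbolic bound names avoid σ,
P and Q. As D is chosen after L, the bisimulation obtained is the early one
(`IsSymbolicBisimulation.exists_match`).

The crux of both directions is communication. For lifting (`IsLift.com`), the premises give M_Pσ ↔ M
and M_Qσ ↔ K for the concrete subjects M and K, the rule gives M ↔ K, and symmetry and transitivity
yield the symbolic constraint M_P ↔ M_Q. All these entailments must come from one assertion. This is
what `SymTrans.exists_subjAtom` provides: the first conjunct of the constraint concerns the
environment composed with the frame of the agent. Well-formedness enters there, since the bodies of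
case and replication must have unit frames. For instantiation (`Instantiable.com`), each symbolic
subject is sent to the instance of the partner's channel term.

The rest is control of binders. Expressions with binders are compared by their instances at fresh
names (`BindEq.bind_eq`, `BindEq.of_bind_eq`). Satisfaction under binders can be tested at any fresh
instance (`Atom.sat_mk_iff`). Induction on concrete transitions may assume distinct and fresh frame
binders (`Trans.strong_induction`). -/

namespace SymPsi

/-! ## Finite partial renamings and fresh names -/

theorem exists_fresh_list {X : Set Name} (hX : X.Finite) (n : ℕ) :
    ∃ d : List Name, d.length = n ∧ d.Nodup ∧ ∀ a ∈ d, a ∉ X := by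
  induction n with
  | zero => exact ⟨[], rfl, List.nodup_nil, by simp⟩
  | succ n ih =>
    obtain ⟨d, h1, h2, h3⟩ := ih
    obtain ⟨c, hc⟩ := (hX.union d.toFinset.finite_toSet).exists_notMem
    simp only [Set.mem_union, List.coe_toFinset, Set.mem_ofPred_eq, not_or] at hc
    exact ⟨c :: d, by simp [h1], by simp [h2, hc.2], by
      rintro a ha
      rcases List.mem_cons.1 ha with rfl | ha
      exacts [hc.1, h3 a ha]⟩

/-- A product of swappings. -/
def swaps (l : List (Name × Name)) : Equiv.Perm Name :=
  (l.map fun p => Equiv.swap p.1 p.2).prod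

@[simp] theorem swaps_nil : swaps [] = 1 := rfl

@[simp] theorem swaps_cons (p : Name × Name) (l : List (Name × Name)) :
    swaps (p :: l) = Equiv.swap p.1 p.2 * swaps l := by simp [swaps]

/-- A partial injection between finite sets of names extends to a product of swappings that moves
only names in its domain and range. -/
theorem exists_swaps_extending (c : Finset Name) (f g : Name → Name)
    (hf : Set.InjOn f c) (hg : Set.InjOn g c) :
    ∃ l : List (Name × Name), (∀ n ∈ c, swaps l (f n) = g n) ∧
      ∀ m, (∀ n ∈ c, m ≠ f n) → (∀ n ∈ c, m ≠ g n) → swaps l m = m := by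
  induction c using Finset.induction_on with
  | empty => exact ⟨[], by simp, by simp⟩
  | insert a c ha ih =>
    obtain ⟨l, h1, h2⟩ := ih (hf.mono (by simp)) (hg.mono (by simp))
    -- `l` already places the names of `c`; one more swapping brings the image of `f a` to `g a`. It
    -- disturbs no earlier value `g n`, which differs from `g a` and from `swaps l (f a)` by the
    -- injectivity of `g` and of `f`.
    refine ⟨(swaps l (f a), g a) :: l, ?_, ?_⟩
    · intro n hn
      rcases Finset.mem_insert.1 hn with rfl | hn
      · simp
      · have hna : n ≠ a := fun h => ha (h ▸ hn)
        have h3 : g n ≠ g a := fun h => hna (hg (by simp [hn]) (by simp) h)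
        have h4 : g n ≠ swaps l (f a) := by
          rw [← h1 n hn]
          intro h
          exact hna (hf (by simp [hn]) (by simp) ((swaps l).injective h))
        simp [h1 n hn, Equiv.swap_apply_of_ne_of_ne h4 h3]
    · intro m hm1 hm2
      have h3 : swaps l m = m := h2 m (fun n hn => hm1 n (by simp [hn])) fun n hn =>
        hm2 n (by simp [hn])
      have h4 : m ≠ swaps l (f a) := by
        intro h
        rw [← h3] at h
        exact hm1 a (by simp) ((swaps l).injective h)
      simp [h3, Equiv.swap_apply_of_ne_of_ne h4 (hm2 a (by simp))]

/-- The law relating renaming to substitution speaks of one swapping at a time, so a permutation is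
replaced by a product of swappings on the finitely many names that matter. -/
theorem exists_swaps_eqOn {s : Set Name} (hs : s.Finite) (π : Equiv.Perm Name) :
    ∃ l, ∀ a ∈ s, swaps l a = π a := by
  obtain ⟨l, h, -⟩ := exists_swaps_extending hs.toFinset id π (Set.injOn_id _) π.injective.injOn
  exact ⟨l, fun a ha => h a (by simpa using ha)⟩

/-- The finite set `B` can be renamed to avoid `X`. -/
theorem exists_perm_avoiding {B X : Set Name} (hB : B.Finite) (hX : X.Finite) :
    ∃ π : Equiv.Perm Name, (∀ b ∈ B, π b ∉ X ∧ π b ∉ B) ∧ ∀ n ∉ B, n ∈ X → π n = n := by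
  obtain ⟨d, h1, h2, h3⟩ := exists_fresh_list (hX.union hB) hB.toFinset.toList.length
  have hlen : ∀ b ∈ hB.toFinset.toList, hB.toFinset.toList.idxOf b < d.length := fun b hb => by
    rw [h1]; exact List.idxOf_lt_length_iff.2 hb
  have hg : ∀ b ∈ hB.toFinset.toList, d.getD (hB.toFinset.toList.idxOf b) b ∈ d := fun b hb => by
    rw [List.getD_eq_getElem _ _ (hlen b hb)]; exact List.getElem_mem _
  -- Each name of `B` goes to the entry of `d` at its position in an enumeration of `B`. The default
  -- of `getD` is never reached, as `d` has the length of that enumeration.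
  obtain ⟨l, h4, h5⟩ := exists_swaps_extending hB.toFinset id
    (fun b => d.getD (hB.toFinset.toList.idxOf b) b) (Set.injOn_id _) (by
      intro a ha b hb hab
      have ha' : a ∈ hB.toFinset.toList := by simpa using ha
      have hb' : b ∈ hB.toFinset.toList := by simpa using hb
      simp only [List.getD_eq_getElem _ _ (hlen a ha'),
        List.getD_eq_getElem _ _ (hlen b hb')] at hab
      exact (List.idxOf_inj ha').1 ((List.Nodup.getElem_inj_iff h2).1 hab))
  refine ⟨swaps l, fun b hb => ?_, fun n hn hnX => h5 n ?_ ?_⟩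
  · have := h3 _ (hg b (by simpa using hb))
    rw [← h4 b (by simpa using hb)] at this
    simpa [not_or] using this
  · rintro m hm rfl
    exact hn (by simpa using hm)
  · rintro m hm rfl
    exact h3 _ (hg m (by simpa using hm)) (Or.inl hnX)

/-! ## Supports -/

section Supports

variable {X : Type u} [Nominal X]

theorem supp_subset_of_supports {x : X} {S : Set Name} (hS : S.Finite)
    (h : ∀ π : Equiv.Perm Name, (∀ a ∈ S, π a = a) → π • x = x) : supp x ⊆ S := by
  intro a ha
  have := ha hS.toFinset (by
    intro π hπ
    exact h π fun a ha => hπ (by simpa using ha))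
  simpa using this

/-- The support is an intersection of supporting sets, so `a` and `b` are a priori missed by two
different ones. A name `c` outside both gives (a b) = (a c)(b c)(a c), and each factor fixes `x`. -/
theorem swap_smul_of_notMem_supp {x : X} {a b : Name} (ha : a ∉ supp x) (hb : b ∉ supp x) :
    Equiv.swap a b • x = x := by
  have key : ∀ a c : Name, ∀ s : Finset Name,
      MulAction.Supports (Equiv.Perm Name) (s : Set Name) x → a ∉ s → c ∉ s →
      Equiv.swap a c • x = x := by
    intro a c s hs ha hc
    apply hs
    intro d hd
    exact Equiv.swap_apply_of_ne_of_ne (fun h => ha (h ▸ hd)) (fun h => hc (h ▸ hd))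
  simp only [supp, Set.mem_ofPred_eq, not_forall] at ha hb
  obtain ⟨s, hs, has⟩ := ha
  obtain ⟨t, ht, hbt⟩ := hb
  by_cases hab : a = b
  · subst hab; simp only [Equiv.swap_self]; exact one_smul _ _
  obtain ⟨c, hc⟩ := Infinite.exists_notMem_finset (s ∪ t ∪ {a, b})
  simp only [Finset.mem_union, Finset.mem_insert, Finset.mem_singleton, not_or] at hc
  have hp : Equiv.swap a b = Equiv.swap a c * (Equiv.swap b c * Equiv.swap a c) := by
    ext d
    simp only [Equiv.Perm.mul_apply, Equiv.swap_apply_def]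
    split_ifs <;> simp_all
  have h1 := key a c s hs has hc.1.1
  have h2 := key b c t ht hbt hc.1.2
  rw [hp, mul_smul, mul_smul, h1, h2, h1]

/-- The support itself supports `x`: names outside it can be erased from a finite supporting set one
by one. If `g` fixes the remaining names but moves the erased name `a`, then `g a` is outside the
set, (a ga)g fixes the whole set and therefore `x`, and (a ga) fixes `x` because neither name is in
its support. -/
theorem smul_eq_self {x : X} {π : Equiv.Perm Name} (h : ∀ a ∈ supp x, π a = a) : π • x = x := by
  classical
  have key : ∀ (s : Finset Name), MulAction.Supports (Equiv.Perm Name) (s : Set Name) x →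
      ∀ a ∉ supp x, MulAction.Supports (Equiv.Perm Name) ((s.erase a : Finset Name) : Set Name) x := by
    intro s hs a ha g hg
    have hg' : ∀ n ∈ s, n ≠ a → g n = n := fun n hn hna => hg (a := n) (by simp [hn, hna])
    by_cases has : a ∈ s
    swap
    · apply hs; intro n hn; exact hg' n hn (fun h => has (h ▸ hn))
    by_cases hga : g a = a
    · apply hs; intro n hn
      by_cases hna : n = a
      · subst hna; exact hga
      · exact hg' n hn hna
    have hgs : g a ∉ s := by
      intro h
      have := hg' _ h hga
      exact hga (g.injective this)
    have h1 : (Equiv.swap a (g a) * g) • x = x := by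
      apply hs
      intro n hn
      by_cases hna : n = a
      · subst hna; simp
      · have h2 := hg' n hn hna
        have h3 : n ≠ g a := fun h => hgs (h ▸ hn)
        change Equiv.swap a (g a) (g n) = n
        rw [h2, Equiv.swap_apply_of_ne_of_ne hna h3]
    have h2 : Equiv.swap a (g a) • x = x :=
      swap_smul_of_notMem_supp ha fun h => hgs (h s hs)
    have h3 : g • x = Equiv.swap a (g a) • (Equiv.swap a (g a) * g) • x := by
      rw [← mul_smul, ← mul_assoc, Equiv.swap_mul_self, one_mul]
    rw [h3, h1, h2]
  have key2 : ∀ (t s : Finset Name), MulAction.Supports (Equiv.Perm Name) (s : Set Name) x →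
      (∀ a ∈ t, a ∉ supp x) →
      MulAction.Supports (Equiv.Perm Name) ((s \ t : Finset Name) : Set Name) x := by
    intro t
    induction t using Finset.induction_on with
    | empty => intro s hs _; simpa using hs
    | insert a t ha ih =>
      intro s hs h
      have := key _ (ih s hs fun b hb => h b (by simp [hb])) a (h a (by simp))
      rwa [← Finset.sdiff_insert] at this
  obtain ⟨s, hs⟩ := Nominal.exists_supports x
  apply key2 (s.filter fun a => a ∉ supp x) s hs (by simp)
  intro n hn
  simp only [Finset.coe_sdiff, Finset.coe_filter, Set.mem_sdiff, Finset.mem_coe,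
    Set.mem_ofPred_eq, not_and, not_not] at hn
  exact h n (hn.2 hn.1)

theorem smul_congr_supp {x : X} {π ρ : Equiv.Perm Name} (h : ∀ a ∈ supp x, π a = ρ a) :
    π • x = ρ • x := by
  have h1 : (ρ⁻¹ * π) • x = x := smul_eq_self fun a ha => by simp [h a ha]
  rw [mul_smul, inv_smul_eq_iff] at h1
  exact h1

/-- The usual test for freshness: otherwise the swapping would carry `a` in the support to `b` in
the support. -/
theorem notMem_supp_of_swap {x : X} {a b : Name} (hb : b ∉ supp x)
    (h : Equiv.swap a b • x = x) : a ∉ supp x := by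
  intro ha
  have := mem_supp_smul (π := Equiv.swap a b) ha
  rw [h] at this
  exact hb (by simpa using this)

theorem supp_prod {Y : Type u} [Nominal Y] (x : X) (y : Y) : supp (x, y) = supp x ∪ supp y := by
  apply Set.Subset.antisymm
  · apply supp_subset_of_supports ((supp_finite x).union (supp_finite y))
    intro π h
    rw [Prod.smul_mk, smul_eq_self fun a ha => h a (Or.inl ha),
      smul_eq_self fun a ha => h a (Or.inr ha)]
  · rintro a (h | h) s hs
    · refine h s fun π hπ => congrArg Prod.fst (hs π hπ)
    · refine h s fun π hπ => congrArg Prod.snd (hs π hπ)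

/-- Equivariant operations create no names. -/
theorem supp_map₂_subset {Y Z : Type u} [Nominal Y] [Nominal Z] (f : X → Y → Z)
    (hf : ∀ (π : Equiv.Perm Name) x y, π • f x y = f (π • x) (π • y)) (x : X) (y : Y) :
    supp (f x y) ⊆ supp x ∪ supp y := by
  apply supp_subset_of_supports ((supp_finite x).union (supp_finite y))
  intro π h
  rw [hf, smul_eq_self fun a ha => h a (Or.inl ha), smul_eq_self fun a ha => h a (Or.inr ha)]

end Supports

theorem supp_ofName {T : Type u} [NameTerm T] (a : Name) :
    supp (NameTerm.ofName a : T) = {a} := by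
  apply Set.Subset.antisymm
  · apply supp_subset_of_supports (Set.finite_singleton a)
    intro π h
    rw [NameTerm.smul_ofName, h a rfl]
  · rintro b rfl
    by_contra hb
    obtain ⟨c, hc⟩ := ((supp_finite (NameTerm.ofName b : T)).union (Set.finite_singleton b)).exists_notMem
    simp only [Set.mem_union, Set.mem_singleton_iff, not_or] at hc
    have := swap_smul_of_notMem_supp hb hc.1
    rw [NameTerm.smul_ofName] at this
    have := NameTerm.ofName_injective this
    simp at this
    exact hc.2 this

variable {𝔓 : PsiCalculus.{u}}

theorem supp_comp_subset (Ψ Ψ' : 𝔓.Assn) : supp (𝔓.comp Ψ Ψ') ⊆ supp Ψ ∪ supp Ψ' :=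
  supp_map₂_subset 𝔓.comp 𝔓.smul_comp Ψ Ψ'

theorem supp_chanEq_subset (M N : 𝔓.Term) : supp (𝔓.chanEq M N) ⊆ supp M ∪ supp N :=
  supp_map₂_subset 𝔓.chanEq 𝔓.smul_chanEq M N

theorem supp_unit : supp 𝔓.unit = ∅ :=
  Set.subset_empty_iff.1 (supp_subset_of_supports Set.finite_empty fun π _ => 𝔓.smul_unit π)

end SymPsi

namespace SymPsi
open HasSubst (subst)

/-! ## Renaming along lists of names -/

/-- The name at the position in `e` of the last occurrence of `n` in `c`. -/
def listMap : List Name → List Name → Name → Name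
  | a :: c, m :: e, n => if n ∈ c then listMap c e n else if n = a then m else n
  | _, _, n => n

theorem listMap_of_notMem : ∀ (c e : List Name) {n : Name}, n ∉ c → listMap c e n = n
  | [], e, n, h => by cases e <;> rfl
  | a :: c, [], n, h => rfl
  | a :: c, m :: e, n, h => by
    simp only [List.mem_cons, not_or] at h
    simp [listMap, h.1, h.2]

theorem listMap_mem : ∀ {c e : List Name} {n : Name}, n ∈ c → e.length = c.length →
    listMap c e n ∈ e
  | a :: c, m :: e, n, h, hl => by
    simp only [List.length_cons, Nat.add_right_cancel_iff] at hl
    by_cases hn : n ∈ c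
    · simp [listMap, hn, listMap_mem hn hl]
    · obtain rfl : n = a := by simpa [hn] using h
      simp [listMap, hn]
  | a :: c, [], n, h, hl => by simp at hl

/-- Repetitions in `c` are harmless, since each name counts only at its last occurrence, the
innermost binder; only the target names must be distinct. -/
theorem listMap_injOn : ∀ {c e : List Name}, e.length = c.length → e.Nodup →
    Set.InjOn (listMap c e) {n | n ∈ c}
  | [], e, _, _ => by intro n hn; simp at hn
  | a :: c, [], hl, _ => by simp at hl
  | a :: c, m :: e, hl, hd => by
    simp only [List.length_cons, Nat.add_right_cancel_iff] at hl
    obtain ⟨hm, hd⟩ := List.nodup_cons.1 hd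
    intro n hn k hk h
    simp only [listMap] at h
    have aux : ∀ l ∈ c, listMap c e l ≠ m := fun l hl' h => hm (h ▸ listMap_mem hl' hl)
    by_cases hnc : n ∈ c <;> by_cases hkc : k ∈ c
    · simp only [hnc, hkc, if_true] at h
      exact listMap_injOn hl hd hnc hkc h
    · obtain rfl : k = a := by simpa [hkc] using hk
      simp only [hnc, hkc, if_true, if_false] at h
      exact absurd h (aux n hnc)
    · obtain rfl : n = a := by simpa [hnc] using hn
      simp only [hnc, hkc, if_true, if_false] at h
      exact absurd h.symm (aux k hkc)
    · have h1 : n = a := by simpa [hnc] using hn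
      have h2 : k = a := by simpa [hkc] using hk
      rw [h1, h2]

theorem listMap_self : ∀ (c : List Name) (n : Name), listMap c c n = n
  | [], n => rfl
  | a :: c, n => by
    simp only [listMap, listMap_self c n]
    split_ifs with h1 h2 <;> simp_all

theorem listMap_map_left : ∀ (c e : List Name) {f : Name → Name} (_ : Function.Injective f)
    {n : Name}, n ∈ c → e.length = c.length → listMap (c.map f) e (f n) = listMap c e n
  | a :: c, [], f, hf, n, hn, hl => by simp at hl
  | a :: c, m :: e, f, hf, n, hn, hl => by
    simp only [List.length_cons, Nat.add_right_cancel_iff] at hl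
    simp only [List.map_cons, listMap, List.mem_map_of_injective hf, hf.eq_iff]
    by_cases hnc : n ∈ c
    · simp [hnc, listMap_map_left c e hf hnc hl]
    · obtain rfl : n = a := by simpa [hnc] using hn
      simp [hnc]

theorem listMap_map_right : ∀ (c e : List Name) (f : Name → Name) {n : Name}, n ∈ c →
    e.length = c.length → listMap c (e.map f) n = f (listMap c e n)
  | a :: c, [], f, n, hn, hl => by simp at hl
  | a :: c, m :: e, f, n, hn, hl => by
    simp only [List.length_cons, Nat.add_right_cancel_iff] at hl
    simp only [List.map_cons, listMap]
    by_cases hnc : n ∈ c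
    · simp [hnc, listMap_map_right c e f hnc hl]
    · obtain rfl : n = a := by simpa [hnc] using hn
      simp [hnc]

/-- Inner binders shadow outer ones, so a name bound in `c₂` is looked up there even if it also
occurs in `c₁`. -/
theorem listMap_append_right : ∀ {c₁ e₁ : List Name} (c₂ e₂ : List Name) {n : Name},
    e₁.length = c₁.length → n ∈ c₂ → listMap (c₁ ++ c₂) (e₁ ++ e₂) n = listMap c₂ e₂ n
  | [], [], c₂, e₂, n, _, _ => rfl
  | [], _ :: _, _, _, _, hl, _ => by simp at hl
  | _ :: _, [], _, _, _, hl, _ => by simp at hl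
  | a :: c₁, m :: e₁, c₂, e₂, n, hl, hn => by
    simp only [List.length_cons, Nat.add_right_cancel_iff] at hl
    simp [listMap, hn, listMap_append_right c₂ e₂ hl hn]

theorem listMap_append_left : ∀ {c₁ e₁ : List Name} (c₂ e₂ : List Name) {n : Name},
    e₁.length = c₁.length → n ∉ c₂ → listMap (c₁ ++ c₂) (e₁ ++ e₂) n = listMap c₁ e₁ n
  | [], [], c₂, e₂, n, _, hn => by simp [listMap_of_notMem _ _ hn, listMap]
  | [], _ :: _, _, _, _, hl, _ => by simp at hl
  | _ :: _, [], _, _, _, hl, _ => by simp at hl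
  | a :: c₁, m :: e₁, c₂, e₂, n, hl, hn => by
    simp only [List.length_cons, Nat.add_right_cancel_iff] at hl
    simp only [List.cons_append, listMap, List.mem_append, hn, or_false,
      listMap_append_left c₂ e₂ hl hn]

namespace Subst

variable {T : Type u} [NameTerm T]

/-- `σ` with the names in `c` mapped to names by `f`. -/
def ren (σ : Subst T) (c : List Name) (f : Name → Name) : Subst T :=
  ⟨fun n => if n ∈ c then NameTerm.ofName (f n) else σ n,
    (σ.finite_dom.union c.toFinset.finite_toSet).subset (by
      intro n hn
      by_cases h : n ∈ c
      · right; simpa using h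
      · left; simpa [h] using hn)⟩

/-- `σ` with the names of the list `c` mapped to those of the list `e`. -/
def bind (σ : Subst T) (c e : List Name) : Subst T := σ.ren c (listMap c e)

/-- The substitution that agrees with `f` on a finite set. -/
noncomputable def onFinite {s : Set Name} (hs : s.Finite) (f : Name → T) : Subst T :=
  ⟨fun n => open Classical in if n ∈ s then f n else NameTerm.ofName n, hs.subset (by
      intro n hn
      by_contra h
      simp [h] at hn)⟩


theorem bind_of_mem (σ : Subst T) {c e : List Name} {n : Name} (h : n ∈ c) :
    σ.bind c e n = NameTerm.ofName (listMap c e n) := if_pos h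

theorem bind_of_notMem (σ : Subst T) {c e : List Name} {n : Name} (h : n ∉ c) :
    σ.bind c e n = σ n := if_neg h

theorem bind_nil (σ : Subst T) (e : List Name) : σ.bind [] e = σ := by
  ext n; exact bind_of_notMem σ (by simp)

theorem onFinite_of_mem {s : Set Name} (hs : s.Finite) (f : Name → T) {n : Name} (h : n ∈ s) :
    onFinite hs f n = f n := if_pos h

theorem update_same (σ : Subst T) (a : Name) (M : T) : σ.update a M a = M := by
  simp [update]

theorem update_of_ne (σ : Subst T) {a n : Name} (M : T) (h : n ≠ a) : σ.update a M n = σ n := by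
  simp [update, h]

theorem id_apply (n : Name) : (Subst.id : Subst T) n = NameTerm.ofName n := rfl

theorem single_same (a : Name) (M : T) : single a M a = M := update_same _ _ _

theorem single_of_ne {a n : Name} (M : T) (h : n ≠ a) : single a M n = NameTerm.ofName n :=
  update_of_ne _ _ h

theorem perm_apply (π : Equiv.Perm Name) (σ : Subst T) (n : Name) :
    σ.perm π n = π • σ (π⁻¹ n) := rfl

theorem eq_ofName_of_notMem_support {σ : Subst T} {n : Name} (h : n ∉ σ.support) :
    σ n = NameTerm.ofName n := by
  by_contra h1
  exact h (Or.inl h1)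

/-- A name outside the support of `σ` is neither moved nor introduced, so it can only come from
itself. This is how freshness for `σ` excludes capture throughout. -/
theorem eq_of_mem_supp {σ : Subst T} {n m : Name} (h : n ∉ σ.support) (hm : n ∈ supp (σ m)) :
    m = n := by
  by_cases h1 : σ m = NameTerm.ofName m
  · rw [h1, supp_ofName] at hm; exact hm.symm
  · exact absurd (Or.inr ⟨m, h1, hm⟩) h

theorem support_finite (σ : Subst T) : σ.support.Finite := by
  refine σ.finite_dom.union ?_
  have : {b | ∃ a, σ a ≠ NameTerm.ofName a ∧ b ∈ supp (σ a)} =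
      ⋃ a ∈ {a | σ a ≠ NameTerm.ofName a}, supp (σ a) := by ext; simp
  rw [this]
  exact σ.finite_dom.biUnion fun a _ => supp_finite _

/-- The names of the terms that `σ` substitutes for the names in `s`. -/
def image (σ : Subst T) (s : Set Name) : Set Name := ⋃ n ∈ s, supp (σ n)

theorem mem_image {σ : Subst T} {s : Set Name} {a : Name} :
    a ∈ σ.image s ↔ ∃ n ∈ s, a ∈ supp (σ n) := by simp [image]

theorem image_finite (σ : Subst T) {s : Set Name} (hs : s.Finite) : (σ.image s).Finite :=
  hs.biUnion fun _ _ => supp_finite _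

end Subst

/-! ## Substitution in data -/

variable {𝔓 : PsiCalculus.{u}}

/-- Composition of substitutions. -/
def Subst.comp (σ τ : Subst 𝔓.Term) : Subst 𝔓.Term :=
  ⟨fun n => subst (σ n) τ, (σ.finite_dom.union τ.finite_dom).subset (by
    intro n hn
    by_contra h
    simp only [Set.mem_union, Set.mem_ofPred_eq, not_or, not_not] at h
    rw [Set.mem_ofPred_eq, h.1, 𝔓.subst_ofName, h.2] at hn
    exact hn rfl)⟩

/-- Atomic constraints bind names in a pair of an assertion and a condition. Making pairs a lawful
nominal data type lets the lemmas on binding cover frames and constraints at once. -/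
instance (T X Y : Type u) [NameTerm T] [HasSubst T X] [HasSubst T Y] : HasSubst T (X × Y) :=
  ⟨fun p σ => (subst p.1 σ, subst p.2 σ)⟩

instance (T X Y : Type u) [NameTerm T] [HasSubst T T] [Nominal X] [Nominal Y] [HasSubst T X]
    [HasSubst T Y] [LawfulSubst T X] [LawfulSubst T Y] : LawfulSubst T (X × Y) where
  smul_subst π x σ := Prod.ext (LawfulSubst.smul_subst π _ σ) (LawfulSubst.smul_subst π _ σ)
  subst_id x := Prod.ext (LawfulSubst.subst_id _) (LawfulSubst.subst_id _)
  subst_congr x σ τ h := by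
    rw [supp_prod] at h
    exact Prod.ext (LawfulSubst.subst_congr _ σ τ fun a ha => h a (Or.inl ha))
      (LawfulSubst.subst_congr _ σ τ fun a ha => h a (Or.inr ha))
  subst_subst x σ τ ρ h := Prod.ext (LawfulSubst.subst_subst _ σ τ ρ h)
    (LawfulSubst.subst_subst _ σ τ ρ h)
  subst_rename x a b h := by
    rw [supp_prod] at h
    exact Prod.ext (LawfulSubst.subst_rename _ a b fun hb => h (Or.inl hb))
      (LawfulSubst.subst_rename _ a b fun hb => h (Or.inr hb))
  supp_subset x σ a h := by
    rw [supp_prod] at h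
    change _ ⊆ supp (subst x.1 σ, subst x.2 σ)
    rw [supp_prod]
    rcases h with h | h
    · exact (LawfulSubst.supp_subset _ σ a h).trans Set.subset_union_left
    · exact (LawfulSubst.supp_subset _ σ a h).trans Set.subset_union_right

section Data

variable {X : Type u} [Nominal X] [HasSubst 𝔓.Term X] [LawfulSubst 𝔓.Term X]

theorem subst_congr_supp {x : X} {σ τ : Subst 𝔓.Term} (h : ∀ n ∈ supp x, σ n = τ n) :
    subst x σ = subst x τ := LawfulSubst.subst_congr x σ τ h

theorem subst_eq_self {x : X} {σ : Subst 𝔓.Term} (h : ∀ n ∈ supp x, σ n = NameTerm.ofName n) :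
    subst x σ = x := by
  rw [subst_congr_supp (τ := Subst.id) h, LawfulSubst.subst_id]

/-- The composition law asks for equality at all names; `Subst.comp` supplies it, and congruence
reduces it to the names that occur. -/
theorem subst_subst_eq {x : X} {σ τ ρ : Subst 𝔓.Term} (h : ∀ n ∈ supp x, ρ n = subst (σ n) τ) :
    subst (subst x σ) τ = subst x ρ := by
  rw [LawfulSubst.subst_subst x σ τ (σ.comp τ) fun a => rfl]
  exact subst_congr_supp fun n hn => (h n hn).symm

/-- One swapping at a time: equivariance gives an action on the data and on the substitution, and
`Raw.subst_swap_data` turns the former into a precomposition, which cancels the inverse swapping in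
the latter. The intermediate substitution is truncated to the support of `x` to have a finite
domain. -/
theorem smul_subst_swaps (l : List (Name × Name)) : ∀ {x : X} {σ τ : Subst 𝔓.Term},
    (∀ n ∈ supp x, τ n = swaps l • σ n) → swaps l • subst x σ = subst x τ := by
  induction l with
  | nil =>
    intro x σ τ h
    simp only [swaps_nil, one_smul] at h ⊢
    exact subst_congr_supp fun n hn => (h n hn).symm
  | cons p l ih =>
    intro x σ τ h
    simp only [swaps_cons, mul_smul] at h ⊢
    rw [ih (τ := Subst.onFinite (supp_finite x) fun n => swaps l • σ n) fun n hn =>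
      Subst.onFinite_of_mem _ _ hn, LawfulSubst.smul_subst, Raw.subst_swap_data]
    refine subst_congr_supp fun n hn => ?_
    rw [h n hn]
    change Equiv.swap p.1 p.2 • Subst.onFinite _ _ ((Equiv.swap p.1 p.2)⁻¹ (Equiv.swap p.1 p.2 n)) = _
    rw [show (Equiv.swap p.1 p.2)⁻¹ (Equiv.swap p.1 p.2 n) = n by simp, Subst.onFinite_of_mem _ _ hn]

/-- A permutation commutes with substitution. -/
theorem smul_subst_eq {π : Equiv.Perm Name} {x : X} {σ τ : Subst 𝔓.Term}
    (h : ∀ n ∈ supp x, τ n = π • σ n) : π • subst x σ = subst x τ := by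
  obtain ⟨l, hl⟩ := exists_swaps_eqOn ((supp_finite (subst x σ)).union
    (σ.image_finite (supp_finite x))) π
  rw [← smul_congr_supp fun a ha => hl a (Or.inl ha)]
  apply smul_subst_swaps
  intro n hn
  rw [h n hn]
  exact (smul_congr_supp fun a ha => hl a (Or.inr (Subst.mem_image.2 ⟨n, hn, ha⟩))).symm

/-- Conjugation: `σ` on the renamed data is the `π`-image of the substitution n ↦ π⁻¹ • σ (π n), so
equivariance takes `π` out and `smul_subst_eq` absorbs it. -/
theorem subst_smul {π : Equiv.Perm Name} {x : X} {σ τ : Subst 𝔓.Term}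
    (h : ∀ n ∈ supp x, τ n = σ (π n)) : subst (π • x) σ = subst x τ := by
  let ρ : Subst 𝔓.Term := Subst.onFinite (supp_finite x) fun n => π⁻¹ • σ (π n)
  have h1 : subst (π • x) σ = subst (π • x) (ρ.perm π) := by
    refine subst_congr_supp fun n hn => ?_
    rw [mem_supp_smul_iff] at hn
    rw [Subst.perm_apply, Subst.onFinite_of_mem _ _ hn]
    simp
  rw [h1, ← LawfulSubst.smul_subst]
  refine smul_subst_eq fun n hn => ?_
  rw [h n hn, Subst.onFinite_of_mem _ _ hn]
  simp

theorem smul_eq_subst {π : Equiv.Perm Name} {x : X} {τ : Subst 𝔓.Term}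
    (h : ∀ n ∈ supp x, τ n = NameTerm.ofName (π n)) : π • x = subst x τ := by
  rw [← subst_eq_self (x := π • x) (σ := (Subst.id : Subst 𝔓.Term)) fun _ _ => rfl]
  exact subst_smul h

/-- One inclusion is a law of substitution. For the other, swapping a name outside the image with a
fresh one changes no substituted term, hence not the result. -/
theorem supp_subst (x : X) (σ : Subst 𝔓.Term) : supp (subst x σ) = σ.image (supp x) := by
  apply Set.Subset.antisymm
  · intro a ha
    by_contra h
    simp only [Subst.mem_image, not_exists, not_and] at h
    obtain ⟨b, hb⟩ := ((supp_finite (subst x σ)).union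
      (σ.image_finite (supp_finite x))).exists_notMem
    simp only [Set.mem_union, not_or, Subst.mem_image, not_exists, not_and] at hb
    refine notMem_supp_of_swap (a := a) hb.1 ?_ ha
    exact smul_subst_eq fun n hn => (swap_smul_of_notMem_supp (h n hn) (hb.2 n hn)).symm
  · intro a ha
    obtain ⟨n, hn, ha⟩ := Subst.mem_image.1 ha
    exact LawfulSubst.supp_subset x σ n hn ha

/-! ## Binding of lists of names -/

/-- Alpha-equivalence of expressions `(νb̃)x`. -/
abbrev BindEq {X : Type u} [Nominal X] : List Name × X → List Name × X → Prop :=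
  Relation.EqvGen BindStep

theorem BindStep.length_eq {X : Type u} [Nominal X] {p q : List Name × X} (h : BindStep p q) :
    q.1.length = p.1.length := by
  cases h; simp

/-- An instance replaces every bound name by the entry of `d` at the position of its binder.
Renaming a binder `a` to a fresh `c` changes names but not positions, and the free names are not
affected. -/
theorem BindStep.bind_eq {p q : List Name × X} (h : BindStep p q) (σ : Subst 𝔓.Term)
    (d : List Name) (hd : d.length = p.1.length) :
    subst p.2 (σ.bind p.1 d) = subst q.2 (σ.bind q.1 d) := by
  obtain ⟨pre, post, a, c, x, h1, h2⟩ := h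
  refine (subst_smul fun n hn => ?_).symm
  have hnc : n ≠ c := fun h => h2 (h ▸ hn)
  have hmem : Equiv.swap a c n ∈ post.map (Equiv.swap a c) ↔ n ∈ post :=
    List.mem_map_of_injective (Equiv.injective _)
  -- The lookup of one name `n` of the scope: if bound, it keeps its position after the swapping; if
  -- free, it is not moved and stays free. The outer binders `pre` are then peeled off by induction.
  suffices key : ∀ (pre d : List Name), d.length = (pre ++ a :: post).length →
      (n ∈ pre ++ a :: post →
        Equiv.swap a c n ∈ pre ++ c :: post.map (Equiv.swap a c) ∧
        listMap (pre ++ a :: post) d n =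
          listMap (pre ++ c :: post.map (Equiv.swap a c)) d (Equiv.swap a c n)) ∧
      (n ∉ pre ++ a :: post → Equiv.swap a c n = n ∧
        n ∉ pre ++ c :: post.map (Equiv.swap a c)) by
    obtain ⟨k1, k2⟩ := key pre d hd
    by_cases hn' : n ∈ pre ++ a :: post
    · rw [Subst.bind_of_mem _ hn', Subst.bind_of_mem _ (k1 hn').1, (k1 hn').2]
    · rw [(k2 hn').1, Subst.bind_of_notMem _ hn', Subst.bind_of_notMem _ (k2 hn').2]
  have hmiss : ∀ pre : List Name, n ∉ pre ++ a :: post → Equiv.swap a c n = n ∧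
        n ∉ pre ++ c :: post.map (Equiv.swap a c) := by
    intro pre h
    simp only [List.mem_append, List.mem_cons, not_or] at h ⊢
    have hs := Equiv.swap_apply_of_ne_of_ne h.2.1 hnc
    refine ⟨hs, h.1, hnc, ?_⟩
    rw [← hs, hmem]; exact h.2.2
  intro pre
  induction pre with
  | nil =>
    intro d hd
    refine ⟨fun hn' => ?_, hmiss []⟩
    obtain ⟨m, d, rfl⟩ : ∃ m d', d = m :: d' := by cases d <;> simp at hd ⊢
    simp only [List.nil_append, List.length_cons, Nat.add_right_cancel_iff] at hd
    simp only [List.nil_append, listMap, hmem, List.mem_cons]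
    by_cases hp : n ∈ post
    · simp only [hp, or_true, if_true, true_and]
      exact (listMap_map_left post d (Equiv.injective _) hp hd).symm
    · obtain rfl : n = a := by simpa [hp] using hn'
      simp [hp]
  | cons b pre ih =>
    intro d hd
    refine ⟨fun hn' => ?_, hmiss (b :: pre)⟩
    obtain ⟨m, d, rfl⟩ : ∃ m d', d = m :: d' := by cases d <;> simp at hd ⊢
    simp only [List.cons_append, List.length_cons, Nat.add_right_cancel_iff] at hd
    obtain ⟨k1, k2⟩ := ih d (by simpa using hd)
    by_cases hp : n ∈ pre ++ a :: post
    · have := k1 hp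
      refine ⟨List.mem_cons_of_mem _ this.1, ?_⟩
      simp only [List.cons_append, listMap, hp, this.1, if_true, this.2]
    · obtain rfl : n = b := by simpa [hp] using hn'
      have := k2 hp
      simp only [List.cons_append, listMap, hp, this.1, this.2, if_false]
      simp

theorem BindEq.length_eq {X : Type u} [Nominal X] {p q : List Name × X} (h : BindEq p q) :
    q.1.length = p.1.length := by
  induction h with
  | rel _ _ h => exact h.length_eq
  | refl => rfl
  | symm _ _ _ ih => exact ih.symm
  | trans _ _ _ _ _ h1 h2 => exact h2.trans h1

/-- The instances of an expression do not depend on the choice of the bound names. -/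
theorem BindEq.bind_eq {p q : List Name × X} (h : BindEq p q) (σ : Subst 𝔓.Term)
    {d : List Name} (hd : d.length = p.1.length) :
    subst p.2 (σ.bind p.1 d) = subst q.2 (σ.bind q.1 d) := by
  induction h with
  | rel _ _ h => exact h.bind_eq σ d hd
  | refl => rfl
  | symm _ _ h ih => exact (ih (hd.trans (BindEq.length_eq h))).symm
  | trans _ _ _ h1 _ h2 h3 => exact (h2 hd).trans (h3 (hd.trans (BindEq.length_eq h1).symm))

theorem mem_map_swap {c : List Name} {a b n : Name} :
    n ∈ c.map (Equiv.swap a b) ↔ Equiv.swap a b n ∈ c := by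
  rw [List.mem_map]
  constructor
  · rintro ⟨m, hm, rfl⟩; simpa using hm
  · intro h; exact ⟨_, h, by simp⟩

theorem mem_map_perm {c : List Name} {π : Equiv.Perm Name} {n : Name} :
    n ∈ c.map π ↔ π⁻¹ n ∈ c := by
  rw [List.mem_map]
  constructor
  · rintro ⟨m, hm, rfl⟩; simpa using hm
  · intro h; exact ⟨_, h, by simp⟩

theorem BindEq.free_eq {X : Type u} [Nominal X] {p q : List Name × X} (h : BindEq p q) :
    {n | n ∈ supp p.2 ∧ n ∉ p.1} = {n | n ∈ supp q.2 ∧ n ∉ q.1} := by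
  induction h with
  | rel _ _ h =>
    obtain ⟨pre, post, a, c, x, h1, h2⟩ := h
    ext d
    simp only [Set.mem_ofPred_eq, List.mem_append, List.mem_cons, mem_map_swap, mem_supp_smul_iff,
      Equiv.swap_inv]
    by_cases hda : d = a
    · subst hda; simp [h2]
    by_cases hdc : d = c
    · subst hdc; simp [h2]
    simp [Equiv.swap_apply_of_ne_of_ne hda hdc, hda, hdc]
  | refl => rfl
  | symm _ _ _ ih => exact ih.symm
  | trans _ _ _ _ _ h1 h2 => exact h1.trans h2

theorem BindEq.mem_free {X : Type u} [Nominal X] {b b' : List Name} {x x' : X}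
    (h : BindEq (b, x) (b', x')) {n : Name} (h1 : n ∈ supp x) (h2 : n ∉ b) :
    n ∈ supp x' ∧ n ∉ b' := by
  have := h.free_eq
  exact this.subset (show n ∈ {n | n ∈ supp x ∧ n ∉ b} from ⟨h1, h2⟩)

theorem BindEq.append_left {X : Type u} [Nominal X] (as : List Name) {b b' : List Name} {x x' : X}
    (h : BindEq (b, x) (b', x')) : BindEq (as ++ b, x) (as ++ b', x') := by
  have key : ∀ p q : List Name × X, BindEq p q → BindEq (as ++ p.1, p.2) (as ++ q.1, q.2) := by
    intro p q h
    induction h with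
    | rel _ _ h =>
      obtain ⟨pre, post, a, c, x, h1, h2⟩ := h
      have := BindStep.mk (as ++ pre) post a c x h1 h2
      exact .rel _ _ (by simpa using this)
    | refl => exact .refl _
    | symm _ _ _ ih => exact .symm _ _ ih
    | trans _ _ _ _ _ h1 h2 => exact .trans _ _ _ h1 h2
  exact key _ _ h

/-- Binders are renamed from the innermost outwards, with those still to be treated kept in `pre`.
As `d` avoids the old binders, the step that renames `a` leaves the inner names of `d` alone. -/
theorem BindEq.rename_disjoint (x : X) : ∀ (pre b d : List Name), d.length = b.length → d.Nodup →
    (∀ m ∈ d, m ∉ supp x ∧ m ∉ b) →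
    BindEq (pre ++ b, x) (pre ++ d, subst x ((Subst.id : Subst 𝔓.Term).bind b d))
  | pre, [], d, hl, _, _ => by
    obtain rfl : d = [] := by simpa using hl
    rw [Subst.bind_nil, LawfulSubst.subst_id]
    exact .refl _
  | pre, a :: b, [], hl, _, _ => by simp at hl
  | pre, a :: b, m :: d, hl, hd, h => by
    simp only [List.length_cons, Nat.add_right_cancel_iff] at hl
    obtain ⟨hm, hd⟩ := List.nodup_cons.1 hd
    have had : a ∉ d := fun ha => (h a (by simp [ha])).2 (by simp)
    have hmx := h m (by simp)
    simp only [List.mem_cons, not_or] at hmx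
    have ih := BindEq.rename_disjoint x (pre ++ [a]) b d hl hd fun k hk =>
      ⟨(h k (by simp [hk])).1, fun hkb => (h k (by simp [hk])).2 (by simp [hkb])⟩
    simp only [List.append_assoc, List.singleton_append] at ih
    refine .trans _ _ _ ih ?_
    have hmS : m ∉ supp (subst x ((Subst.id : Subst 𝔓.Term).bind b d)) := by
      rw [supp_subst, Subst.mem_image]
      rintro ⟨n, hn, hmn⟩
      by_cases hnb : n ∈ b
      · rw [Subst.bind_of_mem _ hnb, supp_ofName] at hmn
        exact hm (hmn ▸ listMap_mem hnb hl)
      · rw [Subst.bind_of_notMem _ hnb, Subst.id_apply, supp_ofName] at hmn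
        exact hmx.1 (hmn ▸ hn)
    have step := BindStep.mk pre d a m _ hm hmS
    have e1 : d.map (Equiv.swap a m) = d := by
      conv_rhs => rw [← List.map_id d]
      refine List.map_congr_left fun k hk => ?_
      exact Equiv.swap_apply_of_ne_of_ne (fun h => had (h ▸ hk)) fun h => hm (h ▸ hk)
    have e2 : Equiv.swap a m • subst x ((Subst.id : Subst 𝔓.Term).bind b d) =
        subst x ((Subst.id : Subst 𝔓.Term).bind (a :: b) (m :: d)) := by
      refine smul_subst_eq fun n hn => ?_
      by_cases hnb : n ∈ b
      · rw [Subst.bind_of_mem _ hnb, Subst.bind_of_mem _ (by simp [hnb]), NameTerm.smul_ofName]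
        have hmem := listMap_mem hnb hl
        rw [Equiv.swap_apply_of_ne_of_ne (fun h : _ = a => had (h ▸ hmem)) fun h : _ = m => hm (h ▸ hmem)]
        simp [listMap, hnb]
      · rw [Subst.bind_of_notMem _ hnb, Subst.id_apply, NameTerm.smul_ofName]
        by_cases hna : n = a
        · subst hna
          rw [Subst.bind_of_mem _ (by simp)]
          simp [listMap, hnb]
        · rw [Subst.bind_of_notMem _ (by simp [hna, hnb]), Subst.id_apply,
            Equiv.swap_apply_of_ne_of_ne hna]
          rintro rfl
          exact hmx.1 hn
    rw [e1, e2] at step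
    exact .rel _ _ step

/-- Bound names can be renamed to distinct fresh names. -/
theorem BindEq.rename {x : X} {b d : List Name} (hl : d.length = b.length) (hd : d.Nodup)
    (h : ∀ m ∈ d, m ∈ supp x → m ∈ b) :
    BindEq (b, x) (d, subst x ((Subst.id : Subst 𝔓.Term).bind b d)) := by
  -- The targets `d` may overlap with `b`, so the renaming passes through names `e` that are fresh
  -- for everything.
  obtain ⟨e, e1, e2, e3⟩ := exists_fresh_list ((supp_finite x).union
    ((b ++ d).toFinset.finite_toSet.union
      (supp_finite (subst x ((Subst.id : Subst 𝔓.Term).bind b d))))) b.length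
  simp only [Set.mem_union, List.coe_toFinset, Set.mem_ofPred_eq, List.mem_append, not_or] at e3
  have s1 := BindEq.rename_disjoint (𝔓 := 𝔓) x [] b e e1 e2 fun m hm => ⟨(e3 m hm).1, (e3 m hm).2.1.1⟩
  refine .trans _ _ _ s1 ?_
  have hsub : supp (subst x ((Subst.id : Subst 𝔓.Term).bind b e)) ⊆
      {n | n ∈ e} ∪ {n | n ∈ supp x ∧ n ∉ b} := by
    rw [supp_subst]
    intro k hk
    obtain ⟨n, hn, hmn⟩ := Subst.mem_image.1 hk
    by_cases hnb : n ∈ b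
    · rw [Subst.bind_of_mem _ hnb, supp_ofName] at hmn
      left; rw [hmn]; exact listMap_mem hnb e1
    · rw [Subst.bind_of_notMem _ hnb, Subst.id_apply, supp_ofName] at hmn
      right; rw [hmn]; exact ⟨hn, hnb⟩
  have s2 := BindEq.rename_disjoint (𝔓 := 𝔓) (subst x ((Subst.id : Subst 𝔓.Term).bind b e)) [] e d
    (hl.trans e1.symm) hd fun m hm => ⟨fun hm' => by
      rcases hsub hm' with h1 | h1
      · exact (e3 m h1).2.1.2 hm
      · exact h1.2 (h m hm h1.1), fun hm' => (e3 m hm').2.1.2 hm⟩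
  rw [List.nil_append, List.nil_append] at s2
  have e4 : subst (subst x ((Subst.id : Subst 𝔓.Term).bind b e)) ((Subst.id : Subst 𝔓.Term).bind e d)
      = subst x ((Subst.id : Subst 𝔓.Term).bind b d) := by
    have := s1.bind_eq (𝔓 := 𝔓) Subst.id (d := d) hl
    exact this.symm
  rwa [e4] at s2

/-- Expressions are alpha-equivalent if they agree at distinct fresh names. -/
theorem BindEq.of_bind_eq {b b' d : List Name} {x x' : X} (hl : d.length = b.length)
    (hl' : d.length = b'.length) (hd : d.Nodup) (h : ∀ m ∈ d, m ∉ supp x ∧ m ∉ supp x')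
    (he : subst x ((Subst.id : Subst 𝔓.Term).bind b d) =
      subst x' ((Subst.id : Subst 𝔓.Term).bind b' d)) : BindEq (b, x) (b', x') := by
  have h1 := BindEq.rename (𝔓 := 𝔓) (x := x) hl hd fun m hm hm' => absurd hm' (h m hm).1
  have h2 := BindEq.rename (𝔓 := 𝔓) (x := x') hl' hd fun m hm hm' => absurd hm' (h m hm).2
  rw [he] at h1
  exact .trans _ _ _ h1 (.symm _ _ h2)

/-- Realizes a renaming of binders by position as a permutation, so that equivariance becomes
applicable. -/
theorem exists_perm_listMap {b d : List Name} (hl : d.length = b.length) (hd : d.Nodup) :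
    ∃ π : Equiv.Perm Name, (∀ n ∈ b, π n = listMap b d n) ∧ ∀ n ∉ b, n ∉ d → π n = n := by
  obtain ⟨l, h1, h2⟩ := exists_swaps_extending b.toFinset id (listMap b d) (Set.injOn_id _)
    (by simpa using listMap_injOn hl hd)
  refine ⟨swaps l, fun n hn => h1 n (by simpa using hn), fun n hn hn' => h2 n ?_ ?_⟩
  · rintro m hm rfl; exact hn (by simpa using hm)
  · rintro m hm rfl; exact hn' (listMap_mem (by simpa using hm) hl)

end Data

/-- A permutation that fixes the free names only renames binders, and keeps their positions even if
names are repeated; both sides therefore agree at distinct fresh names. -/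
theorem BindEq.smul_of_fixes (𝔓 : PsiCalculus.{u}) {X : Type u} [Nominal X]
    [HasSubst 𝔓.Term X] [LawfulSubst 𝔓.Term X] {b : List Name} {x : X} {π : Equiv.Perm Name}
    (h : ∀ n ∈ supp x, n ∉ b → π n = n) : BindEq (b, x) (b.map π, π • x) := by
  obtain ⟨d, d1, d2, d3⟩ := exists_fresh_list ((supp_finite x).union (supp_finite (π • x))) b.length
  simp only [Set.mem_union, not_or] at d3
  refine BindEq.of_bind_eq (𝔓 := 𝔓) d1 (by simpa using d1) d2 d3 ?_
  refine (subst_smul fun n hn => ?_).symm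
  by_cases hnb : n ∈ b
  · rw [Subst.bind_of_mem _ hnb, Subst.bind_of_mem _ (List.mem_map_of_mem hnb),
      listMap_map_left _ _ π.injective hnb d1]
  · rw [Subst.bind_of_notMem _ hnb, h n hn hnb, Subst.bind_of_notMem]
    intro h1
    obtain ⟨k, hk, hkn⟩ := List.mem_map.1 h1
    have := h n hn hnb
    rw [← hkn] at this
    exact hnb (by rw [← hkn, π.injective this]; exact hk)

/-- Renaming of bound names to distinct fresh names by a permutation. -/
theorem BindEq.rename_perm (𝔓 : PsiCalculus.{u}) {X : Type u} [Nominal X]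
    [HasSubst 𝔓.Term X] [LawfulSubst 𝔓.Term X] {b d : List Name} {x : X} {π : Equiv.Perm Name}
    (hl : d.length = b.length) (hd : d.Nodup) (h : ∀ m ∈ d, m ∈ supp x → m ∈ b)
    (h1 : ∀ n ∈ b, π n = listMap b d n) (h2 : ∀ n ∈ supp x, n ∉ b → π n = n) :
    BindEq (b, x) (d, π • x) := by
  rw [smul_eq_subst (𝔓 := 𝔓) (τ := Subst.id.bind b d)]
  · exact BindEq.rename (𝔓 := 𝔓) hl hd h
  · intro n hn
    by_cases hnb : n ∈ b
    · rw [Subst.bind_of_mem _ hnb, h1 n hnb]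
    · rw [Subst.bind_of_notMem _ hnb, h2 n hn hnb, Subst.id_apply]

end SymPsi

/-! ### Raw agents: renaming and substitution up to alpha-equivalence -/

namespace SymPsi
open HasSubst (subst)

theorem freshName_notMem {s : Set Name} (hs : s.Finite) : freshName s ∉ s :=
  Classical.epsilon_spec hs.exists_notMem

variable {𝔓 : PsiCalculus.{u}}

/-- The free names of a substituted binder: the renamed binder `z` contributes only itself, and by
freshness removing it loses nothing else. -/
theorem Subst.image_update (σ : Subst 𝔓.Term) {x z : Name} {S : Set Name}
    (hz : z ∉ σ.image (S \ {x})) :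
    (σ.update x (NameTerm.ofName z)).image S \ {z} = σ.image (S \ {x}) := by
  ext a
  simp only [Set.mem_sdiff, Subst.mem_image, Set.mem_singleton_iff]
  constructor
  · rintro ⟨⟨n, hn, ha⟩, haz⟩
    by_cases hnx : n = x
    · subst hnx
      rw [Subst.update_same, supp_ofName] at ha
      exact absurd ha haz
    · rw [Subst.update_of_ne _ _ hnx] at ha
      exact ⟨n, ⟨hn, hnx⟩, ha⟩
  · rintro ⟨n, ⟨hn, hnx⟩, ha⟩
    refine ⟨⟨n, hn, by rwa [Subst.update_of_ne _ _ hnx]⟩, ?_⟩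
    rintro rfl
    exact hz (Subst.mem_image.2 ⟨n, ⟨hn, hnx⟩, ha⟩)

theorem Subst.image_union (σ : Subst 𝔓.Term) (S T : Set Name) :
    σ.image (S ∪ T) = σ.image S ∪ σ.image T := Set.biUnion_union S T _

theorem Subst.image_mono (σ : Subst 𝔓.Term) {S T : Set Name} (h : S ⊆ T) :
    σ.image S ⊆ σ.image T := Set.biUnion_subset_biUnion_left h

namespace Raw

theorem fn_finite (P : Raw 𝔓) : P.fn.Finite := by
  induction P with
  | out M N P ih => exact ((supp_finite M).union (supp_finite N)).union ih
  | inp M x P ih => exact (supp_finite M).union (ih.subset Set.sdiff_subset)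
  | case n φ P ih => exact Set.finite_iUnion fun i => (supp_finite _).union (ih i)
  | res a P ih => exact ih.subset Set.sdiff_subset
  | par P Q ihP ihQ => exact ihP.union ihQ
  | rep P ih => exact ih
  | ass Ψ => exact supp_finite Ψ

theorem perm_one (P : Raw 𝔓) : P.perm 1 = P := by
  induction P <;> simp_all [perm]

/-- The properties of the binding constructors that are used below. -/
def IsBinder (f : Name → Raw 𝔓 → Raw 𝔓) : Prop :=
  (∀ x P P', Alpha P P' → Alpha (f x P) (f x P')) ∧
    ∀ x y P, y ∉ P.fn → Alpha (f x P) (f y (P.perm (Equiv.swap x y)))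

theorem isBinder_inp (M : 𝔓.Term) : IsBinder (Raw.inp M) :=
  ⟨fun x _ _ h => .inp M x h, fun x y P h => .inp_rename M x y P h⟩

theorem isBinder_res : IsBinder (Raw.res (𝔓 := 𝔓)) :=
  ⟨fun x _ _ h => .res x h, fun x y P h => .res_rename x y P h⟩

/-- Input and restriction are treated alike. If the two images of the binder differ, the first is
renamed to the second; `H` then compares permutations that agree on all of the body. -/
theorem IsBinder.perm_congr {f : Name → Raw 𝔓 → Raw 𝔓} (hf : IsBinder f) {P : Raw 𝔓} {x : Name}
    {π ρ : Equiv.Perm Name} (h : ∀ n ∈ P.fn \ {x}, π n = ρ n)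
    (H : ∀ π ρ : Equiv.Perm Name, (∀ n ∈ P.fn, π n = ρ n) → Alpha (P.perm π) (P.perm ρ)) :
    Alpha (f (π x) (P.perm π)) (f (ρ x) (P.perm ρ)) := by
  by_cases hx : π x = ρ x
  · rw [hx]
    refine hf.1 _ _ _ (H _ _ fun n hn => ?_)
    by_cases hnx : n = x
    · rw [hnx, hx]
    · exact h n ⟨hn, hnx⟩
  -- A free name n ≠ x of the body with π n = ρ x would also satisfy ρ n = ρ x; and n = x is the
  -- case already excluded.
  have hfr : ρ x ∉ (P.perm π).fn := by
    rw [mem_fn_perm]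
    intro hm
    by_cases hnx : π⁻¹ (ρ x) = x
    · apply hx
      conv_lhs => rw [← hnx]
      simp
    · have := h _ ⟨hm, hnx⟩
      rw [show π (π⁻¹ (ρ x)) = ρ x by simp] at this
      exact hnx (ρ.injective this.symm)
  refine (hf.2 _ _ _ hfr).trans (hf.1 _ _ _ ?_)
  rw [perm_perm]
  refine H _ _ fun n hn => ?_
  by_cases hnx : n = x
  · simp [hnx]
  · have h1 := h n ⟨hn, hnx⟩
    rw [Equiv.Perm.mul_apply, Equiv.swap_apply_of_ne_of_ne, h1]
    · exact fun h2 => hnx (π.injective h2)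
    · rw [h1]; exact fun h2 => hnx (ρ.injective h2)

theorem perm_congr (P : Raw 𝔓) : ∀ π ρ : Equiv.Perm Name, (∀ n ∈ P.fn, π n = ρ n) →
    Alpha (P.perm π) (P.perm ρ) := by
  induction P with
  | out M N P ih =>
    intro π ρ h
    simp only [perm]
    rw [smul_congr_supp fun n hn => h n (Or.inl (Or.inl hn)),
      smul_congr_supp (x := N) fun n hn => h n (Or.inl (Or.inr hn))]
    exact .out _ _ (ih π ρ fun n hn => h n (Or.inr hn))
  | inp M x P ih =>
    intro π ρ h
    simp only [perm]
    rw [smul_congr_supp fun n hn => h n (Or.inl hn)]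
    exact (isBinder_inp _).perm_congr (fun n hn => h n (Or.inr hn)) ih
  | case n φ P ih =>
    intro π ρ h
    simp only [perm]
    have h1 : (fun i => π • φ i) = fun i => ρ • φ i := funext fun i =>
      smul_congr_supp fun n hn => h n (Set.mem_iUnion.2 ⟨i, Or.inl hn⟩)
    rw [h1]
    exact .case _ _ fun i => ih i π ρ fun n hn => h n (Set.mem_iUnion.2 ⟨i, Or.inr hn⟩)
  | res a P ih =>
    intro π ρ h
    exact isBinder_res.perm_congr h ih
  | par P Q ihP ihQ =>
    intro π ρ h
    exact .par (ihP π ρ fun n hn => h n (Or.inl hn)) (ihQ π ρ fun n hn => h n (Or.inr hn))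
  | rep P ih =>
    intro π ρ h
    exact .rep (ih π ρ h)
  | ass Ψ =>
    intro π ρ h
    simp only [perm]
    rw [smul_congr_supp h]
    exact .refl _

theorem freshName_image (σ : Subst 𝔓.Term) (P : Raw 𝔓) (x : Name) :
    freshName (⋃ b ∈ P.fn \ {x}, supp (σ b)) ∉ σ.image (P.fn \ {x}) :=
  freshName_notMem (σ.image_finite (P.fn_finite.subset Set.sdiff_subset))

/-- An equality rather than an inclusion, by the law that names of substituted terms survive. Hence
freshness for an instance `Pσ` can be used as freshness for all the terms that `σ` puts into `P`. -/
theorem fn_subst (P : Raw 𝔓) : ∀ σ : Subst 𝔓.Term, (P.subst σ).fn = σ.image P.fn := by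
  induction P with
  | out M N P ih =>
    intro σ; simp only [Raw.subst, fn, ih, Subst.image_union, supp_subst]
  | inp M x P ih =>
    intro σ
    simp only [Raw.subst, fn, ih, Subst.image_union, supp_subst]
    rw [Subst.image_update σ (freshName_image σ P x)]
  | case n φ P ih =>
    intro σ
    simp only [Raw.subst, fn, ih, supp_subst]
    ext a
    simp only [Set.mem_iUnion, Set.mem_union, Subst.mem_image]
    constructor
    · rintro ⟨i, ⟨n, hn, ha⟩ | ⟨n, hn, ha⟩⟩
      exacts [⟨n, ⟨i, Or.inl hn⟩, ha⟩, ⟨n, ⟨i, Or.inr hn⟩, ha⟩]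
    · rintro ⟨n, ⟨i, hn | hn⟩, ha⟩
      exacts [⟨i, Or.inl ⟨n, hn, ha⟩⟩, ⟨i, Or.inr ⟨n, hn, ha⟩⟩]
  | res a P ih =>
    intro σ
    simp only [Raw.subst, fn, ih]
    rw [Subst.image_update σ (freshName_image σ P a)]
  | par P Q ihP ihQ => intro σ; simp only [Raw.subst, fn, ihP, ihQ, Subst.image_union]
  | rep P ih => intro σ; exact ih σ
  | ass Ψ => intro σ; exact supp_subst Ψ σ

/-- The particular fresh name picked for the binder of an instance is irrelevant. Commutation of
renaming and substitution for the body is the hypothesis `H`, because this lemma serves in the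
induction that proves it. -/
theorem IsBinder.change {f : Name → Raw 𝔓 → Raw 𝔓} (hf : IsBinder f) {P : Raw 𝔓} {x z w : Name}
    {σ : Subst 𝔓.Term} (hz : z ∉ σ.image (P.fn \ {x})) (hw : w ∉ σ.image (P.fn \ {x}))
    (H : ∀ (π : Equiv.Perm Name) (σ τ : Subst 𝔓.Term), (∀ n ∈ P.fn, τ n = π • σ n) →
      Alpha ((P.subst σ).perm π) (P.subst τ)) :
    Alpha (f z (P.subst (σ.update x (NameTerm.ofName z))))
      (f w (P.subst (σ.update x (NameTerm.ofName w)))) := by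
  by_cases hzw : z = w
  · subst hzw; exact .refl _
  have hfr : w ∉ (P.subst (σ.update x (NameTerm.ofName z))).fn := by
    rw [fn_subst]
    intro h
    exact hw (by
      rw [← Subst.image_update σ hz]
      exact ⟨h, fun h => hzw h.symm⟩)
  refine (hf.2 _ _ _ hfr).trans (hf.1 _ _ _ (H _ _ _ fun n hn => ?_))
  by_cases hnx : n = x
  · subst hnx
    rw [Subst.update_same, Subst.update_same, NameTerm.smul_ofName, Equiv.swap_apply_left]
  · rw [Subst.update_of_ne _ _ hnx, Subst.update_of_ne _ _ hnx, swap_smul_of_notMem_supp]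
    · exact fun h => hz (Subst.mem_image.2 ⟨n, ⟨hn, hnx⟩, h⟩)
    · exact fun h => hw (Subst.mem_image.2 ⟨n, ⟨hn, hnx⟩, h⟩)

/-- By `H`, permuting the instance with binder `z` gives the instance with binder `π z`, which is
again fresh and can be changed to `w`. -/
theorem IsBinder.perm_subst {f : Name → Raw 𝔓 → Raw 𝔓} (hf : IsBinder f) {P : Raw 𝔓} {x z w : Name}
    {π : Equiv.Perm Name} {σ τ : Subst 𝔓.Term} (hz : z ∉ σ.image (P.fn \ {x}))
    (hw : w ∉ τ.image (P.fn \ {x})) (h : ∀ n ∈ P.fn \ {x}, τ n = π • σ n)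
    (H : ∀ (π : Equiv.Perm Name) (σ τ : Subst 𝔓.Term), (∀ n ∈ P.fn, τ n = π • σ n) →
      Alpha ((P.subst σ).perm π) (P.subst τ)) :
    Alpha (f (π z) ((P.subst (σ.update x (NameTerm.ofName z))).perm π))
      (f w (P.subst (τ.update x (NameTerm.ofName w)))) := by
  refine .trans (hf.1 _ _ _ (H π _ (τ.update x (NameTerm.ofName (π z))) fun n hn => ?_))
    (hf.change ?_ hw H)
  · by_cases hnx : n = x
    · subst hnx
      rw [Subst.update_same, Subst.update_same, NameTerm.smul_ofName]
    · rw [Subst.update_of_ne _ _ hnx, Subst.update_of_ne _ _ hnx, h n ⟨hn, hnx⟩]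
  · intro h1
    obtain ⟨n, hn, h2⟩ := Subst.mem_image.1 h1
    rw [h n hn, mem_supp_smul_iff, show π⁻¹ (π z) = z by simp] at h2
    exact hz (Subst.mem_image.2 ⟨n, hn, h2⟩)

theorem perm_subst (P : Raw 𝔓) : ∀ (π : Equiv.Perm Name) (σ τ : Subst 𝔓.Term),
    (∀ n ∈ P.fn, τ n = π • σ n) → Alpha ((P.subst σ).perm π) (P.subst τ) := by
  induction P with
  | out M N P ih =>
    intro π σ τ h
    simp only [perm, Raw.subst]
    rw [smul_subst_eq fun n hn => h n (Or.inl (Or.inl hn)),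
      smul_subst_eq fun n hn => h n (Or.inl (Or.inr hn))]
    exact .out _ _ (ih π σ τ fun n hn => h n (Or.inr hn))
  | inp M x P ih =>
    intro π σ τ h
    simp only [perm, Raw.subst]
    rw [smul_subst_eq fun n hn => h n (Or.inl hn)]
    exact (isBinder_inp _).perm_subst (freshName_image σ P x) (freshName_image τ P x)
      (fun n hn => h n (Or.inr hn)) ih
  | case n φ P ih =>
    intro π σ τ h
    simp only [perm, Raw.subst]
    have h1 : (fun i => π • HasSubst.subst (φ i) σ) = fun i => HasSubst.subst (φ i) τ :=
      funext fun i => smul_subst_eq fun n hn => h n (Set.mem_iUnion.2 ⟨i, Or.inl hn⟩)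
    rw [h1]
    exact .case _ _ fun i => ih i π σ τ fun n hn => h n (Set.mem_iUnion.2 ⟨i, Or.inr hn⟩)
  | res a P ih =>
    intro π σ τ h
    exact isBinder_res.perm_subst (freshName_image σ P a) (freshName_image τ P a) h ih
  | par P Q ihP ihQ =>
    intro π σ τ h
    exact .par (ihP π σ τ fun n hn => h n (Or.inl hn)) (ihQ π σ τ fun n hn => h n (Or.inr hn))
  | rep P ih => intro π σ τ h; exact .rep (ih π σ τ h)
  | ass Ψ =>
    intro π σ τ h
    simp only [perm, Raw.subst]
    rw [smul_subst_eq h]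
    exact .refl _

/-- Freshness of `z` keeps the second substitution from touching its binder inside the terms of the
first, so on the body the two updated substitutions compose to the update of `ρ` at the same binder,
which is finally changed to `v`. -/
theorem IsBinder.subst_subst {f : Name → Raw 𝔓 → Raw 𝔓} (hf : IsBinder f) {P : Raw 𝔓}
    {x z w v : Name} {σ τ ρ : Subst 𝔓.Term} (hz : z ∉ σ.image (P.fn \ {x}))
    (hw : w ∉ τ.image ((P.subst (σ.update x (NameTerm.ofName z))).fn \ {z}))
    (hv : v ∉ ρ.image (P.fn \ {x}))
    (h : ∀ n ∈ P.fn \ {x}, ρ n = HasSubst.subst (σ n) τ)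
    (H : ∀ (σ τ ρ : Subst 𝔓.Term), (∀ n ∈ P.fn, ρ n = HasSubst.subst (σ n) τ) →
      Alpha ((P.subst σ).subst τ) (P.subst ρ)) :
    Alpha (f w ((P.subst (σ.update x (NameTerm.ofName z))).subst
        (τ.update z (NameTerm.ofName w))))
      (f v (P.subst (ρ.update x (NameTerm.ofName v)))) := by
  refine .trans (hf.1 _ _ _ (H _ _ (ρ.update x (NameTerm.ofName w)) fun n hn => ?_))
    (hf.change ?_ hv (Raw.perm_subst P))
  · by_cases hnx : n = x
    · subst hnx
      rw [Subst.update_same, Subst.update_same, 𝔓.subst_ofName, Subst.update_same]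
    · rw [Subst.update_of_ne _ _ hnx, Subst.update_of_ne _ _ hnx, h n ⟨hn, hnx⟩]
      refine subst_congr_supp fun k hk => (Subst.update_of_ne _ _ ?_).symm
      rintro rfl
      exact hz (Subst.mem_image.2 ⟨n, ⟨hn, hnx⟩, hk⟩)
  · intro h1
    rw [fn_subst, Subst.image_update σ hz] at hw
    apply hw
    obtain ⟨n, hn, h2⟩ := Subst.mem_image.1 h1
    rw [h n hn, supp_subst] at h2
    obtain ⟨k, hk, h3⟩ := Subst.mem_image.1 h2
    exact Subst.mem_image.2 ⟨k, Subst.mem_image.2 ⟨n, hn, hk⟩, h3⟩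

theorem subst_subst (P : Raw 𝔓) : ∀ (σ τ ρ : Subst 𝔓.Term),
    (∀ n ∈ P.fn, ρ n = HasSubst.subst (σ n) τ) → Alpha ((P.subst σ).subst τ) (P.subst ρ) := by
  induction P with
  | out M N P ih =>
    intro σ τ ρ h
    simp only [Raw.subst]
    rw [subst_subst_eq fun n hn => h n (Or.inl (Or.inl hn)),
      subst_subst_eq fun n hn => h n (Or.inl (Or.inr hn))]
    exact .out _ _ (ih σ τ ρ fun n hn => h n (Or.inr hn))
  | inp M x P ih =>
    intro σ τ ρ h
    simp only [Raw.subst]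
    rw [subst_subst_eq fun n hn => h n (Or.inl hn)]
    exact (isBinder_inp _).subst_subst (freshName_image σ P x) (freshName_image τ _ _)
      (freshName_image ρ P x) (fun n hn => h n (Or.inr hn)) ih
  | case n φ P ih =>
    intro σ τ ρ h
    simp only [Raw.subst]
    have h1 : (fun i => HasSubst.subst (HasSubst.subst (φ i) σ) τ) =
        fun i => HasSubst.subst (φ i) ρ :=
      funext fun i => subst_subst_eq fun n hn => h n (Set.mem_iUnion.2 ⟨i, Or.inl hn⟩)
    rw [h1]
    exact .case _ _ fun i => ih i σ τ ρ fun n hn => h n (Set.mem_iUnion.2 ⟨i, Or.inr hn⟩)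
  | res a P ih =>
    intro σ τ ρ h
    exact isBinder_res.subst_subst (freshName_image σ P a) (freshName_image τ _ _)
      (freshName_image ρ P a) h ih
  | par P Q ihP ihQ =>
    intro σ τ ρ h
    exact .par (ihP σ τ ρ fun n hn => h n (Or.inl hn)) (ihQ σ τ ρ fun n hn => h n (Or.inr hn))
  | rep P ih => intro σ τ ρ h; exact .rep (ih σ τ ρ h)
  | ass Ψ =>
    intro σ τ ρ h
    simp only [Raw.subst]
    rw [subst_subst_eq h]
    exact .refl _

theorem subst_eq_self (P : Raw 𝔓) : ∀ σ : Subst 𝔓.Term, (∀ n ∈ P.fn, σ n = NameTerm.ofName n) →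
    Alpha (P.subst σ) P := by
  have aux : ∀ (f : Name → Raw 𝔓 → Raw 𝔓) (_ : IsBinder f) (x : Name) (P : Raw 𝔓)
      (_ : ∀ σ : Subst 𝔓.Term, (∀ n ∈ P.fn, σ n = NameTerm.ofName n) → Alpha (P.subst σ) P)
      (σ : Subst 𝔓.Term) (_ : ∀ n ∈ P.fn \ {x}, σ n = NameTerm.ofName n) (z : Name)
      (_ : z ∉ σ.image (P.fn \ {x})), Alpha (f z (P.subst (σ.update x (NameTerm.ofName z)))) (f x P) := by
    intro f hf x P ih σ h z hz
    -- The original binder `x` is fresh for a substitution that is the identity on the free names,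
    -- so it may be taken as the new binder.
    refine (hf.change hz ?_ (Raw.perm_subst P)).trans (hf.1 _ _ _ (ih _ fun n hn => ?_))
    · intro h1
      obtain ⟨n, hn, h2⟩ := Subst.mem_image.1 h1
      rw [h n hn, supp_ofName] at h2
      exact hn.2 h2.symm
    · by_cases hnx : n = x
      · subst hnx; rw [Subst.update_same]
      · rw [Subst.update_of_ne _ _ hnx, h n ⟨hn, hnx⟩]
  induction P with
  | out M N P ih =>
    intro σ h
    simp only [Raw.subst]
    rw [SymPsi.subst_eq_self fun n hn => h n (Or.inl (Or.inl hn)),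
      SymPsi.subst_eq_self fun n hn => h n (Or.inl (Or.inr hn))]
    exact .out _ _ (ih σ fun n hn => h n (Or.inr hn))
  | inp M x P ih =>
    intro σ h
    simp only [Raw.subst]
    rw [SymPsi.subst_eq_self fun n hn => h n (Or.inl hn)]
    exact aux _ (isBinder_inp _) x P ih σ (fun n hn => h n (Or.inr hn)) _ (freshName_image σ P x)
  | case n φ P ih =>
    intro σ h
    simp only [Raw.subst]
    have h1 : (fun i => HasSubst.subst (φ i) σ) = φ :=
      funext fun i => SymPsi.subst_eq_self fun n hn => h n (Set.mem_iUnion.2 ⟨i, Or.inl hn⟩)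
    rw [h1]
    exact .case _ _ fun i => ih i σ fun n hn => h n (Set.mem_iUnion.2 ⟨i, Or.inr hn⟩)
  | res a P ih =>
    intro σ h
    exact aux _ isBinder_res a P ih σ h _ (freshName_image σ P a)
  | par P Q ihP ihQ =>
    intro σ h
    exact .par (ihP σ fun n hn => h n (Or.inl hn)) (ihQ σ fun n hn => h n (Or.inr hn))
  | rep P ih => intro σ h; exact .rep (ih σ h)
  | ass Ψ =>
    intro σ h
    simp only [Raw.subst]
    rw [SymPsi.subst_eq_self h]
    exact .refl _

/-- The immediate components of alpha-equivalent agents agree up to renaming of the binder. -/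
def SameHead : Raw 𝔓 → Raw 𝔓 → Prop
  | out M N P, out M' N' P' => M = M' ∧ N = N' ∧ Alpha P P'
  | inp M x P, inp M' y Q => M = M' ∧ (x = y ∨ y ∉ P.fn) ∧ Alpha (P.perm (Equiv.swap x y)) Q
  | case n φ P, case m ψ Q =>
      ∃ h : n = m, ∀ i, φ i = ψ (Fin.cast h i) ∧ Alpha (P i) (Q (Fin.cast h i))
  | res x P, res y Q => (x = y ∨ y ∉ P.fn) ∧ Alpha (P.perm (Equiv.swap x y)) Q
  | par P Q, par P' Q' => Alpha P P' ∧ Alpha Q Q'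
  | rep P, rep P' => Alpha P P'
  | ass Ψ, ass Ψ' => Ψ = Ψ'
  | _, _ => False

theorem perm_refl (P : Raw 𝔓) : P.perm (Equiv.refl Name) = P := perm_one P

theorem perm_swap_self (a : Name) (P : Raw 𝔓) : P.perm (Equiv.swap a a) = P := by
  rw [Equiv.swap_self]; exact perm_one P

theorem SameHead.refl (P : Raw 𝔓) : SameHead P P := by
  cases P <;> simp [SameHead, Alpha.refl, perm_refl]

theorem binder_symm {x y : Name} {P Q : Raw 𝔓} (h : x = y ∨ y ∉ P.fn)
    (h' : Alpha (P.perm (Equiv.swap x y)) Q) :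
    (y = x ∨ x ∉ Q.fn) ∧ Alpha (Q.perm (Equiv.swap y x)) P := by
  constructor
  · refine h.imp Eq.symm fun h1 => ?_
    rw [← h'.fn_eq, mem_fn_perm]
    simpa using h1
  · have := (h'.perm (Equiv.swap y x)).symm
    rwa [perm_perm, Equiv.swap_comm x y, Equiv.swap_mul_self, perm_one] at this

/-- Away from the degenerate cases, renaming x to y to z agrees with renaming x to z on the free
names of the body. If z = x, the two renamings cancel. -/
theorem binder_trans {x y z : Name} {P Q R : Raw 𝔓} (h1 : x = y ∨ y ∉ P.fn)
    (h2 : Alpha (P.perm (Equiv.swap x y)) Q) (h3 : y = z ∨ z ∉ Q.fn)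
    (h4 : Alpha (Q.perm (Equiv.swap y z)) R) :
    (x = z ∨ z ∉ P.fn) ∧ Alpha (P.perm (Equiv.swap x z)) R := by
  rcases h1 with rfl | h1
  · rw [perm_swap_self] at h2
    exact ⟨h3.imp_right (by rw [h2.fn_eq]; exact id), (h2.perm _).trans h4⟩
  rcases h3 with rfl | h3
  · rw [perm_swap_self] at h4
    exact ⟨Or.inr h1, h2.trans h4⟩
  rw [← h2.fn_eq, mem_fn_perm, Equiv.swap_inv] at h3
  by_cases hxz : x = z
  · subst hxz
    refine ⟨Or.inl rfl, ?_⟩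
    have := (h2.perm (Equiv.swap y x)).trans h4
    rw [perm_perm, Equiv.swap_comm x y, Equiv.swap_mul_self] at this
    rw [Equiv.swap_self]
    exact this
  have h5 : z ∉ P.fn := by
    by_cases hzy : z = y
    · rwa [hzy]
    · rwa [Equiv.swap_apply_of_ne_of_ne (fun h => hxz h.symm) hzy] at h3
  refine ⟨Or.inr h5, ?_⟩
  refine .trans ?_ ((h2.perm (Equiv.swap y z)).trans h4)
  rw [perm_perm]
  refine perm_congr P _ _ fun n hn => ?_
  have hny : n ≠ y := fun h => h1 (h ▸ hn)
  have hnz : n ≠ z := fun h => h5 (h ▸ hn)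
  by_cases hnx : n = x
  · subst hnx; simp
  · simp [Equiv.swap_apply_of_ne_of_ne, hny, hnz, hnx]

theorem SameHead.symm {P Q : Raw 𝔓} (h : SameHead P Q) : SameHead Q P := by
  cases P <;> cases Q <;> try exact h.elim
  case out => exact ⟨h.1.symm, h.2.1.symm, h.2.2.symm⟩
  case inp => exact ⟨h.1.symm, binder_symm h.2.1 h.2.2⟩
  case case => 
    obtain ⟨rfl, h⟩ := h
    exact ⟨rfl, fun i => ⟨(h i).1.symm, (h i).2.symm⟩⟩
  case res => exact binder_symm h.1 h.2
  case par => exact ⟨h.1.symm, h.2.symm⟩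
  case rep => exact Alpha.symm h
  case ass => exact Eq.symm h

theorem SameHead.trans {P Q R : Raw 𝔓} (h : SameHead P Q) (h' : SameHead Q R) :
    SameHead P R := by
  cases P <;> cases Q <;> (try exact h.elim) <;> cases R <;> try exact h'.elim
  case out => exact ⟨h.1.trans h'.1, h.2.1.trans h'.2.1, h.2.2.trans h'.2.2⟩
  case inp => exact ⟨h.1.trans h'.1, binder_trans h.2.1 h.2.2 h'.2.1 h'.2.2⟩
  case case =>
    obtain ⟨rfl, h⟩ := h
    obtain ⟨rfl, h'⟩ := h'
    exact ⟨rfl, fun i => ⟨(h i).1.trans (h' i).1, (h i).2.trans (h' i).2⟩⟩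
  case res => exact binder_trans h.1 h.2 h'.1 h'.2
  case par => exact ⟨h.1.trans h'.1, h.2.trans h'.2⟩
  case rep => exact Alpha.trans h h'
  case ass => exact Eq.trans h h'

/-- Inversion for a relation closed under symmetry and transitivity cannot be read off its rules.
`SameHead` is an equivalence relation that contains the generating rules, so it contains
alpha-equivalence. -/
theorem Alpha.sameHead {P Q : Raw 𝔓} (h : Alpha P Q) : SameHead P Q := by
  induction h with
  | refl => exact .refl _
  | symm _ ih => exact ih.symm
  | trans _ _ ih1 ih2 => exact ih1.trans ih2
  | out M N h => exact ⟨rfl, rfl, h⟩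
  | inp M x h => exact ⟨rfl, Or.inl rfl, by rwa [perm_swap_self]⟩
  | case n φ h => exact ⟨rfl, fun i => ⟨rfl, h i⟩⟩
  | res a h => exact ⟨Or.inl rfl, by rwa [perm_swap_self]⟩
  | par h h' => exact ⟨h, h'⟩
  | rep h => exact h
  | inp_rename M x y P h => exact ⟨rfl, Or.inr h, .refl _⟩
  | res_rename a b P h => exact ⟨Or.inr h, .refl _⟩

theorem guarded_subst (P : Raw 𝔓) : ∀ σ : Subst 𝔓.Term, (P.subst σ).Guarded ↔ P.Guarded := by
  induction P <;> intro σ <;> simp_all [Raw.subst, Guarded]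

theorem wf_subst (P : Raw 𝔓) : ∀ σ : Subst 𝔓.Term, (P.subst σ).WF ↔ P.WF := by
  induction P <;> intro σ <;> simp_all [Raw.subst, WF, guarded_subst]

end Raw

end SymPsi

/-! ### Agents as alpha-equivalence classes: substitution and inversion -/

namespace SymPsi
open HasSubst (subst)

variable {𝔓 : PsiCalculus.{u}}

namespace Agent

@[elab_as_elim]
theorem induction_mk {C : Agent 𝔓 → Prop} (P : Agent 𝔓) (h : ∀ r : Raw 𝔓, C (Quotient.mk _ r)) :
    C P := Quotient.inductionOn P h

theorem mk_eq {r s : Raw 𝔓} :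
    (Quotient.mk _ r : Agent 𝔓) = Quotient.mk _ s ↔ Raw.Alpha r s := Quotient.eq

theorem perm_mk (π : Equiv.Perm Name) (r : Raw 𝔓) :
    perm π (Quotient.mk _ r : Agent 𝔓) = Quotient.mk _ (r.perm π) := rfl

/-- The case constructor picks representatives of its branches; any others give the same agent. -/
theorem case_mk {n : ℕ} (φ : Fin n → 𝔓.Cond) (R : Fin n → Raw 𝔓) :
    case n φ (fun i => (Quotient.mk _ (R i) : Agent 𝔓)) = Quotient.mk _ (Raw.case n φ R) :=
  Quotient.sound (.case _ _ fun i => Quotient.mk_out (s := Raw.setoid 𝔓) (R i))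

theorem exists_mk_family {n : ℕ} (P : Fin n → Agent 𝔓) :
    ∃ R : Fin n → Raw 𝔓, P = fun i => (Quotient.mk _ (R i) : Agent 𝔓) :=
  ⟨fun i => Quotient.out (P i), funext fun i => (Quotient.out_eq (P i)).symm⟩

theorem fn_finite (P : Agent 𝔓) : P.fn.Finite := P.induction_mk Raw.fn_finite

theorem fn_out (M N : 𝔓.Term) (P : Agent 𝔓) : (out M N P).fn = supp M ∪ supp N ∪ P.fn :=
  P.induction_mk fun _ => rfl

theorem fn_inp (M : 𝔓.Term) (x : Name) (P : Agent 𝔓) : (inp M x P).fn = supp M ∪ (P.fn \ {x}) :=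
  P.induction_mk fun _ => rfl

theorem fn_case (n : ℕ) (φ : Fin n → 𝔓.Cond) (P : Fin n → Agent 𝔓) :
    (case n φ P).fn = ⋃ i, supp (φ i) ∪ (P i).fn := by
  obtain ⟨R, rfl⟩ := exists_mk_family P
  rw [case_mk]; rfl

theorem fn_res (a : Name) (P : Agent 𝔓) : (res a P).fn = P.fn \ {a} :=
  P.induction_mk fun _ => rfl

theorem fn_par (P Q : Agent 𝔓) : (par P Q).fn = P.fn ∪ Q.fn :=
  P.induction_mk fun _ => Q.induction_mk fun _ => rfl

theorem fn_rep (P : Agent 𝔓) : (rep P).fn = P.fn := P.induction_mk fun _ => rfl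

theorem fn_resList (as : List Name) (P : Agent 𝔓) : (resList as P).fn = P.fn \ {a | a ∈ as} := by
  induction as with
  | nil => simp [resList]
  | cons a as ih =>
    change (res a (resList as P)).fn = _
    rw [fn_res, ih]
    ext; simp only [Set.mem_sdiff, Set.mem_singleton_iff, Set.mem_ofPred_eq, List.mem_cons]; tauto

theorem mem_fn_perm {π : Equiv.Perm Name} {P : Agent 𝔓} {a : Name} :
    a ∈ (P.perm π).fn ↔ π⁻¹ a ∈ P.fn := P.induction_mk fun r => Raw.mem_fn_perm π r a

theorem perm_out (π : Equiv.Perm Name) (M N : 𝔓.Term) (P : Agent 𝔓) :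
    (out M N P).perm π = out (π • M) (π • N) (P.perm π) := P.induction_mk fun _ => rfl

theorem perm_inp (π : Equiv.Perm Name) (M : 𝔓.Term) (x : Name) (P : Agent 𝔓) :
    (inp M x P).perm π = inp (π • M) (π x) (P.perm π) := P.induction_mk fun _ => rfl

theorem perm_case (π : Equiv.Perm Name) (n : ℕ) (φ : Fin n → 𝔓.Cond) (P : Fin n → Agent 𝔓) :
    (case n φ P).perm π = case n (fun i => π • φ i) fun i => (P i).perm π := by
  obtain ⟨R, rfl⟩ := exists_mk_family P
  rw [case_mk]
  exact (case_mk _ _).symm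

theorem perm_res (π : Equiv.Perm Name) (a : Name) (P : Agent 𝔓) :
    (res a P).perm π = res (π a) (P.perm π) := P.induction_mk fun _ => rfl

theorem perm_par (π : Equiv.Perm Name) (P Q : Agent 𝔓) :
    (par P Q).perm π = par (P.perm π) (Q.perm π) :=
  P.induction_mk fun _ => Q.induction_mk fun _ => rfl

theorem perm_rep (π : Equiv.Perm Name) (P : Agent 𝔓) : (rep P).perm π = rep (P.perm π) :=
  P.induction_mk fun _ => rfl

theorem perm_resList (π : Equiv.Perm Name) (as : List Name) (P : Agent 𝔓) :
    (resList as P).perm π = resList (as.map π) (P.perm π) := by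
  induction as with
  | nil => rfl
  | cons a as ih =>
    change (res a (resList as P)).perm π = res (π a) (resList (as.map π) (P.perm π))
    rw [perm_res, ih]

theorem perm_perm (π ρ : Equiv.Perm Name) (P : Agent 𝔓) :
    (P.perm ρ).perm π = P.perm (π * ρ) :=
  P.induction_mk fun r => congrArg (Quotient.mk _) (Raw.perm_perm π ρ r)

theorem perm_congr {P : Agent 𝔓} {π ρ : Equiv.Perm Name} (h : ∀ n ∈ P.fn, π n = ρ n) :
    P.perm π = P.perm ρ := by
  revert h
  exact P.induction_mk fun r h => mk_eq.2 (Raw.perm_congr r π ρ h)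

theorem perm_one (P : Agent 𝔓) : P.perm 1 = P :=
  P.induction_mk fun r => congrArg (Quotient.mk _) (Raw.perm_one r)


theorem res_rename {a b : Name} {P : Agent 𝔓} (h : b ∉ P.fn) :
    res a P = res b (P.perm (Equiv.swap a b)) := by
  revert h
  exact P.induction_mk fun r h => mk_eq.2 (.res_rename a b r h)

theorem inp_rename {M : 𝔓.Term} {a b : Name} {P : Agent 𝔓} (h : b ∉ P.fn) :
    inp M a P = inp M b (P.perm (Equiv.swap a b)) := by
  revert h
  exact P.induction_mk fun r h => mk_eq.2 (.inp_rename M a b r h)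

theorem fn_subst (P : Agent 𝔓) (σ : Subst 𝔓.Term) : (P.subst σ).fn = σ.image P.fn :=
  P.induction_mk fun r => Raw.fn_subst r σ

theorem perm_subst {P : Agent 𝔓} {π : Equiv.Perm Name} {σ τ : Subst 𝔓.Term}
    (h : ∀ n ∈ P.fn, τ n = π • σ n) : (P.subst σ).perm π = P.subst τ := by
  revert h
  exact P.induction_mk fun r h => mk_eq.2 (Raw.perm_subst r π σ τ h)

theorem subst_subst {P : Agent 𝔓} {σ τ ρ : Subst 𝔓.Term}
    (h : ∀ n ∈ P.fn, ρ n = HasSubst.subst (σ n) τ) : (P.subst σ).subst τ = P.subst ρ := by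
  revert h
  exact P.induction_mk fun r h => mk_eq.2 (Raw.subst_subst r σ τ ρ h)

theorem subst_congr {P : Agent 𝔓} {σ τ : Subst 𝔓.Term} (h : ∀ n ∈ P.fn, σ n = τ n) :
    P.subst σ = P.subst τ := by
  revert h
  exact P.induction_mk fun r h => congrArg (Quotient.mk _) (Raw.subst_congr r σ τ h)

theorem subst_eq_self {P : Agent 𝔓} {σ : Subst 𝔓.Term}
    (h : ∀ n ∈ P.fn, σ n = NameTerm.ofName n) : P.subst σ = P := by
  revert h
  exact P.induction_mk fun r h => mk_eq.2 (Raw.subst_eq_self r σ h)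

theorem perm_eq_subst {P : Agent 𝔓} {π : Equiv.Perm Name} {τ : Subst 𝔓.Term}
    (h : ∀ n ∈ P.fn, τ n = NameTerm.ofName (π n)) : P.perm π = P.subst τ := by
  conv_lhs => rw [← subst_eq_self (P := P) (σ := Subst.id) fun _ _ => rfl]
  exact perm_subst fun n hn => by rw [h n hn, Subst.id_apply, NameTerm.smul_ofName]

theorem subst_perm {P : Agent 𝔓} {π : Equiv.Perm Name} {σ τ : Subst 𝔓.Term}
    (h : ∀ n ∈ P.fn, τ n = σ (π n)) : (P.perm π).subst σ = P.subst τ := by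
  rw [perm_eq_subst (τ := Subst.onFinite P.fn_finite fun n => NameTerm.ofName (π n)) fun n hn =>
    Subst.onFinite_of_mem _ _ hn]
  refine subst_subst fun n hn => ?_
  rw [Subst.onFinite_of_mem _ _ hn, 𝔓.subst_ofName, h n hn]

theorem subst_out (M N : 𝔓.Term) (P : Agent 𝔓) (σ : Subst 𝔓.Term) :
    (out M N P).subst σ = out (HasSubst.subst M σ) (HasSubst.subst N σ) (P.subst σ) :=
  P.induction_mk fun _ => rfl

/-- Replaces the name chosen by `freshName` by any admissible binder, so that proofs can pick names
suited to the context. -/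
theorem subst_inp {M : 𝔓.Term} {x z : Name} {P : Agent 𝔓} {σ : Subst 𝔓.Term}
    (hz : z ∉ σ.image (P.fn \ {x})) : (inp M x P).subst σ =
      inp (HasSubst.subst M σ) z (P.subst (σ.update x (NameTerm.ofName z))) := by
  revert hz
  exact P.induction_mk fun r hz => mk_eq.2
    ((Raw.isBinder_inp _).change (Raw.freshName_image σ r x) hz (Raw.perm_subst r))

theorem subst_res {a z : Name} {P : Agent 𝔓} {σ : Subst 𝔓.Term}
    (hz : z ∉ σ.image (P.fn \ {a})) : (res a P).subst σ =
      res z (P.subst (σ.update a (NameTerm.ofName z))) := by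
  revert hz
  exact P.induction_mk fun r hz => mk_eq.2
    (Raw.isBinder_res.change (Raw.freshName_image σ r a) hz (Raw.perm_subst r))

theorem subst_case (n : ℕ) (φ : Fin n → 𝔓.Cond) (P : Fin n → Agent 𝔓) (σ : Subst 𝔓.Term) :
    (case n φ P).subst σ = case n (fun i => HasSubst.subst (φ i) σ) fun i => (P i).subst σ := by
  obtain ⟨R, rfl⟩ := exists_mk_family P
  rw [case_mk]
  exact (case_mk _ _).symm

theorem subst_par (P Q : Agent 𝔓) (σ : Subst 𝔓.Term) :
    (par P Q).subst σ = par (P.subst σ) (Q.subst σ) :=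
  P.induction_mk fun _ => Q.induction_mk fun _ => rfl

theorem subst_rep (P : Agent 𝔓) (σ : Subst 𝔓.Term) : (rep P).subst σ = rep (P.subst σ) :=
  P.induction_mk fun _ => rfl

/-- Distinctness of `d` is needed because a new outer binder must not be captured by an inner one.
-/
theorem subst_resList : ∀ {as d : List Name} {P : Agent 𝔓} {σ : Subst 𝔓.Term},
    d.length = as.length → d.Nodup → (∀ m ∈ d, m ∉ σ.image (P.fn \ {a | a ∈ as})) →
    (resList as P).subst σ = resList d (P.subst (σ.bind as d))
  | [], d, P, σ, hl, _, _ => by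
    obtain rfl : d = [] := by simpa using hl
    rw [Subst.bind_nil]; rfl
  | a :: as, [], P, σ, hl, _, _ => by simp at hl
  | a :: as, m :: d, P, σ, hl, hd, h => by
    simp only [List.length_cons, Nat.add_right_cancel_iff] at hl
    obtain ⟨hm, hd⟩ := List.nodup_cons.1 hd
    have hset : P.fn \ {n | n ∈ a :: as} = (P.fn \ {n | n ∈ as}) \ {a} := by
      ext; simp only [Set.mem_sdiff, Set.mem_singleton_iff, Set.mem_ofPred_eq, List.mem_cons]; tauto
    change (res a (resList as P)).subst σ = res m (resList d _)
    rw [subst_res (z := m), subst_resList hl hd]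
    · congr 2
      refine subst_congr fun n _ => ?_
      by_cases hn : n ∈ as
      · rw [Subst.bind_of_mem _ hn, Subst.bind_of_mem _ (by simp [hn])]
        simp [listMap, hn]
      · rw [Subst.bind_of_notMem _ hn]
        by_cases hna : n = a
        · subst hna
          rw [Subst.update_same, Subst.bind_of_mem _ (by simp)]
          simp [listMap, hn]
        · rw [Subst.update_of_ne _ _ hna, Subst.bind_of_notMem _ (by simp [hn, hna])]
    · intro k hk hk'
      obtain ⟨n, hn, h1⟩ := Subst.mem_image.1 hk'
      by_cases hna : n = a
      · subst hna
        rw [Subst.update_same, supp_ofName] at h1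
        exact hm (h1 ▸ hk)
      · rw [Subst.update_of_ne _ _ hna] at h1
        exact h k (by simp [hk]) (Subst.mem_image.2 ⟨n, by rw [hset]; exact ⟨hn, hna⟩, h1⟩)
    · rw [fn_resList, ← hset]
      exact h m (by simp)

/-! Inversion. -/

theorem inp_inj {M M' : 𝔓.Term} {x y : Name} {P Q : Agent 𝔓} (h : inp M x P = inp M' y Q) :
    M = M' ∧ (x = y ∨ y ∉ P.fn) ∧ P.perm (Equiv.swap x y) = Q := by
  revert h
  refine P.induction_mk fun r => Q.induction_mk fun s h => ?_
  obtain ⟨h1, h2, h3⟩ := (mk_eq.1 h).sameHead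
  exact ⟨h1, h2, mk_eq.2 h3⟩

theorem res_inj {x y : Name} {P Q : Agent 𝔓} (h : res x P = res y Q) :
    (x = y ∨ y ∉ P.fn) ∧ P.perm (Equiv.swap x y) = Q := by
  revert h
  refine P.induction_mk fun r => Q.induction_mk fun s h => ?_
  obtain ⟨h2, h3⟩ := (mk_eq.1 h).sameHead
  exact ⟨h2, mk_eq.2 h3⟩

theorem subst_eq_out {P Q : Agent 𝔓} {M N : 𝔓.Term} {σ : Subst 𝔓.Term}
    (h : P.subst σ = out M N Q) : ∃ M₀ N₀ P₀, P = out M₀ N₀ P₀ ∧ HasSubst.subst M₀ σ = M ∧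
      HasSubst.subst N₀ σ = N ∧ P₀.subst σ = Q := by
  revert h
  refine P.induction_mk fun r => Q.induction_mk fun s h => ?_
  have h := (mk_eq.1 h).sameHead
  cases r with
  | out M₀ N₀ r => exact ⟨M₀, N₀, Quotient.mk _ r, rfl, h.1, h.2.1, mk_eq.2 h.2.2⟩
  | _ => exact h.elim

/-- Substitution preserves the outermost constructor, and a fresh `x₀` may be prescribed as the
binder of the original. The binder `x` of the instance then appears as the value at `x₀`, with the
absence of capture recorded last. -/
theorem subst_eq_inp {P Q : Agent 𝔓} {M : 𝔓.Term} {x x₀ : Name} {σ : Subst 𝔓.Term}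
    (h : P.subst σ = inp M x Q) (hx₀ : x₀ ∉ P.fn) (hx : x₀ ∉ σ.support) :
    ∃ M₀ P₀, P = inp M₀ x₀ P₀ ∧ HasSubst.subst M₀ σ = M ∧
      P₀.subst (σ.update x₀ (NameTerm.ofName x)) = Q ∧ x ∉ σ.image (P₀.fn \ {x₀}) := by
  have key : ∃ M₀ P₀, P = inp M₀ x₀ P₀ := by
    revert h hx₀
    refine P.induction_mk fun r => Q.induction_mk fun s h hx₀ => ?_
    have h := (mk_eq.1 h).sameHead
    cases r with
    | inp M₀ z r =>
      by_cases hz : z = x₀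
      · subst hz; exact ⟨M₀, Quotient.mk _ r, rfl⟩
      · refine ⟨M₀, _, inp_rename (P := Quotient.mk _ r) fun h => ?_⟩
        exact hx₀ (Or.inr ⟨h, fun h => hz h.symm⟩)
    | _ => exact h.elim
  obtain ⟨M₀, P₀, rfl⟩ := key
  obtain ⟨z, hz⟩ := (σ.image_finite (P₀.fn_finite.subset (Set.sdiff_subset (t := {x₀})))).exists_notMem
  rw [subst_inp hz] at h
  obtain ⟨h1, h2, h3⟩ := inp_inj h
  have hx' : x ∉ σ.image (P₀.fn \ {x₀}) := by
    rcases h2 with rfl | h2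
    · exact hz
    · intro h4
      rw [fn_subst] at h2
      rw [← Subst.image_update σ hz] at h4
      exact h2 h4.1
  refine ⟨M₀, P₀, rfl, h1, ?_, hx'⟩
  rw [← h3]
  refine (perm_subst fun n hn => ?_).symm
  by_cases hnx : n = x₀
  · subst hnx
    rw [Subst.update_same, Subst.update_same, NameTerm.smul_ofName, Equiv.swap_apply_left]
  · rw [Subst.update_of_ne _ _ hnx, Subst.update_of_ne _ _ hnx, swap_smul_of_notMem_supp]
    · exact fun h => hz (Subst.mem_image.2 ⟨n, ⟨hn, hnx⟩, h⟩)
    · exact fun h => hx' (Subst.mem_image.2 ⟨n, ⟨hn, hnx⟩, h⟩)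

theorem update_ofName_self {σ : Subst 𝔓.Term} {b : Name} (hb : b ∉ σ.support) :
    σ.update b (NameTerm.ofName b) = σ := by
  ext n
  by_cases h : n = b
  · subst h; exact (Subst.update_same _ _ _).trans (Subst.eq_ofName_of_notMem_support hb).symm
  · exact Subst.update_of_ne _ _ h

theorem subst_res_of_notMem {b : Name} {P : Agent 𝔓} {σ : Subst 𝔓.Term} (hb : b ∉ σ.support) :
    (res b P).subst σ = res b (P.subst σ) := by
  rw [subst_res (z := b), update_ofName_self hb]
  intro h
  obtain ⟨n, hn, h1⟩ := Subst.mem_image.1 h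
  exact hn.2 (Subst.eq_of_mem_supp hb h1)

/-- A name fresh for both `P` and `σ` can serve as binder before and after the substitution, so the
bodies are related by the same `σ`. -/
theorem subst_eq_res {P Q : Agent 𝔓} {b : Name} {σ : Subst 𝔓.Term}
    (h : P.subst σ = res b Q) (hb : b ∉ P.fn) (hσ : b ∉ σ.support) :
    ∃ P₀, P = res b P₀ ∧ P₀.subst σ = Q := by
  have key : ∃ P₀, P = res b P₀ := by
    revert h hb
    refine P.induction_mk fun r => Q.induction_mk fun s h hx₀ => ?_
    have h := (mk_eq.1 h).sameHead
    cases r with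
    | res z r =>
      by_cases hz : z = b
      · subst hz; exact ⟨Quotient.mk _ r, rfl⟩
      · refine ⟨_, res_rename (P := Quotient.mk _ r) fun h => ?_⟩
        exact hx₀ ⟨h, fun h => hz h.symm⟩
    | _ => exact h.elim
  obtain ⟨P₀, rfl⟩ := key
  refine ⟨P₀, rfl, ?_⟩
  rw [subst_res_of_notMem hσ] at h
  have := (res_inj h).2
  rwa [Equiv.swap_self, show (Equiv.refl Name) = (1 : Equiv.Perm Name) from rfl, perm_one] at this

theorem subst_eq_par {P Q R : Agent 𝔓} {σ : Subst 𝔓.Term}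
    (h : P.subst σ = par Q R) : ∃ P₀ P₁, P = par P₀ P₁ ∧ P₀.subst σ = Q ∧ P₁.subst σ = R := by
  revert h
  refine P.induction_mk fun r => Q.induction_mk fun s => R.induction_mk fun t h => ?_
  have h := (mk_eq.1 h).sameHead
  cases r with
  | par r₁ r₂ => exact ⟨Quotient.mk _ r₁, Quotient.mk _ r₂, rfl, mk_eq.2 h.1, mk_eq.2 h.2⟩
  | _ => exact h.elim

theorem subst_eq_rep {P Q : Agent 𝔓} {σ : Subst 𝔓.Term}
    (h : P.subst σ = rep Q) : ∃ P₀, P = rep P₀ ∧ P₀.subst σ = Q := by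
  revert h
  refine P.induction_mk fun r => Q.induction_mk fun s h => ?_
  have h := (mk_eq.1 h).sameHead
  cases r with
  | rep r => exact ⟨Quotient.mk _ r, rfl, mk_eq.2 h⟩
  | _ => exact h.elim

theorem subst_eq_case {P : Agent 𝔓} {n : ℕ} {φ : Fin n → 𝔓.Cond} {Q : Fin n → Agent 𝔓}
    {σ : Subst 𝔓.Term} (h : P.subst σ = case n φ Q) : ∃ φ₀ P₀, P = case n φ₀ P₀ ∧
      ∀ i, HasSubst.subst (φ₀ i) σ = φ i ∧ (P₀ i).subst σ = Q i := by
  obtain ⟨S, rfl⟩ := exists_mk_family Q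
  rw [case_mk] at h
  revert h
  refine P.induction_mk fun r h => ?_
  have h := (mk_eq.1 h).sameHead
  cases r with
  | case m φ₀ R =>
    obtain ⟨rfl, h⟩ := h
    exact ⟨φ₀, fun i => Quotient.mk _ (R i), (case_mk _ _).symm, fun i => ⟨(h i).1, mk_eq.2 (h i).2⟩⟩
  | _ => exact h.elim

/-! Well-formedness. -/

/-- No unguarded assertions. -/
def Guarded (P : Agent 𝔓) : Prop :=
  Quotient.lift Raw.Guarded (fun _ _ h => propext (Raw.Alpha.guarded_iff h)) P

theorem wf_subst {P : Agent 𝔓} {σ : Subst 𝔓.Term} : (P.subst σ).WF ↔ P.WF :=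
  P.induction_mk fun r => Raw.wf_subst r σ

theorem wf_case {n : ℕ} {φ : Fin n → 𝔓.Cond} {P : Fin n → Agent 𝔓} :
    (case n φ P).WF ↔ ∀ i, (P i).WF ∧ (P i).Guarded := by
  obtain ⟨R, rfl⟩ := exists_mk_family P
  rw [case_mk]; rfl

theorem wf_res {a : Name} {P : Agent 𝔓} : (res a P).WF ↔ P.WF := P.induction_mk fun _ => Iff.rfl

theorem wf_par {P Q : Agent 𝔓} : (par P Q).WF ↔ P.WF ∧ Q.WF :=
  P.induction_mk fun _ => Q.induction_mk fun _ => Iff.rfl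

theorem wf_rep {P : Agent 𝔓} : (rep P).WF ↔ P.WF ∧ P.Guarded := P.induction_mk fun _ => Iff.rfl

theorem guarded_par_rep {P : Agent 𝔓} : (par P P.rep).Guarded ↔ P.Guarded :=
  P.induction_mk fun _ => and_self_iff

end Agent

/-! ## Frames -/

theorem AssnEq.smul (π : Equiv.Perm Name) {Ψ Ψ' : 𝔓.Assn} (h : AssnEq Ψ Ψ') :
    AssnEq (π • Ψ) (π • Ψ') := by
  induction h with
  | refl => exact .refl _
  | symm _ ih => exact .symm ih
  | trans _ _ ih1 ih2 => exact .trans ih1 ih2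
  | comp _ _ ih1 ih2 => rw [𝔓.smul_comp, 𝔓.smul_comp]; exact .comp ih1 ih2
  | ident Ψ => rw [𝔓.smul_comp, 𝔓.smul_unit]; exact .ident _
  | assoc => simp only [𝔓.smul_comp]; exact .assoc _ _ _
  | comm => simp only [𝔓.smul_comp]; exact .comm _ _

namespace Frame

theorem mem_mk {b b' : List Name} {Ψ Ψ' : 𝔓.Assn} :
    (b', Ψ') ∈ Frame.mk b Ψ ↔ BindEq (b, Ψ) (b', Ψ') := Iff.rfl

theorem mk_self (b : List Name) (Ψ : 𝔓.Assn) : (b, Ψ) ∈ Frame.mk b Ψ := .refl _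

theorem mk_eq_mk {b b' : List Name} {Ψ Ψ' : 𝔓.Assn} (h : BindEq (b, Ψ) (b', Ψ')) :
    Frame.mk b Ψ = Frame.mk b' Ψ' :=
  Set.ext fun _ => ⟨fun h' => .trans _ _ _ (.symm _ _ h) h', fun h' => .trans _ _ _ h h'⟩

theorem new_mk (c : Name) (b : List Name) (Ψ : 𝔓.Assn) :
    (Frame.mk b Ψ).new c = Frame.mk (c :: b) Ψ := by
  ext p
  constructor
  · rintro ⟨b', Ψ', h, hp⟩
    exact .trans _ _ _ (BindEq.append_left [c] h) hp
  · intro h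
    exact ⟨b, Ψ, mk_self b Ψ, h⟩

/-- Both sides are compared at fresh names. Under the freshness conditions each factor only sees its
own binders, so the instance of the composition is the composition of the instances, which do not
depend on the representatives. -/
theorem bindEq_comp {b₁ b₂ c₁ c₂ : List Name} {Ψ₁ Ψ₂ Φ₁ Φ₂ : 𝔓.Assn}
    (h₁ : BindEq (b₁, Ψ₁) (c₁, Φ₁)) (h₂ : BindEq (b₂, Ψ₂) (c₂, Φ₂))
    (hb₁ : ∀ a ∈ b₁, a ∉ b₂ ∧ a ∉ supp Ψ₂) (hb₂ : ∀ a ∈ b₂, a ∉ b₁ ∧ a ∉ supp Ψ₁)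
    (hc₁ : ∀ a ∈ c₁, a ∉ c₂ ∧ a ∉ supp Φ₂) (hc₂ : ∀ a ∈ c₂, a ∉ c₁ ∧ a ∉ supp Φ₁) :
    BindEq (b₁ ++ b₂, 𝔓.comp Ψ₁ Ψ₂) (c₁ ++ c₂, 𝔓.comp Φ₁ Φ₂) := by
  have l1 : c₁.length = b₁.length := h₁.length_eq
  have l2 : c₂.length = b₂.length := h₂.length_eq
  obtain ⟨d, d1, d2, d3⟩ := exists_fresh_list
    ((supp_finite (𝔓.comp Ψ₁ Ψ₂)).union (supp_finite (𝔓.comp Φ₁ Φ₂))) (b₁ ++ b₂).length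
  simp only [Set.mem_union, not_or] at d3
  obtain ⟨d₁, d₂, rfl, k1, k2⟩ : ∃ d₁ d₂, d = d₁ ++ d₂ ∧ d₁.length = b₁.length ∧
      d₂.length = b₂.length := by
    refine ⟨d.take b₁.length, d.drop b₁.length, (List.take_append_drop _ _).symm, ?_, ?_⟩ <;>
      simp [d1]
  refine BindEq.of_bind_eq (𝔓 := 𝔓) d1 (by simp [k1, k2, l1, l2]) d2 d3 ?_
  have aux1 : ∀ {b₁ b₂ : List Name} {Ψ₁ Ψ₂ : 𝔓.Assn} (_ : d₁.length = b₁.length)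
      (_ : ∀ a ∈ b₁, a ∉ b₂ ∧ a ∉ supp Ψ₂) (_ : ∀ a ∈ b₂, a ∉ b₁ ∧ a ∉ supp Ψ₁),
      HasSubst.subst (𝔓.comp Ψ₁ Ψ₂) ((Subst.id : Subst 𝔓.Term).bind (b₁ ++ b₂) (d₁ ++ d₂)) =
      𝔓.comp (HasSubst.subst Ψ₁ ((Subst.id : Subst 𝔓.Term).bind b₁ d₁))
        (HasSubst.subst Ψ₂ ((Subst.id : Subst 𝔓.Term).bind b₂ d₂)) := by
    intro b₁ b₂ Ψ₁ Ψ₂ k1 hb₁ hb₂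
    rw [𝔓.subst_comp]
    congr 1 <;> refine subst_congr_supp fun n hn => ?_
    · have hn2 : n ∉ b₂ := fun h => (hb₂ n h).2 hn
      by_cases hn1 : n ∈ b₁
      · rw [Subst.bind_of_mem _ hn1, Subst.bind_of_mem _ (by simp [hn1]),
          listMap_append_left _ _ k1 hn2]
      · rw [Subst.bind_of_notMem _ hn1, Subst.bind_of_notMem _ (by simp [hn1, hn2])]
    · have hn1 : n ∉ b₁ := fun h => (hb₁ n h).2 hn
      by_cases hn2 : n ∈ b₂
      · rw [Subst.bind_of_mem _ hn2, Subst.bind_of_mem _ (by simp [hn2]),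
          listMap_append_right _ _ k1 hn2]
      · rw [Subst.bind_of_notMem _ hn2, Subst.bind_of_notMem _ (by simp [hn1, hn2])]
  rw [aux1 k1 hb₁ hb₂, aux1 (k1.trans l1.symm) hc₁ hc₂, h₁.bind_eq (𝔓 := 𝔓) _ k1,
    h₂.bind_eq (𝔓 := 𝔓) _ k2]

/-- Composition of frames is defined through all admissible pairs of representatives; a single pair
already determines the class. -/
theorem comp_mk {b₁ b₂ : List Name} {Ψ₁ Ψ₂ : 𝔓.Assn}
    (h₁ : ∀ a ∈ b₁, a ∉ b₂ ∧ a ∉ supp Ψ₂) (h₂ : ∀ a ∈ b₂, a ∉ b₁ ∧ a ∉ supp Ψ₁) :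
    (Frame.mk b₁ Ψ₁).comp (Frame.mk b₂ Ψ₂) = Frame.mk (b₁ ++ b₂) (𝔓.comp Ψ₁ Ψ₂) := by
  ext p
  constructor
  · rintro ⟨c₁, Φ₁, c₂, Φ₂, k1, k2, k3, k4, hp⟩
    exact .trans _ _ _ (bindEq_comp k1 k2 h₁ h₂ k3 k4) hp
  · intro h
    exact ⟨b₁, Ψ₁, b₂, Ψ₂, mk_self _ _, mk_self _ _, h₁, h₂, h⟩

end Frame

namespace Raw

/-- Frames are defined as sets of representatives. This shows that each is one alpha-class, with
distinct binders that can avoid any finite set. The bound on the support makes binders that avoid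
the other agent's free names admissible for composition. -/
theorem exists_frame_eq_mk (r : Raw 𝔓) : ∀ {X : Set Name}, X.Finite →
    ∃ b Ψ, r.frame = Frame.mk b Ψ ∧ b.Nodup ∧ (∀ a ∈ b, a ∉ X) ∧
      (∀ a ∈ supp Ψ, a ∈ b ∨ a ∈ r.fn) := by
  have trivial_case : ∀ {r : Raw 𝔓} {X : Set Name}, r.frame = Frame.mk [] 𝔓.unit →
      ∃ b Ψ, r.frame = Frame.mk b Ψ ∧ b.Nodup ∧ (∀ a ∈ b, a ∉ X) ∧
      (∀ a ∈ supp Ψ, a ∈ b ∨ a ∈ r.fn) := fun h =>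
    ⟨[], 𝔓.unit, h, List.nodup_nil, by simp, by simp [supp_unit]⟩
  induction r with
  | out M N P ih => exact fun _ => trivial_case rfl
  | inp M x P ih => exact fun _ => trivial_case rfl
  | case n φ P ih => exact fun _ => trivial_case rfl
  | rep P ih => exact fun _ => trivial_case rfl
  | ass Ψ => exact fun _ => ⟨[], Ψ, rfl, List.nodup_nil, by simp, fun a ha => Or.inr ha⟩
  | res a P ih =>
    intro X hX
    obtain ⟨c, hc⟩ := (hX.union P.fn_finite).exists_notMem
    simp only [Set.mem_union, not_or] at hc
    obtain ⟨b, Ψ, h1, h2, h3, h4⟩ := ih (hX.union (Set.toFinite {a, c}))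
    simp only [Set.mem_union, Set.mem_insert_iff, Set.mem_singleton_iff, not_or] at h3
    have hcb : c ∉ b := fun h => (h3 c h).2.2 rfl
    have hab : a ∉ b := fun h => (h3 a h).2.1 rfl
    have hcΨ : c ∉ supp Ψ := fun h => (h4 c h).elim hcb hc.2
    have step := BindStep.mk [] b a c Ψ hcb hcΨ
    have e1 : b.map (Equiv.swap a c) = b := by
      conv_rhs => rw [← List.map_id b]
      refine List.map_congr_left fun k hk => ?_
      exact Equiv.swap_apply_of_ne_of_ne (fun h : k = a => hab (h ▸ hk)) fun h : k = c => hcb (h ▸ hk)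
    rw [e1] at step
    refine ⟨c :: b, Equiv.swap a c • Ψ, ?_, by simp [hcb, h2], ?_, ?_⟩
    · change P.frame.new a = _
      rw [h1, Frame.new_mk]
      exact Frame.mk_eq_mk (.rel _ _ step)
    · intro k hk
      rcases List.mem_cons.1 hk with rfl | hk
      exacts [hc.1, (h3 k hk).1]
    · intro k hk
      rw [mem_supp_smul_iff, Equiv.swap_inv] at hk
      by_cases hka : k = a
      · subst hka; rw [Equiv.swap_apply_left] at hk; exact absurd hk hcΨ
      by_cases hkc : k = c
      · simp [hkc]
      rw [Equiv.swap_apply_of_ne_of_ne hka hkc] at hk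
      rcases h4 k hk with h | h
      · simp [h]
      · exact Or.inr ⟨h, hka⟩
  | par P Q ihP ihQ =>
    intro X hX
    obtain ⟨b₁, Ψ₁, h1, h2, h3, h4⟩ := ihP (hX.union Q.fn_finite)
    obtain ⟨b₂, Ψ₂, k1, k2, k3, k4⟩ := ihQ (hX.union ((supp_finite Ψ₁).union
      b₁.toFinset.finite_toSet))
    simp only [Set.mem_union, List.coe_toFinset, Set.mem_ofPred_eq, not_or] at h3 k3
    have e1 : ∀ a ∈ b₁, a ∉ b₂ := fun a h h' => (k3 a h').2.2 h
    refine ⟨b₁ ++ b₂, 𝔓.comp Ψ₁ Ψ₂, ?_, ?_, ?_, ?_⟩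
    · change P.frame.comp Q.frame = _
      rw [h1, k1, Frame.comp_mk]
      · exact fun a ha => ⟨e1 a ha, fun h => (k4 a h).elim (e1 a ha) (h3 a ha).2⟩
      · exact fun a ha => ⟨(k3 a ha).2.2, (k3 a ha).2.1⟩
    · exact List.nodup_append.2 ⟨h2, k2, fun a ha b hb h => e1 a ha (h ▸ hb)⟩
    · intro a ha
      rcases List.mem_append.1 ha with ha | ha
      exacts [(h3 a ha).1, (k3 a ha).1]
    · intro a ha
      rcases supp_comp_subset _ _ ha with ha | ha
      · rcases h4 a ha with h | h
        · simp [h]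
        · exact Or.inr (Or.inl h)
      · rcases k4 a ha with h | h
        · simp [h]
        · exact Or.inr (Or.inr h)

theorem frame_perm (π : Equiv.Perm Name) (r : Raw 𝔓) : ∀ {b : List Name} {Ψ : 𝔓.Assn},
    (b, Ψ) ∈ r.frame → (b.map π, π • Ψ) ∈ (r.perm π).frame := by
  have mk : ∀ {b b' : List Name} {Ψ Ψ' : 𝔓.Assn}, BindEq (b, Ψ) (b', Ψ') →
      BindEq (b.map π, π • Ψ) (b'.map π, π • Ψ') := by
    intro b b' Ψ Ψ' h
    have key : ∀ p q : List Name × 𝔓.Assn, BindEq p q →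
        BindEq (p.1.map π, π • p.2) (q.1.map π, π • q.2) := by
      intro p q h
      induction h with
      | rel _ _ h =>
        obtain ⟨pre, post, a, c, x, h1, h2⟩ := h
        have := BindStep.mk (pre.map π) (post.map π) (π a) (π c) (π • x)
          (by simpa using h1) (by simpa [mem_supp_smul_iff] using h2)
        refine .rel _ _ ?_
        have e : π * Equiv.swap a c = Equiv.swap (π a) (π c) * π := Equiv.mul_swap_eq_swap_mul _ _ _
        have e2 : (post.map (Equiv.swap a c)).map π = (post.map π).map (Equiv.swap (π a) (π c)) := by
          rw [List.map_map, List.map_map]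
          refine List.map_congr_left fun k _ => ?_
          exact congrFun (congrArg DFunLike.coe e) k
        simp only [List.map_append, List.map_cons, e2]
        rw [← mul_smul, e, mul_smul]
        exact this
      | refl => exact .refl _
      | symm _ _ _ ih => exact .symm _ _ ih
      | trans _ _ _ _ _ h1 h2 => exact .trans _ _ _ h1 h2
    exact key _ _ h
  have unit_case : ∀ {b : List Name} {Ψ : 𝔓.Assn}, (b, Ψ) ∈ Frame.mk [] 𝔓.unit →
      (b.map π, π • Ψ) ∈ Frame.mk [] 𝔓.unit := fun h => by
    have := mk h
    rwa [𝔓.smul_unit] at this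
  induction r with
  | out M N P ih => exact unit_case
  | inp M x P ih => exact unit_case
  | case n φ P ih => exact unit_case
  | rep P ih => exact unit_case
  | ass Φ => exact mk
  | res a P ih =>
    rintro b Ψ ⟨c, Φ, h1, h2⟩
    exact ⟨_, _, ih h1, mk h2⟩
  | par P Q ihP ihQ =>
    rintro b Ψ ⟨b₁, Ψ₁, b₂, Ψ₂, h1, h2, h3, h4, h5⟩
    refine ⟨_, _, _, _, ihP h1, ihQ h2, ?_, ?_, ?_⟩
    · intro a ha
      rw [mem_map_perm] at ha ⊢
      rw [mem_supp_smul_iff]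
      exact h3 _ ha
    · intro a ha
      rw [mem_map_perm] at ha ⊢
      rw [mem_supp_smul_iff]
      exact h4 _ ha
    · rw [← 𝔓.smul_comp, ← List.map_append]
      exact mk h5

/-- Only renaming of restrictions is of interest: by equivariance, the renamed body has the renamed
frame, and closing it with the new binder is one step of renaming. -/
theorem Alpha.frame_eq {r s : Raw 𝔓} (h : Alpha r s) : r.frame = s.frame := by
  induction h with
  | refl => rfl
  | symm _ ih => exact ih.symm
  | trans _ _ ih1 ih2 => exact ih1.trans ih2
  | out | inp | case | rep | inp_rename => rfl
  | res a _ ih => exact congrArg (Frame.new a) ih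
  | par _ _ ih1 ih2 => exact congrArg₂ Frame.comp ih1 ih2
  | res_rename a c P hc =>
    obtain ⟨b, Ψ, h1, h2, h3, h4⟩ := P.exists_frame_eq_mk (X := {c}) (Set.finite_singleton c)
    obtain ⟨b', Ψ', h1', -, -, -⟩ :=
      (P.perm (Equiv.swap a c)).exists_frame_eq_mk Set.finite_empty
    have hcb : c ∉ b := fun h => h3 c h rfl
    have step := BindStep.mk [] b a c Ψ hcb fun h => (h4 c h).elim hcb hc
    have h5 := frame_perm (Equiv.swap a c) P (b := b) (Ψ := Ψ) (by rw [h1]; exact Frame.mk_self _ _)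
    change P.frame.new a = (P.perm (Equiv.swap a c)).frame.new c
    rw [h1', Frame.mem_mk] at h5
    rw [h1, h1', Frame.mk_eq_mk h5, Frame.new_mk, Frame.new_mk]
    exact Frame.mk_eq_mk (.rel _ _ step)

/-- Parallel composition of guarded agents composes units, so the assertion is the unit only up to
the monoid laws; permutations preserve these laws, hence so does renaming of frame binders. -/
theorem Guarded.assnEq_unit {r : Raw 𝔓} (hr : r.Guarded) : ∀ {b : List Name} {Ψ : 𝔓.Assn},
    (b, Ψ) ∈ r.frame → AssnEq Ψ 𝔓.unit := by
  have mk : ∀ p q : List Name × 𝔓.Assn, BindEq p q → (AssnEq p.2 𝔓.unit ↔ AssnEq q.2 𝔓.unit) := by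
    intro p q h
    induction h with
    | rel _ _ h =>
      obtain ⟨pre, post, a, c, x, h1, h2⟩ := h
      constructor
      · intro h
        have := h.smul (Equiv.swap a c)
        rwa [𝔓.smul_unit] at this
      · intro h
        have := AssnEq.smul (Equiv.swap a c) h
        rwa [𝔓.smul_unit, ← mul_smul, Equiv.swap_mul_self, one_smul] at this
    | refl => exact Iff.rfl
    | symm _ _ _ ih => exact ih.symm
    | trans _ _ _ _ _ h1 h2 => exact h1.trans h2
  have unit_case : ∀ {b : List Name} {Ψ : 𝔓.Assn}, (b, Ψ) ∈ Frame.mk [] 𝔓.unit →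
      AssnEq Ψ 𝔓.unit := fun h => (mk _ _ h).1 (.refl _)
  induction r with
  | out M N P ih => exact fun {_ _} h => unit_case h
  | inp M x P ih => exact fun {_ _} h => unit_case h
  | case n φ P ih => exact fun {_ _} h => unit_case h
  | rep P ih => exact fun {_ _} h => unit_case h
  | ass Φ => exact hr.elim
  | res a P ih =>
    rintro b Ψ ⟨c, Φ, h1, h2⟩
    exact (mk _ _ h2).1 (ih hr h1)
  | par P Q ihP ihQ =>
    rintro b Ψ ⟨b₁, Ψ₁, b₂, Ψ₂, h1, h2, h3, h4, h5⟩
    exact (mk _ _ h5).1 ((AssnEq.comp (ihP hr.1 h1) (ihQ hr.2 h2)).trans (.ident _))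

end Raw

/-! ### Frames of agents and of their substitution instances -/

namespace Agent

theorem frame_mk (r : Raw 𝔓) : frame (Quotient.mk _ r : Agent 𝔓) = r.frame := by
  ext p
  constructor
  · rintro ⟨s, hs, hp⟩
    rwa [← (mk_eq.1 hs).frame_eq]
  · intro hp
    exact ⟨r, rfl, hp⟩

theorem exists_frame_eq_mk (P : Agent 𝔓) {X : Set Name} (hX : X.Finite) :
    ∃ b Ψ, P.frame = Frame.mk b Ψ ∧ b.Nodup ∧ (∀ a ∈ b, a ∉ X) ∧
      (∀ a ∈ supp Ψ, a ∈ b ∨ a ∈ P.fn) :=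
  P.induction_mk fun r => by rw [frame_mk]; exact r.exists_frame_eq_mk hX

theorem bindEq_of_mem_frame {P : Agent 𝔓} {b b' : List Name} {Ψ Ψ' : 𝔓.Assn}
    (h : (b, Ψ) ∈ P.frame) (h' : (b', Ψ') ∈ P.frame) : BindEq (b, Ψ) (b', Ψ') := by
  obtain ⟨c, Φ, h1, -⟩ := P.exists_frame_eq_mk Set.finite_empty
  rw [h1, Frame.mem_mk] at h h'
  exact .trans _ _ _ (.symm _ _ h) h'

theorem mem_frame_of_bindEq {P : Agent 𝔓} {b b' : List Name} {Ψ Ψ' : 𝔓.Assn}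
    (h : (b, Ψ) ∈ P.frame) (h' : BindEq (b, Ψ) (b', Ψ')) : (b', Ψ') ∈ P.frame := by
  obtain ⟨c, Φ, h1, -⟩ := P.exists_frame_eq_mk Set.finite_empty
  rw [h1, Frame.mem_mk] at h ⊢
  exact .trans _ _ _ h h'

theorem mem_fn_of_mem_frame {P : Agent 𝔓} {b : List Name} {Ψ : 𝔓.Assn}
    (h : (b, Ψ) ∈ P.frame) {n : Name} (hn : n ∈ supp Ψ) (hb : n ∉ b) : n ∈ P.fn := by
  obtain ⟨c, Φ, h1, -, -, h4⟩ := P.exists_frame_eq_mk Set.finite_empty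
  rw [h1, Frame.mem_mk] at h
  obtain ⟨k1, k2⟩ := BindEq.mem_free (.symm _ _ h) hn hb
  exact (h4 n k1).resolve_left k2

theorem mem_frame_perm (π : Equiv.Perm Name) {P : Agent 𝔓} {b : List Name} {Ψ : 𝔓.Assn}
    (h : (b, Ψ) ∈ P.frame) : (b.map π, π • Ψ) ∈ (P.perm π).frame := by
  revert h
  exact P.induction_mk fun r h => by
    rw [perm_mk, frame_mk] at *
    exact Raw.frame_perm π r h

theorem mem_frame_par {P Q : Agent 𝔓} {b₁ b₂ : List Name} {Ψ₁ Ψ₂ : 𝔓.Assn}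
    (h₁ : (b₁, Ψ₁) ∈ P.frame) (h₂ : (b₂, Ψ₂) ∈ Q.frame)
    (k₁ : ∀ a ∈ b₁, a ∉ b₂ ∧ a ∉ supp Ψ₂) (k₂ : ∀ a ∈ b₂, a ∉ b₁ ∧ a ∉ supp Ψ₁) :
    (b₁ ++ b₂, 𝔓.comp Ψ₁ Ψ₂) ∈ (par P Q).frame := by
  revert h₁ h₂
  refine P.induction_mk fun r => Q.induction_mk fun s h₁ h₂ => ?_
  rw [frame_mk] at h₁ h₂
  exact ⟨Raw.par r s, rfl, b₁, Ψ₁, b₂, Ψ₂, h₁, h₂, k₁, k₂, Frame.mk_self _ _⟩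

theorem mem_frame_res {P : Agent 𝔓} {b : List Name} {Ψ : 𝔓.Assn} (a : Name)
    (h : (b, Ψ) ∈ P.frame) : (a :: b, Ψ) ∈ (res a P).frame := by
  revert h
  refine P.induction_mk fun r h => ?_
  rw [frame_mk] at h
  exact ⟨Raw.res a r, rfl, b, Ψ, h, Frame.mk_self _ _⟩

theorem mem_frame_out (M N : 𝔓.Term) (P : Agent 𝔓) : ([], 𝔓.unit) ∈ (out M N P).frame :=
  P.induction_mk fun r => ⟨Raw.out M N r, rfl, Frame.mk_self _ _⟩

theorem mem_frame_inp (M : 𝔓.Term) (x : Name) (P : Agent 𝔓) :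
    ([], 𝔓.unit) ∈ (inp M x P).frame :=
  P.induction_mk fun r => ⟨Raw.inp M x r, rfl, Frame.mk_self _ _⟩

theorem mem_frame_case (n : ℕ) (φ : Fin n → 𝔓.Cond) (P : Fin n → Agent 𝔓) :
    ([], 𝔓.unit) ∈ (case n φ P).frame := ⟨Raw.case n φ _, rfl, Frame.mk_self _ _⟩

theorem mem_frame_rep (P : Agent 𝔓) : ([], 𝔓.unit) ∈ (rep P).frame :=
  P.induction_mk fun r => ⟨Raw.rep r, rfl, Frame.mk_self _ _⟩

theorem Guarded.assnEq_unit {P : Agent 𝔓} (hP : P.Guarded) {b : List Name} {Ψ : 𝔓.Assn}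
    (h : (b, Ψ) ∈ P.frame) : AssnEq Ψ 𝔓.unit := by
  revert hP h
  refine P.induction_mk fun r hr h => ?_
  rw [frame_mk] at h
  exact Raw.Guarded.assnEq_unit hr h

/-- With binders fresh for `σ`, one representative of the frame of `P` is turned into one of the
frame of `Pσ` just by substituting. All other statements about frames of instances follow by
renaming. -/
theorem exists_mem_frame_subst (P : Agent 𝔓) : ∀ (σ : Subst 𝔓.Term) {X : Set Name}, X.Finite →
    ∃ b Ψ, (b, Ψ) ∈ P.frame ∧ (b, HasSubst.subst Ψ σ) ∈ (P.subst σ).frame ∧ b.Nodup ∧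
      ∀ a ∈ b, a ∉ X ∧ a ∉ σ.support := by
  have unit_case : ∀ {P : Agent 𝔓} {σ : Subst 𝔓.Term} {X : Set Name},
      ([], 𝔓.unit) ∈ P.frame → ([], 𝔓.unit) ∈ (P.subst σ).frame →
      ∃ b Ψ, (b, Ψ) ∈ P.frame ∧ (b, HasSubst.subst Ψ σ) ∈ (P.subst σ).frame ∧ b.Nodup ∧
        ∀ a ∈ b, a ∉ X ∧ a ∉ σ.support := fun h h' =>
    ⟨[], 𝔓.unit, h, by rwa [𝔓.subst_unit], List.nodup_nil, by simp⟩
  refine P.induction_mk fun r => ?_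
  induction r with
  | out M N P ih => exact fun σ X _ => unit_case ⟨_, rfl, Frame.mk_self _ _⟩ ⟨_, rfl, Frame.mk_self _ _⟩
  | inp M x P ih => exact fun σ X _ => unit_case ⟨_, rfl, Frame.mk_self _ _⟩ ⟨_, rfl, Frame.mk_self _ _⟩
  | case n φ P ih => exact fun σ X _ => unit_case ⟨_, rfl, Frame.mk_self _ _⟩ ⟨_, rfl, Frame.mk_self _ _⟩
  | rep P ih => exact fun σ X _ => unit_case ⟨_, rfl, Frame.mk_self _ _⟩ ⟨_, rfl, Frame.mk_self _ _⟩
  | ass Ψ =>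
    exact fun σ X _ => ⟨[], Ψ, ⟨_, rfl, Frame.mk_self _ _⟩, ⟨_, rfl, Frame.mk_self _ _⟩,
      List.nodup_nil, by simp⟩
  | res a P ih =>
    intro σ X hX
    -- The binder `z` must serve twice: it avoids the image of the body to be the binder of the
    -- instance, and avoids the body and `σ` to be the binder of the uninstantiated frame.
    obtain ⟨z, hz⟩ := (hX.union (P.fn_finite.union (σ.support_finite.union
      (σ.image_finite (P.fn_finite.subset (Set.sdiff_subset (t := {a}))))))).exists_notMem
    simp only [Set.mem_union, not_or] at hz
    obtain ⟨hzX, hzP, hzσ, hz⟩ := hz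
    obtain ⟨b, Ψ, h1, h2, h3, h4⟩ := ih (σ.update a (NameTerm.ofName z))
      (X := X ∪ (σ.support ∪ {a, z})) (hX.union (σ.support_finite.union (Set.toFinite _)))
    simp only [Set.mem_union, Set.mem_insert_iff, Set.mem_singleton_iff, not_or] at h4
    have hzb : z ∉ b := fun h => (h4 z h).1.2.2.2 rfl
    have hab : a ∉ b := fun h => (h4 a h).1.2.2.1 rfl
    have hzΨ : z ∉ supp Ψ := fun h => hzP (mem_fn_of_mem_frame h1 h hzb)
    have step := BindStep.mk [] b a z Ψ hzb hzΨ
    have e1 : b.map (Equiv.swap a z) = b := by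
      conv_rhs => rw [← List.map_id b]
      refine List.map_congr_left fun k hk => ?_
      exact Equiv.swap_apply_of_ne_of_ne (fun h : k = a => hab (h ▸ hk)) fun h : k = z => hzb (h ▸ hk)
    rw [e1] at step
    refine ⟨z :: b, Equiv.swap a z • Ψ,
      mem_frame_of_bindEq (mem_frame_res (P := Quotient.mk _ P) a h1) (.rel _ _ step), ?_,
      by simp [hzb, h3], ?_⟩
    · have h5 := mem_frame_res z h2
      have e2 := subst_res (P := Quotient.mk _ P) (a := a) (σ := σ) hz
      have e3 : HasSubst.subst (Equiv.swap a z • Ψ) σ = HasSubst.subst Ψ (σ.update a (NameTerm.ofName z)) := by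
        refine subst_smul fun n hn => ?_
        by_cases hna : n = a
        · subst hna
          rw [Subst.update_same, Equiv.swap_apply_left, Subst.eq_ofName_of_notMem_support hzσ]
        · rw [Subst.update_of_ne _ _ hna,
            Equiv.swap_apply_of_ne_of_ne hna fun h : n = z => hzΨ (h ▸ hn)]
      rw [e3]
      rw [← e2] at h5
      exact h5
    · intro k hk
      rcases List.mem_cons.1 hk with rfl | hk
      exacts [⟨hzX, hzσ⟩, ⟨(h4 k hk).1.1, (h4 k hk).1.2.1⟩]
  | par P Q ihP ihQ =>
    intro σ X hX
    obtain ⟨b₁, Ψ₁, h1, h2, h3, h4⟩ := ihP σ (hX.union (Q.fn_finite.union (Q.subst σ).fn_finite))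
    obtain ⟨b₂, Ψ₂, k1, k2, k3, k4⟩ := ihQ σ (hX.union ((supp_finite Ψ₁).union
      ((supp_finite (HasSubst.subst Ψ₁ σ)).union b₁.toFinset.finite_toSet)))
    simp only [Set.mem_union, List.coe_toFinset, Set.mem_ofPred_eq, not_or] at h4 k4
    have e1 : ∀ a ∈ b₁, a ∉ b₂ := fun a h h' => (k4 a h').1.2.2.2 h
    refine ⟨b₁ ++ b₂, 𝔓.comp Ψ₁ Ψ₂, mem_frame_par (P := Quotient.mk _ P) (Q := Quotient.mk _ Q)
      h1 k1 ?_ ?_, ?_, ?_, ?_⟩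
    · exact fun a ha => ⟨e1 a ha, fun h => (h4 a ha).1.2.1 (mem_fn_of_mem_frame k1 h (e1 a ha))⟩
    · exact fun a ha => ⟨(k4 a ha).1.2.2.2, (k4 a ha).1.2.1⟩
    · rw [𝔓.subst_comp]
      refine mem_frame_par (P := Quotient.mk _ (P.subst σ)) (Q := Quotient.mk _ (Q.subst σ)) h2 k2 ?_ ?_
      · exact fun a ha => ⟨e1 a ha, fun h => (h4 a ha).1.2.2 (mem_fn_of_mem_frame k2 h (e1 a ha))⟩
      · exact fun a ha => ⟨(k4 a ha).1.2.2.2, (k4 a ha).1.2.2.1⟩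
    · exact List.nodup_append.2 ⟨h3, k3, fun a ha b hb h => e1 a ha (h ▸ hb)⟩
    · intro a ha
      rcases List.mem_append.1 ha with ha | ha
      exacts [⟨(h4 a ha).1.1, (h4 a ha).2⟩, ⟨(k4 a ha).1.1, (k4 a ha).2⟩]

/-- Binders fresh for `σ` are not moved by it and do not occur in its terms, so substituting first
and instantiating the binders afterwards is the simultaneous substitution. -/
theorem subst_bind_of_notMem_support {X : Type u} [Nominal X] [HasSubst 𝔓.Term X]
    [LawfulSubst 𝔓.Term X] {x : X} {b d : List Name} {σ : Subst 𝔓.Term}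
    (hb : ∀ a ∈ b, a ∉ σ.support) :
    HasSubst.subst (HasSubst.subst x σ) ((Subst.id : Subst 𝔓.Term).bind b d) = HasSubst.subst x (σ.bind b d) := by
  refine subst_subst_eq fun n _ => ?_
  by_cases hn : n ∈ b
  · rw [Subst.eq_ofName_of_notMem_support (hb n hn), 𝔓.subst_ofName, Subst.bind_of_mem _ hn,
      Subst.bind_of_mem _ hn]
  · rw [Subst.bind_of_notMem _ hn]
    refine (SymPsi.subst_eq_self fun k hk => ?_).symm
    refine Subst.bind_of_notMem _ fun hkb => hn ?_
    rwa [Subst.eq_of_mem_supp (hb k hkb) hk]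

/-- Substitution in frames. -/
theorem mem_frame_subst {P : Agent 𝔓} {b d : List Name} {Ψ : 𝔓.Assn} {σ : Subst 𝔓.Term}
    (h : (b, Ψ) ∈ P.frame) (hl : d.length = b.length) (hd : d.Nodup)
    (hdP : ∀ m ∈ d, m ∉ σ.image P.fn) : (d, HasSubst.subst Ψ (σ.bind b d)) ∈ (P.subst σ).frame := by
  obtain ⟨e, Φ, h1, h2, h3, h4⟩ := P.exists_mem_frame_subst σ Set.finite_empty
  have h5 := bindEq_of_mem_frame h h1
  have h6 := h5.bind_eq (𝔓 := 𝔓) σ hl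
  change HasSubst.subst Ψ (σ.bind b d) = HasSubst.subst Φ (σ.bind e d) at h6
  rw [h6, ← subst_bind_of_notMem_support fun a ha => (h4 a ha).2]
  refine mem_frame_of_bindEq h2 (BindEq.rename (hl.trans h5.length_eq.symm) hd fun m hm hm' => ?_)
  rw [supp_subst] at hm'
  obtain ⟨n, hn, h7⟩ := Subst.mem_image.1 hm'
  by_cases hne : n ∈ e
  · rw [Subst.eq_ofName_of_notMem_support (h4 n hne).2, supp_ofName] at h7
    rw [h7]; exact hne
  · exact absurd (Subst.mem_image.2 ⟨n, mem_fn_of_mem_frame h1 hn hne, h7⟩) (hdP m hm)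

theorem mem_frame_subst_of_notMem_support {P : Agent 𝔓} {b : List Name} {Ψ : 𝔓.Assn}
    {σ : Subst 𝔓.Term} (h : (b, Ψ) ∈ P.frame) (hb : ∀ a ∈ b, a ∉ σ.support) :
    (b, HasSubst.subst Ψ σ) ∈ (P.subst σ).frame := by
  obtain ⟨d, d1, d2, d3⟩ := exists_fresh_list ((σ.image_finite P.fn_finite).union
    (supp_finite (HasSubst.subst Ψ σ))) b.length
  simp only [Set.mem_union, not_or] at d3
  have h1 := mem_frame_subst h d1 d2 fun m hm => (d3 m hm).1
  rw [← subst_bind_of_notMem_support hb] at h1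
  refine mem_frame_of_bindEq h1 (.symm _ _ (BindEq.rename d1 d2 fun m hm hm' => ?_))
  exact absurd hm' (d3 m hm).2

/-- Identifies the frames in the concrete static clause with those of the symbolic one. -/
theorem frame_subst (P : Agent 𝔓) (σ : Subst 𝔓.Term) : (P.subst σ).frame = P.frame.subst σ := by
  ext p
  constructor
  · intro hp
    obtain ⟨e, Φ, h1, h2, h3, h4⟩ := P.exists_mem_frame_subst σ Set.finite_empty
    exact ⟨e, Φ, h1, fun a ha => (h4 a ha).2, bindEq_of_mem_frame h2 hp⟩
  · rintro ⟨b, Ψ, h1, h2, h3⟩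
    exact mem_frame_of_bindEq (mem_frame_subst_of_notMem_support h1 h2) h3

/-- Every representation with fresh names of the frame of a substitution instance is a substitution
instance of one of the frame. -/
theorem exists_of_mem_frame_subst {P : Agent 𝔓} {b : List Name} {Φ : 𝔓.Assn} {σ : Subst 𝔓.Term}
    (h : (b, Φ) ∈ (P.subst σ).frame) (hd : b.Nodup) (hb : ∀ a ∈ b, a ∉ P.fn ∧ a ∉ σ.support) :
    ∃ Ψ, (b, Ψ) ∈ P.frame ∧ HasSubst.subst Ψ σ = Φ := by
  obtain ⟨e, Ψ, h1, h2, h3, h4⟩ := P.exists_mem_frame_subst σ Set.finite_empty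
  have h5 := bindEq_of_mem_frame h2 h
  have hl : b.length = e.length := h5.length_eq
  refine ⟨HasSubst.subst Ψ ((Subst.id : Subst 𝔓.Term).bind e b), mem_frame_of_bindEq h1
    (BindEq.rename hl hd fun m hm hm' => ?_), ?_⟩
  · by_contra hme
    exact (hb m hm).1 (mem_fn_of_mem_frame h1 hm' hme)
  · have h6 := h5.bind_eq (𝔓 := 𝔓) Subst.id (d := b) hl
    have e1 : HasSubst.subst Φ ((Subst.id : Subst 𝔓.Term).bind b b) = Φ := by
      refine SymPsi.subst_eq_self fun n _ => ?_
      by_cases hn : n ∈ b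
      · rw [Subst.bind_of_mem _ hn, listMap_self]
      · rw [Subst.bind_of_notMem _ hn, Subst.id_apply]
    change HasSubst.subst (HasSubst.subst Ψ σ) _ = HasSubst.subst Φ _ at h6
    rw [e1] at h6
    rw [← h6, subst_bind_of_notMem_support fun a ha => (h4 a ha).2]
    refine subst_subst_eq fun n _ => ?_
    by_cases hn : n ∈ e
    · rw [Subst.bind_of_mem _ hn, Subst.bind_of_mem _ hn, 𝔓.subst_ofName,
        Subst.eq_ofName_of_notMem_support (hb _ (listMap_mem hn hl)).2]
    · rw [Subst.bind_of_notMem _ hn, Subst.bind_of_notMem _ hn, Subst.id_apply, 𝔓.subst_ofName]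

/-- Substitution in a frame whose bound names are mapped injectively to fresh names. -/
theorem exists_mem_frame_subst_ren {P : Agent 𝔓} {b : List Name} {Ψ : 𝔓.Assn}
    {σ τ : Subst 𝔓.Term} {g : Name → Name} {X : Set Name} (hX : X.Finite) (h : (b, Ψ) ∈ P.frame)
    (h1 : ∀ n ∈ supp Ψ, n ∉ b → τ n = σ n) (h2 : ∀ n ∈ b, τ n = NameTerm.ofName (g n))
    (hg : Set.InjOn g {n | n ∈ b}) (h3 : ∀ n ∈ b, g n ∉ σ.image P.fn) :
    ∃ b', (b', HasSubst.subst Ψ τ) ∈ (P.subst σ).frame ∧ ∀ m ∈ b', (∃ n ∈ b, m = g n) ∨ m ∉ X := by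
  obtain ⟨d, d1, d2, d3⟩ := exists_fresh_list (hX.union ((σ.image_finite P.fn_finite).union
    (b.toFinset.finite_toSet.image g))) b.length
  simp only [Set.mem_union, not_or, Set.mem_image, List.coe_toFinset, Set.mem_ofPred_eq, not_exists,
    not_and] at d3
  have k1 := mem_frame_subst h d1 d2 fun m hm => (d3 m hm).2.1
  -- After instantiating the binders by fresh names `d`, a permutation moves these to the prescribed
  -- values of `g` without touching the names in the substituted free part.
  obtain ⟨l, l1, l2⟩ := exists_swaps_extending b.toFinset (listMap b d) g
    (by simpa using listMap_injOn d1 d2) (by simpa using hg)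
  simp only [List.mem_toFinset] at l1 l2
  have hfix : ∀ n ∈ supp Ψ, n ∉ b → ∀ k ∈ supp (σ n), swaps l k = k := by
    intro n hn hnb k hk
    have hk' : k ∈ σ.image P.fn := Subst.mem_image.2 ⟨n, mem_fn_of_mem_frame h hn hnb, hk⟩
    refine l2 k ?_ ?_
    · rintro m hm rfl; exact (d3 _ (listMap_mem hm d1)).2.1 hk'
    · rintro m hm rfl; exact h3 m hm hk'
  have e1 : swaps l • HasSubst.subst Ψ (σ.bind b d) = HasSubst.subst Ψ τ := by
    refine smul_subst_eq fun n hn => ?_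
    by_cases hnb : n ∈ b
    · rw [h2 n hnb, Subst.bind_of_mem _ hnb, NameTerm.smul_ofName, l1 n hnb]
    · rw [h1 n hn hnb, Subst.bind_of_notMem _ hnb, smul_eq_self (hfix n hn hnb)]
  refine ⟨d.map (swaps l), ?_, ?_⟩
  · rw [← e1]
    refine mem_frame_of_bindEq k1 (BindEq.smul_of_fixes 𝔓 fun k hk hkd => ?_)
    rw [supp_subst] at hk
    obtain ⟨n, hn, hk⟩ := Subst.mem_image.1 hk
    by_cases hnb : n ∈ b
    · rw [Subst.bind_of_mem _ hnb, supp_ofName] at hk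
      exact absurd (listMap_mem hnb d1) (hk ▸ hkd)
    · rw [Subst.bind_of_notMem _ hnb] at hk
      exact hfix n hn hnb k hk
  · intro m hm
    obtain ⟨k, hk, rfl⟩ := List.mem_map.1 hm
    by_cases hkb : ∃ n ∈ b, k = listMap b d n
    · obtain ⟨n, hn, rfl⟩ := hkb
      exact Or.inl ⟨n, hn, l1 n hn⟩
    -- A position of `d` whose binder in `b` is shadowed by a later repetition: its name stays
    -- fresh.
    · right
      rw [l2 k (fun n hn h => hkb ⟨n, hn, h⟩) fun n hn h => (d3 k hk).2.2 n hn h.symm]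
      exact (d3 k hk).1

end Agent

/-! ## Assertions up to static equivalence -/

/-- Static equivalence of assertions. -/
def assnSetoid (𝔓 : PsiCalculus.{u}) : Setoid 𝔓.Assn where
  r Ψ Ψ' := ∀ φ, 𝔓.entails Ψ φ ↔ 𝔓.entails Ψ' φ
  iseqv := ⟨fun _ _ => Iff.rfl, fun h φ => (h φ).symm, fun h h' φ => (h φ).trans (h' φ)⟩

/-- Assertions up to static equivalence. -/
def AssnClass (𝔓 : PsiCalculus.{u}) : Type u := Quotient (assnSetoid 𝔓)

/-- The class of an assertion. -/
def assnClass (Ψ : 𝔓.Assn) : AssnClass 𝔓 := Quotient.mk (assnSetoid 𝔓) Ψ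

theorem assnClass_eq {Ψ Ψ' : 𝔓.Assn} :
    assnClass Ψ = assnClass Ψ' ↔ ∀ φ, 𝔓.entails Ψ φ ↔ 𝔓.entails Ψ' φ := Quotient.eq

theorem entails_of_assnClass_eq {Ψ Ψ' : 𝔓.Assn} (h : assnClass Ψ = assnClass Ψ') {φ : 𝔓.Cond}
    (h' : 𝔓.entails Ψ φ) : 𝔓.entails Ψ' φ := (assnClass_eq.1 h φ).1 h'

/-- The requisites on composition say exactly that classes form a commutative monoid. The symbolic
and concrete rules compose the same assertions in different orders, and these differences are
settled by computing here. -/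
instance : CommMonoid (AssnClass 𝔓) where
  mul := Quotient.map₂ 𝔓.comp fun Ψ₁ Ψ₁' h₁ Ψ₂ Ψ₂' h₂ φ =>
    (𝔓.composition Ψ₁ Ψ₁' Ψ₂ h₁ φ).trans ((𝔓.commutativity _ _ φ).trans
      ((𝔓.composition Ψ₂ Ψ₂' Ψ₁' h₂ φ).trans (𝔓.commutativity _ _ φ)))
  one := assnClass 𝔓.unit
  mul_assoc a b c := Quotient.inductionOn₃ a b c fun Ψ Ψ' Ψ'' =>
    Quotient.sound (𝔓.associativity Ψ Ψ' Ψ'')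
  mul_comm a b := Quotient.inductionOn₂ a b fun Ψ Ψ' => Quotient.sound (𝔓.commutativity Ψ Ψ')
  one_mul a := Quotient.inductionOn a fun Ψ => Quotient.sound fun φ =>
    (𝔓.commutativity _ _ φ).trans (𝔓.identity Ψ φ)
  mul_one a := Quotient.inductionOn a fun Ψ => Quotient.sound (𝔓.identity Ψ)

theorem assnClass_comp (Ψ Ψ' : 𝔓.Assn) :
    assnClass (𝔓.comp Ψ Ψ') = assnClass Ψ * assnClass Ψ' := rfl

theorem assnClass_unit : assnClass 𝔓.unit = 1 := rfl

theorem AssnEq.assnClass_eq {Ψ Ψ' : 𝔓.Assn} (h : AssnEq Ψ Ψ') : assnClass Ψ = assnClass Ψ' := by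
  induction h with
  | refl => rfl
  | symm _ ih => exact ih.symm
  | trans _ _ ih1 ih2 => exact ih1.trans ih2
  | comp _ _ ih1 ih2 => rw [assnClass_comp, assnClass_comp, ih1, ih2]
  | ident Ψ => exact mul_one (assnClass Ψ)
  | assoc Ψ Ψ' Ψ'' => exact mul_assoc (assnClass Ψ) (assnClass Ψ') (assnClass Ψ'')
  | comm Ψ Ψ' => exact mul_comm (assnClass Ψ) (assnClass Ψ')

theorem AssnEq.subst (σ : Subst 𝔓.Term) {Ψ Ψ' : 𝔓.Assn} (h : AssnEq Ψ Ψ') :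
    AssnEq (subst Ψ σ) (subst Ψ' σ) := by
  induction h with
  | refl => exact .refl _
  | symm _ ih => exact .symm ih
  | trans _ _ ih1 ih2 => exact .trans ih1 ih2
  | comp _ _ ih1 ih2 => rw [𝔓.subst_comp, 𝔓.subst_comp]; exact .comp ih1 ih2
  | ident Ψ => rw [𝔓.subst_comp, 𝔓.subst_unit]; exact .ident _
  | assoc => simp only [𝔓.subst_comp]; exact .assoc _ _ _
  | comm => simp only [𝔓.subst_comp]; exact .comm _ _

theorem entails_weaken {Ψ Ψ' Φ : 𝔓.Assn} {φ : 𝔓.Cond} (h : 𝔓.entails (𝔓.comp Φ Ψ) φ) :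
    𝔓.entails (𝔓.comp Φ (𝔓.comp Ψ Ψ')) φ :=
  (𝔓.associativity _ _ _ φ).1 (𝔓.weakening _ Ψ' φ h)

/-! ## Solutions of constraints -/

/-- `τ` agrees on `V` with `σ`, except that it maps the names in `c` injectively (by `g`) to names
that are fresh for `Ψ` and for `σ`. -/
structure FreshInst (σ : Subst 𝔓.Term) (Ψ : 𝔓.Assn) (c : List Name) (V : Set Name)
    (τ : Subst 𝔓.Term) (g : Name → Name) : Prop where
  eq_of_notMem : ∀ n ∈ V, n ∉ c → τ n = σ n
  eq_of_mem : ∀ n ∈ V, n ∈ c → τ n = NameTerm.ofName (g n)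
  notMem_assn : ∀ n ∈ V, n ∈ c → g n ∉ supp Ψ
  notMem_subst : ∀ n ∈ V, n ∈ c → ∀ m ∈ V, m ∉ c → g n ∉ supp (σ m)
  injOn : Set.InjOn g {n | n ∈ V ∧ n ∈ c}

theorem FreshInst.bind_of_sdiff {σ : Subst 𝔓.Term} {Ψ : 𝔓.Assn} {c d : List Name} {V : Set Name}
    (hl : d.length = c.length) (hd : d.Nodup)
    (h : ∀ m ∈ d, m ∉ supp Ψ ∧ ∀ n ∈ V, n ∉ c → m ∉ supp (σ n)) :
    FreshInst σ Ψ c V (σ.bind c d) (listMap c d) where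
  eq_of_notMem _ _ hn := Subst.bind_of_notMem _ hn
  eq_of_mem _ _ hn := Subst.bind_of_mem _ hn
  notMem_assn _ _ hn := (h _ (listMap_mem hn hl)).1
  notMem_subst _ _ hn m hm hmc := (h _ (listMap_mem hn hl)).2 m hm hmc
  injOn := (listMap_injOn hl hd).mono fun _ hn => hn.2

theorem FreshInst.bind {σ : Subst 𝔓.Term} {Ψ : 𝔓.Assn} {c d : List Name} {V : Set Name}
    (hl : d.length = c.length) (hd : d.Nodup) (h : ∀ m ∈ d, m ∉ supp Ψ ∧ m ∉ σ.image V) :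
    FreshInst σ Ψ c V (σ.bind c d) (listMap c d) :=
  .bind_of_sdiff hl hd fun m hm =>
    ⟨(h m hm).1, fun n hn _ h' => (h m hm).2 (Subst.mem_image.2 ⟨n, hn, h'⟩)⟩

theorem FreshInst.refl {σ : Subst 𝔓.Term} {Ψ : 𝔓.Assn} {c : List Name} {V : Set Name}
    (h : ∀ a ∈ c, σ a = NameTerm.ofName a ∧ a ∉ supp Ψ ∧ ∀ m ∈ V, m ∉ c → a ∉ supp (σ m)) :
    FreshInst σ Ψ c V σ id where
  eq_of_notMem _ _ _ := rfl
  eq_of_mem n _ hn := (h n hn).1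
  notMem_assn n _ hn := (h n hn).2.1
  notMem_subst n _ hn m hm hmc := (h n hn).2.2 m hm hmc
  injOn := Set.injOn_id _

/-- Two fresh instances of the same binders differ by a permutation that exchanges the chosen names
and fixes `Ψ` and the terms substituted for free names; entailment is equivariant. -/
theorem entails_of_freshInst {σ τ₁ τ₂ : Subst 𝔓.Term} {Ψ Φ : 𝔓.Assn} {φ : 𝔓.Cond} {c : List Name}
    {V : Set Name} {g₁ g₂ : Name → Name} (hΦ : supp Φ ⊆ V) (hφ : supp φ ⊆ V)
    (h₁ : FreshInst σ Ψ c V τ₁ g₁) (h₂ : FreshInst σ Ψ c V τ₂ g₂)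
    (h : 𝔓.entails (𝔓.comp (subst Φ τ₁) Ψ) (subst φ τ₁)) :
    𝔓.entails (𝔓.comp (subst Φ τ₂) Ψ) (subst φ τ₂) := by
  classical
  have hmem : ∀ n, n ∈ c.toFinset.filter (· ∈ V) ↔ n ∈ V ∧ n ∈ c := fun n => by
    simp [and_comm]
  obtain ⟨l, l1, l2⟩ := exists_swaps_extending (c.toFinset.filter (· ∈ V)) g₁ g₂
    (by intro a ha b hb; exact h₁.injOn ((hmem a).1 ha) ((hmem b).1 hb))
    (by intro a ha b hb; exact h₂.injOn ((hmem a).1 ha) ((hmem b).1 hb))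
  simp only [hmem] at l1 l2
  have hτ : ∀ n ∈ V, τ₂ n = swaps l • τ₁ n := by
    intro n hn
    by_cases hc : n ∈ c
    · rw [h₁.eq_of_mem n hn hc, h₂.eq_of_mem n hn hc, NameTerm.smul_ofName, l1 n ⟨hn, hc⟩]
    · rw [h₁.eq_of_notMem n hn hc, h₂.eq_of_notMem n hn hc]
      refine (smul_eq_self fun k hk => l2 k ?_ ?_).symm
      · rintro m ⟨hm, hmc⟩ rfl
        exact h₁.notMem_subst m hm hmc n hn hc hk
      · rintro m ⟨hm, hmc⟩ rfl
        exact h₂.notMem_subst m hm hmc n hn hc hk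
  have hΨ : swaps l • Ψ = Ψ := smul_eq_self fun k hk => l2 k
    (by rintro m ⟨hm, hmc⟩ rfl; exact h₁.notMem_assn m hm hmc hk)
    (by rintro m ⟨hm, hmc⟩ rfl; exact h₂.notMem_assn m hm hmc hk)
  have := 𝔓.smul_entails (swaps l) _ _ h
  rwa [𝔓.smul_comp, hΨ, smul_subst_eq fun n hn => hτ n (hΦ hn),
    smul_subst_eq fun n hn => hτ n (hφ hn)] at this

namespace Atom

theorem mk_eq_mk {b b' : List Name} {Ψ Ψ' : 𝔓.Assn} {φ φ' : 𝔓.Cond} :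
    mk b Ψ φ = mk b' Ψ' φ' ↔ BindEq (b, (Ψ, φ)) (b', (Ψ', φ')) :=
  ⟨Quot.eqvGen_exact, Quot.eqvGen_sound⟩

theorem exists_eq_mk (A : Atom 𝔓) : ∃ b Ψ φ, A = mk b Ψ φ := by
  obtain ⟨⟨b, Ψ, φ⟩, rfl⟩ := Quot.exists_rep A
  exact ⟨b, Ψ, φ, rfl⟩

theorem new_mk (as b : List Name) (Ψ : 𝔓.Assn) (φ : 𝔓.Cond) :
    new as (mk b Ψ φ) = mk (as ++ b) Ψ φ := rfl

theorem mem_fn_mk {b : List Name} {Ψ : 𝔓.Assn} {φ : 𝔓.Cond} {a : Name} :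
    a ∈ (mk b Ψ φ).fn ↔ (a ∈ supp Ψ ∨ a ∈ supp φ) ∧ a ∉ b := by
  change a ∈ supp (Ψ, φ) ∧ a ∉ b ↔ _
  rw [supp_prod]; rfl

theorem mem_fn_new {as : List Name} {A : Atom 𝔓} {a : Name} :
    a ∈ (A.new as).fn ↔ a ∈ A.fn ∧ a ∉ as := by
  obtain ⟨b, Ψ, φ, rfl⟩ := A.exists_eq_mk
  rw [new_mk, mem_fn_mk, mem_fn_mk, List.mem_append]
  tauto

theorem fn_finite (A : Atom 𝔓) : A.fn.Finite := by
  obtain ⟨b, Ψ, φ, rfl⟩ := A.exists_eq_mk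
  exact ((supp_finite Ψ).union (supp_finite φ)).subset fun a ha => (mem_fn_mk.1 ha).1

/-- Satisfaction asks for some alpha-variant whose binders avoid the solution. This replaces it by
entailment at any chosen fresh instance of a given representative, the form used in all later
arguments. -/
theorem sat_mk_iff {σ τ : Subst 𝔓.Term} {Ψ Φ : 𝔓.Assn} {φ : 𝔓.Cond} {c : List Name}
    {V : Set Name} {g : Name → Name} (hV : V = supp Φ ∪ supp φ) (h : FreshInst σ Ψ c V τ g) :
    (mk c Φ φ).Sat σ Ψ ↔ 𝔓.entails (𝔓.comp (subst Φ τ) Ψ) (subst φ τ) := by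
  have hΦV : supp Φ ⊆ V := hV ▸ Set.subset_union_left
  have hφV : supp φ ⊆ V := hV ▸ Set.subset_union_right
  have hVfin : V.Finite := hV ▸ (supp_finite Φ).union (supp_finite φ)
  constructor
  · rintro ⟨b, Φ', φ', heq, hb, hent⟩
    have hbind := mk_eq_mk.1 heq
    have hl : b.length = c.length := hbind.length_eq
    obtain ⟨d, d1, d2, d3⟩ := exists_fresh_list ((supp_finite Ψ).union
      ((σ.image_finite hVfin).union (σ.image_finite ((supp_finite Φ').union (supp_finite φ')))))
      c.length
    simp only [Set.mem_union, not_or] at d3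
    -- Binders that are fresh for `σ` and `Ψ` are already their own fresh instance.
    have h1 : FreshInst σ Ψ b (supp Φ' ∪ supp φ') σ id := FreshInst.refl fun a ha =>
      ⟨Subst.eq_ofName_of_notMem_support (hb a ha).1, (hb a ha).2, fun m _ hmb hm =>
        hmb (Subst.eq_of_mem_supp (hb a ha).1 hm ▸ ha)⟩
    have h2 := entails_of_freshInst Set.subset_union_left Set.subset_union_right h1
      (FreshInst.bind (d1.trans hl.symm) d2 fun m hm => ⟨(d3 m hm).1, (d3 m hm).2.2⟩) hent
    have h3 := hbind.bind_eq (𝔓 := 𝔓) σ d1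
    have h4 : subst Φ (σ.bind c d) = subst Φ' (σ.bind b d) := congrArg Prod.fst h3
    have h5 : subst φ (σ.bind c d) = subst φ' (σ.bind b d) := congrArg Prod.snd h3
    rw [← h4, ← h5] at h2
    exact entails_of_freshInst hΦV hφV
      (FreshInst.bind d1 d2 fun m hm => ⟨(d3 m hm).1, (d3 m hm).2.1⟩) h h2
  · intro hent
    obtain ⟨d, d1, d2, d3⟩ := exists_fresh_list ((supp_finite Ψ).union
      ((σ.image_finite hVfin).union (σ.support_finite.union hVfin))) c.length
    simp only [Set.mem_union, not_or] at d3
    have h1 := entails_of_freshInst hΦV hφV h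
      (FreshInst.bind d1 d2 fun m hm => ⟨(d3 m hm).1, (d3 m hm).2.1⟩) hent
    have e1 : ∀ {X : Type u} [Nominal X] [HasSubst 𝔓.Term X] [LawfulSubst 𝔓.Term X] (x : X),
        subst (subst x ((Subst.id : Subst 𝔓.Term).bind c d)) σ = subst x (σ.bind c d) := by
      intro X _ _ _ x
      refine subst_subst_eq fun n _ => ?_
      by_cases hn : n ∈ c
      · rw [Subst.bind_of_mem _ hn, Subst.bind_of_mem _ hn, 𝔓.subst_ofName,
          Subst.eq_ofName_of_notMem_support (d3 _ (listMap_mem hn d1)).2.2.1]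
      · rw [Subst.bind_of_notMem _ hn, Subst.bind_of_notMem _ hn, Subst.id_apply, 𝔓.subst_ofName]
    refine ⟨d, subst Φ ((Subst.id : Subst 𝔓.Term).bind c d),
      subst φ ((Subst.id : Subst 𝔓.Term).bind c d), mk_eq_mk.2 ?_, fun a ha =>
        ⟨(d3 a ha).2.2.1, (d3 a ha).1⟩, by rwa [e1, e1]⟩
    refine BindEq.rename (𝔓 := 𝔓) (x := (Φ, φ)) d1 d2 fun m hm hm' => ?_
    rw [supp_prod, ← hV] at hm'
    exact absurd hm' (d3 m hm).2.2.2

/-- A binder in front of a constraint is removed by instantiating its names freshly. In the proof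
the fresh names for the outer binders are combined with new ones for the inner binders of the atom.
-/
theorem sat_new_iff {σ τ : Subst 𝔓.Term} {Ψ : 𝔓.Assn} {as : List Name} {A : Atom 𝔓}
    {g : Name → Name} (h : FreshInst σ Ψ as A.fn τ g) : (A.new as).Sat σ Ψ ↔ A.Sat τ Ψ := by
  obtain ⟨b, Φ, φ, rfl⟩ := A.exists_eq_mk
  have hVfin : (supp Φ ∪ supp φ).Finite := (supp_finite Φ).union (supp_finite φ)
  have hfn : ∀ {n}, n ∈ supp Φ ∪ supp φ → n ∉ b → n ∈ (mk b Φ φ).fn := fun h1 h2 =>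
    mem_fn_mk.2 ⟨h1, h2⟩
  obtain ⟨d, d1, d2, d3⟩ := exists_fresh_list ((supp_finite Ψ).union
      ((σ.image_finite hVfin).union (τ.image_finite hVfin))) b.length
  simp only [Set.mem_union, not_or] at d3
  rw [new_mk, sat_mk_iff (V := supp Φ ∪ supp φ) rfl (FreshInst.bind d1 d2 fun m hm =>
      ⟨(d3 m hm).1, (d3 m hm).2.2⟩),
    sat_mk_iff (V := supp Φ ∪ supp φ) (τ := τ.bind b d)
      (g := fun n => if n ∈ b then listMap b d n else g n) rfl]
  constructor
  · intro n hn hnc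
    simp only [List.mem_append, not_or] at hnc
    rw [Subst.bind_of_notMem _ hnc.2, h.eq_of_notMem n (hfn hn hnc.2) hnc.1]
  · intro n hn hnc
    by_cases hnb : n ∈ b
    · rw [Subst.bind_of_mem _ hnb, if_pos hnb]
    · have : n ∈ as := by simpa [hnb] using hnc
      rw [Subst.bind_of_notMem _ hnb, if_neg hnb, h.eq_of_mem n (hfn hn hnb) this]
  · intro n hn hnc
    by_cases hnb : n ∈ b
    · rw [if_pos hnb]; exact (d3 _ (listMap_mem hnb d1)).1
    · have : n ∈ as := by simpa [hnb] using hnc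
      rw [if_neg hnb]; exact h.notMem_assn n (hfn hn hnb) this
  · intro n hn hnc m hm hmc
    simp only [List.mem_append, not_or] at hmc
    by_cases hnb : n ∈ b
    · rw [if_pos hnb]
      exact fun h' => (d3 _ (listMap_mem hnb d1)).2.1 (Subst.mem_image.2 ⟨m, hm, h'⟩)
    · have : n ∈ as := by simpa [hnb] using hnc
      rw [if_neg hnb]; exact h.notMem_subst n (hfn hn hnb) this m (hfn hm hmc.2) hmc.1
  · have aux : ∀ n m, n ∈ supp Φ ∪ supp φ → n ∈ as → n ∉ b → m ∈ b → g n ≠ listMap b d m := by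
      intro n m hn hnc hnb hmb he
      refine (d3 _ (listMap_mem hmb d1)).2.2 (Subst.mem_image.2 ⟨n, hn, ?_⟩)
      rw [h.eq_of_mem n (hfn hn hnb) hnc, supp_ofName, he]
      exact rfl
    rintro n ⟨hn, hnc⟩ m ⟨hm, hmc⟩ he
    rw [List.mem_append] at hnc hmc
    by_cases hnb : n ∈ b <;> by_cases hmb : m ∈ b <;>
      simp only [hnb, hmb, if_true, if_false] at he
    · exact listMap_injOn d1 d2 hnb hmb he
    · exact absurd he.symm (aux m n hm (hmc.resolve_right hmb) hmb hnb)
    · exact absurd he (aux n m hn (hnc.resolve_right hnb) hnb hmb)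
    · exact h.injOn ⟨hfn hn hnb, hnc.resolve_right hnb⟩ ⟨hfn hm hmb, hmc.resolve_right hmb⟩ he

theorem new_nil (A : Atom 𝔓) : A.new [] = A := by
  obtain ⟨b, Φ, φ, rfl⟩ := A.exists_eq_mk; rfl

/-- The case of no binders: whether (σ, Ψ) is a solution depends only on `σ` at the free names. This
allows `σ` to be changed at fresh subjects and bound names. -/
theorem sat_congr {σ τ : Subst 𝔓.Term} {Ψ : 𝔓.Assn} {A : Atom 𝔓} (h : ∀ n ∈ A.fn, τ n = σ n) :
    A.Sat σ Ψ ↔ A.Sat τ Ψ := by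
  have := sat_new_iff (σ := σ) (τ := τ) (Ψ := Ψ) (as := []) (A := A) (g := id)
    ⟨fun n hn _ => h n hn, by simp, by simp, by simp, Set.injOn_id _⟩
  rwa [new_nil] at this

theorem sat_mk_nil {σ : Subst 𝔓.Term} {Ψ Φ : 𝔓.Assn} {φ : 𝔓.Cond} :
    (mk [] Φ φ).Sat σ Ψ ↔ 𝔓.entails (𝔓.comp (subst Φ σ) Ψ) (subst φ σ) :=
  sat_mk_iff rfl (FreshInst.refl (by simp))

/-- The same instance is tested on both sides, with its names fresh also for the larger assertion;
the entailment is then weakened. -/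
theorem Sat.weaken {σ : Subst 𝔓.Term} {Ψ : 𝔓.Assn} {A : Atom 𝔓} (h : A.Sat σ Ψ) (Ψ' : 𝔓.Assn) :
    A.Sat σ (𝔓.comp Ψ Ψ') := by
  obtain ⟨b, Φ, φ, rfl⟩ := A.exists_eq_mk
  obtain ⟨d, d1, d2, d3⟩ := exists_fresh_list ((supp_finite Ψ).union
      ((supp_finite (𝔓.comp Ψ Ψ')).union
        (σ.image_finite ((supp_finite Φ).union (supp_finite φ))))) b.length
  simp only [Set.mem_union, not_or] at d3
  rw [sat_mk_iff (V := supp Φ ∪ supp φ) rfl (FreshInst.bind d1 d2 fun m hm =>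
      ⟨(d3 m hm).1, (d3 m hm).2.2⟩)] at h
  rw [sat_mk_iff (V := supp Φ ∪ supp φ) rfl (FreshInst.bind d1 d2 fun m hm =>
      ⟨(d3 m hm).2.1, (d3 m hm).2.2⟩)]
  exact entails_weaken h

end Atom

namespace BasicConstraint

theorem fn_finite (B : BasicConstraint 𝔓) : B.fn.Finite := by
  cases B with
  | atom A => exact A.fn_finite
  | eq M N => exact (supp_finite M).union (supp_finite N)
  | fresh a X x => exact (Set.finite_singleton a).union (supp_finite x)
  | freshAgent a P => exact (Set.finite_singleton a).union P.fn_finite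

theorem sat_congr {σ τ : Subst 𝔓.Term} {Ψ : 𝔓.Assn} {B : BasicConstraint 𝔓}
    (h : ∀ n ∈ B.fn, τ n = σ n) : B.Sat σ Ψ ↔ B.Sat τ Ψ := by
  cases B with
  | atom A => exact Atom.sat_congr h
  | eq M N =>
    simp only [Sat]
    rw [subst_congr_supp fun n hn => h n (Or.inl hn), subst_congr_supp (x := N) fun n hn => h n (Or.inr hn)]
  | fresh a X x =>
    simp only [Sat]
    rw [subst_congr_supp (x := x) (σ := τ) (τ := σ) fun n hn => h n (Or.inr hn)]
  | freshAgent a P =>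
    simp only [Sat]
    rw [Agent.subst_congr (P := P) (σ := τ) (τ := σ) fun n hn => h n (Or.inr hn)]

theorem Sat.weaken {σ : Subst 𝔓.Term} {Ψ : 𝔓.Assn} {B : BasicConstraint 𝔓} (h : B.Sat σ Ψ)
    (Ψ' : 𝔓.Assn) : B.Sat σ (𝔓.comp Ψ Ψ') := by
  cases B with
  | atom A => exact Atom.Sat.weaken h Ψ'
  | _ => exact h

end BasicConstraint

namespace Constraint

theorem fn_finite (C : Constraint 𝔓) : C.fn.Finite := by
  have : C.fn = ⋃ B ∈ {B | B ∈ C}, B.fn := by ext; simp [fn]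
  rw [this]
  refine Set.Finite.biUnion ?_ fun B _ => B.fn_finite
  classical
  exact C.finite_toSet

theorem sat_congr {σ τ : Subst 𝔓.Term} {Ψ : 𝔓.Assn} {C : Constraint 𝔓}
    (h : ∀ n ∈ C.fn, τ n = σ n) : C.Sat σ Ψ ↔ C.Sat τ Ψ :=
  forall₂_congr fun B hB => BasicConstraint.sat_congr fun n hn => h n ⟨B, hB, hn⟩

theorem Sat.weaken {σ : Subst 𝔓.Term} {Ψ : 𝔓.Assn} {C : Constraint 𝔓} (h : C.Sat σ Ψ)
    (Ψ' : 𝔓.Assn) : C.Sat σ (𝔓.comp Ψ Ψ') := fun B hB => (h B hB).weaken Ψ'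

theorem sat_append {σ : Subst 𝔓.Term} {Ψ : 𝔓.Assn} {C D : Constraint 𝔓} :
    Sat σ Ψ (C ++ D) ↔ Sat σ Ψ C ∧ Sat σ Ψ D := by
  simp only [Sat, List.mem_append]
  exact ⟨fun h => ⟨fun B hB => h B (Or.inl hB), fun B hB => h B (Or.inr hB)⟩,
    fun h B hB => hB.elim (h.1 B) (h.2 B)⟩

end Constraint

/-- `(σ, Ψ)` solves the transition constraint `C`. -/
def TransConstraint.Sat (σ : Subst 𝔓.Term) (Ψ : 𝔓.Assn) (C : TransConstraint 𝔓) : Prop :=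
  ∀ A ∈ C, A.Sat σ Ψ

theorem Constraint.sat_ofTrans {σ : Subst 𝔓.Term} {Ψ : 𝔓.Assn} {C : TransConstraint 𝔓} :
    Constraint.Sat σ Ψ (Constraint.ofTrans C) ↔ C.Sat σ Ψ := by
  simp [Constraint.Sat, Constraint.ofTrans, TransConstraint.Sat, BasicConstraint.Sat]

theorem Constraint.mem_fn_ofTrans {C : TransConstraint 𝔓} {a : Name} :
    a ∈ (Constraint.ofTrans C).fn ↔ ∃ A ∈ C, a ∈ A.fn := by
  simp [Constraint.fn, Constraint.ofTrans, BasicConstraint.fn]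

namespace TransConstraint

theorem sat_cons {σ : Subst 𝔓.Term} {Ψ : 𝔓.Assn} {A : Atom 𝔓} {C : TransConstraint 𝔓} :
    TransConstraint.Sat σ Ψ (A :: C) ↔ A.Sat σ Ψ ∧ TransConstraint.Sat σ Ψ C := by
  simp [TransConstraint.Sat]

theorem sat_append {σ : Subst 𝔓.Term} {Ψ : 𝔓.Assn} {C D : TransConstraint 𝔓} :
    TransConstraint.Sat σ Ψ (C ++ D) ↔ TransConstraint.Sat σ Ψ C ∧ TransConstraint.Sat σ Ψ D := by
  simp only [TransConstraint.Sat, List.mem_append]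
  exact ⟨fun h => ⟨fun B hB => h B (Or.inl hB), fun B hB => h B (Or.inr hB)⟩,
    fun h B hB => hB.elim (h.1 B) (h.2 B)⟩

theorem sat_new_iff {σ τ : Subst 𝔓.Term} {Ψ : 𝔓.Assn} {as : List Name} {C : TransConstraint 𝔓}
    {g : Name → Name} (h : ∀ A ∈ C, FreshInst σ Ψ as A.fn τ g) :
    TransConstraint.Sat σ Ψ (C.new as) ↔ C.Sat τ Ψ := by
  simp only [TransConstraint.Sat, TransConstraint.new, List.forall_mem_map]
  exact forall₂_congr fun A hA => Atom.sat_new_iff (h A hA)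

end TransConstraint

/-! ## Names in transitions -/

/-- The list of binding names. -/
def Action.bnList {S T : Type*} : Action S T → List Name
  | .out _ as _ => as
  | .inp _ x => [x]
  | .tau => []

/-- The names of the object of an output. -/
def Action.objNames {S : Type*} {T : Type u} [Nominal T] : Action S T → Set Name
  | .out _ _ N => supp N
  | _ => ∅

theorem Action.mem_bn {S T : Type*} {α : Action S T} {a : Name} : a ∈ α.bn ↔ a ∈ α.bnList := by
  cases α <;> simp [bn, bnList]

theorem Action.mem_symNames {α : Action Name 𝔓.Term} {a : Name} :
    a ∈ α.symNames ↔ a ∈ α.symSubj ∨ a ∈ α.bnList ∨ a ∈ α.objNames := by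
  cases α <;> simp [symNames, symSubj, bnList, objNames, or_assoc]

/-- With `O` the names of an object or a derivative and `S` those of the source agent, this keeps
the invariant of the next two theorems under renaming of a bound name of the action. -/
theorem mem_of_swap_mem {S O : Set Name} {as : List Name} {a c n : Name}
    (hO : ∀ n ∈ O, n ∈ S ∨ n ∈ as) (ha : a ∈ as) (hc : c ∉ O) (hn : Equiv.swap a c n ∈ O) :
    n ∈ S ∨ n ∈ as.map (Equiv.swap a c) := by
  rw [mem_map_swap]
  by_cases hnc : n = c
  · subst hnc; right; simpa using ha
  by_cases hna : n = a
  · subst hna; rw [Equiv.swap_apply_left] at hn; exact absurd hn hc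
  rw [Equiv.swap_apply_of_ne_of_ne hna hnc] at hn ⊢
  exact hO n hn

theorem Agent.mem_fn_subst1 {P : Agent 𝔓} {N : 𝔓.Term} {x n : Name} (h : n ∈ (P.subst1 N x).fn) :
    n ∈ supp N ∨ n ∈ P.fn ∧ n ≠ x := by
  rw [subst1, fn_subst] at h
  obtain ⟨m, hm, h⟩ := Subst.mem_image.1 h
  by_cases hmx : m = x
  · subst hmx; rw [Subst.single_same] at h; exact Or.inl h
  · rw [Subst.single_of_ne _ hmx, supp_ofName] at h
    obtain rfl : n = m := h
    exact Or.inr ⟨hm, hmx⟩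

theorem Agent.mem_fn_com {P Q P' Q' : Agent 𝔓} {as : List Name} {N : 𝔓.Term} {x n : Name}
    (hP : ∀ n ∈ P'.fn, n ∈ P.fn ∨ n ∈ as) (hN : ∀ n ∈ supp N, n ∈ P.fn ∨ n ∈ as)
    (hQ : ∀ n ∈ Q'.fn, n ∈ Q.fn ∨ n ∈ [x]) (h : n ∈ P'.fn ∨ n ∈ (Q'.subst1 N x).fn)
    (has : n ∉ as) : n ∈ P.fn ∨ n ∈ Q.fn := by
  rcases h with h | h
  · exact Or.inl ((hP n h).resolve_right has)
  · rcases mem_fn_subst1 h with h | ⟨h, hx⟩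
    · exact Or.inl ((hN n h).resolve_right has)
    · exact Or.inr ((hQ n h).resolve_right (by simpa using hx))

theorem nodup_insert {as₁ as₂ : List Name} {b : Name} (h : (as₁ ++ as₂).Nodup)
    (hb : b ∉ as₁ ++ as₂) : (as₁ ++ b :: as₂).Nodup :=
  List.nodup_middle.2 (List.nodup_cons.2 ⟨hb, h⟩)

/-- Names enter the derivative and the object only from the agent or through the bound names of the
action, so freshness for the agent controls what substitutions and permutations do to a derivative.
-/
theorem Trans.names {Ψ : 𝔓.Assn} {P P' : Agent 𝔓} {α : Action 𝔓.Term 𝔓.Term}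
    (h : Trans Ψ P α P') : (∀ n ∈ P'.fn, n ∈ P.fn ∨ n ∈ α.bnList) ∧
      (∀ n ∈ α.objNames, n ∈ P.fn ∨ n ∈ α.bnList) ∧ α.bnList.Nodup := by
  induction h with
  | inp Ψ M K x P _ =>
    refine ⟨fun n hn => ?_, by simp [Action.objNames], by simp [Action.bnList]⟩
    by_cases hnx : n = x
    · simp [Action.bnList, hnx]
    · left; rw [Agent.fn_inp]; exact Or.inr ⟨hn, hnx⟩
  | out Ψ M K N P _ =>
    refine ⟨fun n hn => Or.inl ?_, fun n hn => Or.inl ?_, by simp [Action.bnList]⟩ <;>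
      rw [Agent.fn_out]
    exacts [Or.inr hn, Or.inl (Or.inr hn)]
  | case Ψ n φ P i _ _ ih =>
    have : (P i).fn ⊆ (Agent.case n φ P).fn := fun m hm => by
      rw [Agent.fn_case]; exact Set.mem_iUnion.2 ⟨i, Or.inr hm⟩
    exact ⟨fun m hm => (ih.1 m hm).imp_left (this ·), fun m hm => (ih.2.1 m hm).imp_left (this ·),
      ih.2.2⟩
  | comL Ψ P Q _ _ _ _ _ _ _ _ ih1 ih2 =>
    refine ⟨fun n hn => Or.inl ?_, by simp [Action.objNames], by simp [Action.bnList]⟩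
    rw [Agent.fn_resList, Agent.fn_par] at hn
    rw [Agent.fn_par]
    exact Agent.mem_fn_com ih1.1 ih1.2.1 ih2.1 hn.1 hn.2
  | comR Ψ P Q _ _ _ _ _ _ _ _ ih1 ih2 =>
    refine ⟨fun n hn => Or.inl ?_, by simp [Action.objNames], by simp [Action.bnList]⟩
    rw [Agent.fn_resList, Agent.fn_par] at hn
    rw [Agent.fn_par]
    exact (Agent.mem_fn_com ih2.1 ih2.2.1 ih1.1 hn.1.symm hn.2).symm
  | parL Ψ P Q _ _ _ _ ih =>
    simp only [Agent.fn_par]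
    refine ⟨fun n hn => ?_, fun n hn => (ih.2.1 n hn).imp_left Or.inl, ih.2.2⟩
    exact hn.elim (fun h => (ih.1 n h).imp_left Or.inl) fun h => Or.inl (Or.inr h)
  | parR Ψ P Q _ _ _ _ ih =>
    simp only [Agent.fn_par]
    refine ⟨fun n hn => ?_, fun n hn => (ih.2.1 n hn).imp_left Or.inr, ih.2.2⟩
    exact hn.elim (fun h => Or.inl (Or.inl h)) fun h => (ih.1 n h).imp_left Or.inr
  | @scope Ψ b P α P' _ hb _ ih =>
    simp only [Agent.fn_res]
    refine ⟨fun n hn => (ih.1 n hn.1).imp_left fun h => ⟨h, hn.2⟩, fun n hn => ?_, ih.2.2⟩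
    refine (ih.2.1 n hn).imp_left fun h => ⟨h, ?_⟩
    rintro rfl
    cases α <;> simp_all [Action.objNames, Action.names]
  | opn Ψ b P _ hb _ _ _ ih =>
    simp only [Agent.fn_res, Action.bnList, Action.objNames, List.mem_append, List.mem_cons] at ih ⊢
    refine ⟨fun n hn => ?_, fun n hn => ?_, nodup_insert ih.2.2 hb⟩
    · by_cases hnb : n = b
      · simp [hnb]
      · have := ih.1 n hn; simp only [Set.mem_sdiff, Set.mem_singleton_iff]; tauto
    · by_cases hnb : n = b
      · simp [hnb]
      · have := ih.2.1 n hn; simp only [Set.mem_sdiff, Set.mem_singleton_iff]; tauto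
  | rep Ψ P _ ih =>
    simpa only [Agent.fn_par, Agent.fn_rep, Set.union_self] using ih
  | alphaOut a c _ ha _ hcN hcP ih =>
    refine ⟨fun n hn => mem_of_swap_mem ih.1 ha hcP (by simpa [Agent.mem_fn_perm] using hn),
      fun n hn => mem_of_swap_mem ih.2.1 ha hcN ?_, ih.2.2.map (Equiv.injective _)⟩
    have : n ∈ supp (Equiv.swap a c • _) := hn
    rwa [mem_supp_smul_iff, Equiv.swap_inv] at this
  | @alphaInp Ψ P M x P' c _ hcP ih =>
    refine ⟨fun n hn => ?_, by simp [Action.objNames], by simp [Action.bnList]⟩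
    have := mem_of_swap_mem (a := x) ih.1 (by simp [Action.bnList]) hcP
      (by simpa [Agent.mem_fn_perm] using hn)
    simpa [Action.bnList] using this

theorem SymTrans.names {Ψ : 𝔓.Assn} {P P' : Agent 𝔓} {α : Action Name 𝔓.Term}
    {C : TransConstraint 𝔓} (h : SymTrans Ψ P α C P') :
    (∀ n ∈ P'.fn, n ∈ P.fn ∨ n ∈ α.bnList) ∧
      (∀ n ∈ α.objNames, n ∈ P.fn ∨ n ∈ α.bnList) ∧ α.bnList.Nodup := by
  induction h with
  | inp Ψ M x P y =>
    refine ⟨fun n hn => ?_, by simp [Action.objNames], by simp [Action.bnList]⟩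
    by_cases hnx : n = x
    · simp [Action.bnList, hnx]
    · left; rw [Agent.fn_inp]; exact Or.inr ⟨hn, hnx⟩
  | out Ψ M N P y =>
    refine ⟨fun n hn => Or.inl ?_, fun n hn => Or.inl ?_, by simp [Action.bnList]⟩ <;>
      rw [Agent.fn_out]
    exacts [Or.inr hn, Or.inl (Or.inr hn)]
  | case Ψ n φ P i _ ih =>
    have : (P i).fn ⊆ (Agent.case n φ P).fn := fun m hm => by
      rw [Agent.fn_case]; exact Set.mem_iUnion.2 ⟨i, Or.inr hm⟩
    exact ⟨fun m hm => (ih.1 m hm).imp_left (this ·), fun m hm => (ih.2.1 m hm).imp_left (this ·),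
      ih.2.2⟩
  | comL Ψ P Q _ _ _ _ _ _ _ _ _ _ ih1 ih2 =>
    refine ⟨fun n hn => Or.inl ?_, by simp [Action.objNames], by simp [Action.bnList]⟩
    rw [Agent.fn_resList, Agent.fn_par] at hn
    rw [Agent.fn_par]
    exact Agent.mem_fn_com ih1.1 ih1.2.1 ih2.1 hn.1 hn.2
  | comR Ψ P Q _ _ _ _ _ _ _ _ _ _ ih1 ih2 =>
    refine ⟨fun n hn => Or.inl ?_, by simp [Action.objNames], by simp [Action.bnList]⟩
    rw [Agent.fn_resList, Agent.fn_par] at hn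
    rw [Agent.fn_par]
    exact (Agent.mem_fn_com ih2.1 ih2.2.1 ih1.1 hn.1.symm hn.2).symm
  | parL Ψ P Q _ _ _ _ _ ih =>
    simp only [Agent.fn_par]
    refine ⟨fun n hn => ?_, fun n hn => (ih.2.1 n hn).imp_left Or.inl, ih.2.2⟩
    exact hn.elim (fun h => (ih.1 n h).imp_left Or.inl) fun h => Or.inl (Or.inr h)
  | parR Ψ P Q _ _ _ _ _ ih =>
    simp only [Agent.fn_par]
    refine ⟨fun n hn => ?_, fun n hn => (ih.2.1 n hn).imp_left Or.inr, ih.2.2⟩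
    exact hn.elim (fun h => Or.inl (Or.inl h)) fun h => (ih.1 n h).imp_left Or.inr
  | @scope Ψ b P α C P' _ hb _ ih =>
    simp only [Agent.fn_res]
    refine ⟨fun n hn => (ih.1 n hn.1).imp_left fun h => ⟨h, hn.2⟩, fun n hn => ?_, ih.2.2⟩
    refine (ih.2.1 n hn).imp_left fun h => ⟨h, ?_⟩
    rintro rfl
    exact hb (Action.mem_symNames.2 (Or.inr (Or.inr hn)))
  | opn Ψ b P _ _ hb _ _ ih =>
    simp only [Agent.fn_res, Action.bnList, Action.objNames, List.mem_append, List.mem_cons] at ih ⊢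
    refine ⟨fun n hn => ?_, fun n hn => ?_, nodup_insert ih.2.2 hb⟩
    · by_cases hnb : n = b
      · simp [hnb]
      · have := ih.1 n hn; simp only [Set.mem_sdiff, Set.mem_singleton_iff]; tauto
    · by_cases hnb : n = b
      · simp [hnb]
      · have := ih.2.1 n hn; simp only [Set.mem_sdiff, Set.mem_singleton_iff]; tauto
  | rep Ψ P _ ih =>
    simpa only [Agent.fn_par, Agent.fn_rep, Set.union_self] using ih
  | alphaOut a c _ ha _ hcN hcP ih =>
    refine ⟨fun n hn => mem_of_swap_mem ih.1 ha hcP (by simpa [Agent.mem_fn_perm] using hn),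
      fun n hn => mem_of_swap_mem ih.2.1 ha hcN ?_, ih.2.2.map (Equiv.injective _)⟩
    have : n ∈ supp (Equiv.swap a c • _) := hn
    rwa [mem_supp_smul_iff, Equiv.swap_inv] at this
  | @alphaInp Ψ P M x C P' c _ hcP ih =>
    refine ⟨fun n hn => ?_, by simp [Action.objNames], by simp [Action.bnList]⟩
    have := mem_of_swap_mem (a := x) ih.1 (by simp [Action.bnList]) hcP
      (by simpa [Agent.mem_fn_perm] using hn)
    simpa [Action.bnList] using this

theorem TransConstraint.fn_finite (C : TransConstraint 𝔓) : {n | ∃ A ∈ C, n ∈ A.fn}.Finite :=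
  (Constraint.ofTrans C).fn_finite.subset fun _ hn => Constraint.mem_fn_ofTrans.2 hn

/-- The names in the constraint of an input or output; the subject occurs only in its first
conjunct. -/
theorem SymTrans.fn_constraint {Ψ : 𝔓.Assn} {P P' : Agent 𝔓} {α : Action Name 𝔓.Term}
    {C : TransConstraint 𝔓} (h : SymTrans Ψ P α C P') {y : Name} (hy : y ∈ α.symSubj) :
    ∃ A C₀, C = A :: C₀ ∧ (∀ n ∈ A.fn, n = y ∨ n ∈ supp Ψ ∨ n ∈ P.fn) ∧
      ∀ B ∈ C₀, ∀ n ∈ B.fn, n ∈ supp Ψ ∨ n ∈ P.fn := by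
  have head : ∀ {Ψ : 𝔓.Assn} {M : 𝔓.Term} {n : Name},
      n ∈ (chanAtom [] Ψ M (NameTerm.ofName y)).fn → n = y ∨ n ∈ supp Ψ ∨ n ∈ supp M := by
    intro Ψ M n hn
    rcases (Atom.mem_fn_mk.1 hn).1 with h | h
    · exact Or.inr (Or.inl h)
    · rcases supp_chanEq_subset _ _ h with h | h
      · exact Or.inr (Or.inr h)
      · rw [supp_ofName] at h; exact Or.inl h
  -- The premise's environment contains the assertion of the frame of `Q`; its names are either
  -- names of `Q` or bound by the new binder of the constraint.
  have par : ∀ {Ψ ΨQ : 𝔓.Assn} {P Q : Agent 𝔓} {bQ : List Name} {C : TransConstraint 𝔓},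
      (bQ, ΨQ) ∈ Q.frame →
      (∃ A C₀, C = A :: C₀ ∧ (∀ n ∈ A.fn, n = y ∨ n ∈ supp (𝔓.comp Ψ ΨQ) ∨ n ∈ P.fn) ∧
        ∀ B ∈ C₀, ∀ n ∈ B.fn, n ∈ supp (𝔓.comp Ψ ΨQ) ∨ n ∈ P.fn) →
      ∃ A C₀, C.new bQ = A :: C₀ ∧ (∀ n ∈ A.fn, n = y ∨ n ∈ supp Ψ ∨ n ∈ P.fn ∨ n ∈ Q.fn) ∧
        ∀ B ∈ C₀, ∀ n ∈ B.fn, n ∈ supp Ψ ∨ n ∈ P.fn ∨ n ∈ Q.fn := by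
    rintro Ψ ΨQ P Q bQ _ hQ ⟨A, C₀, rfl, h1, h2⟩
    have key : ∀ n, n ∈ supp (𝔓.comp Ψ ΨQ) ∨ n ∈ P.fn → n ∉ bQ →
        n ∈ supp Ψ ∨ n ∈ P.fn ∨ n ∈ Q.fn := by
      rintro n (hn | hn) hb
      · exact (supp_comp_subset _ _ hn).imp_right fun h =>
          Or.inr (Agent.mem_fn_of_mem_frame hQ h hb)
      · exact Or.inr (Or.inl hn)
    refine ⟨A.new bQ, C₀.map (Atom.new bQ), rfl, fun n hn => ?_, ?_⟩
    · obtain ⟨hn, hb⟩ := Atom.mem_fn_new.1 hn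
      exact (h1 n hn).imp_right fun h => key n h hb
    · simp only [List.forall_mem_map]
      intro B hB n hn
      obtain ⟨hn, hb⟩ := Atom.mem_fn_new.1 hn
      exact key n (h2 B hB n hn) hb
  have res : ∀ {Ψ : 𝔓.Assn} {P : Agent 𝔓} {a : Name} {C : TransConstraint 𝔓},
      (∃ A C₀, C = A :: C₀ ∧ (∀ n ∈ A.fn, n = y ∨ n ∈ supp Ψ ∨ n ∈ P.fn) ∧
        ∀ B ∈ C₀, ∀ n ∈ B.fn, n ∈ supp Ψ ∨ n ∈ P.fn) →
      ∃ A C₀, C.new [a] = A :: C₀ ∧ (∀ n ∈ A.fn, n = y ∨ n ∈ supp Ψ ∨ n ∈ (Agent.res a P).fn) ∧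
        ∀ B ∈ C₀, ∀ n ∈ B.fn, n ∈ supp Ψ ∨ n ∈ (Agent.res a P).fn := by
    rintro Ψ P a _ ⟨A, C₀, rfl, h1, h2⟩
    have hr : ∀ {n}, n ∈ P.fn → n ∉ [a] → n ∈ (Agent.res a P).fn := fun h h' => by
      rw [Agent.fn_res]; exact ⟨h, by simpa using h'⟩
    refine ⟨A.new [a], C₀.map (Atom.new [a]), rfl, fun n hn => ?_, ?_⟩
    · obtain ⟨hn, hb⟩ := Atom.mem_fn_new.1 hn
      exact (h1 n hn).imp_right fun h => h.imp_right (hr · hb)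
    · simp only [List.forall_mem_map]
      intro B hB n hn
      obtain ⟨hn, hb⟩ := Atom.mem_fn_new.1 hn
      exact (h2 B hB n hn).imp_right (hr · hb)
  induction h with
  | inp Ψ M x P z =>
    obtain rfl : y = z := hy
    refine ⟨_, [], rfl, fun n hn => (head hn).imp_right fun h => h.imp_right fun h => ?_, by simp⟩
    rw [Agent.fn_inp]; exact Or.inl h
  | out Ψ M N P z =>
    obtain rfl : y = z := hy
    refine ⟨_, [], rfl, fun n hn => (head hn).imp_right fun h => h.imp_right fun h => ?_, by simp⟩
    rw [Agent.fn_out]; exact Or.inl (Or.inl h)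
  | case Ψ n φ P i _ ih =>
    obtain ⟨A, C₀, rfl, h1, h2⟩ := ih hy
    have hi : ∀ {m}, m ∈ supp (φ i) ∨ m ∈ (P i).fn → m ∈ (Agent.case n φ P).fn := fun h => by
      rw [Agent.fn_case]; exact Set.mem_iUnion.2 ⟨i, h⟩
    refine ⟨A, C₀ ++ [Atom.mk [] Ψ (φ i)], rfl, fun m hm => (h1 m hm).imp_right fun h =>
      h.imp_right fun h => hi (Or.inr h), fun B hB m hm => ?_⟩
    rcases List.mem_append.1 hB with hB | hB
    · exact (h2 B hB m hm).imp_right fun h => hi (Or.inr h)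
    · obtain rfl := List.mem_singleton.1 hB
      exact (Atom.mem_fn_mk.1 hm).1.imp_right fun h => hi (Or.inl h)
  | comL | comR => exact absurd hy (by simp [Action.symSubj])
  | parL Ψ P Q hQ _ _ _ _ ih =>
    obtain ⟨A, C₀, h0, h1, h2⟩ := par hQ (ih hy)
    refine ⟨A, C₀, h0, ?_, ?_⟩ <;> simpa only [Agent.fn_par]
  | parR Ψ P Q hP _ _ _ _ ih =>
    obtain ⟨A, C₀, h0, h1, h2⟩ := par hP (ih hy)
    refine ⟨A, C₀, h0, ?_, ?_⟩ <;> simpa only [Agent.fn_par, Set.mem_union, or_comm (a := _ ∈ P.fn)]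
  | scope Ψ a P _ _ _ ih => exact res (ih hy)
  | opn Ψ a P _ _ _ _ _ ih => exact res (ih hy)
  | rep Ψ P _ ih => simpa only [Agent.fn_par, Agent.fn_rep, Set.union_self] using ih hy
  | alphaOut a c _ _ _ _ _ ih => exact ih hy
  | alphaInp c _ _ ih => exact ih hy

/-! ## The subject conjunct of a transition constraint -/

/-- `A` is an atomic constraint `(νc̃)⟦Ψ₁ ⊢ M ↔ y⟧`, where `Ψ₁` consists of `Ψ` and the assertion
`ΨP` in a frame `(νb̃)ΨP` of `P` with `b̃ ⊆ c̃`. -/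
structure SubjAtom (Ψ : 𝔓.Assn) (P : Agent 𝔓) (y : Name) (A : Atom 𝔓) (c b : List Name)
    (ΨP Ψ₁ : 𝔓.Assn) (M : 𝔓.Term) : Prop where
  eq : A = chanAtom c Ψ₁ M (NameTerm.ofName y)
  mem_frame : (b, ΨP) ∈ P.frame
  subset : ∀ n ∈ b, n ∈ c
  notMem : y ∉ supp M
  mem_of_mem_term : ∀ n ∈ supp M, n ∈ P.fn ∨ n ∈ c
  mem_of_mem_assn : ∀ n ∈ supp Ψ₁, n ∈ supp Ψ ∨ n ∈ P.fn ∨ n ∈ c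
  assnEq : AssnEq Ψ₁ (𝔓.comp Ψ ΨP)

/-- The frame and the constraint share binders, so they must be renamed by the same permutation; it
has to fix what is free in each. -/
theorem SubjAtom.rename_perm {Ψ : 𝔓.Assn} {P : Agent 𝔓} {y : Name} {A : Atom 𝔓} {c b : List Name}
    {ΨP Ψ₁ : 𝔓.Assn} {M : 𝔓.Term} (h : SubjAtom Ψ P y A c b ΨP Ψ₁ M) {π : Equiv.Perm Name}
    (hΨ : ∀ n ∈ supp Ψ, π n = n) (hy : π y = y) (hΨP : ∀ n ∈ supp ΨP, n ∉ b → π n = n)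
    (hP : ∀ n ∈ P.fn, n ∉ c → π n = n) :
    SubjAtom Ψ P y A (c.map π) (b.map π) (π • ΨP) (π • Ψ₁) (π • M) where
  eq := by
    rw [h.eq]
    have := BindEq.smul_of_fixes 𝔓 (b := c)
      (x := (Ψ₁, 𝔓.chanEq M (NameTerm.ofName y))) (π := π) fun n hn hc => ?_
    · refine Atom.mk_eq_mk.2 ?_
      change BindEq _ (_, (π • Ψ₁, π • 𝔓.chanEq M (NameTerm.ofName y))) at this
      rwa [𝔓.smul_chanEq, NameTerm.smul_ofName, hy] at this
    · rw [supp_prod] at hn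
      rcases hn with hn | hn
      · rcases h.mem_of_mem_assn n hn with h' | h' | h'
        exacts [hΨ n h', hP n h' hc, absurd h' hc]
      · rcases supp_chanEq_subset _ _ hn with h' | h'
        · exact (h.mem_of_mem_term n h').elim (fun h' => hP n h' hc) fun h' => absurd h' hc
        · rw [supp_ofName] at h'
          obtain rfl : n = y := h'
          exact hy
  mem_frame := Agent.mem_frame_of_bindEq h.mem_frame (BindEq.smul_of_fixes 𝔓 hΨP)
  subset n hn := by
    rw [mem_map_perm] at hn ⊢
    exact h.subset _ hn
  notMem := by
    rw [mem_supp_smul_iff, show π⁻¹ y = y by rw [Equiv.Perm.inv_eq_iff_eq, hy]]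
    exact h.notMem
  mem_of_mem_term n hn := by
    rw [mem_supp_smul_iff] at hn
    rw [mem_map_perm]
    by_cases hc : π⁻¹ n ∈ c
    · exact Or.inr hc
    · have h1 := (h.mem_of_mem_term _ hn).resolve_right hc
      have h2 := hP _ h1 hc
      rw [show π (π⁻¹ n) = n by simp] at h2
      exact Or.inl (h2 ▸ h1)
  mem_of_mem_assn n hn := by
    rw [mem_supp_smul_iff] at hn
    rw [mem_map_perm]
    by_cases hc : π⁻¹ n ∈ c
    · exact Or.inr (Or.inr hc)
    · rcases h.mem_of_mem_assn _ hn with h1 | h1 | h1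
      · have h2 := hΨ _ h1
        rw [show π (π⁻¹ n) = n by simp] at h2
        exact Or.inl (h2 ▸ h1)
      · have h2 := hP _ h1 hc
        rw [show π (π⁻¹ n) = n by simp] at h2
        exact Or.inr (Or.inl (h2 ▸ h1))
      · exact absurd h1 hc
  assnEq := by
    have := h.assnEq.smul π
    rwa [𝔓.smul_comp, smul_eq_self hΨ] at this

/-- The condition on `c` says that its names are not free in the environment, the subject or the
frame, which therefore remain fixed when `c` is moved away from `X`. -/
theorem SubjAtom.exists_avoiding {Ψ : 𝔓.Assn} {P : Agent 𝔓} {y : Name} {A : Atom 𝔓}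
    {c b : List Name} {ΨP Ψ₁ : 𝔓.Assn} {M : 𝔓.Term} (h : SubjAtom Ψ P y A c b ΨP Ψ₁ M)
    (hc : ∀ n ∈ c, n ∉ supp Ψ ∧ n ≠ y ∧ (n ∈ supp ΨP → n ∈ b)) {X : Set Name} (hX : X.Finite) :
    ∃ c b ΨP Ψ₁ M, SubjAtom Ψ P y A c b ΨP Ψ₁ M ∧ ∀ n ∈ c, n ∉ X := by
  obtain ⟨π, h1, h2⟩ := exists_perm_avoiding (B := {n | n ∈ c})
    c.finite_toSet
    (hX.union ((supp_finite Ψ).union (P.fn_finite.union (Set.finite_singleton y))))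
  simp only [Set.mem_union, not_or, Set.mem_ofPred_eq, Set.mem_singleton_iff] at h1 h2
  refine ⟨_, _, _, _, _, h.rename_perm (π := π) (fun n hn => h2 n (fun h' => (hc n h').1 hn)
    (by simp [hn])) (h2 y (fun h' => (hc y h').2.1 rfl) (by simp)) (fun n hn hb => ?_)
    (fun n hn hb => h2 n hb (by simp [hn])), fun n hn => ?_⟩
  · exact h2 n (fun h' => hb ((hc n h').2.2 hn))
      (by simp [Agent.mem_fn_of_mem_frame h.mem_frame hn hb])
  · obtain ⟨m, hm, rfl⟩ := List.mem_map.1 hn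
    exact (h1 m hm).1.1

/-- Restrictions and parallel components add the same binders to the frame and to the constraint, so
both stay in step. Quantifying over `X` lets each rule ask its premise for binders fresh for the
names about to be added, and `SubjAtom.exists_avoiding` restores this freedom afterwards. -/
theorem SymTrans.exists_subjAtom {Ψ : 𝔓.Assn} {P P' : Agent 𝔓} {α : Action Name 𝔓.Term}
    {C : TransConstraint 𝔓} (h : SymTrans Ψ P α C P') (hP : P.WF) {y : Name}
    (hy : y ∈ α.symSubj) : ∀ X : Set Name, X.Finite →
    ∃ A C₀ c b ΨP Ψ₁ M, C = A :: C₀ ∧ SubjAtom Ψ P y A c b ΨP Ψ₁ M ∧ ∀ n ∈ c, n ∉ X := by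
  have res : ∀ {Ψ : 𝔓.Assn} {P : Agent 𝔓} {a : Name} {C : TransConstraint 𝔓},
      (∀ X : Set Name, X.Finite →
        ∃ A C₀ c b ΨP Ψ₁ M, C = A :: C₀ ∧ SubjAtom Ψ P y A c b ΨP Ψ₁ M ∧ ∀ n ∈ c, n ∉ X) →
      a ∉ supp Ψ → a ≠ y → ∀ X : Set Name, X.Finite →
        ∃ A C₀ c b ΨP Ψ₁ M, C.new [a] = A :: C₀ ∧ SubjAtom Ψ (Agent.res a P) y A c b ΨP Ψ₁ M ∧
          ∀ n ∈ c, n ∉ X := by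
    intro Ψ P a C ih h1 h2 X hX
    obtain ⟨A, C₀, c, b, ΨP, Ψ₁, M, rfl, h3, h4⟩ := ih _
      ((supp_finite Ψ).union (P.fn_finite.union (Set.finite_singleton y)))
    simp only [Set.mem_union, not_or, Set.mem_singleton_iff] at h4
    have h5 : SubjAtom Ψ (Agent.res a P) y (A.new [a]) (a :: c) (a :: b) ΨP Ψ₁ M := by
      have hr : ∀ n, n ∈ P.fn ∨ n ∈ c → n ∈ (Agent.res a P).fn ∨ n ∈ a :: c := by
        intro n hn
        rw [Agent.fn_res, List.mem_cons, Set.mem_sdiff, Set.mem_singleton_iff]; tauto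
      exact ⟨by rw [h3.eq]; rfl, Agent.mem_frame_res a h3.mem_frame, fun n hn => by
        rw [List.mem_cons] at hn ⊢; exact hn.imp_right (h3.subset n), h3.notMem,
        fun n hn => hr n (h3.mem_of_mem_term n hn),
        fun n hn => (h3.mem_of_mem_assn n hn).imp_right (hr n), h3.assnEq⟩
    have hc : ∀ n ∈ a :: c, n ∉ supp Ψ ∧ n ≠ y ∧ (n ∈ supp ΨP → n ∈ a :: b) := by
      intro n hn
      rcases List.mem_cons.1 hn with rfl | hn
      · exact ⟨h1, h2, fun _ => List.mem_cons_self⟩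
      · refine ⟨(h4 n hn).1, (h4 n hn).2.2, fun h' => ?_⟩
        by_contra hb
        exact (h4 n hn).2.1 (Agent.mem_fn_of_mem_frame h3.mem_frame h'
          fun h'' => hb (List.mem_cons_of_mem _ h''))
    obtain ⟨c', b', ΨP', Ψ₁', M', h6, h7⟩ := h5.exists_avoiding hc hX
    exact ⟨_, _, c', b', ΨP', Ψ₁', M', rfl, h6, h7⟩
  have par : ∀ {Ψ ΨQ : 𝔓.Assn} {P Q R : Agent 𝔓} {bQ : List Name} {C : TransConstraint 𝔓},
      (∀ X : Set Name, X.Finite → ∃ A C₀ c b ΨP Ψ₁ M, C = A :: C₀ ∧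
        SubjAtom (𝔓.comp Ψ ΨQ) P y A c b ΨP Ψ₁ M ∧ ∀ n ∈ c, n ∉ X) →
      (bQ, ΨQ) ∈ Q.frame → (∀ n ∈ bQ, n ∉ supp Ψ ∧ n ∉ P.fn ∧ n ≠ y) →
      (∀ {b ΨP}, (b, ΨP) ∈ P.frame → (∀ a ∈ b, a ∉ bQ ∧ a ∉ supp ΨQ) →
        (∀ a ∈ bQ, a ∉ b ∧ a ∉ supp ΨP) →
        ∃ b' Φ, (b', Φ) ∈ R.frame ∧ (∀ n, n ∈ b' ↔ n ∈ b ∨ n ∈ bQ) ∧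
          supp Φ ⊆ supp ΨP ∪ supp ΨQ ∧ AssnEq Φ (𝔓.comp ΨQ ΨP)) →
      (R.fn = P.fn ∪ Q.fn) → ∀ X : Set Name, X.Finite →
        ∃ A C₀ c b ΨP Ψ₁ M, C.new bQ = A :: C₀ ∧ SubjAtom Ψ R y A c b ΨP Ψ₁ M ∧
          ∀ n ∈ c, n ∉ X := by
    intro Ψ ΨQ P Q R bQ C ih hQ hbQ hR hfn X hX
    obtain ⟨A, C₀, c, b, ΨP, Ψ₁, M, rfl, h3, h4⟩ := ih _
      ((supp_finite Ψ).union (P.fn_finite.union ((Set.finite_singleton y).union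
        (Q.fn_finite.union ((supp_finite ΨQ).union (bQ.toFinset.finite_toSet))))))
    simp only [Set.mem_union, not_or, Set.mem_singleton_iff, List.coe_toFinset,
      Set.mem_ofPred_eq] at h4
    have hΨP : ∀ n ∈ bQ, n ∉ b ∧ n ∉ supp ΨP := by
      intro n hn
      have hb : n ∉ b := fun h' => (h4 n (h3.subset n h')).2.2.2.2.2 hn
      exact ⟨hb, fun h' => (hbQ n hn).2.1 (Agent.mem_fn_of_mem_frame h3.mem_frame h' hb)⟩
    obtain ⟨b', Φ, k1, k2, k3, k4⟩ := hR h3.mem_frame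
      (fun a ha => ⟨(h4 a (h3.subset a ha)).2.2.2.2.2, (h4 a (h3.subset a ha)).2.2.2.2.1⟩) hΨP
    have h5 : SubjAtom Ψ R y (A.new bQ) (bQ ++ c) b' Φ Ψ₁ M := by
      refine ⟨by rw [h3.eq]; rfl, k1, fun n hn => ?_, h3.notMem, fun n hn => ?_, fun n hn => ?_, ?_⟩
      · rw [List.mem_append]
        exact ((k2 n).1 hn).elim (fun h' => Or.inr (h3.subset n h')) Or.inl
      · rw [hfn, List.mem_append, Set.mem_union]
        have := h3.mem_of_mem_term n hn; tauto
      · rw [hfn, List.mem_append, Set.mem_union]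
        rcases h3.mem_of_mem_assn n hn with h' | h' | h'
        · rcases supp_comp_subset _ _ h' with h' | h'
          · exact Or.inl h'
          · by_cases hb : n ∈ bQ
            · tauto
            · have := Agent.mem_fn_of_mem_frame hQ h' hb; tauto
        · tauto
        · tauto
      · exact h3.assnEq.trans ((AssnEq.assoc _ _ _).trans (.comp (.refl _) k4.symm))
    have hc : ∀ n ∈ bQ ++ c, n ∉ supp Ψ ∧ n ≠ y ∧ (n ∈ supp Φ → n ∈ b') := by
      intro n hn
      rcases List.mem_append.1 hn with hn | hn
      · exact ⟨(hbQ n hn).1, (hbQ n hn).2.2, fun _ => (k2 n).2 (Or.inr hn)⟩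
      · refine ⟨(h4 n hn).1, (h4 n hn).2.2.1, fun h' => (k2 n).2 (Or.inl ?_)⟩
        by_contra hb
        rcases k3 h' with h' | h'
        · exact (h4 n hn).2.1 (Agent.mem_fn_of_mem_frame h3.mem_frame h' hb)
        · exact (h4 n hn).2.2.2.2.1 h'
    obtain ⟨c', b'', ΨP', Ψ₁', M', h6, h7⟩ := h5.exists_avoiding hc hX
    exact ⟨_, _, c', b'', ΨP', Ψ₁', M', rfl, h6, h7⟩
  induction h with
  | inp Ψ M x P z _ hM =>
    obtain rfl : y = z := hy
    exact fun _ _ => ⟨_, [], [], [], 𝔓.unit, Ψ, M, rfl, ⟨rfl, Agent.mem_frame_inp _ _ _, by simp, hM,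
      fun n hn => by rw [Agent.fn_inp]; exact Or.inl (Or.inl hn), fun n hn => Or.inl hn,
      .symm (.ident _)⟩, by simp⟩
  | out Ψ M N P z _ hM =>
    obtain rfl : y = z := hy
    exact fun _ _ => ⟨_, [], [], [], 𝔓.unit, Ψ, M, rfl, ⟨rfl, Agent.mem_frame_out _ _ _, by simp, hM,
      fun n hn => by rw [Agent.fn_out]; exact Or.inl (Or.inl (Or.inl hn)), fun n hn => Or.inl hn,
      .symm (.ident _)⟩, by simp⟩
  | case Ψ n φ P i _ ih =>
    intro X hX
    have hi := Agent.wf_case.1 hP i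
    obtain ⟨A, C₀, c, b, ΨP, Ψ₁, M, rfl, h3, h4⟩ := ih hi.1 hy X hX
    have hfn : ∀ {m}, m ∈ (P i).fn → m ∈ (Agent.case n φ P).fn := fun h => by
      rw [Agent.fn_case]; exact Set.mem_iUnion.2 ⟨i, Or.inr h⟩
    -- The frame of the case agent forgets that of the branch. This is sound because a branch is
    -- guarded, so the assertion of its frame is the unit up to the monoid laws.
    exact ⟨A, C₀ ++ [Atom.mk [] Ψ (φ i)], c, [], 𝔓.unit, Ψ₁, M, rfl, ⟨h3.eq,
      Agent.mem_frame_case _ _ _, by simp, h3.notMem,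
      fun m hm => (h3.mem_of_mem_term m hm).imp_left hfn,
      fun m hm => (h3.mem_of_mem_assn m hm).imp_right fun h => h.imp_left hfn,
      h3.assnEq.trans (.comp (.refl _) (hi.2.assnEq_unit h3.mem_frame))⟩, h4⟩
  | comL | comR => exact absurd hy (by simp [Action.symSubj])
  | parL Ψ P Q hQ hbQ _ _ _ ih =>
    refine par (ih (Agent.wf_par.1 hP).1 hy) hQ (fun n hn => ⟨(hbQ n hn).1, (hbQ n hn).2.1, ?_⟩)
      (fun {b ΨP} k1 k2 k3 => ⟨b ++ _, _, Agent.mem_frame_par k1 hQ k2 k3, by simp,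
        supp_comp_subset _ _, .comm _ _⟩) (Agent.fn_par _ _)
    rintro rfl
    exact (hbQ n hn).2.2 (Action.mem_symNames.2 (Or.inl hy))
  | parR Ψ P Q hQ hbQ _ _ _ ih =>
    refine par (ih (Agent.wf_par.1 hP).2 hy) hQ (fun n hn => ⟨(hbQ n hn).1, (hbQ n hn).2.1, ?_⟩)
      (fun {b ΨP} k1 k2 k3 => ⟨_ ++ b, _, Agent.mem_frame_par hQ k1 k3 k2, by simp [or_comm],
        (supp_comp_subset _ _).trans (Set.union_comm _ _).subset, .refl _⟩)
      ((Agent.fn_par _ _).trans (Set.union_comm _ _))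
    rintro rfl
    exact (hbQ n hn).2.2 (Action.mem_symNames.2 (Or.inl hy))
  | scope Ψ a P _ ha haΨ ih =>
    exact res (ih (Agent.wf_res.1 hP) hy) haΨ fun h => ha (h ▸ Action.mem_symNames.2 (Or.inl hy))
  | opn Ψ a P _ _ _ haΨ hay ih =>
    exact res (ih (Agent.wf_res.1 hP) hy) haΨ fun h => hay (h.trans hy)
  | rep Ψ P _ ih =>
    intro X hX
    obtain ⟨hP1, hP2⟩ := Agent.wf_rep.1 hP
    obtain ⟨A, C₀, c, b, ΨP, Ψ₁, M, rfl, h3, h4⟩ := ih (Agent.wf_par.2 ⟨hP1, hP⟩) hy X hX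
    have hfn : (P.par P.rep).fn = P.rep.fn := by
      rw [Agent.fn_par, Agent.fn_rep, Set.union_self]
    -- As for case: the unfolded agent is guarded, so its frame can be replaced by the trivial one
    -- of the replication.
    have h5 := (Agent.guarded_par_rep.2 hP2).assnEq_unit h3.mem_frame
    exact ⟨A, C₀, c, [], 𝔓.unit, Ψ₁, M, rfl, ⟨h3.eq, Agent.mem_frame_rep _, by simp, h3.notMem,
      fun m hm => hfn ▸ h3.mem_of_mem_term m hm, fun m hm => hfn ▸ h3.mem_of_mem_assn m hm,
      h3.assnEq.trans (.comp (.refl _) h5)⟩, h4⟩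
  | alphaOut a c _ _ _ _ _ ih => exact ih hP hy
  | alphaInp c _ _ ih => exact ih hP hy

/-- The subject conjunct, for a given frame with fresh bound names. -/
theorem SymTrans.exists_subjAtom_of_mem_frame {Ψ : 𝔓.Assn} {P P' : Agent 𝔓}
    {α : Action Name 𝔓.Term} {C : TransConstraint 𝔓} (h : SymTrans Ψ P α C P') (hP : P.WF)
    {y : Name} (hy : y ∈ α.symSubj) {bP : List Name} {ΨP : 𝔓.Assn} (hf : (bP, ΨP) ∈ P.frame)
    (hd : bP.Nodup) (hb : ∀ n ∈ bP, n ∉ supp Ψ ∧ n ∉ P.fn ∧ n ≠ y) {X : Set Name}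
    (hX : X.Finite) : ∃ A C₀ c b Ψ₁ M, C = A :: C₀ ∧ SubjAtom Ψ P y A c b ΨP Ψ₁ M ∧
      ∀ n ∈ c, n ∈ bP ∨ n ∉ X := by
  obtain ⟨A, C₀, c, b, Φ, Ψ₁, M, rfl, h1, h2⟩ := h.exists_subjAtom hP hy _
    (hX.union ((supp_finite Ψ).union (P.fn_finite.union ((Set.finite_singleton y).union
      bP.toFinset.finite_toSet))))
  simp only [Set.mem_union, not_or, Set.mem_singleton_iff, List.coe_toFinset,
    Set.mem_ofPred_eq] at h2
  have h3 := Agent.bindEq_of_mem_frame h1.mem_frame hf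
  have hl : bP.length = b.length := h3.length_eq
  obtain ⟨π, h4, h5⟩ := exists_perm_listMap hl hd
  have fixes : ∀ n, n ∉ bP → (n ∈ supp Ψ ∨ n = y ∨ n ∈ P.fn) → π n = n := by
    intro n hn h'
    refine h5 n (fun hb => ?_) hn
    have := h2 n (h1.subset n hb)
    tauto
  have hfP : ∀ n ∈ P.fn, π n = n := fun n hn =>
    fixes n (fun h' => (hb n h').2.1 hn) (by simp [hn])
  have hfΦ : ∀ n ∈ supp Φ, n ∉ b → π n = n := fun n hn hnb =>
    hfP n (Agent.mem_fn_of_mem_frame h1.mem_frame hn hnb)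
  -- Both are the instance at `bP` of one alpha-class, and distinctness of `bP` makes the positional
  -- renaming the permutation `π`.
  have h6 : π • Φ = ΨP := by
    have := h3.bind_eq (𝔓 := 𝔓) Subst.id hl
    change HasSubst.subst Φ (Subst.id.bind b bP) = HasSubst.subst ΨP (Subst.id.bind bP bP) at this
    rw [subst_eq_self (x := ΨP)] at this
    · rw [← this]
      refine smul_eq_subst fun n hn => ?_
      by_cases hnb : n ∈ b
      · rw [Subst.bind_of_mem _ hnb, h4 n hnb]
      · rw [Subst.bind_of_notMem _ hnb, hfΦ n hn hnb, Subst.id_apply]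
    · intro n _
      by_cases hnb : n ∈ bP
      · rw [Subst.bind_of_mem _ hnb, listMap_self]
      · rw [Subst.bind_of_notMem _ hnb, Subst.id_apply]
  have h7 := h1.rename_perm (π := π)
    (fun n hn => fixes n (fun h' => (hb n h').1 hn) (by simp [hn]))
    (fixes y (fun h' => (hb y h').2.2 rfl) (by simp)) hfΦ fun n hn _ => hfP n hn
  rw [h6] at h7
  refine ⟨A, C₀, _, _, _, _, rfl, h7, fun n hn => ?_⟩
  obtain ⟨m, hm, rfl⟩ := List.mem_map.1 hn
  by_cases hmb : m ∈ b
  · rw [h4 m hmb]; exact Or.inl (listMap_mem hmb hl)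
  · rw [h5 m hmb (h2 m hm).2.2.2.2]; exact Or.inr (h2 m hm).1

/-! ## Instances of symbolic actions -/

namespace Subst

variable {T : Type u} [NameTerm T]

theorem bind_singleton (σ : Subst T) (a b : Name) :
    σ.bind [a] [b] = σ.update a (NameTerm.ofName b) := by
  ext n
  by_cases h : n = a
  · subst h
    exact (bind_of_mem σ (by simp)).trans ((by simp [listMap] : _ = _).trans
      (update_same σ n _).symm)
  · exact (bind_of_notMem σ (by simpa using h)).trans (update_of_ne σ _ h).symm

theorem bind_congr {σ τ : Subst T} {c e : List Name} {n : Name} (h : n ∉ c → σ n = τ n) :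
    σ.bind c e n = τ.bind c e n := by
  by_cases hn : n ∈ c
  · rw [bind_of_mem _ hn, bind_of_mem _ hn]
  · rw [bind_of_notMem _ hn, bind_of_notMem _ hn, h hn]

theorem bind_update (σ : Subst T) {c e : List Name} {a : Name} (M : T) (ha : a ∉ c) (n : Name) :
    (σ.update a M).bind c e n = (σ.bind c e).update a M n := by
  by_cases hna : n = a
  · subst hna; rw [bind_of_notMem _ ha, update_same, update_same]
  · rw [update_of_ne _ _ hna]
    exact bind_congr fun _ => update_of_ne _ _ hna

/-- For the opening rule: listing the extruded name among the bound names has the same effect as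
updating the substitution at it beforehand. -/
theorem bind_insert (σ : Subst T) {c₁ c₂ e₁ e₂ : List Name} {a b : Name}
    (hl : e₁.length = c₁.length) (ha : a ∉ c₁ ++ c₂) (n : Name) :
    σ.bind (c₁ ++ a :: c₂) (e₁ ++ b :: e₂) n =
      (σ.update a (NameTerm.ofName b)).bind (c₁ ++ c₂) (e₁ ++ e₂) n := by
  by_cases hna : n = a
  · subst hna
    rw [bind_of_mem _ (by simp), bind_of_notMem _ ha, update_same,
      listMap_append_right _ _ hl (by simp)]
    simp only [List.mem_append, not_or] at ha
    simp [listMap, ha.2]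
  by_cases hn : n ∈ c₁ ++ c₂
  · rw [bind_of_mem _ hn, bind_of_mem _ (by simp at hn ⊢; tauto)]
    congr 1
    by_cases h2 : n ∈ c₂
    · rw [listMap_append_right _ _ hl h2, listMap_append_right _ _ hl (by simp [h2])]
      simp [listMap, h2]
    · rw [listMap_append_left _ _ hl h2, listMap_append_left _ _ hl (by simp [h2, hna])]
  · rw [bind_of_notMem _ hn, bind_of_notMem _ (by simp at hn ⊢; tauto), update_of_ne _ _ hna]

/-- Renaming a bound name of a symbolic action leaves its instances unchanged, as they depend only
on positions. -/
theorem bind_map_swap (σ : Subst T) {c e : List Name} {a b n : Name} (ha : a ∈ c) (hn : n ≠ b)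
    (hl : e.length = c.length) :
    σ.bind c e n = σ.bind (c.map (Equiv.swap a b)) e (Equiv.swap a b n) := by
  by_cases hnc : n ∈ c
  · rw [bind_of_mem _ hnc, bind_of_mem _ (List.mem_map_of_mem hnc),
      listMap_map_left _ _ (Equiv.injective _) hnc hl]
  · have hna : n ≠ a := fun h => hnc (h ▸ ha)
    rw [bind_of_notMem _ hnc, bind_of_notMem, Equiv.swap_apply_of_ne_of_ne hna hn]
    simpa [mem_map_swap] using hnc

end Subst

/-- The instance of a symbolic action by a substitution, with the names `e` for the binding names. -/
def Action.inst (α : Action Name 𝔓.Term) (σ : Subst 𝔓.Term) (e : List Name) :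
    Action 𝔓.Term 𝔓.Term :=
  match α with
  | .out y as N => .out (σ y) e (subst N (σ.bind as e))
  | .inp y x => .inp (σ y) (listMap [x] e x)
  | .tau => .tau

theorem Action.bnList_inst {α : Action Name 𝔓.Term} {σ : Subst 𝔓.Term} {e : List Name}
    (he : e.length = α.bnList.length) : (α.inst σ e).bnList = e := by
  cases α with
  | out => rfl
  | inp y x =>
    obtain ⟨x', rfl⟩ := List.length_eq_one_iff.1 he
    simp [inst, bnList, listMap]
  | tau => exact (List.eq_nil_of_length_eq_zero he).symm

theorem Action.inst_congr {α : Action Name 𝔓.Term} {σ τ : Subst 𝔓.Term} {e : List Name}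
    (h1 : ∀ n ∈ α.symSubj, σ n = τ n)
    (h2 : ∀ n ∈ α.objNames, n ∉ α.bnList → σ n = τ n) : α.inst σ e = α.inst τ e := by
  cases α with
  | out y as N =>
    simp only [inst]
    rw [h1 y rfl, subst_congr_supp (τ := τ.bind as e) fun n hn =>
      Subst.bind_congr fun hn' => h2 n hn hn']
  | inp y x => simp only [inst]; rw [h1 y rfl]
  | tau => rfl

theorem Action.mem_names_inst {α : Action Name 𝔓.Term} {σ : Subst 𝔓.Term} {e : List Name}
    (he : e.length = α.bnList.length) {a : Name} (ha : a ∈ (α.inst σ e).names) :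
    a ∈ e ∨ ∃ n, (n ∈ α.symSubj ∨ n ∈ α.objNames) ∧ a ∈ supp (σ n) := by
  cases α with
  | out y as N =>
    rcases ha with (ha | ha) | ha
    · exact Or.inr ⟨y, Or.inl rfl, ha⟩
    · exact Or.inl ha
    · rw [supp_subst] at ha
      obtain ⟨n, hn, ha⟩ := Subst.mem_image.1 ha
      by_cases hna : n ∈ as
      · rw [Subst.bind_of_mem _ hna, supp_ofName] at ha
        obtain rfl : a = _ := ha
        exact Or.inl (listMap_mem hna he)
      · rw [Subst.bind_of_notMem _ hna] at ha
        exact Or.inr ⟨n, Or.inr hn, ha⟩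
  | inp y x =>
    obtain ⟨x', rfl⟩ := List.length_eq_one_iff.1 he
    rcases ha with ha | ha
    · exact Or.inr ⟨y, Or.inl rfl, ha⟩
    · left; simpa [listMap] using ha
  | tau => exact ha.elim

/-- The instances of a symbolic transition by solutions of its constraint are transitions. -/
def Instantiable (Ψs : 𝔓.Assn) (P : Agent 𝔓) (α : Action Name 𝔓.Term) (C : TransConstraint 𝔓)
    (P' : Agent 𝔓) : Prop :=
  ∀ ⦃σ : Subst 𝔓.Term⦄ ⦃Ψ Ψc : 𝔓.Assn⦄ ⦃e : List Name⦄,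
    assnClass Ψc = assnClass (𝔓.comp (subst Ψs σ) Ψ) → C.Sat σ Ψ → e.length = α.bnList.length →
    e.Nodup → (∀ a ∈ e, a ∉ supp Ψ ∧ a ∉ supp Ψc ∧
      ∀ n, n ∈ supp Ψs ∨ n ∈ P.fn ∨ n ∈ α.symSubj → a ∉ supp (σ n)) →
    Trans Ψc (P.subst σ) (α.inst σ e) (P'.subst (σ.bind α.bnList e))

/-- The frame binders of the passive component are instantiated by fresh names `d`, both in the
constraint and in its frame. The premise's agent and action do not contain them, so their instances
are still those by `σ`. -/
theorem Instantiable.par {Ψs ΨQ : 𝔓.Assn} {P Q P' : Agent 𝔓} {α : Action Name 𝔓.Term}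
    {C : TransConstraint 𝔓} {bQ : List Name} (ih : Instantiable (𝔓.comp Ψs ΨQ) P α C P')
    (h : SymTrans (𝔓.comp Ψs ΨQ) P α C P') (hQ : (bQ, ΨQ) ∈ Q.frame)
    (hbQ : ∀ b ∈ bQ, b ∉ supp Ψs ∧ b ∉ P.fn ∧ b ∉ α.symNames)
    {σ : Subst 𝔓.Term} {Ψ Ψc : 𝔓.Assn} {e : List Name}
    (hΨ : assnClass Ψc = assnClass (𝔓.comp (subst Ψs σ) Ψ))
    (hC : TransConstraint.Sat σ Ψ (C.new bQ))
    (hl : e.length = α.bnList.length) (hd : e.Nodup) (he : ∀ a ∈ e, a ∉ supp Ψ ∧ a ∉ supp Ψc ∧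
      ∀ n, n ∈ supp Ψs ∨ (n ∈ P.fn ∨ n ∈ Q.fn) ∨ n ∈ α.symSubj → a ∉ supp (σ n)) :
    ∃ d Φ, (d, Φ) ∈ (Q.subst σ).frame ∧
      (∀ b ∈ d, b ∉ supp Ψc ∧ b ∉ (P.subst σ).fn ∧ b ∉ (α.inst σ e).names) ∧
      Trans (𝔓.comp Φ Ψc) (P.subst σ) (α.inst σ e) (P'.subst (σ.bind α.bnList e)) := by
  have hfinS : α.symSubj.Finite := by cases α <;> simp [Action.symSubj]
  have hfinO : α.objNames.Finite := by cases α <;> simp [Action.objNames, supp_finite]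
  obtain ⟨d, d1, d2, d3⟩ := exists_fresh_list (e.toFinset.finite_toSet.union ((supp_finite Ψ).union
    ((supp_finite Ψc).union ((σ.image_finite C.fn_finite).union ((σ.image_finite P.fn_finite).union
    ((σ.image_finite Q.fn_finite).union (σ.image_finite (hfinS.union hfinO)))))))) bQ.length
  simp only [Set.mem_union, not_or, List.coe_toFinset, Set.mem_ofPred_eq] at d3
  have hσ : ∀ n, n ∉ bQ → σ.bind bQ d n = σ n := fun n hn => Subst.bind_of_notMem _ hn
  have hΨs : ∀ n ∈ supp Ψs, n ∉ bQ := fun n hn hb => (hbQ n hb).1 hn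
  have hPs : ∀ n ∈ P.fn, n ∉ bQ := fun n hn hb => (hbQ n hb).2.1 hn
  have hSs : ∀ n ∈ α.symSubj, n ∉ bQ := fun n hn hb =>
    (hbQ n hb).2.2 (Action.mem_symNames.2 (Or.inl hn))
  have hOs : ∀ n ∈ α.objNames, n ∉ bQ := fun n hn hb =>
    (hbQ n hb).2.2 (Action.mem_symNames.2 (Or.inr (Or.inr hn)))
  have hBs : ∀ n ∈ α.bnList, n ∉ bQ := fun n hn hb =>
    (hbQ n hb).2.2 (Action.mem_symNames.2 (Or.inr (Or.inl hn)))
  have key : ∀ a ∈ e, ∀ n, (n ∉ bQ → a ∉ supp (σ n)) → a ∉ supp (σ.bind bQ d n) := by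
    intro a ha n hn
    by_cases hb : n ∈ bQ
    · rw [Subst.bind_of_mem _ hb, supp_ofName]
      exact fun h' : a = _ => (d3 _ (listMap_mem hb d1)).1 (h' ▸ ha)
    · rw [hσ n hb]; exact hn hb
  have hΨQ : ∀ n ∈ supp ΨQ, n ∉ bQ → n ∈ Q.fn := fun n hn hb => Agent.mem_fn_of_mem_frame hQ hn hb
  -- The concrete rule composes the frame assertion on the left and the symbolic one on the right;
  -- this is why instances are formulated for any environment statically equivalent to the expected
  -- one.
  have h1 := ih (σ := σ.bind bQ d) (Ψ := Ψ) (Ψc := 𝔓.comp (subst ΨQ (σ.bind bQ d)) Ψc) (e := e)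
    (by
      rw [assnClass_comp, hΨ, 𝔓.subst_comp, subst_congr_supp (x := Ψs) fun n hn => hσ n (hΨs n hn)]
      simp only [assnClass_comp, mul_left_comm, mul_assoc])
    ((TransConstraint.sat_new_iff fun A hA => FreshInst.bind d1 d2 fun m hm =>
      ⟨(d3 m hm).2.1, fun h' => (d3 m hm).2.2.2.1 (by
        obtain ⟨n, hn, h'⟩ := Subst.mem_image.1 h'
        exact Subst.mem_image.2 ⟨n, ⟨A, hA, hn⟩, h'⟩)⟩).1 hC) hl hd
    (by
      intro a ha
      obtain ⟨e1, e2, e3⟩ := he a ha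
      refine ⟨e1, fun h' => ?_, fun n hn => key a ha n fun hb => e3 n ?_⟩
      · rcases supp_comp_subset _ _ h' with h' | h'
        · rw [supp_subst] at h'
          obtain ⟨n, hn, h'⟩ := Subst.mem_image.1 h'
          exact key a ha n (fun hb => e3 n (Or.inr (Or.inl (Or.inr (hΨQ n hn hb))))) h'
        · exact e2 h'
      · rcases hn with hn | hn | hn
        · rcases supp_comp_subset _ _ hn with hn | hn
          · exact Or.inl hn
          · exact Or.inr (Or.inl (Or.inr (hΨQ n hn hb)))
        · exact Or.inr (Or.inl (Or.inl hn))
        · exact Or.inr (Or.inr hn))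
  rw [Agent.subst_congr fun n hn => hσ n (hPs n hn),
    Action.inst_congr (τ := σ) (fun n hn => hσ n (hSs n hn)) (fun n hn _ => hσ n (hOs n hn)),
    Agent.subst_congr (P := P') (τ := σ.bind α.bnList e) fun n hn => Subst.bind_congr fun hn' =>
      hσ n (hPs n ((h.names.1 n hn).resolve_right hn'))] at h1
  refine ⟨d, _, Agent.mem_frame_subst hQ d1 d2 fun m hm => (d3 m hm).2.2.2.2.2.1, fun b hb => ?_, h1⟩
  refine ⟨(d3 b hb).2.2.1, by rw [Agent.fn_subst]; exact (d3 b hb).2.2.2.2.1, fun h' => ?_⟩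
  rcases Action.mem_names_inst hl h' with h' | ⟨n, hn, h'⟩
  · exact (d3 b hb).1 h'
  · exact (d3 b hb).2.2.2.2.2.2 (Subst.mem_image.2 ⟨n, hn, h'⟩)

theorem AssnEq.comp_right_comm (Ψ Ψ₁ Ψ₂ : 𝔓.Assn) :
    AssnEq (𝔓.comp (𝔓.comp Ψ Ψ₁) Ψ₂) (𝔓.comp (𝔓.comp Ψ Ψ₂) Ψ₁) :=
  (AssnEq.assoc _ _ _).trans ((AssnEq.comp (.refl _) (.comm _ _)).trans (.symm (.assoc _ _ _)))

/-- The transition of one partner of a communication: its subject is instantiated by the subject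
of the other one. -/
theorem Instantiable.partner {Ψs ΨP ΨQ Ψ₁ : 𝔓.Assn} {P Q P' : Agent 𝔓} {α : Action Name 𝔓.Term}
    {bP bQ cP cQ as : List Name} {MP MQ N : 𝔓.Term} {y : Name} {CP : TransConstraint 𝔓}
    (ih : Instantiable (𝔓.comp Ψs ΨQ) P α (chanAtom cP Ψ₁ MP (NameTerm.ofName y) :: CP) P')
    (h : SymTrans (𝔓.comp Ψs ΨQ) P α (chanAtom cP Ψ₁ MP (NameTerm.ofName y) :: CP) P')
    (hy : α.symSubj = {y}) (hP : (bP, ΨP) ∈ P.frame) (hQ : (bQ, ΨQ) ∈ Q.frame)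
    (hA : AssnEq Ψ₁ (𝔓.comp (𝔓.comp Ψs ΨP) ΨQ))
    (hf : ComFresh Ψs P Q bP bQ cP cQ MP MQ y as N)
    (hcQ : ∀ n ∈ cQ, n ∉ supp Ψs ∧ n ∉ P.fn) {c : List Name} (hc : ∀ n, n ∈ c ↔ n ∈ cP ∨ n ∈ cQ)
    {σ σ₁ : Subst 𝔓.Term} {Ψ Ψc : 𝔓.Assn} {W : Set Name} {g : Name → Name}
    (hfi : FreshInst σ Ψ c W σ₁ g) (hWc : ∀ n ∈ c, n ∈ W)
    (hWΨs : supp Ψs ⊆ W) (hWP : P.fn ⊆ W) (hWQ : supp ΨQ ⊆ W)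
    (hWMQ : supp MQ ⊆ W) (hWΨ₁ : supp Ψ₁ ⊆ W) (hWMP : supp MP ⊆ W)
    (hent : 𝔓.entails (𝔓.comp (subst (𝔓.comp (𝔓.comp Ψs ΨP) ΨQ) σ₁) Ψ)
      (𝔓.chanEq (subst MP σ₁) (subst MQ σ₁)))
    (hCP : CP.Sat σ₁ Ψ) (hΨ : assnClass Ψc = assnClass (𝔓.comp (subst Ψs σ) Ψ))
    {e : List Name} (hl : e.length = α.bnList.length) (hd : e.Nodup)
    (he : ∀ a ∈ e, a ∉ supp Ψ ∧ a ∉ supp Ψc ∧ a ∉ σ₁.image W) :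
    Trans (𝔓.comp (subst ΨQ σ₁) Ψc) (P.subst σ) (α.inst (σ.update y (subst MQ σ₁)) e)
      (P'.subst (σ.bind α.bnList e)) := by
  obtain ⟨f1, f2, f3, f4, f5, f6, f7, f8, f9, f10, f11, -, -⟩ := hf
  have hΨPs : ∀ n ∈ supp ΨP, n ∈ P.fn ∨ n ∈ bP := fun n hn => by
    by_cases hb : n ∈ bP
    exacts [Or.inr hb, Or.inl (Agent.mem_fn_of_mem_frame hP hn hb)]
  have hΨQs : ∀ n ∈ supp ΨQ, n ∈ Q.fn ∨ n ∈ bQ := fun n hn => by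
    by_cases hb : n ∈ bQ
    exacts [Or.inr hb, Or.inl (Agent.mem_fn_of_mem_frame hQ hn hb)]
  have hyc : y ∉ c := by rw [hc]; tauto
  have hyΨQ : y ∉ supp ΨQ := fun h' => by have := hΨQs y h'; tauto
  have hyΨP : y ∉ supp ΨP := fun h' => by have := hΨPs y h'; tauto
  have hσ : ∀ n, n ∈ supp Ψs ∨ n ∈ P.fn → σ₁ n = σ n := by
    intro n hn
    refine hfi.eq_of_notMem n (hn.elim (hWΨs ·) (hWP ·)) ?_
    rw [hc]
    rintro (h' | h')
    · have := f2 n h'; tauto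
    · have := hcQ n h'; tauto
  -- The subject is sent to the partner's channel term, so that the subject conjunct of the premise
  -- becomes the solved conjunct between the two channel terms.
  set σP := σ₁.update y (subst MQ σ₁) with hσP
  have hne : ∀ {n}, n ≠ y → σP n = σ₁ n := fun hn => Subst.update_of_ne _ _ hn
  have hyy : σP y = subst MQ σ₁ := Subst.update_same _ _ _
  have hcong : ∀ {X : Type u} [Nominal X] [HasSubst 𝔓.Term X] [LawfulSubst 𝔓.Term X] {x : X},
      y ∉ supp x → subst x σP = subst x σ₁ := fun hx =>
    subst_congr_supp fun n hn => hne fun h' => hx (h' ▸ hn)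
  have hyΨ : y ∉ supp (𝔓.comp (𝔓.comp Ψs ΨP) ΨQ) := by
    intro h'
    rcases supp_comp_subset _ _ h' with h' | h'
    · rcases supp_comp_subset _ _ h' with h' | h'
      exacts [f3 h', hyΨP h']
    · exact hyΨQ h'
  -- The name chosen for a binder determines it, since it occurs in no term substituted for another
  -- relevant name.
  have hinj : ∀ n ∈ c, ∀ m ∈ W, g n ∈ supp (σ₁ m) → m = n := by
    intro n hn m hm h'
    by_cases hmc : m ∈ c
    · rw [hfi.eq_of_mem m hm hmc, supp_ofName] at h'
      exact (hfi.injOn ⟨hWc n hn, hn⟩ ⟨hm, hmc⟩ h').symm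
    · rw [hfi.eq_of_notMem m hm hmc] at h'
      exact absurd h' (hfi.notMem_subst n (hWc n hn) hn m hm hmc)
  have hsat : TransConstraint.Sat σP Ψ (chanAtom cP Ψ₁ MP (NameTerm.ofName y) :: CP) := by
    rw [TransConstraint.sat_cons]
    constructor
    · have hcP : ∀ n ∈ cP, n ∈ c := fun n hn => (hc n).2 (Or.inl hn)
      have hneP : ∀ n ∈ cP, n ≠ y := fun n hn h' => hyc (h' ▸ hcP n hn)
      have hV : ∀ m ∈ supp Ψ₁ ∪ supp (𝔓.chanEq MP (NameTerm.ofName y)), m ≠ y → m ∈ W := by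
        rintro m (hm | hm) hmy
        · exact hWΨ₁ hm
        · rcases supp_chanEq_subset _ _ hm with hm | hm
          · exact hWMP hm
          · rw [supp_ofName] at hm; exact absurd hm hmy
      refine (Atom.sat_mk_iff (τ := σP) (g := g) rfl ⟨fun _ _ _ => rfl, fun n _ hn => ?_,
        fun n _ hn => hfi.notMem_assn n (hWc n (hcP n hn)) (hcP n hn), fun n _ hn m hm hmc h' => ?_,
        fun n hn m hm h' => ?_⟩).2 ?_
      · rw [hne (hneP n hn), hfi.eq_of_mem n (hWc n (hcP n hn)) (hcP n hn)]
      · by_cases hmy : m = y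
        · subst hmy
          rw [hyy, supp_subst] at h'
          obtain ⟨k, hk, h'⟩ := Subst.mem_image.1 h'
          obtain rfl := hinj n (hcP n hn) k (hWMQ hk) h'
          exact (f2 k hn).2.2.2.2.2 hk
        · rw [hne hmy] at h'
          obtain rfl := hinj n (hcP n hn) m (hV m hm hmy) h'
          exact hmc hn
      · exact hfi.injOn ⟨hWc n (hcP n hn.2), hcP n hn.2⟩ ⟨hWc m (hcP m hm.2), hcP m hm.2⟩ h'
      · rw [𝔓.subst_chanEq, 𝔓.subst_ofName, hyy, hcong f10]
        refine entails_of_assnClass_eq ?_ hent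
        rw [assnClass_comp, assnClass_comp, (hA.subst σP).assnClass_eq, hcong hyΨ]
    -- The remaining conjuncts do not mention the subject, so the update is invisible to them.
    · obtain ⟨A, C₀, h1, -, h2⟩ := h.fn_constraint (y := y) (by rw [hy]; rfl)
      obtain ⟨-, rfl⟩ := List.cons.inj h1
      intro B hB
      refine (Atom.sat_congr fun n hn => hne ?_).1 (hCP B hB)
      rintro rfl
      rcases h2 B hB n hn with h' | h'
      · exact (supp_comp_subset _ _ h').elim f3 hyΨQ
      · exact f4 h'
  have h1 := ih (σ := σP) (Ψ := Ψ) (Ψc := 𝔓.comp (subst ΨQ σ₁) Ψc) (e := e) (by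
      rw [assnClass_comp, hΨ, 𝔓.subst_comp, hcong f3, hcong hyΨQ,
        subst_congr_supp (x := Ψs) fun n hn => hσ n (Or.inl hn)]
      simp only [assnClass_comp, mul_left_comm, mul_assoc]) hsat hl hd (by
    intro a ha
    obtain ⟨e1, e2, e3⟩ := he a ha
    have e4 : ∀ {n}, n ∈ W → a ∉ supp (σ₁ n) := fun hn h' => e3 (Subst.mem_image.2 ⟨_, hn, h'⟩)
    have e5 : ∀ {X : Type u} [Nominal X] [HasSubst 𝔓.Term X] [LawfulSubst 𝔓.Term X] {x : X},
        supp x ⊆ W → a ∉ supp (subst x σ₁) := fun hx h' => by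
      rw [supp_subst] at h'
      obtain ⟨n, hn, h'⟩ := Subst.mem_image.1 h'
      exact e4 (hx hn) h'
    refine ⟨e1, fun h' => (supp_comp_subset _ _ h').elim (e5 hWQ) e2, fun n hn => ?_⟩
    by_cases hny : n = y
    · rw [hny, hyy]; exact e5 hWMQ
    · rw [hne hny]
      rcases hn with hn | hn | hn
      · exact e4 ((supp_comp_subset _ _ hn).elim (hWΨs ·) (hWQ ·))
      · exact e4 (hWP hn)
      · rw [hy] at hn; exact absurd hn hny)
  have hPne : ∀ n ∈ P.fn, σP n = σ n := fun n hn =>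
    (hne fun h' => f4 (h' ▸ hn)).trans (hσ n (Or.inr hn))
  rwa [Agent.subst_congr (P := P) hPne, Action.inst_congr (τ := σ.update y (subst MQ σ₁)),
    Agent.subst_congr (P := P') (τ := σ.bind α.bnList e) fun n hn => Subst.bind_congr fun hn' =>
      hPne n ((h.names.1 n hn).resolve_right hn')] at h1
  · intro n hn
    rw [hy] at hn
    obtain rfl : n = y := hn
    rw [hyy, Subst.update_same]
  · intro n hn hn'
    have hnP := (h.names.2.1 n hn).resolve_right hn'
    rw [hPne n hnP, Subst.update_of_ne _ _ fun h' : n = y => f4 (h' ▸ hnP)]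

/-! ## Instances of symbolic transitions -/

/-- Shared by both communication rules: `α` and `β` may be output and input in either order. The
derivatives are given for all bound names outside a finite set `Y`, since the rules choose these
names to suit the substitution of the object. -/
theorem Instantiable.com {Ψs ΨP ΨQ Ψ₁ Ψ₂ : 𝔓.Assn} {P Q P' Q' : Agent 𝔓}
    {α β : Action Name 𝔓.Term} {bP bQ cP cQ as : List Name} {MP MQ N : 𝔓.Term} {y z : Name}
    {CP CQ : TransConstraint 𝔓}
    (ihP : Instantiable (𝔓.comp Ψs ΨQ) P α (chanAtom cP Ψ₁ MP (NameTerm.ofName y) :: CP) P')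
    (ihQ : Instantiable (𝔓.comp Ψs ΨP) Q β (chanAtom cQ Ψ₂ MQ (NameTerm.ofName z) :: CQ) Q')
    (hsP : SymTrans (𝔓.comp Ψs ΨQ) P α (chanAtom cP Ψ₁ MP (NameTerm.ofName y) :: CP) P')
    (hsQ : SymTrans (𝔓.comp Ψs ΨP) Q β (chanAtom cQ Ψ₂ MQ (NameTerm.ofName z) :: CQ) Q')
    (hα : α.symSubj = {y}) (hβ : β.symSubj = {z})
    (hP : (bP, ΨP) ∈ P.frame) (hQ : (bQ, ΨQ) ∈ Q.frame)
    (hA₁ : AssnEq Ψ₁ (𝔓.comp (𝔓.comp Ψs ΨP) ΨQ)) (hA₂ : AssnEq Ψ₂ (𝔓.comp (𝔓.comp Ψs ΨP) ΨQ))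
    (hfP : ComFresh Ψs P Q bP bQ cP cQ MP MQ y as N)
    (hfQ : ComFresh Ψs Q P bQ bP cQ cP MQ MP z as N)
    {σ : Subst 𝔓.Term} {Ψ Ψc : 𝔓.Assn} (hΨ : assnClass Ψc = assnClass (𝔓.comp (subst Ψs σ) Ψ))
    (hC : TransConstraint.Sat σ Ψ (TransConstraint.new (cP ++ cQ)
          (chanAtom [] (𝔓.comp (𝔓.comp Ψs ΨP) ΨQ) MP MQ :: (CP ++ CQ)))) :
    ∃ bP' bQ' ΨP' ΨQ' M K, (bP', ΨP') ∈ (P.subst σ).frame ∧ (bQ', ΨQ') ∈ (Q.subst σ).frame ∧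
      (∀ b ∈ bP', b ∉ supp Ψc ∧ b ∉ bQ' ∧ b ∉ (Q.subst σ).fn ∧ b ∉ supp M ∧ b ∉ (P.subst σ).fn) ∧
      (∀ b ∈ bQ', b ∉ supp Ψc ∧ b ∉ bP' ∧ b ∉ (P.subst σ).fn ∧ b ∉ supp K ∧ b ∉ (Q.subst σ).fn) ∧
      𝔓.entails (𝔓.comp (𝔓.comp Ψc ΨP') ΨQ') (𝔓.chanEq M K) ∧
      ∃ Y : Set Name, Y.Finite ∧
      (∀ e : List Name, e.length = α.bnList.length → e.Nodup → (∀ a ∈ e, a ∉ Y) →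
        Trans (𝔓.comp ΨQ' Ψc) (P.subst σ) (α.inst (σ.update y M) e)
          (P'.subst (σ.bind α.bnList e))) ∧
      (∀ e : List Name, e.length = β.bnList.length → e.Nodup → (∀ a ∈ e, a ∉ Y) →
        Trans (𝔓.comp ΨP' Ψc) (Q.subst σ) (β.inst (σ.update z K) e)
          (Q'.subst (σ.bind β.bnList e))) := by
  -- `W` collects all names of the symbolic data; names fresh for its image under `σ` replace all
  -- the constraint binders at once.
  obtain ⟨W, hW⟩ : ∃ W, W = {n | n ∈ cP ++ cQ} ∪ (supp Ψs ∪ (P.fn ∪ (Q.fn ∪ (supp ΨP ∪ (supp ΨQ ∪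
    (supp MP ∪ (supp MQ ∪ (supp Ψ₁ ∪ (supp Ψ₂ ∪ {n | ∃ A ∈ chanAtom []
      (𝔓.comp (𝔓.comp Ψs ΨP) ΨQ) MP MQ :: (CP ++ CQ), n ∈ A.fn}))))))))) := ⟨_, rfl⟩
  have hWfin : W.Finite := by
    rw [hW]
    exact (cP ++ cQ).finite_toSet.union ((supp_finite _).union (P.fn_finite.union (Q.fn_finite.union
      ((supp_finite _).union ((supp_finite _).union ((supp_finite _).union ((supp_finite _).union
      ((supp_finite _).union ((supp_finite _).union (TransConstraint.fn_finite _))))))))))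
  have hWc : ∀ n ∈ cP ++ cQ, n ∈ W := by intro n hn; rw [hW]; exact Or.inl hn
  have hWΨs : supp Ψs ⊆ W := by intro n hn; rw [hW]; simp [hn]
  have hWP : P.fn ⊆ W := by intro n hn; rw [hW]; simp [hn]
  have hWQ : Q.fn ⊆ W := by intro n hn; rw [hW]; simp [hn]
  have hWΨP : supp ΨP ⊆ W := by intro n hn; rw [hW]; simp [hn]
  have hWΨQ : supp ΨQ ⊆ W := by intro n hn; rw [hW]; simp [hn]
  have hWMP : supp MP ⊆ W := by intro n hn; rw [hW]; simp [hn]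
  have hWMQ : supp MQ ⊆ W := by intro n hn; rw [hW]; simp [hn]
  have hWΨ₁ : supp Ψ₁ ⊆ W := by intro n hn; rw [hW]; simp [hn]
  have hWΨ₂ : supp Ψ₂ ⊆ W := by intro n hn; rw [hW]; simp [hn]
  have hWC : ∀ A ∈ chanAtom [] (𝔓.comp (𝔓.comp Ψs ΨP) ΨQ) MP MQ :: (CP ++ CQ), A.fn ⊆ W := by
    intro A hA n hn
    rw [hW]
    iterate 10 right
    exact ⟨A, hA, hn⟩
  clear hW
  obtain ⟨d, d1, d2, d3⟩ := exists_fresh_list ((supp_finite Ψ).union ((supp_finite Ψc).union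
    (σ.image_finite hWfin))) (cP ++ cQ).length
  simp only [Set.mem_union, not_or] at d3
  have hd : ∀ n ∈ cP ++ cQ, listMap (cP ++ cQ) d n ∈ d := fun n hn => listMap_mem hn d1
  have hfi : FreshInst σ Ψ (cP ++ cQ) W (σ.bind (cP ++ cQ) d) (listMap (cP ++ cQ) d) :=
    .bind d1 d2 fun m hm => ⟨(d3 m hm).1, (d3 m hm).2.2⟩
  have hg := listMap_injOn d1 d2
  have hmem : ∀ n ∈ cP ++ cQ, σ.bind (cP ++ cQ) d n = NameTerm.ofName (listMap (cP ++ cQ) d n) :=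
    fun n hn => Subst.bind_of_mem _ hn
  have hnot : ∀ n ∉ cP ++ cQ, σ.bind (cP ++ cQ) d n = σ n := fun n hn => Subst.bind_of_notMem _ hn
  generalize σ.bind (cP ++ cQ) d = σ₁ at hfi hmem hnot
  generalize listMap (cP ++ cQ) d = g at hd hfi hg hmem
  obtain ⟨p1, p2, -⟩ := id hfP
  obtain ⟨q1, q2, -⟩ := id hfQ
  have hcP : ∀ n ∈ cP, n ∈ cP ++ cQ := fun n hn => List.mem_append_left _ hn
  have hcQ : ∀ n ∈ cQ, n ∈ cP ++ cQ := fun n hn => List.mem_append_right _ hn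
  rw [TransConstraint.sat_new_iff (τ := σ₁) (g := g) fun A hA =>
      ⟨fun n hn => hfi.eq_of_notMem n (hWC A hA hn), fun n hn => hfi.eq_of_mem n (hWC A hA hn),
        fun n hn => hfi.notMem_assn n (hWC A hA hn), fun n hn hnc m hm =>
          hfi.notMem_subst n (hWC A hA hn) hnc m (hWC A hA hm), hg.mono fun n hn => hn.2⟩,
    TransConstraint.sat_cons, TransConstraint.sat_append, chanAtom, Atom.sat_mk_nil,
    𝔓.subst_chanEq] at hC
  obtain ⟨hent, hCP, hCQ⟩ := hC
  have hinj : ∀ n ∈ cP ++ cQ, ∀ m ∈ W, g n ∈ supp (σ₁ m) → m = n := by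
    intro n hn m hm h'
    by_cases hmc : m ∈ cP ++ cQ
    · rw [hmem m hmc, supp_ofName] at h'
      exact (hg hn hmc h').symm
    · rw [hnot m hmc] at h'
      exact absurd (Subst.mem_image.2 ⟨m, hm, h'⟩) (d3 _ (hd n hn)).2.2
  have hPfix : ∀ n ∈ P.fn, σ₁ n = σ n := fun n hn => hnot n fun h' =>
    (List.mem_append.1 h').elim (fun h' => (p2 n h').2.1 hn) fun h' => (q2 n h').2.2.1 hn
  have hQfix : ∀ n ∈ Q.fn, σ₁ n = σ n := fun n hn => hnot n fun h' =>
    (List.mem_append.1 h').elim (fun h' => (p2 n h').2.2.1 hn) fun h' => (q2 n h').2.1 hn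
  have hΨs : subst Ψs σ₁ = subst Ψs σ := subst_congr_supp fun n hn => hnot n fun h' =>
    (List.mem_append.1 h').elim (fun h' => (p2 n h').1 hn) fun h' => (q2 n h').1 hn
  have hX : (supp Ψc ∪ ((P.subst σ).fn ∪ ((Q.subst σ).fn ∪ (supp (subst MP σ₁) ∪
      (supp (subst MQ σ₁) ∪ {n | n ∈ d}))))).Finite :=
    (supp_finite _).union ((Agent.fn_finite _).union ((Agent.fn_finite _).union
      ((supp_finite _).union ((supp_finite _).union d.finite_toSet))))
  -- The frame binders are among the constraint binders and must take the values of `g`, so that the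
  -- frames and the entailment refer to the same names. Names left over from repeated binders are
  -- fresh for everything else.
  obtain ⟨bP', k1, k2⟩ := Agent.exists_mem_frame_subst_ren (τ := σ₁) (g := g) (σ := σ) hX hP
    (fun n hn hb => hPfix n (Agent.mem_fn_of_mem_frame hP hn hb))
    (fun n hn => hmem n (hcP n (p1 n hn))) (hg.mono fun n hn => hcP n (p1 n hn))
    (fun n hn h' => (d3 _ (hd n (hcP n (p1 n hn)))).2.2 (Subst.image_mono _ hWP h'))
  obtain ⟨bQ', l1, l2⟩ := Agent.exists_mem_frame_subst_ren (τ := σ₁) (g := g) (σ := σ)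
    (hX.union bP'.finite_toSet) hQ
    (fun n hn hb => hQfix n (Agent.mem_fn_of_mem_frame hQ hn hb))
    (fun n hn => hmem n (hcQ n (q1 n hn))) (hg.mono fun n hn => hcQ n (q1 n hn))
    (fun n hn h' => (d3 _ (hd n (hcQ n (q1 n hn)))).2.2 (Subst.image_mono _ hWQ h'))
  simp only [Set.mem_union, not_or, Set.mem_ofPred_eq] at k2 l2
  have hsupp : ∀ n ∈ cP ++ cQ, ∀ {M : 𝔓.Term}, supp M ⊆ W → n ∉ supp M →
      g n ∉ supp (subst M σ₁) := by
    intro n hn M hM hnM h'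
    rw [supp_subst] at h'
    obtain ⟨m, hm, h'⟩ := Subst.mem_image.1 h'
    exact hnM (hinj n hn m (hM hm) h' ▸ hm)
  have hdfn : ∀ n ∈ cP ++ cQ, ∀ {R : Agent 𝔓}, R.fn ⊆ W → g n ∉ (R.subst σ).fn := by
    intro n hn R hR h'
    rw [Agent.fn_subst] at h'
    exact (d3 _ (hd n hn)).2.2 (Subst.image_mono _ hR h')
  -- Each partner uses the other's channel term as its subject. This makes the frame binders of `P`
  -- fresh for the subject of `P`, as the rule demands: they are fresh for `MQ`, though possibly not
  -- for `MP`.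
  refine ⟨bP', bQ', _, _, subst MQ σ₁, subst MP σ₁, k1, l1, fun b hb => ?_, fun b hb => ?_, ?_,
    supp Ψ ∪ (supp Ψc ∪ σ₁.image W),
    (supp_finite _).union ((supp_finite _).union (σ₁.image_finite hWfin)),
    fun e e1 e2 e3 => ?_, fun e e1 e2 e3 => ?_⟩
  · rcases k2 b hb with ⟨n, hn, rfl⟩ | hb'
    · have hnc := hcP n (p1 n hn)
      refine ⟨(d3 _ (hd n hnc)).2.1, fun h' => ?_, hdfn n hnc hWQ,
        hsupp n hnc hWMQ (p2 n (p1 n hn)).2.2.2.2.2, hdfn n hnc hWP⟩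
      rcases l2 _ h' with ⟨m, hm, h'⟩ | h'
      · have := hg hnc (hcQ m (q1 m hm)) h'
        exact (p2 n (p1 n hn)).2.2.2.2.1 (this ▸ q1 m hm)
      · exact h'.1.2.2.2.2.2 (hd n hnc)
    · refine ⟨hb'.1, fun h' => ?_, hb'.2.2.1, hb'.2.2.2.2.1, hb'.2.1⟩
      rcases l2 _ h' with ⟨m, hm, rfl⟩ | h'
      · exact hb'.2.2.2.2.2 (hd m (hcQ m (q1 m hm)))
      · exact h'.2 hb
  · rcases l2 b hb with ⟨n, hn, rfl⟩ | hb'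
    · have hnc := hcQ n (q1 n hn)
      refine ⟨(d3 _ (hd n hnc)).2.1, fun h' => ?_, hdfn n hnc hWP,
        hsupp n hnc hWMP (q2 n (q1 n hn)).2.2.2.2.2, hdfn n hnc hWQ⟩
      rcases k2 _ h' with ⟨m, hm, h'⟩ | h'
      · have := hg hnc (hcP m (p1 m hm)) h'
        exact (q2 n (q1 n hn)).2.2.2.2.1 (this ▸ p1 m hm)
      · exact h'.2.2.2.2.2 (hd n hnc)
    · exact ⟨hb'.1.1, hb'.2, hb'.1.2.1, hb'.1.2.2.2.1, hb'.1.2.2.1⟩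
  · refine 𝔓.chan_symm _ _ _ (entails_of_assnClass_eq ?_ hent)
    simp only [assnClass_comp, hΨ, 𝔓.subst_comp, hΨs, mul_comm, mul_assoc]
  · simp only [Set.mem_union, not_or] at e3
    exact ihP.partner hsP hα hP hQ hA₁ hfP (fun n hn => ⟨(q2 n hn).1, (q2 n hn).2.2.1⟩)
      (fun n => List.mem_append) hfi hWc hWΨs hWP hWΨQ hWMQ hWΨ₁ hWMP hent hCP hΨ e1 e2 e3
  · simp only [Set.mem_union, not_or] at e3
    refine ihQ.partner hsQ hβ hQ hP (hA₂.trans (.comp_right_comm _ _ _)) hfQ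
      (fun n hn => ⟨(p2 n hn).1, (p2 n hn).2.2.1⟩)
      (fun n => List.mem_append.trans or_comm) hfi hWc hWΨs hWQ hWΨP hWMP hWΨ₂ hWMQ
      (𝔓.chan_symm _ _ _ (entails_of_assnClass_eq ?_ hent)) hCQ hΨ e1 e2 e3
    simp only [assnClass_comp, 𝔓.subst_comp, mul_comm, mul_left_comm, mul_assoc]

/-- Instantiating a derivative commutes with passing the object: the received term is itself
instantiated, and the fresh input name `x'` is only a place holder. -/
theorem Agent.subst_bind_subst1 {Q : Agent 𝔓} {N : 𝔓.Term} {x x' : Name} {as e : List Name}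
    {σ : Subst 𝔓.Term} (has : ∀ n ∈ Q.fn, n ≠ x → n ∉ as)
    (hx' : ∀ n ∈ Q.fn, n ≠ x → x' ∉ supp (σ n)) :
    (Q.subst1 N x).subst (σ.bind as e) =
      (Q.subst (σ.bind [x] [x'])).subst1 (HasSubst.subst N (σ.bind as e)) x' := by
  rw [subst1, subst1, subst_subst (ρ := (σ.bind as e).update x (HasSubst.subst N (σ.bind as e))),
    ← subst_subst (ρ := (σ.bind as e).update x (HasSubst.subst N (σ.bind as e)))]
  · intro n hn
    rw [Subst.bind_singleton]
    by_cases hnx : n = x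
    · subst hnx
      rw [Subst.update_same, Subst.update_same, 𝔓.subst_ofName, Subst.single_same]
    · rw [Subst.update_of_ne _ _ hnx, Subst.update_of_ne _ _ hnx,
        Subst.bind_of_notMem _ (has n hn hnx)]
      exact (SymPsi.subst_eq_self fun k hk =>
        Subst.single_of_ne _ fun h' : k = x' => hx' n hn hnx (h' ▸ hk)).symm
  · intro n _
    by_cases hnx : n = x
    · subst hnx
      rw [Subst.update_same, Subst.single_same]
    · rw [Subst.update_of_ne _ _ hnx, Subst.single_of_ne _ hnx, 𝔓.subst_ofName]

/-- Common to the scope and opening rules: instantiating the restricted name by `a'` discharges its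
binder in the constraint and keeps the hypotheses of the induction. Here `a'` is only required to
avoid the images of the constraint's other names, as in the opening rule it is prescribed. -/
theorem Instantiable.res {Ψs : 𝔓.Assn} {P : Agent 𝔓} {a a' : Name} {C : TransConstraint 𝔓}
    {σ : Subst 𝔓.Term} {Ψ Ψc : 𝔓.Assn} {e : List Name} {S : Set Name} (haΨ : a ∉ supp Ψs) (haS : a ∉ S)
    (hΨ : assnClass Ψc = assnClass (𝔓.comp (subst Ψs σ) Ψ))
    (hC : TransConstraint.Sat σ Ψ (C.new [a]))
    (he : ∀ m ∈ e, m ∉ supp Ψ ∧ m ∉ supp Ψc ∧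
      ∀ n, n ∈ supp Ψs ∨ n ∈ (Agent.res a P).fn ∨ n ∈ S → m ∉ supp (σ n))
    (ha' : a' ∉ supp Ψ ∧ a' ∉ e ∧ ∀ A ∈ C, ∀ n ∈ A.fn, n ≠ a → a' ∉ supp (σ n)) :
    assnClass Ψc = assnClass (𝔓.comp (subst Ψs (σ.update a (NameTerm.ofName a'))) Ψ) ∧
    TransConstraint.Sat (σ.update a (NameTerm.ofName a')) Ψ C ∧
    (∀ m ∈ e, m ∉ supp Ψ ∧ m ∉ supp Ψc ∧ ∀ n, n ∈ supp Ψs ∨ n ∈ P.fn ∨ n ∈ S →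
      m ∉ supp (σ.update a (NameTerm.ofName a') n)) := by
  have hne : ∀ {n}, n ≠ a → σ.update a (NameTerm.ofName a') n = σ n := fun h =>
    Subst.update_of_ne _ _ h
  refine ⟨?_, ?_, fun m hm => ⟨(he m hm).1, (he m hm).2.1, fun n hn => ?_⟩⟩
  · rw [hΨ, subst_congr_supp (x := Ψs) (σ := σ.update a _) fun n hn => hne fun h => haΨ (h ▸ hn)]
  · rw [← Subst.bind_singleton]
    refine (TransConstraint.sat_new_iff (g := listMap [a] [a']) fun A hA =>
      FreshInst.bind_of_sdiff rfl (by simp) fun m hm => ?_).1 hC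
    obtain rfl := List.mem_singleton.1 hm
    exact ⟨ha'.1, fun n hn hna => ha'.2.2 A hA n hn (by simpa using hna)⟩
  · by_cases hna : n = a
    · subst hna
      rw [Subst.update_same, supp_ofName]
      exact fun h : m = a' => ha'.2.1 (h ▸ hm)
    · rw [hne hna]
      refine (he m hm).2.2 n (hn.imp_right fun h => h.imp_left fun h => ?_)
      rw [Agent.fn_res]; exact ⟨h, hna⟩

/-- Each symbolic rule records as a constraint the test which the concrete rule makes immediately,
so a solution allows the concrete rule to be applied. The substitution is generalized because
premises need it extended at frame binders, restricted names and subjects. -/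
theorem SymTrans.instantiable {Ψs : 𝔓.Assn} {P P' : Agent 𝔓} {α : Action Name 𝔓.Term}
    {C : TransConstraint 𝔓} (h : SymTrans Ψs P α C P') : Instantiable Ψs P α C P' := by
  induction h with
  | inp Ψs M x P y _ _ _ _ =>
    intro σ Ψ Ψc e hΨ hC hl hd he
    obtain ⟨x', rfl⟩ := List.length_eq_one_iff.1 hl
    rw [chanAtom, TransConstraint.sat_cons, Atom.sat_mk_nil, 𝔓.subst_chanEq, 𝔓.subst_ofName] at hC
    rw [Agent.subst_inp (z := x')]
    · have := Trans.inp Ψc (subst M σ) (σ y) x' (P.subst (σ.update x (NameTerm.ofName x')))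
        (entails_of_assnClass_eq hΨ.symm hC.1)
      simpa [Action.inst, listMap, Action.bnList, Subst.bind_singleton] using this
    · intro h'
      obtain ⟨n, hn, h'⟩ := Subst.mem_image.1 h'
      exact (he x' (by simp)).2.2 n (Or.inr (Or.inl (by rw [Agent.fn_inp]; exact Or.inr hn))) h'
  | out Ψs M N P y _ _ _ _ =>
    intro σ Ψ Ψc e hΨ hC hl hd he
    obtain rfl := List.eq_nil_of_length_eq_zero hl
    rw [chanAtom, TransConstraint.sat_cons, Atom.sat_mk_nil, 𝔓.subst_chanEq, 𝔓.subst_ofName] at hC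
    rw [Agent.subst_out]
    simp only [Action.inst, Action.bnList, Subst.bind_nil]
    exact .out _ _ _ _ _ (entails_of_assnClass_eq hΨ.symm hC.1)
  | case Ψs n φ P i _ ih =>
    intro σ Ψ Ψc e hΨ hC hl hd he
    rw [TransConstraint.sat_append, TransConstraint.sat_cons, Atom.sat_mk_nil] at hC
    rw [Agent.subst_case]
    refine .case _ _ _ _ i (ih hΨ hC.1 hl hd fun a ha => ⟨(he a ha).1, (he a ha).2.1, fun m hm =>
      (he a ha).2.2 m (hm.imp_right fun h => h.imp_left fun h => ?_)⟩)
      (entails_of_assnClass_eq hΨ.symm hC.2.1)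
    rw [Agent.fn_case]; exact Set.mem_iUnion.2 ⟨i, Or.inr h⟩
  | @comL Ψs P Q bP bQ cP cQ ΨP ΨQ Ψ₁ Ψ₂ MP MQ N as x y z CP CQ P' Q' hP hQ hsP hsQ hA₁ hA₂ hfP hfQ
      hyz has ihP ihQ =>
    intro σ Ψ Ψc e hΨ hC hl hd he
    obtain ⟨bP', bQ', ΨP', ΨQ', M, K, k1, k2, k3, k4, k5, Y, hY, k6, k7⟩ :=
      ihP.com ihQ hsP hsQ rfl rfl hP hQ hA₁ hA₂ hfP hfQ hΨ hC
    -- The bound names of the two premises are invisible in a silent action, so their instances are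
    -- chosen afresh; those of the output become the restrictions of the derivative.
    obtain ⟨d, d1, d2, d3⟩ := exists_fresh_list (hY.union ((σ.image_finite P.fn_finite).union
      (σ.image_finite Q.fn_finite))) as.length
    obtain ⟨x', hx'⟩ := (hY.union (σ.image_finite Q.fn_finite)).exists_notMem
    simp only [Set.mem_union, not_or] at d3 hx'
    have t1 := k6 d d1 d2 fun a ha => (d3 a ha).1
    have t2 := k7 [x'] rfl (by simp) (by simpa using hx'.1)
    -- The subject is not in the object, so sending it to a channel term does not change the
    -- transmitted object.
    have hyN : y ∉ supp N := by obtain ⟨_, _, _, _, _, _, _, _, _, _, _, _, h⟩ := hfP; exact h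
    simp only [Action.inst, Action.bnList, Subst.update_same, listMap] at t1 t2
    rw [subst_congr_supp (x := N) (τ := σ.bind as d) fun n hn => Subst.bind_congr fun _ =>
      Subst.update_of_ne _ _ fun h : n = y => hyN (h ▸ hn)] at t1
    simp only [List.not_mem_nil, if_false, if_true] at t2
    have t3 := Trans.comL Ψc _ _ k1 k2 k3 k4 t1 t2 k5 fun a ha => by
      rw [Agent.fn_subst]; exact (d3 a ha).2.2
    obtain ⟨n1, n2, n3⟩ := hsP.names
    obtain ⟨m1, -⟩ := hsQ.names
    simp only [Action.bnList, List.mem_singleton] at n1 n2 m1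
    rw [Agent.subst_par]
    change Trans Ψc _ .tau ((Agent.resList as _).subst (σ.bind [] e))
    rw [Subst.bind_nil, Agent.subst_resList d1 d2, Agent.subst_par,
      Agent.subst_bind_subst1 (x' := x')]
    · exact t3
    · intro n hn hnx ha
      exact has n ha ((m1 n hn).resolve_right hnx)
    · intro n hn hnx h'
      exact hx'.2 (Subst.mem_image.2 ⟨n, (m1 n hn).resolve_right hnx, h'⟩)
    · intro m hm h'
      obtain ⟨n, hn, h'⟩ := Subst.mem_image.1 h'
      rw [Agent.fn_par] at hn
      rcases Agent.mem_fn_com (P := P) (Q := Q) n1 n2 (by simpa using m1) hn.1 hn.2 with hn | hn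
      · exact (d3 m hm).2.1 (Subst.mem_image.2 ⟨n, hn, h'⟩)
      · exact (d3 m hm).2.2 (Subst.mem_image.2 ⟨n, hn, h'⟩)
  | @comR Ψs P Q bP bQ cP cQ ΨP ΨQ Ψ₁ Ψ₂ MP MQ N as x y z CP CQ P' Q' hP hQ hsP hsQ hA₁ hA₂ hfP hfQ
      hyz has ihP ihQ =>
    intro σ Ψ Ψc e hΨ hC hl hd he
    obtain ⟨bP', bQ', ΨP', ΨQ', M, K, k1, k2, k3, k4, k5, Y, hY, k6, k7⟩ :=
      ihP.com ihQ hsP hsQ rfl rfl hP hQ hA₁ hA₂ hfP hfQ hΨ hC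
    obtain ⟨d, d1, d2, d3⟩ := exists_fresh_list (hY.union ((σ.image_finite Q.fn_finite).union
      (σ.image_finite P.fn_finite))) as.length
    obtain ⟨x', hx'⟩ := (hY.union (σ.image_finite P.fn_finite)).exists_notMem
    simp only [Set.mem_union, not_or] at d3 hx'
    have t1 := k7 d d1 d2 fun a ha => (d3 a ha).1
    have t2 := k6 [x'] rfl (by simp) (by simpa using hx'.1)
    have hyN : y ∉ supp N := by obtain ⟨_, _, _, _, _, _, _, _, _, _, _, _, h⟩ := hfQ; exact h
    simp only [Action.inst, Action.bnList, Subst.update_same, listMap] at t1 t2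
    rw [subst_congr_supp (x := N) (τ := σ.bind as d) fun n hn => Subst.bind_congr fun _ =>
      Subst.update_of_ne _ _ fun h : n = y => hyN (h ▸ hn)] at t1
    simp only [List.not_mem_nil, if_false, if_true] at t2
    have t3 := Trans.comR Ψc _ _ k1 k2 k3 k4 t2 t1 (𝔓.chan_symm _ _ _ k5) fun a ha => by
      rw [Agent.fn_subst]; exact (d3 a ha).2.2
    obtain ⟨n1, n2, n3⟩ := hsQ.names
    obtain ⟨m1, -⟩ := hsP.names
    simp only [Action.bnList, List.mem_singleton] at n1 n2 m1
    rw [Agent.subst_par]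
    change Trans Ψc _ .tau ((Agent.resList as _).subst (σ.bind [] e))
    rw [Subst.bind_nil, Agent.subst_resList d1 d2, Agent.subst_par,
      Agent.subst_bind_subst1 (x' := x')]
    · exact t3
    · intro n hn hnx ha
      exact has n ha ((m1 n hn).resolve_right hnx)
    · intro n hn hnx h'
      exact hx'.2 (Subst.mem_image.2 ⟨n, (m1 n hn).resolve_right hnx, h'⟩)
    · intro m hm h'
      obtain ⟨n, hn, h'⟩ := Subst.mem_image.1 h'
      rw [Agent.fn_par] at hn
      rcases Agent.mem_fn_com (P := Q) (Q := P) n1 n2 (by simpa using m1) hn.1.symm hn.2 with hn | hn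
      · exact (d3 m hm).2.1 (Subst.mem_image.2 ⟨n, hn, h'⟩)
      · exact (d3 m hm).2.2 (Subst.mem_image.2 ⟨n, hn, h'⟩)
  | parL Ψs P Q hQ hbQ hs hbn hsubj ih =>
    intro σ Ψ Ψc e hΨ hC hl hd he
    rw [Agent.fn_par] at he
    obtain ⟨d, Φ, k1, k2, k3⟩ := ih.par hs hQ hbQ hΨ hC hl hd he
    rw [Agent.subst_par, Agent.subst_par, Agent.subst_congr (P := Q) fun n hn =>
      Subst.bind_of_notMem σ fun h' => hbn n (Action.mem_bn.2 h') hn]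
    refine .parL _ _ _ k1 k2 k3 fun a ha h' => ?_
    rw [Action.mem_bn, Action.bnList_inst hl] at ha
    rw [Agent.fn_subst] at h'
    obtain ⟨n, hn, h'⟩ := Subst.mem_image.1 h'
    exact (he a ha).2.2 n (Or.inr (Or.inl (Or.inr hn))) h'
  | parR Ψs P Q hQ hbQ hs hbn hsubj ih =>
    intro σ Ψ Ψc e hΨ hC hl hd he
    rw [Agent.fn_par, Set.union_comm] at he
    obtain ⟨d, Φ, k1, k2, k3⟩ := ih.par hs hQ hbQ hΨ hC hl hd he
    rw [Agent.subst_par, Agent.subst_par, Agent.subst_congr (P := P) fun n hn =>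
      Subst.bind_of_notMem σ fun h' => hbn n (Action.mem_bn.2 h') hn]
    refine .parR _ _ _ k1 k2 k3 fun a ha h' => ?_
    rw [Action.mem_bn, Action.bnList_inst hl] at ha
    rw [Agent.fn_subst] at h'
    obtain ⟨n, hn, h'⟩ := Subst.mem_image.1 h'
    exact (he a ha).2.2 n (Or.inr (Or.inl (Or.inr hn))) h'
  | @scope Ψs a P α C P' hs ha haΨ ih =>
    intro σ Ψ Ψc e hΨ hC hl hd he
    have hfinS : α.symSubj.Finite := by cases α <;> simp [Action.symSubj]
    have hfinO : α.objNames.Finite := by cases α <;> simp [Action.objNames, supp_finite]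
    obtain ⟨a', ha'⟩ := ((supp_finite Ψ).union ((supp_finite Ψc).union
      ((σ.image_finite C.fn_finite).union ((σ.image_finite P.fn_finite).union
      ((σ.image_finite (hfinS.union hfinO)).union (e.finite_toSet.union
      ((σ.bind α.bnList e).image_finite P'.fn_finite))))))).exists_notMem
    simp only [Set.mem_union, not_or, Set.mem_ofPred_eq] at ha'
    obtain ⟨a1, a2, a3, a4, a5, a6, a7⟩ := ha'
    rw [Action.mem_symNames, not_or, not_or] at ha
    obtain ⟨i1, i2, i3⟩ := Instantiable.res haΨ ha.1 hΨ hC he ⟨a1, a6, fun A hA n hn _ h' =>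
      a3 (Subst.mem_image.2 ⟨n, ⟨A, hA, hn⟩, h'⟩)⟩
    have t := ih i1 i2 hl hd i3
    rw [Action.inst_congr (τ := σ)
        (fun n hn => Subst.update_of_ne _ _ fun h' : n = a => ha.1 (h' ▸ hn))
        (fun n hn _ => Subst.update_of_ne _ _ fun h' : n = a => ha.2.2 (h' ▸ hn)),
      Agent.subst_congr (P := P') fun n _ => Subst.bind_update σ _ ha.2.1 n] at t
    rw [Agent.subst_res (P := P) (z := a') fun h' => a4 (Subst.image_mono _ Set.sdiff_subset h'),
      Agent.subst_res (P := P') (z := a') fun h' => a7 (Subst.image_mono _ Set.sdiff_subset h')]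
    refine .scope _ _ _ t (fun h' => ?_) a2
    rcases Action.mem_names_inst hl h' with h' | ⟨n, hn, h'⟩
    exacts [a6 h', a5 (Subst.mem_image.2 ⟨n, hn, h'⟩)]
  | @opn Ψs a P y as₁ as₂ N C P' hs haN ha haΨ hay ih =>
    intro σ Ψ Ψc e hΨ hC hl hd he
    -- `a'` is the prescribed instance of the extruded name, found at the position of that name in
    -- the bound list.
    obtain ⟨e₁, a', e₂, rfl, hl₁⟩ : ∃ e₁ a' e₂, e = e₁ ++ a' :: e₂ ∧ e₁.length = as₁.length := by
      have hlt : as₁.length < e.length := by rw [hl]; simp [Action.bnList]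
      refine ⟨e.take as₁.length, e[as₁.length], e.drop (as₁.length + 1), ?_, ?_⟩
      · rw [List.getElem_cons_drop, List.take_append_drop]
      · rw [List.length_take]; omega
    have hl' : (e₁ ++ e₂).length = (Action.out y (as₁ ++ as₂) N).bnList.length := by
      simp only [Action.bnList, List.length_append, List.length_cons] at hl ⊢; omega
    obtain ⟨ha'e, hd'⟩ := List.nodup_cons.1 (List.nodup_middle.1 hd)
    have he' : ∀ m ∈ e₁ ++ e₂, m ∈ e₁ ++ a' :: e₂ := fun m hm => by
      simp only [List.mem_append, List.mem_cons] at hm ⊢; tauto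
    obtain ⟨a1, a2, a3⟩ := he a' (by simp)
    -- Freshness of `a'` is given for the images of names of the environment, the agent and the
    -- subject only; this suffices because the constraint has no other free names.
    obtain ⟨A, C₀, rfl, c1, c2⟩ := hs.fn_constraint (y := y) rfl
    have hr : ∀ n ∈ P.fn, n ≠ a → n ∈ (Agent.res a P).fn := fun n hn hna => by
      rw [Agent.fn_res]; exact ⟨hn, hna⟩
    obtain ⟨i1, i2, i3⟩ := Instantiable.res (P := P) (S := {y}) haΨ hay hΨ hC
      (fun m hm => he m (he' m hm)) ⟨a1, ha'e, fun B hB n hn hna => by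
        rcases List.mem_cons.1 hB with rfl | hB
        · rcases c1 n hn with hn | hn | hn
          exacts [a3 n (Or.inr (Or.inr hn)), a3 n (Or.inl hn), a3 n (Or.inr (Or.inl (hr n hn hna)))]
        · rcases c2 B hB n hn with hn | hn
          exacts [a3 n (Or.inl hn), a3 n (Or.inr (Or.inl (hr n hn hna)))]⟩
    have t := ih i1 i2 hl' hd' i3
    simp only [Action.inst, Action.bnList] at t ⊢
    rw [Subst.update_of_ne _ _ hay.symm] at t
    rw [Agent.subst_res (P := P) (z := a'),
      subst_congr_supp (x := N) fun n _ => Subst.bind_insert σ hl₁ ha n,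
      Agent.subst_congr (P := P') fun n _ => Subst.bind_insert σ hl₁ ha n]
    · refine .opn _ _ _ t ha'e a2 (a3 y (Or.inr (Or.inr rfl))) ?_
      rw [supp_subst]
      refine Subst.mem_image.2 ⟨a, haN, ?_⟩
      rw [Subst.bind_of_notMem _ ha, Subst.update_same, supp_ofName]
      exact rfl
    · intro h'
      obtain ⟨n, hn, h'⟩ := Subst.mem_image.1 h'
      exact a3 n (Or.inr (Or.inl (hr n hn.1 hn.2))) h'
  | rep Ψs P _ ih =>
    intro σ Ψ Ψc e hΨ hC hl hd he
    have t := ih hΨ hC hl hd (by simpa only [Agent.fn_par, Agent.fn_rep, Set.union_self] using he)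
    rw [Agent.subst_par, Agent.subst_rep] at t
    rw [Agent.subst_rep]
    exact .rep _ _ t
  | @alphaOut Ψs P y as N C P' a c hs ha hc hcN hcP ih =>
    intro σ Ψ Ψc e hΨ hC hl hd he
    have hl' : e.length = as.length := by simpa [Action.bnList] using hl
    have t := ih hΨ hC hl' hd he
    simp only [Action.inst, Action.bnList] at t ⊢
    rwa [subst_smul (τ := σ.bind as e) fun n hn =>
        Subst.bind_map_swap σ ha (fun h : n = c => hcN (h ▸ hn)) hl',
      Agent.subst_perm (τ := σ.bind as e) fun n hn =>
        Subst.bind_map_swap σ ha (fun h : n = c => hcP (h ▸ hn)) hl']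
  | @alphaInp Ψs P y x C P' c hs hcP ih =>
    intro σ Ψ Ψc e hΨ hC hl hd he
    obtain ⟨x', rfl⟩ := List.length_eq_one_iff.1 hl
    have t := ih hΨ hC hl hd he
    have h2 : [c] = [x].map (Equiv.swap x c) := by simp
    simp only [Action.inst, Action.bnList] at t ⊢
    rw [h2, Agent.subst_perm (P := P') (τ := σ.bind [x] [x']) fun n hn =>
      Subst.bind_map_swap (a := x) σ (by simp) (fun h : n = c => hcP (h ▸ hn)) hl]
    simpa [listMap] using t

/-! ## Renaming in concrete transitions -/

/-- Name permutation on concrete actions. -/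
def Action.perm (π : Equiv.Perm Name) : Action 𝔓.Term 𝔓.Term → Action 𝔓.Term 𝔓.Term
  | .out M as N => .out (π • M) (as.map π) (π • N)
  | .inp M x => .inp (π • M) (π x)
  | .tau => .tau

theorem Action.names_finite : ∀ α : Action 𝔓.Term 𝔓.Term, α.names.Finite
  | .out M as N => ((supp_finite M).union as.finite_toSet).union (supp_finite N)
  | .inp M x => (supp_finite M).union (Set.finite_singleton x)
  | .tau => Set.finite_empty

theorem Action.mem_names_perm {π : Equiv.Perm Name} {α : Action 𝔓.Term 𝔓.Term} {a : Name} :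
    a ∈ (α.perm π).names ↔ π⁻¹ a ∈ α.names := by
  cases α with
  | out M as N =>
    simp only [perm, names, Set.mem_union, mem_supp_smul_iff, Set.mem_ofPred_eq, mem_map_perm]
  | inp M x =>
    simp only [perm, names, Set.mem_union, mem_supp_smul_iff, Set.mem_singleton_iff,
      Equiv.Perm.inv_eq_iff_eq, eq_comm (a := a)]
  | tau => exact Iff.rfl

theorem Action.mem_bn_perm {π : Equiv.Perm Name} {α : Action 𝔓.Term 𝔓.Term} {a : Name} :
    a ∈ (α.perm π).bn ↔ π⁻¹ a ∈ α.bn := by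
  cases α with
  | out M as N => exact mem_map_perm
  | inp M x =>
    simp only [perm, bn, Set.mem_singleton_iff, Equiv.Perm.inv_eq_iff_eq]
  | tau => exact Iff.rfl

theorem Action.perm_perm (π ρ : Equiv.Perm Name) (α : Action 𝔓.Term 𝔓.Term) :
    (α.perm ρ).perm π = α.perm (π * ρ) := by
  cases α <;> simp [perm, mul_smul]

theorem Action.perm_eq_self {π : Equiv.Perm Name} {α : Action 𝔓.Term 𝔓.Term}
    (h : ∀ n ∈ α.names, π n = n) : α.perm π = α := by
  cases α with
  | out M as N =>
    simp only [perm]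
    rw [smul_eq_self fun n hn => h n (Or.inl (Or.inl hn)), smul_eq_self fun n hn => h n (Or.inr hn),
      List.map_congr_left (g := id) fun n hn => h n (Or.inl (Or.inr hn)), List.map_id]
  | inp M x =>
    simp only [perm]
    rw [smul_eq_self fun n hn => h n (Or.inl hn), h x (Or.inr rfl)]
  | tau => rfl

theorem Agent.perm_subst1 (π : Equiv.Perm Name) (P : Agent 𝔓) (N : 𝔓.Term) (x : Name) :
    (P.subst1 N x).perm π = (P.perm π).subst1 (π • N) (π x) := by
  rw [subst1, subst1, perm_subst (τ := Subst.onFinite P.fn_finite fun n => π • Subst.single x N n)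
    fun n hn => Subst.onFinite_of_mem _ _ hn]
  refine (subst_perm fun n hn => ?_).symm
  rw [Subst.onFinite_of_mem _ _ hn]
  by_cases h : n = x
  · subst h; rw [Subst.single_same, Subst.single_same]
  · rw [Subst.single_of_ne _ h, Subst.single_of_ne _ fun h' => h (π.injective h'),
      NameTerm.smul_ofName]

/-- The bound names of a frame can be made distinct and fresh by a permutation. -/
theorem Agent.exists_perm_frame {P : Agent 𝔓} {b : List Name} {Ψ : 𝔓.Assn}
    (h : (b, Ψ) ∈ P.frame) {X : Set Name} (hX : X.Finite) :
    ∃ (π : Equiv.Perm Name) (d : List Name), (d, π • Ψ) ∈ P.frame ∧ d.Nodup ∧ (∀ n ∈ d, n ∉ X) ∧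
      ∀ n ∈ X, n ∉ b → π n = n := by
  obtain ⟨d, d1, d2, d3⟩ := exists_fresh_list (hX.union (supp_finite Ψ)) b.length
  simp only [Set.mem_union, not_or] at d3
  obtain ⟨π, h1, h2⟩ := exists_perm_listMap d1 d2
  exact ⟨π, d, mem_frame_of_bindEq h (BindEq.rename_perm 𝔓 d1 d2
    (fun m hm hm' => absurd hm' (d3 m hm).2) h1
    fun n hn hb => h2 n hb fun hd => (d3 n hd).2 hn), d2, fun n hn => (d3 n hn).1,
    fun n hn hb => h2 n hb fun hd => (d3 n hd).1 hn⟩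

/-- One permutation must rename both frames, as the entailment between the subjects refers to both.
A subject may contain binders of the partner's frame and is then moved too, which is why freshness
is asserted for the permuted subjects. -/
theorem Agent.exists_perm_frames {P Q : Agent 𝔓} {bP bQ : List Name} {ΨP ΨQ : 𝔓.Assn}
    {M K : 𝔓.Term} (hP : (bP, ΨP) ∈ P.frame) (hQ : (bQ, ΨQ) ∈ Q.frame)
    (hbP : ∀ b ∈ bP, b ∉ bQ ∧ b ∉ Q.fn ∧ b ∉ supp M)
    (hbQ : ∀ b ∈ bQ, b ∉ P.fn ∧ b ∉ supp K) {X : Set Name} (hX : X.Finite) :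
    ∃ (π : Equiv.Perm Name) (dP dQ : List Name), (dP, π • ΨP) ∈ P.frame ∧ (dQ, π • ΨQ) ∈ Q.frame ∧
      dP.Nodup ∧ dQ.Nodup ∧ (∀ n ∈ dP, n ∉ X) ∧ (∀ n ∈ dQ, n ∉ X) ∧
      (∀ n ∈ dP, n ∉ dQ ∧ n ∉ supp (π • M)) ∧ (∀ n ∈ dQ, n ∉ supp (π • K)) ∧
      ∀ n ∈ X, n ∉ bP → n ∉ bQ → π n = n := by
  have hfin := (supp_finite ΨP).union ((supp_finite ΨQ).union ((supp_finite M).union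
    ((supp_finite K).union hX)))
  obtain ⟨dP, d1, d2, d3⟩ := exists_fresh_list hfin bP.length
  obtain ⟨dQ, e1, e2, e3⟩ := exists_fresh_list (hfin.union dP.finite_toSet) bQ.length
  simp only [Set.mem_union, not_or, Set.mem_ofPred_eq] at d3 e3
  have hl : (dP ++ dQ).length = (bP ++ bQ).length := by simp [d1, e1]
  have hd : (dP ++ dQ).Nodup := List.nodup_append.2 ⟨d2, e2, fun a ha b hb h => by
    subst h; exact (e3 a hb).2 ha⟩
  obtain ⟨π, h1, h2⟩ := exists_perm_listMap hl hd
  simp only [List.mem_append, not_or] at h1 h2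
  have hπP : ∀ n ∈ bP, π n = listMap bP dP n := fun n hn => by
    rw [h1 n (Or.inl hn), listMap_append_left _ _ d1 (hbP n hn).1]
  have hπQ : ∀ n ∈ bQ, π n = listMap bQ dQ n := fun n hn => by
    rw [h1 n (Or.inr hn), listMap_append_right _ _ d1 hn]
  -- A name outside the old and the new binders is fixed by `π`, so no new binder can be its image.
  have inv : ∀ n, n ∈ dP ∨ n ∈ dQ → π⁻¹ n ∈ bP ∨ π⁻¹ n ∈ bQ ∨ π⁻¹ n ∈ dP ∨ π⁻¹ n ∈ dQ := by
    intro n hn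
    by_contra hc
    simp only [not_or] at hc
    have := h2 _ ⟨hc.1, hc.2.1⟩ ⟨hc.2.2.1, hc.2.2.2⟩
    rw [show π (π⁻¹ n) = n by simp] at this
    rw [← this] at hc
    exact hn.elim hc.2.2.1 hc.2.2.2
  refine ⟨π, dP, dQ, ?_, ?_, d2, e2, fun n hn => (d3 n hn).2.2.2.2,
    fun n hn => (e3 n hn).1.2.2.2.2, fun n hn => ⟨fun h' => (e3 n h').2 hn, fun h' => ?_⟩,
    fun n hn h' => ?_, fun n hn hb hb' => h2 n ⟨hb, hb'⟩
      ⟨fun h' => (d3 n h').2.2.2.2 hn, fun h' => (e3 n h').1.2.2.2.2 hn⟩⟩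
  · refine mem_frame_of_bindEq hP (BindEq.rename_perm 𝔓 d1 d2
      (fun m hm hm' => absurd hm' (d3 m hm).1) hπP fun n hn hb => h2 n ⟨hb, fun hb' => ?_⟩
        ⟨fun h' => (d3 n h').1 hn, fun h' => (e3 n h').1.1 hn⟩)
    exact (hbQ n hb').1 (mem_fn_of_mem_frame hP hn hb)
  · refine mem_frame_of_bindEq hQ (BindEq.rename_perm 𝔓 e1 e2
      (fun m hm hm' => absurd hm' (e3 m hm).1.2.1) hπQ fun n hn hb => h2 n ⟨fun hb' => ?_, hb⟩
        ⟨fun h' => (d3 n h').2.1 hn, fun h' => (e3 n h').1.2.1 hn⟩)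
    exact (hbP n hb').2.1 (mem_fn_of_mem_frame hQ hn hb)
  · rw [mem_supp_smul_iff] at h'
    rcases inv n (Or.inl hn) with hm | hm | hm | hm
    · exact (hbP _ hm).2.2 h'
    · have h3 := listMap_mem hm e1
      rw [← hπQ _ hm, show π (π⁻¹ n) = n by simp] at h3
      exact (e3 n h3).2 hn
    · exact (d3 _ hm).2.2.1 h'
    · exact (e3 _ hm).1.2.2.1 h'
  · rw [mem_supp_smul_iff] at h'
    rcases inv n (Or.inr hn) with hm | hm | hm | hm
    · have h3 := listMap_mem hm d1
      rw [← hπP _ hm, show π (π⁻¹ n) = n by simp] at h3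
      exact (e3 n hn).2 h3
    · exact (hbQ _ hm).2 h'
    · exact (d3 _ hm).2.2.2.1 h'
    · exact (e3 _ hm).1.2.2.2.1 h'

/-- Composes the renaming of the frames with the permutation carried through the induction. The
binders are fresh for the conclusion of the rule, which therefore cannot tell `ρ` from `π`, although
the data of the premises can. -/
theorem exists_perm_com {Ψ ΨP ΨQ : 𝔓.Assn} {P Q : Agent 𝔓} {bP bQ : List Name} {M K : 𝔓.Term}
    (hP : (bP, ΨP) ∈ P.frame) (hQ : (bQ, ΨQ) ∈ Q.frame)
    (hbP : ∀ b ∈ bP, b ∉ supp Ψ ∧ b ∉ bQ ∧ b ∉ Q.fn ∧ b ∉ supp M ∧ b ∉ P.fn)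
    (hbQ : ∀ b ∈ bQ, b ∉ supp Ψ ∧ b ∉ bP ∧ b ∉ P.fn ∧ b ∉ supp K ∧ b ∉ Q.fn)
    (π : Equiv.Perm Name) {X : Set Name} (hX : X.Finite) :
    ∃ (ρ : Equiv.Perm Name) (dP dQ : List Name), (dP, ρ • ΨP) ∈ (P.perm π).frame ∧
      (dQ, ρ • ΨQ) ∈ (Q.perm π).frame ∧ dP.Nodup ∧ dQ.Nodup ∧ (∀ n ∈ dP, n ∉ X) ∧
      (∀ n ∈ dQ, n ∉ X) ∧ (∀ n ∈ dP, n ∉ dQ ∧ n ∉ supp (ρ • M)) ∧ (∀ n ∈ dQ, n ∉ supp (ρ • K)) ∧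
      ρ • Ψ = π • Ψ ∧ P.perm ρ = P.perm π ∧ Q.perm ρ = Q.perm π ∧
      ∀ R : Agent 𝔓, (∀ n ∈ R.fn, n ∈ P.fn ∨ n ∈ Q.fn) → R.perm ρ = R.perm π := by
  obtain ⟨ρ, dP, dQ, r1, r2, r3, r4, r5, r6, r7, r8, r9⟩ := Agent.exists_perm_frames
    (M := π • M) (K := π • K) (Agent.mem_frame_perm π hP) (Agent.mem_frame_perm π hQ)
    (fun b hb => by
      rw [mem_map_perm] at hb
      simp only [mem_map_perm, Agent.mem_fn_perm, mem_supp_smul_iff]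
      exact ⟨(hbP _ hb).2.1, (hbP _ hb).2.2.1, (hbP _ hb).2.2.2.1⟩)
    (fun b hb => by
      rw [mem_map_perm] at hb
      simp only [Agent.mem_fn_perm, mem_supp_smul_iff]
      exact ⟨(hbQ _ hb).2.2.1, (hbQ _ hb).2.2.2.1⟩)
    (hX.union ((supp_finite (π • Ψ)).union ((P.perm π).fn_finite.union (Q.perm π).fn_finite)))
  have fix : ∀ n, n ∈ supp Ψ ∨ n ∈ P.fn ∨ n ∈ Q.fn → (ρ * π) n = π n := by
    intro n hn
    refine r9 (π n) (Or.inr ?_) ?_ ?_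
    · simpa [mem_supp_smul_iff, Agent.mem_fn_perm] using hn
    · rw [mem_map_perm, show π⁻¹ (π n) = n by simp]
      intro hb; have := hbP _ hb; tauto
    · rw [mem_map_perm, show π⁻¹ (π n) = n by simp]
      intro hb; have := hbQ _ hb; tauto
  simp only [← mul_smul] at r1 r2 r7 r8
  exact ⟨ρ * π, dP, dQ, r1, r2, r3, r4, fun n hn h => r5 n hn (Or.inl h),
    fun n hn h => r6 n hn (Or.inl h), r7, r8, smul_congr_supp fun n hn => fix n (Or.inl hn),
    Agent.perm_congr fun n hn => fix n (Or.inr (Or.inl hn)),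
    Agent.perm_congr fun n hn => fix n (Or.inr (Or.inr hn)),
    fun R hR => Agent.perm_congr fun n hn => fix n (Or.inr (hR n hn))⟩

/-- Here the action is part of the conclusion; it and the derivative are preserved because the frame
binders are fresh for the action. -/
theorem exists_perm_par {Ψ Ψ' ΨQ : 𝔓.Assn} {P Q P' : Agent 𝔓} {bQ : List Name}
    {α : Action 𝔓.Term 𝔓.Term} (hQ : (bQ, ΨQ) ∈ Q.frame)
    (hbQ : ∀ b ∈ bQ, b ∉ supp Ψ ∧ b ∉ P.fn ∧ b ∉ α.names) (h : Trans Ψ' P α P')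
    (π : Equiv.Perm Name) {X : Set Name} (hX : X.Finite) :
    ∃ (ρ : Equiv.Perm Name) (d : List Name), (d, ρ • ΨQ) ∈ (Q.perm π).frame ∧ d.Nodup ∧
      (∀ n ∈ d, n ∉ X ∧ n ∉ (α.perm π).names) ∧ ρ • Ψ = π • Ψ ∧ P.perm ρ = P.perm π ∧
      α.perm ρ = α.perm π ∧ P'.perm ρ = P'.perm π := by
  obtain ⟨ρ, d, r1, r2, r3, r4⟩ := Agent.exists_perm_frame (Agent.mem_frame_perm π hQ)
    (hX.union (((α.perm π).names_finite).union ((supp_finite (π • Ψ)).union ((P.perm π).fn_finite))))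
  have fix : ∀ n, n ∈ α.names ∨ n ∈ supp Ψ ∨ n ∈ P.fn → (ρ * π) n = π n := by
    intro n hn
    refine r4 (π n) (Or.inr ?_) ?_
    · simpa [mem_supp_smul_iff, Agent.mem_fn_perm, Action.mem_names_perm] using hn
    · rw [mem_map_perm, show π⁻¹ (π n) = n by simp]
      intro hb; have := hbQ _ hb; tauto
  rw [← mul_smul] at r1
  refine ⟨ρ * π, d, r1, r2, fun n hn => ⟨fun h => r3 n hn (Or.inl h),
    fun h => r3 n hn (Or.inr (Or.inl h))⟩, smul_congr_supp fun n hn => fix n (Or.inr (Or.inl hn)),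
    Agent.perm_congr fun n hn => fix n (Or.inr (Or.inr hn)), ?_,
    Agent.perm_congr fun n hn => fix n ?_⟩
  · have : α.perm (π⁻¹ * (ρ * π)) = α := Action.perm_eq_self fun n hn => by
      rw [Equiv.Perm.mul_apply, fix n (Or.inl hn)]; simp
    conv_rhs => rw [← this]
    rw [Action.perm_perm, mul_inv_cancel_left]
  · rcases h.names.1 n hn with h' | h'
    · exact Or.inr (Or.inr h')
    · left
      cases α with
      | out M as N => exact Or.inl (Or.inr h')
      | inp M x => exact Or.inr (by simpa [Action.bnList] using h')
      | tau => exact absurd h' List.not_mem_nil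

/-- Induction on transitions that provides distinct fresh bound names. The premises of the
hypotheses may be used for all finite sets of names to be avoided. -/
theorem Trans.strong_induction
    {Claim : Set Name → 𝔓.Assn → Agent 𝔓 → Action 𝔓.Term 𝔓.Term → Agent 𝔓 → Prop}
    (inp : ∀ {X : Set Name}, X.Finite → ∀ (Ψ : 𝔓.Assn) (M K : 𝔓.Term) (x : Name) (P : Agent 𝔓),
      𝔓.entails Ψ (𝔓.chanEq M K) → Claim X Ψ (Agent.inp M x P) (.inp K x) P)
    (out : ∀ {X : Set Name}, X.Finite → ∀ (Ψ : 𝔓.Assn) (M K N : 𝔓.Term) (P : Agent 𝔓),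
      𝔓.entails Ψ (𝔓.chanEq M K) → Claim X Ψ (Agent.out M N P) (.out K [] N) P)
    (case : ∀ {X : Set Name}, X.Finite → ∀ (Ψ : 𝔓.Assn) (n : ℕ) (φ : Fin n → 𝔓.Cond)
      (P : Fin n → Agent 𝔓) (i : Fin n) (α : Action 𝔓.Term 𝔓.Term) (P' : Agent 𝔓),
      (∀ Y : Set Name, Y.Finite → Claim Y Ψ (P i) α P') → 𝔓.entails Ψ (φ i) →
      Claim X Ψ (Agent.case n φ P) α P')
    (comL : ∀ {X : Set Name}, X.Finite → ∀ (Ψ : 𝔓.Assn) (P Q : Agent 𝔓) (bP bQ : List Name)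
      (ΨP ΨQ : 𝔓.Assn) (M K N : 𝔓.Term) (as : List Name) (x : Name) (P' Q' : Agent 𝔓),
      (bP, ΨP) ∈ P.frame → (bQ, ΨQ) ∈ Q.frame → bP.Nodup → bQ.Nodup → (∀ b ∈ bP, b ∉ X) →
      (∀ b ∈ bQ, b ∉ X) → (∀ b ∈ bP, b ∉ bQ ∧ b ∉ supp M) → (∀ b ∈ bQ, b ∉ supp K) →
      (∀ Y : Set Name, Y.Finite → Claim Y (𝔓.comp ΨQ Ψ) P (.out M as N) P') →
      (∀ Y : Set Name, Y.Finite → Claim Y (𝔓.comp ΨP Ψ) Q (.inp K x) Q') →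
      𝔓.entails (𝔓.comp (𝔓.comp Ψ ΨP) ΨQ) (𝔓.chanEq M K) → (∀ a ∈ as, a ∉ Q.fn) →
      Claim X Ψ (P.par Q) .tau (Agent.resList as (P'.par (Q'.subst1 N x))))
    (comR : ∀ {X : Set Name}, X.Finite → ∀ (Ψ : 𝔓.Assn) (P Q : Agent 𝔓) (bP bQ : List Name)
      (ΨP ΨQ : 𝔓.Assn) (M K N : 𝔓.Term) (as : List Name) (x : Name) (P' Q' : Agent 𝔓),
      (bP, ΨP) ∈ P.frame → (bQ, ΨQ) ∈ Q.frame → bP.Nodup → bQ.Nodup → (∀ b ∈ bP, b ∉ X) →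
      (∀ b ∈ bQ, b ∉ X) → (∀ b ∈ bP, b ∉ bQ ∧ b ∉ supp K) → (∀ b ∈ bQ, b ∉ supp M) →
      (∀ Y : Set Name, Y.Finite → Claim Y (𝔓.comp ΨQ Ψ) P (.inp K x) P') →
      (∀ Y : Set Name, Y.Finite → Claim Y (𝔓.comp ΨP Ψ) Q (.out M as N) Q') →
      𝔓.entails (𝔓.comp (𝔓.comp Ψ ΨP) ΨQ) (𝔓.chanEq M K) → (∀ a ∈ as, a ∉ P.fn) →
      Claim X Ψ (P.par Q) .tau (Agent.resList as ((P'.subst1 N x).par Q')))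
    (parL : ∀ {X : Set Name}, X.Finite → ∀ (Ψ : 𝔓.Assn) (P Q : Agent 𝔓) (bQ : List Name)
      (ΨQ : 𝔓.Assn) (α : Action 𝔓.Term 𝔓.Term) (P' : Agent 𝔓), (bQ, ΨQ) ∈ Q.frame → bQ.Nodup →
      (∀ b ∈ bQ, b ∉ X ∧ b ∉ α.names) →
      (∀ Y : Set Name, Y.Finite → Claim Y (𝔓.comp ΨQ Ψ) P α P') → (∀ a ∈ α.bn, a ∉ Q.fn) →
      Claim X Ψ (P.par Q) α (P'.par Q))
    (parR : ∀ {X : Set Name}, X.Finite → ∀ (Ψ : 𝔓.Assn) (P Q : Agent 𝔓) (bP : List Name)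
      (ΨP : 𝔓.Assn) (α : Action 𝔓.Term 𝔓.Term) (Q' : Agent 𝔓), (bP, ΨP) ∈ P.frame → bP.Nodup →
      (∀ b ∈ bP, b ∉ X ∧ b ∉ α.names) →
      (∀ Y : Set Name, Y.Finite → Claim Y (𝔓.comp ΨP Ψ) Q α Q') → (∀ a ∈ α.bn, a ∉ P.fn) →
      Claim X Ψ (P.par Q) α (P.par Q'))
    (scope : ∀ {X : Set Name}, X.Finite → ∀ (Ψ : 𝔓.Assn) (b : Name) (P : Agent 𝔓)
      (α : Action 𝔓.Term 𝔓.Term) (P' : Agent 𝔓), b ∉ X → b ∉ α.names →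
      (∀ Y : Set Name, Y.Finite → Claim Y Ψ P α P') →
      Claim X Ψ (Agent.res b P) α (Agent.res b P'))
    (opn : ∀ {X : Set Name}, X.Finite → ∀ (Ψ : 𝔓.Assn) (b : Name) (P : Agent 𝔓)
      (M N : 𝔓.Term) (as₁ as₂ : List Name) (P' : Agent 𝔓), b ∉ X →
      (∀ Y : Set Name, Y.Finite → Claim Y Ψ P (.out M (as₁ ++ as₂) N) P') →
      b ∉ as₁ ++ as₂ → b ∉ supp M → b ∈ supp N →
      Claim X Ψ (Agent.res b P) (.out M (as₁ ++ b :: as₂) N) P')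
    (rep : ∀ {X : Set Name}, X.Finite → ∀ (Ψ : 𝔓.Assn) (P : Agent 𝔓)
      (α : Action 𝔓.Term 𝔓.Term) (P' : Agent 𝔓),
      (∀ Y : Set Name, Y.Finite → Claim Y Ψ (P.par P.rep) α P') → Claim X Ψ P.rep α P')
    (alphaOut : ∀ {X : Set Name}, X.Finite → ∀ (Ψ : 𝔓.Assn) (P : Agent 𝔓) (M : 𝔓.Term)
      (as : List Name) (N : 𝔓.Term) (P' : Agent 𝔓) (a c : Name),
      a ∈ as → c ∉ as → c ∉ supp N → c ∉ P'.fn → Claim X Ψ P (.out M as N) P' →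
      Claim X Ψ P (.out M (as.map (Equiv.swap a c)) (Equiv.swap a c • N))
        (P'.perm (Equiv.swap a c)))
    (alphaInp : ∀ {X : Set Name}, X.Finite → ∀ (Ψ : 𝔓.Assn) (P : Agent 𝔓) (M : 𝔓.Term)
      (x : Name) (P' : Agent 𝔓) (c : Name), c ∉ P'.fn → Claim X Ψ P (.inp M x) P' →
      Claim X Ψ P (.inp M c) (P'.perm (Equiv.swap x c)))
    {Ψ : 𝔓.Assn} {P P' : Agent 𝔓} {α : Action 𝔓.Term 𝔓.Term} (h : Trans Ψ P α P') :
    ∀ {X : Set Name}, X.Finite → Claim X Ψ P α P' := by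
  -- Proving the claim for all permuted transitions lets each rule rename its binders before
  -- appealing to the induction hypothesis.
  suffices key : ∀ (π : Equiv.Perm Name) {X : Set Name}, X.Finite →
      Claim X (π • Ψ) (P.perm π) (α.perm π) (P'.perm π) by
    intro X hX
    have := key 1 hX
    rwa [one_smul, Agent.perm_one, Agent.perm_one, Action.perm_eq_self fun _ _ => rfl] at this
  induction h with
  | inp Ψ M K x P hent =>
    intro π X hX
    have := 𝔓.smul_entails π _ _ hent
    rw [𝔓.smul_chanEq] at this
    rw [Agent.perm_inp]
    exact inp hX _ _ _ _ _ this
  | out Ψ M K N P hent =>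
    intro π X hX
    have := 𝔓.smul_entails π _ _ hent
    rw [𝔓.smul_chanEq] at this
    rw [Agent.perm_out]
    exact out hX _ _ _ _ _ this
  | case Ψ n φ P i _ hent ih =>
    intro π X hX
    rw [Agent.perm_case]
    exact case hX _ _ _ _ i _ _ (fun Y hY => ih π hY) (𝔓.smul_entails π _ _ hent)
  | @comL Ψ P Q bP bQ ΨP ΨQ M K N as x P' Q' hP hQ hbP hbQ ht1 ht2 hent has ih1 ih2 =>
    intro π X hX
    -- A silent derivative has only names of the two agents, so it is permuted alike by `ρ` and by
    -- `π`.
    have hR := (Trans.comL Ψ P Q hP hQ hbP hbQ ht1 ht2 hent has).names.1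
    simp only [Action.bnList, List.not_mem_nil, or_false, Agent.fn_par] at hR
    obtain ⟨ρ, dP, dQ, r1, r2, r3, r4, r5, r6, r7, r8, rΨ, rP, rQ, rR⟩ :=
      exists_perm_com hP hQ hbP hbQ π hX
    have i1 := fun Y hY => ih1 ρ (X := Y) hY
    have i2 := fun Y hY => ih2 ρ (X := Y) hY
    have h3 := 𝔓.smul_entails ρ _ _ hent
    simp only [𝔓.smul_comp, rΨ, rP, rQ, 𝔓.smul_chanEq] at i1 i2 h3
    rw [← rR _ hR, Agent.perm_par, Agent.perm_resList, Agent.perm_par, Agent.perm_subst1]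
    refine comL hX _ _ _ _ _ _ _ _ _ _ _ _ _ _ r1 r2 r3 r4 r5 r6 r7 r8 i1 i2 h3 fun a ha => ?_
    rw [mem_map_perm] at ha
    rw [← rQ, Agent.mem_fn_perm]
    exact has _ ha
  | @comR Ψ P Q bP bQ ΨP ΨQ M K N as x P' Q' hP hQ hbP hbQ ht1 ht2 hent has ih1 ih2 =>
    intro π X hX
    have hR := (Trans.comR Ψ P Q hP hQ hbP hbQ ht1 ht2 hent has).names.1
    simp only [Action.bnList, List.not_mem_nil, or_false, Agent.fn_par] at hR
    obtain ⟨ρ, dP, dQ, r1, r2, r3, r4, r5, r6, r7, r8, rΨ, rP, rQ, rR⟩ :=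
      exists_perm_com hP hQ hbP hbQ π hX
    have i1 := fun Y hY => ih1 ρ (X := Y) hY
    have i2 := fun Y hY => ih2 ρ (X := Y) hY
    have h3 := 𝔓.smul_entails ρ _ _ hent
    simp only [𝔓.smul_comp, rΨ, rP, rQ, 𝔓.smul_chanEq] at i1 i2 h3
    rw [← rR _ hR, Agent.perm_par, Agent.perm_resList, Agent.perm_par, Agent.perm_subst1]
    refine comR hX _ _ _ _ _ _ _ _ _ _ _ _ _ _ r1 r2 r3 r4 r5 r6 r7 r8 i1 i2 h3 fun a ha => ?_
    rw [mem_map_perm] at ha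
    rw [← rP, Agent.mem_fn_perm]
    exact has _ ha
  | @parL Ψ P Q bQ ΨQ α P' hQ hbQ ht hbn ih =>
    intro π X hX
    obtain ⟨ρ, d, r1, r2, r3, rΨ, rP, rα, rP'⟩ := exists_perm_par hQ hbQ ht π hX
    have i1 := fun Y hY => ih ρ (X := Y) hY
    simp only [𝔓.smul_comp, rΨ, rP, rα, rP'] at i1
    rw [Agent.perm_par, Agent.perm_par]
    refine parL hX _ _ _ _ _ _ _ r1 r2 r3 i1 fun a ha => ?_
    rw [Action.mem_bn_perm] at ha
    rw [Agent.mem_fn_perm]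
    exact hbn _ ha
  | @parR Ψ P Q bP ΨP α Q' hP hbP ht hbn ih =>
    intro π X hX
    obtain ⟨ρ, d, r1, r2, r3, rΨ, rQ, rα, rQ'⟩ := exists_perm_par hP hbP ht π hX
    have i1 := fun Y hY => ih ρ (X := Y) hY
    simp only [𝔓.smul_comp, rΨ, rQ, rα, rQ'] at i1
    rw [Agent.perm_par, Agent.perm_par]
    refine parR hX _ _ _ _ _ _ _ r1 r2 r3 i1 fun a ha => ?_
    rw [Action.mem_bn_perm] at ha
    rw [Agent.mem_fn_perm]
    exact hbn _ ha
  | @scope Ψ b P α P' ht hb hbΨ ih =>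
    intro π X hX
    obtain ⟨c, hc⟩ := (hX.union (((α.perm π).names_finite).union ((supp_finite (π • Ψ)).union
      ((P.perm π).fn_finite.union (P'.perm π).fn_finite)))).exists_notMem
    simp only [Set.mem_union, not_or] at hc
    obtain ⟨c1, c2, c3, c4, c5⟩ := hc
    have hb' : π b ∉ (α.perm π).names := by simpa [Action.mem_names_perm] using hb
    have i1 := fun Y hY => ih (Equiv.swap (π b) c * π) (X := Y) hY
    rw [mul_smul, swap_smul_of_notMem_supp (by simpa [mem_supp_smul_iff] using hbΨ) c3,
      ← Action.perm_perm, Action.perm_eq_self (π := Equiv.swap (π b) c) fun n hn =>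
        Equiv.swap_apply_of_ne_of_ne (fun h => hb' (h ▸ hn)) (fun h => c2 (h ▸ hn)),
      ← Agent.perm_perm, ← Agent.perm_perm] at i1
    rw [Agent.perm_res, Agent.perm_res, Agent.res_rename c4, Agent.res_rename c5]
    exact scope hX _ _ _ _ _ c1 c2 i1
  | @opn Ψ b P M N as₁ as₂ P' ht hb hbΨ hbM hbN ih =>
    intro π X hX
    obtain ⟨c, hc⟩ := (hX.union ((supp_finite (π • M)).union ((supp_finite (π • N)).union
      (((as₁ ++ as₂).map π).finite_toSet.union ((supp_finite (π • Ψ)).union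
      ((P.perm π).fn_finite.union (P'.perm π).fn_finite)))))).exists_notMem
    simp only [Set.mem_union, not_or, Set.mem_ofPred_eq] at hc
    obtain ⟨c1, c2, c3, c4, c5, c6, c7⟩ := hc
    have hb' : π b ∉ (as₁ ++ as₂).map π := by simpa [mem_map_perm] using hb
    have hcb : c ≠ π b := by
      rintro rfl; exact c3 (by simpa [mem_supp_smul_iff] using hbN)
    have hmap : ∀ l : List Name, (∀ n ∈ l, n ≠ π b ∧ n ≠ c) → l.map (Equiv.swap (π b) c) = l :=
      fun l hl => (List.map_congr_left fun n hn =>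
        Equiv.swap_apply_of_ne_of_ne (hl n hn).1 (hl n hn).2).trans (List.map_id _)
    have hl : ∀ n ∈ (as₁ ++ as₂).map π, n ≠ π b ∧ n ≠ c := fun n hn =>
      ⟨fun h => hb' (h ▸ hn), fun h => c4 (h ▸ hn)⟩
    have i1 := fun Y hY => ih (Equiv.swap (π b) c * π) (X := Y) hY
    rw [mul_smul, swap_smul_of_notMem_supp (by simpa [mem_supp_smul_iff] using hbΨ) c5,
      ← Action.perm_perm, ← Agent.perm_perm, ← Agent.perm_perm] at i1
    simp only [Action.perm] at i1
    rw [hmap _ hl, swap_smul_of_notMem_supp (by simpa [mem_supp_smul_iff] using hbM) c2,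
      List.map_append] at i1
    rw [List.map_append] at hb' c4 hl
    have h1 := opn hX _ c _ _ _ _ _ _ c1 i1 c4 c2
      (by rw [mem_supp_smul_iff, Equiv.swap_inv, Equiv.swap_apply_right]
          simpa [mem_supp_smul_iff] using hbN)
    rw [← Agent.res_rename c6] at h1
    -- The restricted name was replaced by the fresh `c`, but it is visible in the action; renaming
    -- the extruded `c` back to `π b` recovers the required action and derivative.
    have h2 := alphaOut hX _ _ _ _ _ _ c (π b) (by simp)
      (by simp only [List.mem_append, List.mem_cons, not_or] at hb' ⊢
          exact ⟨hb'.1, hcb.symm, hb'.2⟩)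
      (by rwa [mem_supp_smul_iff, Equiv.swap_inv, Equiv.swap_apply_left])
      (by rwa [Agent.mem_fn_perm, Equiv.swap_inv, Equiv.swap_apply_left]) h1
    rw [Equiv.swap_comm c, List.map_append, List.map_cons, Equiv.swap_apply_right,
      hmap _ fun n hn => hl n (List.mem_append_left _ hn),
      hmap _ fun n hn => hl n (List.mem_append_right _ hn), Agent.perm_perm, ← mul_smul,
      Equiv.swap_mul_self, one_smul, Agent.perm_one] at h2
    simp only [Action.perm, List.map_append, List.map_cons, Agent.perm_res]
    exact h2
  | rep Ψ P _ ih =>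
    intro π X hX
    rw [Agent.perm_rep]
    refine rep hX _ _ _ _ fun Y hY => ?_
    have := ih π hY
    rwa [Agent.perm_par, Agent.perm_rep] at this
  | @alphaOut Ψ P M as N P' a c _ ha hc hcN hcP ih =>
    intro π X hX
    have := alphaOut hX _ _ _ _ _ _ (π a) (π c) (List.mem_map_of_mem ha)
      (by simpa [mem_map_perm] using hc) (by simpa [mem_supp_smul_iff] using hcN)
      (by simpa [Agent.mem_fn_perm] using hcP) (ih π hX)
    rw [Agent.perm_perm, ← mul_smul, List.map_map, ← Equiv.Perm.coe_mul,
      ← Equiv.mul_swap_eq_swap_mul, ← Agent.perm_perm, mul_smul, Equiv.Perm.coe_mul,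
      ← List.map_map] at this
    exact this
  | @alphaInp Ψ P M x P' c _ hcP ih =>
    intro π X hX
    have := alphaInp hX _ _ _ _ _ (π c) (by simpa [Agent.mem_fn_perm] using hcP) (ih π hX)
    rw [Agent.perm_perm, ← Equiv.mul_swap_eq_swap_mul, ← Agent.perm_perm] at this
    exact this

/-! ## Symbolic transitions behind concrete ones -/

theorem Subst.bind_map_right (σ : Subst 𝔓.Term) {c e : List Name} {a b n : Name}
    (hl : e.length = c.length) (h : n ∉ c → a ∉ supp (σ n) ∧ b ∉ supp (σ n)) :
    σ.bind c (e.map (Equiv.swap a b)) n = Equiv.swap a b • σ.bind c e n := by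
  by_cases hn : n ∈ c
  · rw [bind_of_mem _ hn, bind_of_mem _ hn, listMap_map_right _ _ _ hn hl, NameTerm.smul_ofName]
  · rw [bind_of_notMem _ hn, bind_of_notMem _ hn, swap_smul_of_notMem_supp (h hn).1 (h hn).2]

/-- The symbolic transition `P —αs,C→ P₁`, with bound names and subject fresh for `X`, has the
instance `Pσ —α→ P''` for the solution `(σ', Ψ)` of `C`, which differs from `(σ, Ψ)` at most at the
subject. -/
structure IsLift (X : Set Name) (Ψs : 𝔓.Assn) (σ : Subst 𝔓.Term) (Ψ : 𝔓.Assn) (P : Agent 𝔓)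
    (α : Action 𝔓.Term 𝔓.Term) (P'' : Agent 𝔓) (αs : Action Name 𝔓.Term) (C : TransConstraint 𝔓)
    (P₁ : Agent 𝔓) (σ' : Subst 𝔓.Term) : Prop where
  trans : SymTrans Ψs P αs C P₁
  eq_of_notMem : ∀ n ∉ αs.symSubj, σ' n = σ n
  length_eq : α.bnList.length = αs.bnList.length
  bn_notMem : ∀ a ∈ αs.bnList, a ∉ X
  subj_notMem : ∀ y ∈ αs.symSubj, y ∉ X ∧ y ∉ αs.bnList
  action_eq : α = αs.inst σ' α.bnList
  sat : C.Sat σ' Ψ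
  agent_eq : P'' = P₁.subst (σ'.bind αs.bnList α.bnList)
  nodup : α.bnList.Nodup
  bn_notMem_subst : ∀ a ∈ α.bnList, ∀ n, n ∈ P₁.fn ∨ n ∈ αs.objNames → n ∉ αs.bnList →
    a ∉ supp (σ n)

/-- Every transition of an instance of an agent is an instance of a symbolic one. -/
def HasLifts (X : Set Name) (Ψc : 𝔓.Assn) (Pc : Agent 𝔓) (α : Action 𝔓.Term 𝔓.Term)
    (P'' : Agent 𝔓) : Prop :=
  ∀ (Ψs : 𝔓.Assn) (σ : Subst 𝔓.Term) (Ψ : 𝔓.Assn) (P : Agent 𝔓), supp Ψs ⊆ X → σ.support ⊆ X →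
    supp Ψ ⊆ X → P.fn ⊆ X → P.WF → Pc = P.subst σ →
    assnClass Ψc = assnClass (𝔓.comp (subst Ψs σ) Ψ) →
    ∃ αs C P₁ σ', IsLift X Ψs σ Ψ P α P'' αs C P₁ σ'

section

variable {X Y : Set Name} {Ψs Ψ : 𝔓.Assn} {σ σ' : Subst 𝔓.Term} {P P₁ P'' : Agent 𝔓}
  {α : Action 𝔓.Term 𝔓.Term} {αs : Action Name 𝔓.Term} {C : TransConstraint 𝔓}

theorem IsLift.notMem_subst_subj (h : IsLift X Ψs σ Ψ P α P'' αs C P₁ σ') {b y : Name}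
    (hb : b ∉ α.names) (hy : y ∈ αs.symSubj) : b ∉ supp (σ' y) := by
  rw [h.action_eq] at hb
  intro h'
  refine hb ?_
  cases αs with
  | out z as N =>
    obtain rfl : y = z := hy
    exact Or.inl (Or.inl h')
  | inp z x =>
    obtain rfl : y = z := hy
    exact Or.inl h'
  | tau => exact absurd hy (by simp [Action.symSubj])

theorem IsLift.eq_on_agent (h : IsLift X Ψs σ Ψ P α P'' αs C P₁ σ') (hP : P.fn ⊆ X) {n : Name}
    (hn : n ∈ P₁.fn ∨ n ∈ αs.objNames) : σ' n = σ n := by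
  refine h.eq_of_notMem n fun hy => ?_
  have h1 : n ∈ P.fn ∨ n ∈ αs.bnList := hn.elim (h.trans.names.1 n) (h.trans.names.2.1 n)
  exact h1.elim (fun h1 => (h.subj_notMem n hy).1 (hP h1)) (h.subj_notMem n hy).2

/-- Binders fresh for `σ`, `Ψ`, the symbolic subject and its value need no renaming: the
substitution at hand is already a fresh instance of them. -/
theorem IsLift.sat_new (h : IsLift X Ψs σ Ψ P α P'' αs C P₁ σ') {bs : List Name}
    (hb : ∀ b ∈ bs, b ∉ σ.support ∧ b ∉ supp Ψ ∧ b ∉ αs.symSubj ∧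
      ∀ y ∈ αs.symSubj, b ∉ supp (σ' y)) : TransConstraint.Sat σ' Ψ (C.new bs) := by
  refine (TransConstraint.sat_new_iff (τ := σ') (g := id) fun A _ => .refl fun a ha => ?_).2 h.sat
  obtain ⟨h1, h2, h3, h4⟩ := hb a ha
  refine ⟨by rw [h.eq_of_notMem a h3, Subst.eq_ofName_of_notMem_support h1], h2,
    fun m _ hm h' => ?_⟩
  by_cases hy : m ∈ αs.symSubj
  · exact h4 m hy h'
  · rw [h.eq_of_notMem m hy] at h'
    exact hm (Subst.eq_of_mem_supp h1 h' ▸ ha)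

/-- Passes a lift through a rule that leaves the action unchanged and puts binders in front of the
constraint, as in the parallel and scope rules. What depends on the rule is the symbolic transition
and the derivative. -/
theorem IsLift.new (h : IsLift Y Ψs σ Ψ P α P'' αs C P₁ σ') (hXY : X ⊆ Y) {bs : List Name}
    (hb : ∀ b ∈ bs, b ∉ σ.support ∧ b ∉ supp Ψ ∧ b ∈ Y ∧ b ∉ α.names) {Ψt : 𝔓.Assn}
    {R R₁ R'' : Agent 𝔓} (ht : SymTrans Ψt R αs (C.new bs) R₁)
    (hR : R'' = R₁.subst (σ'.bind αs.bnList α.bnList))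
    (hc : ∀ a ∈ α.bnList, ∀ n ∈ R₁.fn, n ∉ αs.bnList → a ∉ supp (σ n)) :
    IsLift X Ψt σ Ψ R α R'' αs (C.new bs) R₁ σ' where
  trans := ht
  eq_of_notMem := h.eq_of_notMem
  length_eq := h.length_eq
  bn_notMem a ha h' := h.bn_notMem a ha (hXY h')
  subj_notMem y hy := ⟨fun h' => (h.subj_notMem y hy).1 (hXY h'), (h.subj_notMem y hy).2⟩
  action_eq := h.action_eq
  sat := h.sat_new fun b hb' => ⟨(hb b hb').1, (hb b hb').2.1,
    fun hy => (h.subj_notMem b hy).1 (hb b hb').2.2.1,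
    fun _ hy => h.notMem_subst_subj (hb b hb').2.2.2 hy⟩
  agent_eq := hR
  nodup := h.nodup
  bn_notMem_subst a ha n hn hn' := hn.elim (fun hn => hc a ha n hn hn')
    fun hn => h.bn_notMem_subst a ha n (Or.inr hn) hn'

/-- The subject conjunct of a lifted transition. -/
theorem IsLift.exists_subj (h : IsLift X Ψs σ Ψ P α P'' αs C P₁ σ') (hP : P.WF) {y : Name}
    (hy : αs.symSubj = {y}) {bP : List Name} {ΨP : 𝔓.Assn} (hf : (bP, ΨP) ∈ P.frame)
    (hd : bP.Nodup) (hb : ∀ b ∈ bP, b ∉ supp Ψs ∧ b ∉ P.fn ∧ b ≠ y ∧ b ∉ σ.support ∧ b ∉ supp Ψ ∧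
      b ∉ supp (σ' y)) (hyΨs : y ∉ supp Ψs) (hyP : y ∉ P.fn) (hyΨP : y ∉ supp ΨP)
    {Z : Set Name} (hZ : Z.Finite) :
    ∃ c b Ψ₁ M CP, C = chanAtom c Ψ₁ M (NameTerm.ofName y) :: CP ∧ (b, ΨP) ∈ P.frame ∧
      (∀ n ∈ b, n ∈ c) ∧ y ∉ supp M ∧ (∀ n ∈ supp M, n ∈ P.fn ∨ n ∈ c) ∧
      AssnEq Ψ₁ (𝔓.comp Ψs ΨP) ∧ (∀ n ∈ c, n ∈ bP ∨ n ∉ Z) ∧ TransConstraint.Sat σ Ψ CP ∧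
      𝔓.entails (𝔓.comp (subst (𝔓.comp Ψs ΨP) σ) Ψ) (𝔓.chanEq (subst M σ) (σ' y)) := by
  have hy' : y ∈ αs.symSubj := by rw [hy]; rfl
  have hne : ∀ {n}, n ≠ y → σ' n = σ n := fun hn => h.eq_of_notMem _ (by rwa [hy])
  obtain ⟨A, CP, c, b, Ψ₁, M, rfl, h1, h2⟩ := h.trans.exists_subjAtom_of_mem_frame hP hy' hf hd
    (fun n hn => ⟨(hb n hn).1, (hb n hn).2.1, (hb n hn).2.2.1⟩) (hZ.union
      ((Set.finite_singleton y).union (σ.support_finite.union ((supp_finite Ψ).union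
      (supp_finite (σ' y))))))
  simp only [Set.mem_union, not_or, Set.mem_singleton_iff] at h2
  have hc : ∀ n ∈ c, n ≠ y ∧ n ∉ σ.support ∧ n ∉ supp Ψ ∧ n ∉ supp (σ' y) := fun n hn =>
    (h2 n hn).elim (fun h' => (hb n h').2.2) fun h' => h'.2
  obtain ⟨hA, hCP⟩ := TransConstraint.sat_cons.1 h.sat
  refine ⟨c, b, Ψ₁, M, CP, by rw [h1.eq], h1.mem_frame, h1.subset, h1.notMem, h1.mem_of_mem_term,
    h1.assnEq, fun n hn => (h2 n hn).imp_right And.left, fun B hB => ?_, ?_⟩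
  · obtain ⟨A', C₀, h3, -, h4⟩ := h.trans.fn_constraint hy'
    obtain ⟨-, rfl⟩ := List.cons.inj h3
    refine (Atom.sat_congr fun n hn => hne ?_).2 (hCP B hB)
    rintro rfl
    exact (h4 B hB n hn).elim hyΨs hyP
  · rw [h1.eq, chanAtom, Atom.sat_mk_iff (τ := σ') (g := id) rfl (.refl fun a ha => ?_),
      𝔓.subst_chanEq, 𝔓.subst_ofName,
      subst_congr_supp (x := M) fun n hn => hne fun h' => h1.notMem (h' ▸ hn)] at hA
    · refine entails_of_assnClass_eq ?_ hA
      have hΨ : subst (𝔓.comp Ψs ΨP) σ' = subst (𝔓.comp Ψs ΨP) σ := subst_congr_supp fun n hn =>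
        hne fun h' => (supp_comp_subset _ _ hn).elim (fun hn => hyΨs (h' ▸ hn))
          fun hn => hyΨP (h' ▸ hn)
      rw [assnClass_comp, assnClass_comp, (h1.assnEq.subst σ').assnClass_eq, hΨ]
    · obtain ⟨c1, c2, c3, c4⟩ := hc a ha
      refine ⟨by rw [hne c1, Subst.eq_ofName_of_notMem_support c2], c3, fun m _ hm h' => ?_⟩
      by_cases hmy : m = y
      · subst hmy; exact c4 h'
      · rw [hne hmy] at h'
        exact hm (Subst.eq_of_mem_supp c2 h' ▸ ha)

end

/-- The subjects of two lifted transitions of communicating agents. -/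
theorem IsLift.com {X YP YQ : Set Name} {Ψs Ψ Ψc ΨP ΨQ : 𝔓.Assn} {σ σP σQ : Subst 𝔓.Term}
    {P P₁ P'' Q Q₁ Q'' : Agent 𝔓} {α β : Action 𝔓.Term 𝔓.Term} {αs βs : Action Name 𝔓.Term}
    {CP CQ : TransConstraint 𝔓} {bP bQ as : List Name} {N : 𝔓.Term} {y z : Name}
    (hP : IsLift YP (𝔓.comp Ψs ΨQ) σ Ψ P α P'' αs CP P₁ σP)
    (hQ : IsLift YQ (𝔓.comp Ψs ΨP) σ Ψ Q β Q'' βs CQ Q₁ σQ)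
    (hWP : P.WF) (hWQ : Q.WF) (hα : αs.symSubj = {y}) (hβ : βs.symSubj = {z})
    (hfP : (bP, ΨP) ∈ P.frame) (hfQ : (bQ, ΨQ) ∈ Q.frame) (hdP : bP.Nodup) (hdQ : bQ.Nodup)
    (hX : X.Finite) (hΨs : supp Ψs ⊆ X) (hσ : σ.support ⊆ X) (hΨ : supp Ψ ⊆ X) (hPX : P.fn ⊆ X)
    (hQX : Q.fn ⊆ X) (hbP : ∀ b ∈ bP, b ∉ X ∧ b ∉ bQ ∧ b ∉ supp (σP y))
    (hbQ : ∀ b ∈ bQ, b ∉ X ∧ b ∉ supp (σQ z))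
    (hy : y ∉ X ∧ y ∉ bP ∧ y ∉ bQ ∧ y ∉ as ∧ y ∉ supp N)
    (hz : z ∉ X ∧ z ∉ bP ∧ z ∉ bQ ∧ z ∉ as ∧ z ∉ supp N) 
    (hc : assnClass Ψc = assnClass (𝔓.comp (subst Ψs σ) Ψ))
    (hent : 𝔓.entails (𝔓.comp (𝔓.comp Ψc (subst ΨP σ)) (subst ΨQ σ)) (𝔓.chanEq (σP y) (σQ z))) :
    ∃ bP bQ cP cQ Ψ₁ Ψ₂ MP MQ CP' CQ', (bP, ΨP) ∈ P.frame ∧ (bQ, ΨQ) ∈ Q.frame ∧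
      CP = chanAtom cP Ψ₁ MP (NameTerm.ofName y) :: CP' ∧
      CQ = chanAtom cQ Ψ₂ MQ (NameTerm.ofName z) :: CQ' ∧
      AssnEq Ψ₁ (𝔓.comp (𝔓.comp Ψs ΨP) ΨQ) ∧ AssnEq Ψ₂ (𝔓.comp (𝔓.comp Ψs ΨP) ΨQ) ∧
      ComFresh Ψs P Q bP bQ cP cQ MP MQ y as N ∧ ComFresh Ψs Q P bQ bP cQ cP MQ MP z as N ∧
      TransConstraint.Sat σ Ψ (TransConstraint.new (cP ++ cQ)
          (chanAtom [] (𝔓.comp (𝔓.comp Ψs ΨP) ΨQ) MP MQ :: (CP' ++ CQ'))) := by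
  have hΨP : ∀ n, n ∉ X → n ∉ bP → n ∉ supp ΨP := fun n h1 h2 h3 =>
    h1 (hPX (Agent.mem_fn_of_mem_frame hfP h3 h2))
  have hΨQ : ∀ n, n ∉ X → n ∉ bQ → n ∉ supp ΨQ := fun n h1 h2 h3 =>
    h1 (hQX (Agent.mem_fn_of_mem_frame hfQ h3 h2))
  have hcomp : ∀ n, n ∉ X → ∀ {Φ : 𝔓.Assn}, n ∉ supp Φ → n ∉ supp (𝔓.comp Ψs Φ) :=
    fun n h1 Φ h2 h3 => (supp_comp_subset _ _ h3).elim (fun h3 => h1 (hΨs h3)) h2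
  have hbQP : ∀ b ∈ bQ, b ∉ bP := fun b h1 h2 => (hbP b h2).2.1 h1
  obtain ⟨cP, dP, Ψ₁, MP, CP', p1, p2, p3, p4, p5, p6, p7, p8, p9⟩ := hP.exists_subj hWP hα hfP hdP
    (fun b hb => by
      obtain ⟨h1, h2, h3⟩ := hbP b hb
      exact ⟨hcomp b h1 (hΨQ b h1 h2), fun h => h1 (hPX h), fun h => hy.2.1 (h ▸ hb),
        fun h => h1 (hσ h), fun h => h1 (hΨ h), h3⟩)
    (hcomp y hy.1 (hΨQ y hy.1 hy.2.2.1)) (fun h => hy.1 (hPX h)) (hΨP y hy.1 hy.2.1)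
    (hX.union (bQ.finite_toSet.union ((Set.finite_singleton y).union (Set.finite_singleton z))))
  obtain ⟨cQ, dQ, Ψ₂, MQ, CQ', q1, q2, q3, q4, q5, q6, q7, q8, q9⟩ := hQ.exists_subj hWQ hβ hfQ hdQ
    (fun b hb => by
      obtain ⟨h1, h3⟩ := hbQ b hb
      exact ⟨hcomp b h1 (hΨP b h1 (hbQP b hb)), fun h => h1 (hQX h), fun h => hz.2.2.1 (h ▸ hb),
        fun h => h1 (hσ h), fun h => h1 (hΨ h), h3⟩)
    (hcomp z hz.1 (hΨP z hz.1 hz.2.1)) (fun h => hz.1 (hQX h)) (hΨQ z hz.1 hz.2.2.1)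
    (hX.union (cP.finite_toSet.union ((Set.finite_singleton y).union (Set.finite_singleton z))))
  simp only [Set.mem_union, not_or, Set.mem_singleton_iff, Set.mem_ofPred_eq] at p7 q7
  -- `cQ` was chosen after `cP` and avoids it except possibly at the frame binders `bQ`, which `cP`
  -- avoids in turn; hence the two lists are disjoint.
  have kP : ∀ n ∈ cP, n ∉ X ∧ n ∉ cQ ∧ n ≠ y ∧ n ≠ z := by
    intro n hn
    have h1 : n ∉ X ∧ n ∉ bQ ∧ n ≠ y ∧ n ≠ z := (p7 n hn).elim
      (fun h => ⟨(hbP n h).1, (hbP n h).2.1, fun h' => hy.2.1 (h' ▸ h), fun h' => hz.2.1 (h' ▸ h)⟩)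
      fun h => ⟨h.1, h.2.1, h.2.2.1, h.2.2.2⟩
    exact ⟨h1.1, fun h' => (q7 n h').elim h1.2.1 fun h'' => h''.2.1 hn, h1.2.2⟩
  have kQ : ∀ n ∈ cQ, n ∉ X ∧ n ∉ cP ∧ n ≠ y ∧ n ≠ z := by
    intro n hn
    refine ⟨?_, fun h' => (kP n h').2.1 hn, ?_⟩
    · exact (q7 n hn).elim (fun h => (hbQ n h).1) fun h => h.1
    · exact (q7 n hn).elim (fun h => ⟨fun h' => hy.2.2.1 (h' ▸ h), fun h' => hz.2.2.1 (h' ▸ h)⟩)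
        fun h => ⟨h.2.2.1, h.2.2.2⟩
  have mQ : ∀ n, n ∉ X → n ∉ cQ → n ∉ supp MQ := fun n h1 h2 h3 =>
    (q5 n h3).elim (fun h3 => h1 (hQX h3)) h2
  have mP : ∀ n, n ∉ X → n ∉ cP → n ∉ supp MP := fun n h1 h2 h3 =>
    (p5 n h3).elim (fun h3 => h1 (hPX h3)) h2
  have ycP : y ∉ cP := fun h => (kP y h).2.2.1 rfl
  have ycQ : y ∉ cQ := fun h => (kQ y h).2.2.1 rfl
  have zcP : z ∉ cP := fun h => (kP z h).2.2.2 rfl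
  have zcQ : z ∉ cQ := fun h => (kQ z h).2.2.2 rfl
  refine ⟨dP, dQ, cP, cQ, Ψ₁, Ψ₂, MP, MQ, CP', CQ', p2, q2, p1, q1,
    p6.trans (.comp_right_comm _ _ _), q6, ⟨p3, fun b hb => ?_, ?_⟩, ⟨q3, fun b hb => ?_, ?_⟩, ?_⟩
  · obtain ⟨h1, h2, -⟩ := kP b hb
    exact ⟨fun h => h1 (hΨs h), fun h => h1 (hPX h), fun h => h1 (hQX h), fun h => h2 (q3 b h), h2,
      mQ b h1 h2⟩
  · exact ⟨fun h => hy.1 (hΨs h), fun h => hy.1 (hPX h), fun h => hy.1 (hQX h),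
      fun h => ycP (p3 y h), fun h => ycQ (q3 y h), ycP, ycQ, p4, mQ y hy.1 ycQ, hy.2.2.2⟩
  · obtain ⟨h1, h2, -⟩ := kQ b hb
    exact ⟨fun h => h1 (hΨs h), fun h => h1 (hQX h), fun h => h1 (hPX h), fun h => h2 (p3 b h), h2,
      mP b h1 h2⟩
  · exact ⟨fun h => hz.1 (hΨs h), fun h => hz.1 (hQX h), fun h => hz.1 (hPX h),
      fun h => zcQ (q3 z h), fun h => zcP (p3 z h), zcQ, zcP, q4, mP z hz.1 zcP, hz.2.2.2⟩
  · have hcX : ∀ n ∈ cP ++ cQ, n ∉ X := fun n hn =>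
      (List.mem_append.1 hn).elim (fun h => (kP n h).1) fun h => (kQ n h).1
    rw [TransConstraint.sat_new_iff (τ := σ) (g := id) fun A _ => .refl fun a ha =>
        ⟨Subst.eq_ofName_of_notMem_support fun h => hcX a ha (hσ h), fun h => hcX a ha (hΨ h),
          fun m _ hm h' => hm (Subst.eq_of_mem_supp (fun h => hcX a ha (hσ h)) h' ▸ ha)⟩,
      TransConstraint.sat_cons, TransConstraint.sat_append, chanAtom, Atom.sat_mk_nil,
      𝔓.subst_chanEq]
    -- The instance of `MP` is equivalent to the subject of `P`, this to the subject of `Q` by the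
    -- concrete rule, and this to the instance of `MQ`. The three assertions have the same class.
    refine ⟨𝔓.chan_trans _ _ _ _ (entails_of_assnClass_eq ?_ p9)
      (𝔓.chan_trans _ _ _ _ (entails_of_assnClass_eq ?_ hent)
        (𝔓.chan_symm _ _ _ (entails_of_assnClass_eq ?_ q9))), p8, q8⟩
    all_goals simp only [assnClass_comp, hc, 𝔓.subst_comp, mul_comm, mul_left_comm, mul_assoc]

theorem IsLift.mem_names_of_mem_obj {X : Set Name} {Ψs Ψ : 𝔓.Assn} {σ σ' : Subst 𝔓.Term}
    {P P₁ P'' : Agent 𝔓} {α : Action 𝔓.Term 𝔓.Term} {αs : Action Name 𝔓.Term}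
    {C : TransConstraint 𝔓} (h : IsLift X Ψs σ Ψ P α P'' αs C P₁ σ') {a n : Name}
    (hn : n ∈ αs.objNames) (ha : a ∈ supp (σ'.bind αs.bnList α.bnList n)) : a ∈ α.names := by
  rw [h.action_eq]
  cases αs with
  | out y as N =>
    refine Or.inr ?_
    rw [supp_subst]
    exact Subst.mem_image.2 ⟨n, hn, ha⟩
  | inp y x => exact absurd hn (by simp [Action.objNames])
  | tau => exact absurd hn (by simp [Action.objNames])

/-! ### Lifting the concrete rules one by one -/

theorem HasLifts.inp {X : Set Name} (hX : X.Finite) {Ψ : 𝔓.Assn} {M K : 𝔓.Term} {x : Name}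
    {P : Agent 𝔓} (h : 𝔓.entails Ψ (𝔓.chanEq M K)) :
    HasLifts X Ψ (Agent.inp M x P) (.inp K x) P := by
  intro Ψs σ Ψ₀ P₀ hΨs hσ hΨ hP hW he hc
  obtain ⟨x₀, hx₀⟩ := hX.exists_notMem
  obtain ⟨M₀, P₁, rfl, rfl, rfl, hx⟩ := Agent.subst_eq_inp he.symm (fun h => hx₀ (hP h))
    (fun h => hx₀ (hσ h))
  obtain ⟨y, hy⟩ := (hX.union ((Set.finite_singleton x₀).union P₁.fn_finite)).exists_notMem
  simp only [Set.mem_union, not_or, Set.mem_singleton_iff] at hy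
  obtain ⟨y1, y2, y3⟩ := hy
  rw [Agent.fn_inp] at hP
  have hyM : y ∉ supp M₀ := fun h => y1 (hP (Or.inl h))
  have hyΨ : y ∉ supp Ψs := fun h => y1 (hΨs h)
  -- The fresh subject `y` is sent to the actual subject `K`; the concrete side condition then
  -- becomes the symbolic constraint.
  refine ⟨.inp y x₀, _, P₁, σ.update y K, .inp Ψs M₀ x₀ P₁ y hyΨ hyM y3 y2,
    fun n hn => Subst.update_of_ne _ _ hn, rfl, ?_, ?_, ?_, ?_, ?_, List.nodup_singleton _, ?_⟩
  · intro a ha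
    obtain rfl := List.mem_singleton.1 ha
    exact hx₀
  · rintro z rfl
    exact ⟨y1, by simpa [Action.bnList] using y2⟩
  · simp [Action.inst, Action.bnList, Subst.update_same, listMap]
  · rw [TransConstraint.sat_cons, chanAtom, Atom.sat_mk_nil, 𝔓.subst_chanEq, 𝔓.subst_ofName,
      Subst.update_same, subst_congr_supp (x := Ψs) fun n hn =>
        Subst.update_of_ne σ K fun h' : n = y => hyΨ (h' ▸ hn),
      subst_congr_supp (x := M₀) fun n hn =>
        Subst.update_of_ne σ K fun h' : n = y => hyM (h' ▸ hn)]
    exact ⟨entails_of_assnClass_eq hc h, by simp [TransConstraint.Sat]⟩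
  · simp only [Action.bnList]
    refine Agent.subst_congr fun n hn => ?_
    rw [← Subst.bind_singleton]
    exact Subst.bind_congr fun _ => (Subst.update_of_ne _ _ fun h' : n = y => y3 (h' ▸ hn)).symm
  · intro a ha n hn hn' h'
    obtain rfl := List.mem_singleton.1 ha
    exact hx (Subst.mem_image.2 ⟨n, ⟨hn.resolve_right (by simp [Action.objNames]),
      by simpa [Action.bnList] using hn'⟩, h'⟩)

theorem HasLifts.out {X : Set Name} (hX : X.Finite) {Ψ : 𝔓.Assn} {M K N : 𝔓.Term}
    {P : Agent 𝔓} (h : 𝔓.entails Ψ (𝔓.chanEq M K)) :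
    HasLifts X Ψ (Agent.out M N P) (.out K [] N) P := by
  intro Ψs σ Ψ₀ P₀ hΨs hσ hΨ hP hW he hc
  obtain ⟨M₀, N₀, P₁, rfl, rfl, rfl, rfl⟩ := Agent.subst_eq_out he.symm
  obtain ⟨y, hy⟩ := hX.exists_notMem
  rw [Agent.fn_out] at hP
  have hyM : y ∉ supp M₀ := fun h => hy (hP (Or.inl (Or.inl h)))
  have hyN : y ∉ supp N₀ := fun h => hy (hP (Or.inl (Or.inr h)))
  have hyP : y ∉ P₁.fn := fun h => hy (hP (Or.inr h))
  have hyΨ : y ∉ supp Ψs := fun h => hy (hΨs h)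
  refine ⟨.out y [] N₀, _, P₁, σ.update y K, .out Ψs M₀ N₀ P₁ y hyΨ hyM hyN hyP,
    fun n hn => Subst.update_of_ne _ _ hn, rfl, by simp [Action.bnList], ?_, ?_, ?_, ?_,
    List.nodup_nil, by simp [Action.bnList]⟩
  · rintro z rfl
    exact ⟨hy, by simp [Action.bnList]⟩
  · simp only [Action.inst, Action.bnList, Subst.update_same, Subst.bind_nil]
    rw [subst_congr_supp (x := N₀) fun n hn =>
        Subst.update_of_ne σ K fun h' : n = y => hyN (h' ▸ hn)]
  · rw [TransConstraint.sat_cons, chanAtom, Atom.sat_mk_nil, 𝔓.subst_chanEq, 𝔓.subst_ofName,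
      Subst.update_same, subst_congr_supp (x := Ψs) fun n hn =>
        Subst.update_of_ne σ K fun h' : n = y => hyΨ (h' ▸ hn),
      subst_congr_supp (x := M₀) fun n hn =>
        Subst.update_of_ne σ K fun h' : n = y => hyM (h' ▸ hn)]
    exact ⟨entails_of_assnClass_eq hc h, by simp [TransConstraint.Sat]⟩
  · simp only [Action.bnList, Subst.bind_nil]
    exact Agent.subst_congr fun n hn =>
      (Subst.update_of_ne _ _ fun h' : n = y => hyP (h' ▸ hn)).symm

theorem HasLifts.case {X : Set Name} (hX : X.Finite) {Ψ : 𝔓.Assn} {n : ℕ} {φ : Fin n → 𝔓.Cond}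
    {P : Fin n → Agent 𝔓} {i : Fin n} {α : Action 𝔓.Term 𝔓.Term} {P' : Agent 𝔓}
    (ih : ∀ Y : Set Name, Y.Finite → HasLifts Y Ψ (P i) α P') (h : 𝔓.entails Ψ (φ i)) :
    HasLifts X Ψ (Agent.case n φ P) α P' := by
  intro Ψs σ Ψ₀ P₀ hΨs hσ hΨ hP hW he hc
  obtain ⟨φ₀, Q, rfl, hi⟩ := Agent.subst_eq_case he.symm
  rw [Agent.fn_case] at hP
  have hφX : supp (φ₀ i) ⊆ X := fun m hm => hP (Set.mem_iUnion.2 ⟨i, Or.inl hm⟩)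
  obtain ⟨αs, C, P₁, σ', L⟩ := ih X hX Ψs σ Ψ₀ (Q i) hΨs hσ hΨ
    (fun m hm => hP (Set.mem_iUnion.2 ⟨i, Or.inr hm⟩)) (Agent.wf_case.1 hW i).1 (hi i).2.symm hc
  refine ⟨αs, _, P₁, σ', .case Ψs n φ₀ Q i L.trans, L.eq_of_notMem, L.length_eq, L.bn_notMem,
    L.subj_notMem, L.action_eq, ?_, L.agent_eq, L.nodup, L.bn_notMem_subst⟩
  -- The two substitutions can differ only at the subject, which avoids `X`, so the condition of the
  -- branch is tested at its instance by `σ`.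
  have hfix : ∀ m ∈ X, σ' m = σ m := fun m hm =>
    L.eq_of_notMem m fun h' => (L.subj_notMem m h').1 hm
  rw [TransConstraint.sat_append, TransConstraint.sat_cons, Atom.sat_mk_nil,
    subst_congr_supp (x := Ψs) fun m hm => hfix m (hΨs hm),
    subst_congr_supp (x := φ₀ i) fun m hm => hfix m (hφX hm), (hi i).1]
  exact ⟨L.sat, entails_of_assnClass_eq hc h, by simp [TransConstraint.Sat]⟩

theorem HasLifts.parL {X : Set Name} (hX : X.Finite) {Ψ : 𝔓.Assn} {P Q : Agent 𝔓} {bQ : List Name}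
    {ΨQ : 𝔓.Assn} {α : Action 𝔓.Term 𝔓.Term} {P' : Agent 𝔓} (hQ : (bQ, ΨQ) ∈ Q.frame)
    (hd : bQ.Nodup) (hb : ∀ b ∈ bQ, b ∉ X ∧ b ∉ α.names)
    (ih : ∀ Y : Set Name, Y.Finite → HasLifts Y (𝔓.comp ΨQ Ψ) P α P')
    (hbn : ∀ a ∈ α.bn, a ∉ Q.fn) : HasLifts X Ψ (P.par Q) α (P'.par Q) := by
  intro Ψs σ Ψ₀ P₀ hΨs hσ hΨ hP hW he hc
  obtain ⟨P₀, Q₀, rfl, rfl, rfl⟩ := Agent.subst_eq_par he.symm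
  rw [Agent.fn_par, Set.union_subset_iff] at hP
  obtain ⟨Φ, hΦ, rfl⟩ := Agent.exists_of_mem_frame_subst hQ hd fun b h =>
    ⟨fun h' => (hb b h).1 (hP.2 h'), fun h' => (hb b h).1 (hσ h')⟩
  -- The premise is lifted while also avoiding the frame of the other component, whose assertion
  -- joins the environment and whose binders will be put in front of the constraint.
  have hXY : X ⊆ X ∪ (supp Φ ∪ {n | n ∈ bQ}) := Set.subset_union_left
  obtain ⟨αs, C, P₁, σ', L⟩ := ih (X ∪ (supp Φ ∪ {n | n ∈ bQ}))
    (hX.union ((supp_finite Φ).union bQ.finite_toSet)) (𝔓.comp Ψs Φ) σ Ψ₀ P₀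
    ((supp_comp_subset _ _).trans (Set.union_subset (hΨs.trans hXY) fun n hn =>
      Or.inr (Or.inl hn))) (hσ.trans hXY) (hΨ.trans hXY) (hP.1.trans hXY) (Agent.wf_par.1 hW).1 rfl
    (by simp only [assnClass_comp, hc, 𝔓.subst_comp, mul_comm, mul_assoc])
  have hbQ : ∀ b ∈ bQ, b ∉ αs.symSubj ∧ b ∉ αs.bnList := fun b h =>
    ⟨fun h' => (L.subj_notMem b h').1 (Or.inr (Or.inr h)),
      fun h' => L.bn_notMem b h' (Or.inr (Or.inr h))⟩
  have hQfix : ∀ n ∈ Q₀.fn, σ'.bind αs.bnList α.bnList n = σ n := fun n hn => by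
    rw [Subst.bind_of_notMem _ fun h' => L.bn_notMem n h' (Or.inl (hP.2 hn)),
      L.eq_of_notMem n fun h' => (L.subj_notMem n h').1 (Or.inl (hP.2 hn))]
  refine ⟨αs, _, P₁.par Q₀, σ', L.new hXY (fun b h => ⟨fun h' => (hb b h).1 (hσ h'),
    fun h' => (hb b h).1 (hΨ h'), Or.inr (Or.inr h), (hb b h).2⟩)
    (.parL Ψs P₀ Q₀ hΦ (fun b h => ⟨fun h' => (hb b h).1 (hΨs h'), fun h' => (hb b h).1 (hP.1 h'),
      fun h' => ?_⟩) L.trans (fun a ha h' => L.bn_notMem a (Action.mem_bn.1 ha) (Or.inl (hP.2 h')))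
      fun a ha h' => (L.subj_notMem a ha).1 (Or.inl (hP.2 h'))) ?_ fun a ha n hn hn' h' => ?_⟩
  · rcases Action.mem_symNames.1 h' with h' | h' | h'
    · exact (hbQ b h).1 h'
    · exact (hbQ b h).2 h'
    · exact (L.trans.names.2.1 b h').elim (fun h' => (hb b h).1 (hP.1 h')) (hbQ b h).2
  · rw [Agent.subst_par, L.agent_eq, Agent.subst_congr hQfix]
  · rw [Agent.fn_par] at hn
    rcases hn with hn | hn
    · exact L.bn_notMem_subst a ha n (Or.inl hn) hn' h'
    · refine hbn a (Action.mem_bn.2 ha) ?_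
      rw [Agent.fn_subst]
      exact Subst.mem_image.2 ⟨n, hn, h'⟩

theorem HasLifts.parR {X : Set Name} (hX : X.Finite) {Ψ : 𝔓.Assn} {P Q : Agent 𝔓} {bP : List Name}
    {ΨP : 𝔓.Assn} {α : Action 𝔓.Term 𝔓.Term} {Q' : Agent 𝔓} (hP : (bP, ΨP) ∈ P.frame)
    (hd : bP.Nodup) (hb : ∀ b ∈ bP, b ∉ X ∧ b ∉ α.names)
    (ih : ∀ Y : Set Name, Y.Finite → HasLifts Y (𝔓.comp ΨP Ψ) Q α Q')
    (hbn : ∀ a ∈ α.bn, a ∉ P.fn) : HasLifts X Ψ (P.par Q) α (P.par Q') := by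
  intro Ψs σ Ψ₀ P₀ hΨs hσ hΨ hPX hW he hc
  obtain ⟨P₀, Q₀, rfl, rfl, rfl⟩ := Agent.subst_eq_par he.symm
  rw [Agent.fn_par, Set.union_subset_iff] at hPX
  obtain ⟨Φ, hΦ, rfl⟩ := Agent.exists_of_mem_frame_subst hP hd fun b h =>
    ⟨fun h' => (hb b h).1 (hPX.1 h'), fun h' => (hb b h).1 (hσ h')⟩
  have hXY : X ⊆ X ∪ (supp Φ ∪ {n | n ∈ bP}) := Set.subset_union_left
  obtain ⟨αs, C, Q₁, σ', L⟩ := ih (X ∪ (supp Φ ∪ {n | n ∈ bP}))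
    (hX.union ((supp_finite Φ).union bP.finite_toSet)) (𝔓.comp Ψs Φ) σ Ψ₀ Q₀
    ((supp_comp_subset _ _).trans (Set.union_subset (hΨs.trans hXY) fun n hn =>
      Or.inr (Or.inl hn))) (hσ.trans hXY) (hΨ.trans hXY) (hPX.2.trans hXY) (Agent.wf_par.1 hW).2 rfl
    (by simp only [assnClass_comp, hc, 𝔓.subst_comp, mul_comm, mul_assoc])
  have hbP : ∀ b ∈ bP, b ∉ αs.symSubj ∧ b ∉ αs.bnList := fun b h =>
    ⟨fun h' => (L.subj_notMem b h').1 (Or.inr (Or.inr h)),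
      fun h' => L.bn_notMem b h' (Or.inr (Or.inr h))⟩
  have hPfix : ∀ n ∈ P₀.fn, σ'.bind αs.bnList α.bnList n = σ n := fun n hn => by
    rw [Subst.bind_of_notMem _ fun h' => L.bn_notMem n h' (Or.inl (hPX.1 hn)),
      L.eq_of_notMem n fun h' => (L.subj_notMem n h').1 (Or.inl (hPX.1 hn))]
  refine ⟨αs, _, P₀.par Q₁, σ', L.new hXY (fun b h => ⟨fun h' => (hb b h).1 (hσ h'),
    fun h' => (hb b h).1 (hΨ h'), Or.inr (Or.inr h), (hb b h).2⟩)
    (.parR Ψs P₀ Q₀ hΦ (fun b h => ⟨fun h' => (hb b h).1 (hΨs h'), fun h' => (hb b h).1 (hPX.2 h'),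
      fun h' => ?_⟩) L.trans (fun a ha h' => L.bn_notMem a (Action.mem_bn.1 ha) (Or.inl (hPX.1 h')))
      fun a ha h' => (L.subj_notMem a ha).1 (Or.inl (hPX.1 h'))) ?_ fun a ha n hn hn' h' => ?_⟩
  · rcases Action.mem_symNames.1 h' with h' | h' | h'
    · exact (hbP b h).1 h'
    · exact (hbP b h).2 h'
    · exact (L.trans.names.2.1 b h').elim (fun h' => (hb b h).1 (hPX.2 h')) (hbP b h).2
  · rw [Agent.subst_par, L.agent_eq, Agent.subst_congr hPfix]
  · rw [Agent.fn_par] at hn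
    rcases hn with hn | hn
    · refine hbn a (Action.mem_bn.2 ha) ?_
      rw [Agent.fn_subst]
      exact Subst.mem_image.2 ⟨n, hn, h'⟩
    · exact L.bn_notMem_subst a ha n (Or.inl hn) hn' h'

theorem HasLifts.scope {X : Set Name} (hX : X.Finite) {Ψ : 𝔓.Assn} {b : Name} {P P' : Agent 𝔓}
    {α : Action 𝔓.Term 𝔓.Term} (hb : b ∉ X) (hbα : b ∉ α.names)
    (ih : ∀ Y : Set Name, Y.Finite → HasLifts Y Ψ P α P') :
    HasLifts X Ψ (Agent.res b P) α (Agent.res b P') := by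
  intro Ψs σ Ψ₀ P₀ hΨs hσ hΨ hP hW he hc
  obtain ⟨P₀, rfl, rfl⟩ := Agent.subst_eq_res he.symm (fun h => hb (hP h)) (fun h => hb (hσ h))
  -- The body may contain `b` freely, so the premise needs a larger set of names to avoid; in
  -- particular the symbolic subject and bound names differ from `b`.
  have hXY : X ⊆ X ∪ (P₀.fn ∪ {b}) := Set.subset_union_left
  have hbY : b ∈ X ∪ (P₀.fn ∪ {b}) := Or.inr (Or.inr rfl)
  obtain ⟨αs, C, P₁, σ', L⟩ := ih (X ∪ (P₀.fn ∪ {b}))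
    (hX.union (P₀.fn_finite.union (Set.finite_singleton b))) Ψs σ Ψ₀ P₀ (hΨs.trans hXY)
    (hσ.trans hXY) (hΨ.trans hXY) (fun n hn => Or.inr (Or.inl hn)) (Agent.wf_res.1 hW) rfl hc
  have hbs : b ∉ αs.symSubj := fun h' => (L.subj_notMem b h').1 hbY
  have hbb : b ∉ αs.bnList := fun h' => L.bn_notMem b h' hbY
  have hbα' : b ∉ α.bnList := fun h' => hbα (by
    cases α with
    | out M as N => exact Or.inl (Or.inr h')
    | inp M x => exact Or.inr (by simpa [Action.bnList] using h')
    | tau => exact absurd h' List.not_mem_nil)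
  refine ⟨αs, _, Agent.res b P₁, σ', L.new hXY (fun c hc => ?_)
    (.scope Ψs b P₀ L.trans (fun h' => ?_) fun h' => hb (hΨs h')) ?_ fun a ha n hn hn' h' => ?_⟩
  · obtain rfl := List.mem_singleton.1 hc
    exact ⟨fun h' => hb (hσ h'), fun h' => hb (hΨ h'), hbY, hbα⟩
  · rcases Action.mem_symNames.1 h' with h' | h' | h'
    · exact hbs h'
    · exact hbb h'
    · refine hbα (L.mem_names_of_mem_obj h' ?_)
      rw [Subst.bind_of_notMem _ hbb, L.eq_of_notMem b hbs,
        Subst.eq_ofName_of_notMem_support fun h' => hb (hσ h'), supp_ofName]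
      rfl
  · rw [Agent.subst_res (z := b), L.agent_eq]
    · congr 1
      refine Agent.subst_congr fun n _ => ?_
      by_cases hn : n = b
      · subst hn
        rw [Subst.update_same, Subst.bind_of_notMem _ hbb, L.eq_of_notMem n hbs,
          Subst.eq_ofName_of_notMem_support fun h' => hb (hσ h')]
      · rw [Subst.update_of_ne _ _ hn]
    · intro h'
      obtain ⟨n, ⟨-, hn⟩, h'⟩ := Subst.mem_image.1 h'
      by_cases hnb : n ∈ αs.bnList
      · rw [Subst.bind_of_mem _ hnb, supp_ofName] at h'
        obtain rfl : b = _ := h'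
        exact hbα' (listMap_mem hnb L.length_eq)
      · rw [Subst.bind_of_notMem _ hnb] at h'
        by_cases hns : n ∈ αs.symSubj
        · exact L.notMem_subst_subj hbα hns h'
        · rw [L.eq_of_notMem n hns] at h'
          exact hn (Subst.eq_of_mem_supp (fun h' => hb (hσ h')) h')
  · rw [Agent.fn_res] at hn
    exact L.bn_notMem_subst a ha n (Or.inl hn.1) hn' h'

theorem Action.inst_eq_out {αs : Action Name 𝔓.Term} {σ : Subst 𝔓.Term} {e as : List Name}
    {M N : 𝔓.Term} (h : Action.out M as N = αs.inst σ e) : ∃ y as₀ N₀, αs = .out y as₀ N₀ ∧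
      M = σ y ∧ N = subst N₀ (σ.bind as₀ e) := by
  cases αs with
  | out y as₀ N₀ =>
    simp only [inst, out.injEq] at h
    exact ⟨y, as₀, N₀, rfl, h.1, h.2.2⟩
  | inp y x => simp [inst] at h
  | tau => simp [inst] at h

theorem Action.inst_eq_inp {αs : Action Name 𝔓.Term} {σ : Subst 𝔓.Term} {e : List Name}
    {M : 𝔓.Term} {x : Name} (h : Action.inp M x = αs.inst σ e) : ∃ y x₀, αs = .inp y x₀ ∧
      M = σ y := by
  cases αs with
  | inp y x₀ =>
    simp only [inst, inp.injEq] at h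
    exact ⟨y, x₀, rfl, h.1⟩
  | out y as₀ N₀ => simp [inst] at h
  | tau => simp [inst] at h

theorem HasLifts.opn {X : Set Name} (hX : X.Finite) {Ψ : 𝔓.Assn} {b : Name} {P P' : Agent 𝔓}
    {M N : 𝔓.Term} {as₁ as₂ : List Name} (hb : b ∉ X)
    (ih : ∀ Y : Set Name, Y.Finite → HasLifts Y Ψ P (.out M (as₁ ++ as₂) N) P')
    (hbas : b ∉ as₁ ++ as₂) (hbM : b ∉ supp M) (hbN : b ∈ supp N) :
    HasLifts X Ψ (Agent.res b P) (.out M (as₁ ++ b :: as₂) N) P' := by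
  intro Ψs σ Ψ₀ P₀ hΨs hσ hΨ hP hW he hc
  obtain ⟨P₀, rfl, rfl⟩ := Agent.subst_eq_res he.symm (fun h => hb (hP h)) (fun h => hb (hσ h))
  have hbσ : b ∉ σ.support := fun h => hb (hσ h)
  have hXY : X ⊆ X ∪ (P₀.fn ∪ {b}) := Set.subset_union_left
  have hbY : b ∈ X ∪ (P₀.fn ∪ {b}) := Or.inr (Or.inr rfl)
  have hPY : P₀.fn ⊆ X ∪ (P₀.fn ∪ {b}) := fun n hn => Or.inr (Or.inl hn)
  obtain ⟨αs, C, P₁, σ', L⟩ := ih (X ∪ (P₀.fn ∪ {b}))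
    (hX.union (P₀.fn_finite.union (Set.finite_singleton b))) Ψs σ Ψ₀ P₀ (hΨs.trans hXY)
    (hσ.trans hXY) (hΨ.trans hXY) hPY (Agent.wf_res.1 hW) rfl hc
  obtain ⟨y, as₀, N₀, rfl, rfl, hN⟩ := Action.inst_eq_out L.action_eq
  replace hN : N = subst N₀ (σ'.bind as₀ (as₁ ++ as₂)) := hN
  subst hN
  have hl : (as₁ ++ as₂).length = as₀.length := L.length_eq
  obtain ⟨c₁, c₂, rfl, hl₁⟩ : ∃ c₁ c₂, as₀ = c₁ ++ c₂ ∧ as₁.length = c₁.length := by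
    refine ⟨as₀.take as₁.length, as₀.drop as₁.length, (List.take_append_drop _ _).symm, ?_⟩
    rw [List.length_take, ← hl, List.length_append, Nat.min_eq_left (Nat.le_add_right _ _)]
  have hyb : y ≠ b := fun h => (L.subj_notMem y rfl).1 (h ▸ hbY)
  have hb₀ : b ∉ c₁ ++ c₂ := fun h => L.bn_notMem b h hbY
  have hbσ' : σ' b = NameTerm.ofName b := by
    rw [L.eq_of_notMem b fun h : b = y => hyb h.symm, Subst.eq_ofName_of_notMem_support hbσ]
  -- The restricted name is outside the support of `σ` and is its own instance, so listing it as a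
  -- bound name on both levels changes neither the object nor the derivative.
  have hτ : ∀ n, σ'.bind (c₁ ++ c₂) (as₁ ++ as₂) n =
      σ'.bind (c₁ ++ b :: c₂) (as₁ ++ b :: as₂) n := fun n => by
    rw [Subst.bind_insert σ' hl₁ hb₀]
    refine Subst.bind_congr fun _ => ?_
    by_cases hn : n = b
    · rw [hn, Subst.update_same, hbσ']
    · rw [Subst.update_of_ne _ _ hn]
  -- An occurrence of `b` in the instantiated object cannot come from another bound name or from
  -- `σ`, so it is already in the symbolic object, as opening requires.
  have hbN₀ : b ∈ supp N₀ := by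
    rw [supp_subst] at hbN
    obtain ⟨n, hn, h'⟩ := Subst.mem_image.1 hbN
    by_cases hnc : n ∈ c₁ ++ c₂
    · rw [Subst.bind_of_mem _ hnc, supp_ofName] at h'
      obtain rfl : b = _ := h'
      exact absurd (listMap_mem hnc hl) hbas
    · rw [Subst.bind_of_notMem _ hnc, L.eq_on_agent hPY (Or.inr hn)] at h'
      exact Subst.eq_of_mem_supp hbσ h' ▸ hn
  refine ⟨.out y (c₁ ++ b :: c₂) N₀, _, P₁, σ', .opn Ψs b P₀ L.trans hbN₀ hb₀
    (fun h => hb (hΨs h)) hyb.symm, L.eq_of_notMem, ?_, fun a ha h' => ?_, fun z hz => ?_, ?_,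
    L.sat_new fun c hc => ?_, ?_, nodup_insert L.nodup hbas, fun a ha n hn hn' h' => ?_⟩
  · simpa [Action.bnList, ← Nat.add_assoc] using hl
  · rcases (by simpa [Action.bnList] using ha : a ∈ c₁ ∨ a = b ∨ a ∈ c₂) with h | rfl | h
    · exact L.bn_notMem a (List.mem_append_left _ h) (hXY h')
    · exact hb h'
    · exact L.bn_notMem a (List.mem_append_right _ h) (hXY h')
  · obtain rfl : z = y := hz
    have := (L.subj_notMem z rfl).2
    simp only [Action.bnList, List.mem_append, List.mem_cons, not_or] at this ⊢
    exact ⟨fun h => (L.subj_notMem z rfl).1 (hXY h), this.1, hyb, this.2⟩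
  · simp only [Action.inst, Action.bnList]
    rw [subst_congr_supp fun n _ => hτ n]
  · obtain rfl := List.mem_singleton.1 hc
    refine ⟨hbσ, fun h => hb (hΨ h), fun h : c = y => hyb h.symm, fun z hz => ?_⟩
    obtain rfl : z = y := hz
    exact hbM
  · rw [L.agent_eq]
    exact Agent.subst_congr fun n _ => hτ n
  · rw [Action.bnList, List.mem_append, List.mem_cons, not_or, not_or] at hn'
    rcases (by simpa [Action.bnList] using ha : a ∈ as₁ ∨ a = b ∨ a ∈ as₂) with h | rfl | h
    · exact L.bn_notMem_subst a (List.mem_append_left _ h) n hn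
        (fun h => (List.mem_append.1 h).elim hn'.1 hn'.2.2) h'
    · exact hn'.2.1 (Subst.eq_of_mem_supp hbσ h')
    · exact L.bn_notMem_subst a (List.mem_append_right _ h) n hn
        (fun h => (List.mem_append.1 h).elim hn'.1 hn'.2.2) h'

theorem HasLifts.rep {X : Set Name} {Ψ : 𝔓.Assn} {P P' : Agent 𝔓}
    {α : Action 𝔓.Term 𝔓.Term} (ih : HasLifts X Ψ (P.par P.rep) α P') :
    HasLifts X Ψ P.rep α P' := by
  intro Ψs σ Ψ₀ P₀ hΨs hσ hΨ hP hW he hc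
  obtain ⟨P₀, rfl, rfl⟩ := Agent.subst_eq_rep he.symm
  obtain ⟨αs, C, P₁, σ', L⟩ := ih Ψs σ Ψ₀ (P₀.par P₀.rep) hΨs hσ hΨ
    (by rwa [Agent.fn_par, Agent.fn_rep, Set.union_self, ← Agent.fn_rep])
    (Agent.wf_par.2 ⟨(Agent.wf_rep.1 hW).1, hW⟩) (by rw [Agent.subst_par, Agent.subst_rep]) hc
  exact ⟨αs, C, P₁, σ', .rep Ψs P₀ L.trans, L.eq_of_notMem, L.length_eq, L.bn_notMem,
    L.subj_notMem, L.action_eq, L.sat, L.agent_eq, L.nodup, L.bn_notMem_subst⟩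

theorem HasLifts.alphaOut {X : Set Name} {Ψ : 𝔓.Assn} {P P' : Agent 𝔓} {M N : 𝔓.Term}
    {as : List Name} {a c : Name} (ha : a ∈ as) (hc : c ∉ as) (hcN : c ∉ supp N) (hcP : c ∉ P'.fn)
    (ih : HasLifts X Ψ P (.out M as N) P') :
    HasLifts X Ψ P (.out M (as.map (Equiv.swap a c)) (Equiv.swap a c • N))
      (P'.perm (Equiv.swap a c)) := by
  intro Ψs σ Ψ₀ P₀ hΨs hσ hΨ hP hW he hcl
  obtain ⟨αs, C, P₁, σ', L⟩ := ih Ψs σ Ψ₀ P₀ hΨs hσ hΨ hP hW he hcl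
  obtain ⟨y, as₀, N₀, rfl, rfl, hN⟩ := Action.inst_eq_out L.action_eq
  replace hN : N = subst N₀ (σ'.bind as₀ as) := hN
  subst hN
  have hl : as.length = as₀.length := L.length_eq
  have hagent : P' = P₁.subst (σ'.bind as₀ as) := L.agent_eq
  subst hagent
  have hσ' : ∀ {n}, n ∈ P₁.fn ∨ n ∈ supp N₀ → σ' n = σ n := fun hn => L.eq_on_agent hP hn
  have hcσ : ∀ n, n ∈ P₁.fn ∨ n ∈ supp N₀ → n ∉ as₀ → c ∉ supp (σ n) := by
    intro n hn hn' h'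
    rw [← hσ' hn, ← Subst.bind_of_notMem σ' (e := as) hn'] at h'
    rcases hn with hn | hn
    · rw [Agent.fn_subst] at hcP
      exact hcP (Subst.mem_image.2 ⟨n, hn, h'⟩)
    · rw [supp_subst] at hcN
      exact hcN (Subst.mem_image.2 ⟨n, hn, h'⟩)
  have haσ : ∀ n, n ∈ P₁.fn ∨ n ∈ supp N₀ → n ∉ as₀ → ∀ b ∈ as, b ∉ supp (σ n) :=
    fun n hn hn' b hb => L.bn_notMem_subst b hb n hn hn'
  have hτ : ∀ n, n ∈ P₁.fn ∨ n ∈ supp N₀ → σ'.bind as₀ (as.map (Equiv.swap a c)) n =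
      Equiv.swap a c • σ'.bind as₀ as n := fun n hn =>
    Subst.bind_map_right σ' hl fun hn' => by
      rw [hσ' hn]; exact ⟨haσ n hn hn' a ha, hcσ n hn hn'⟩
  -- The same symbolic transition serves: renaming a concrete bound name only changes the names by
  -- which the symbolic ones are instantiated.
  refine ⟨.out y as₀ N₀, C, P₁, σ', L.trans, L.eq_of_notMem,
    by simpa [Action.bnList] using hl, L.bn_notMem, L.subj_notMem, ?_, L.sat,
    Agent.perm_subst fun n hn => hτ n (Or.inl hn), L.nodup.map (Equiv.injective _),
    fun b hb n hn hn' => ?_⟩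
  · simp only [Action.inst, Action.bnList]
    rw [smul_subst_eq fun n hn => hτ n (Or.inr hn)]
  · obtain ⟨d, hd, rfl⟩ := List.mem_map.1 hb
    by_cases hda : d = a
    · rw [hda, Equiv.swap_apply_left]
      exact hcσ n hn hn'
    · rw [Equiv.swap_apply_of_ne_of_ne hda fun h : d = c => hc (h ▸ hd)]
      exact haσ n hn hn' d hd

theorem HasLifts.alphaInp {X : Set Name} {Ψ : 𝔓.Assn} {P P' : Agent 𝔓} {M : 𝔓.Term}
    {x c : Name} (hcP : c ∉ P'.fn) (ih : HasLifts X Ψ P (.inp M x) P') :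
    HasLifts X Ψ P (.inp M c) (P'.perm (Equiv.swap x c)) := by
  intro Ψs σ Ψ₀ P₀ hΨs hσ hΨ hP hW he hcl
  obtain ⟨αs, C, P₁, σ', L⟩ := ih Ψs σ Ψ₀ P₀ hΨs hσ hΨ hP hW he hcl
  obtain ⟨y, x₀, rfl, rfl⟩ := Action.inst_eq_inp L.action_eq
  have hagent : P' = P₁.subst (σ'.bind [x₀] [x]) := L.agent_eq
  subst hagent
  have hcσ : ∀ n ∈ P₁.fn, n ∉ [x₀] → c ∉ supp (σ n) := by
    intro n hn hn' h'
    rw [← L.eq_on_agent hP (Or.inl hn), ← Subst.bind_of_notMem σ' (e := [x]) hn'] at h'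
    rw [Agent.fn_subst] at hcP
    exact hcP (Subst.mem_image.2 ⟨n, hn, h'⟩)
  refine ⟨.inp y x₀, C, P₁, σ', L.trans, L.eq_of_notMem, rfl, L.bn_notMem, L.subj_notMem,
    by simp [Action.inst, Action.bnList, listMap], L.sat, ?_, List.nodup_singleton _,
    fun b hb n hn hn' => ?_⟩
  · simp only [Action.bnList]
    rw [Agent.perm_subst fun n hn => Subst.bind_map_right (c := [x₀]) (e := [x]) (a := x) (b := c) σ' L.length_eq
      fun hn' => ?_]
    · simp
    · rw [L.eq_on_agent hP (Or.inl hn)]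
      exact ⟨L.bn_notMem_subst x (List.mem_singleton_self x) n (Or.inl hn) hn', hcσ n hn hn'⟩
  · obtain rfl := List.mem_singleton.1 hb
    exact hcσ n (hn.resolve_right (by simp [Action.objNames])) hn'

/-- Reassembles the instances of the two derivatives into the instance of the communication
derivative, in both orders of the components. The hypotheses say that the chosen restrictions and
the input name are not captured. -/
theorem Agent.subst_com {P Q : Agent 𝔓} {σ : Subst 𝔓.Term} {as₀ as : List Name} {N : 𝔓.Term}
    {x₀ x : Name} (hl : as.length = as₀.length) (hd : as.Nodup)
    (h₁ : ∀ n, n ∈ P.fn ∨ n ∈ supp N → n ∉ as₀ → ∀ a ∈ as, a ∉ supp (σ n))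
    (h₂ : ∀ n ∈ Q.fn, n ≠ x₀ → n ∉ as₀ ∧ x ∉ supp (σ n) ∧ ∀ a ∈ as, a ∉ supp (σ n)) :
    (resList as₀ (P.par (Q.subst1 N x₀))).subst σ =
      resList as ((P.subst (σ.bind as₀ as)).par
        ((Q.subst (σ.bind [x₀] [x])).subst1 (HasSubst.subst N (σ.bind as₀ as)) x)) ∧
    (resList as₀ ((Q.subst1 N x₀).par P)).subst σ =
      resList as (((Q.subst (σ.bind [x₀] [x])).subst1 (HasSubst.subst N (σ.bind as₀ as)) x).par
        (P.subst (σ.bind as₀ as))) := by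
  have key : ∀ n, n ∈ P.fn ∨ n ∈ (Q.subst1 N x₀).fn → n ∉ as₀ → ∀ a ∈ as, a ∉ supp (σ n) := by
    intro n hn hn'
    rcases hn with hn | hn
    · exact h₁ n (Or.inl hn) hn'
    · rcases mem_fn_subst1 hn with hn | hn
      · exact h₁ n (Or.inr hn) hn'
      · exact (h₂ n hn.1 hn.2).2.2
  have hQ := subst_bind_subst1 (N := N) (e := as) (fun n hn hx => (h₂ n hn hx).1)
    fun n hn hx => (h₂ n hn hx).2.1
  constructor
  · rw [subst_resList hl hd, subst_par, hQ]
    intro a ha h'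
    obtain ⟨n, ⟨hn, hn'⟩, h'⟩ := Subst.mem_image.1 h'
    rw [fn_par] at hn
    exact key n hn hn' a ha h'
  · rw [subst_resList hl hd, subst_par, hQ]
    intro a ha h'
    obtain ⟨n, ⟨hn, hn'⟩, h'⟩ := Subst.mem_image.1 h'
    rw [fn_par, Set.union_comm] at hn
    exact key n hn hn' a ha h'

theorem IsLift.tau {X : Set Name} {Ψs Ψ : 𝔓.Assn} {σ : Subst 𝔓.Term} {P P₁ : Agent 𝔓}
    {C : TransConstraint 𝔓} (h : SymTrans Ψs P .tau C P₁) (hC : C.Sat σ Ψ) :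
    IsLift X Ψs σ Ψ P .tau (P₁.subst σ) .tau C P₁ σ where
  trans := h
  eq_of_notMem _ _ := rfl
  length_eq := rfl
  bn_notMem _ ha := absurd ha List.not_mem_nil
  subj_notMem _ hy := absurd hy (by simp [Action.symSubj])
  action_eq := rfl
  sat := hC
  agent_eq := by rw [Action.bnList, Action.bnList, Subst.bind_nil]
  nodup := List.nodup_nil
  bn_notMem_subst _ ha := absurd ha List.not_mem_nil

theorem HasLifts.comL {X : Set Name} (hX : X.Finite) {Ψ : 𝔓.Assn} {P Q : Agent 𝔓}
    {bP bQ : List Name} {ΨP ΨQ : 𝔓.Assn} {M K N : 𝔓.Term} {as : List Name} {x : Name}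
    {P' Q' : Agent 𝔓} (hfP : (bP, ΨP) ∈ P.frame) (hfQ : (bQ, ΨQ) ∈ Q.frame) (hdP : bP.Nodup)
    (hdQ : bQ.Nodup) (hPX : ∀ b ∈ bP, b ∉ X) (hQX : ∀ b ∈ bQ, b ∉ X)
    (hbP : ∀ b ∈ bP, b ∉ bQ ∧ b ∉ supp M) (hbQ : ∀ b ∈ bQ, b ∉ supp K)
    (ihP : ∀ Y : Set Name, Y.Finite → HasLifts Y (𝔓.comp ΨQ Ψ) P (.out M as N) P')
    (ihQ : ∀ Y : Set Name, Y.Finite → HasLifts Y (𝔓.comp ΨP Ψ) Q (.inp K x) Q')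
    (hent : 𝔓.entails (𝔓.comp (𝔓.comp Ψ ΨP) ΨQ) (𝔓.chanEq M K)) (has : ∀ a ∈ as, a ∉ Q.fn) :
    HasLifts X Ψ (P.par Q) .tau (Agent.resList as (P'.par (Q'.subst1 N x))) := by
  intro Ψs σ Ψ₀ P₀ hΨs hσ hΨ hP hW he hc
  obtain ⟨P₀, Q₀, rfl, rfl, rfl⟩ := Agent.subst_eq_par he.symm
  rw [Agent.fn_par, Set.union_subset_iff] at hP
  rw [Agent.wf_par] at hW
  obtain ⟨ΦP, hΦP, rfl⟩ := Agent.exists_of_mem_frame_subst hfP hdP fun b h =>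
    ⟨fun h' => hPX b h (hP.1 h'), fun h' => hPX b h (hσ h')⟩
  obtain ⟨ΦQ, hΦQ, rfl⟩ := Agent.exists_of_mem_frame_subst hfQ hdQ fun b h =>
    ⟨fun h' => hQX b h (hP.2 h'), fun h' => hQX b h (hσ h')⟩
  obtain ⟨Y, hYfin, hXY, hYP, hYQ, hYbP, hYbQ⟩ : ∃ Y : Set Name, Y.Finite ∧ X ⊆ Y ∧
      supp ΦP ⊆ Y ∧ supp ΦQ ⊆ Y ∧ (∀ n ∈ bP, n ∈ Y) ∧ ∀ n ∈ bQ, n ∈ Y := by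
    refine ⟨X ∪ (supp ΦP ∪ (supp ΦQ ∪ ({n | n ∈ bP} ∪ {n | n ∈ bQ}))), hX.union
      ((supp_finite _).union ((supp_finite _).union (bP.finite_toSet.union bQ.finite_toSet))),
      ?_, ?_, ?_, ?_, ?_⟩ <;> intro n hn <;> simp [hn]
  obtain ⟨αs, CP, P₁, σP, LP⟩ := ihP Y hYfin (𝔓.comp Ψs ΦQ) σ Ψ₀ P₀
    ((supp_comp_subset _ _).trans (Set.union_subset (hΨs.trans hXY) hYQ)) (hσ.trans hXY)
    (hΨ.trans hXY) (hP.1.trans hXY) hW.1 rfl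
    (by simp only [assnClass_comp, hc, 𝔓.subst_comp, mul_comm, mul_assoc])
  obtain ⟨y, as₀, N₀, rfl, rfl, hN⟩ := Action.inst_eq_out LP.action_eq
  replace hN : N = subst N₀ (σP.bind as₀ as) := hN
  have hYZ : Y ⊆ Y ∪ ({y} ∪ ({n | n ∈ as₀} ∪ supp N₀)) := Set.subset_union_left
  -- The second premise is lifted only after the first, so that its subject also avoids the first
  -- subject, the bound names and the object; this yields the freshness conditions of the symbolic
  -- rule.
  obtain ⟨βs, CQ, Q₁, σQ, LQ⟩ := ihQ (Y ∪ ({y} ∪ ({n | n ∈ as₀} ∪ supp N₀)))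
    (hYfin.union ((Set.finite_singleton y).union (as₀.finite_toSet.union (supp_finite N₀))))
    (𝔓.comp Ψs ΦP) σ Ψ₀ Q₀
    ((supp_comp_subset _ _).trans (Set.union_subset ((hΨs.trans hXY).trans hYZ)
      (Set.Subset.trans hYP hYZ))) ((hσ.trans hXY).trans hYZ) ((hΨ.trans hXY).trans hYZ)
    ((hP.2.trans hXY).trans hYZ) hW.2 rfl
    (by simp only [assnClass_comp, hc, 𝔓.subst_comp, mul_comm, mul_assoc])
  obtain ⟨z, x₀, rfl, rfl⟩ := Action.inst_eq_inp LQ.action_eq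
  have hy := LP.subj_notMem y rfl
  have hz := (LQ.subj_notMem z rfl).1
  simp only [Set.mem_union, not_or, Set.mem_singleton_iff, Set.mem_ofPred_eq] at hz
  obtain ⟨dP, dQ, cP, cQ, Ψ₁, Ψ₂, MP, MQ, CP', CQ', k1, k2, rfl, rfl, k3, k4, k5, k6, k7⟩ :=
    LP.com (as := as₀) (N := N₀) LQ hW.1 hW.2 rfl rfl hΦP hΦQ hdP hdQ hX hΨs hσ hΨ hP.1 hP.2
    (fun b hb => ⟨hPX b hb, hbP b hb⟩) (fun b hb => ⟨hQX b hb, hbQ b hb⟩)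
    ⟨fun h => hy.1 (hXY h), fun h => hy.1 (hYbP y h), fun h => hy.1 (hYbQ y h), hy.2, fun h =>
      (LP.trans.names.2.1 y h).elim (fun h => hy.1 (hXY (hP.1 h))) hy.2⟩
    ⟨fun h => hz.1 (hXY h), fun h => hz.1 (hYbP z h), fun h => hz.1 (hYbQ z h), hz.2.2⟩ hc hent
  have has₀ : ∀ a ∈ as₀, a ∉ Q₀.fn := fun a ha h => LP.bn_notMem a ha (hXY (hP.2 h))
  have e := (Agent.subst_com (P := P₁) (Q := Q₁) (σ := σ) (as₀ := as₀) (as := as) (N := N₀)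
    (x₀ := x₀) (x := x) LP.length_eq LP.nodup (fun n hn hn' a ha => LP.bn_notMem_subst a ha n hn hn')
    fun n hn hx => ?_).1
  · rw [LP.agent_eq, LQ.agent_eq, hN]
    simp only [Action.bnList]
    rw [Agent.subst_congr (P := P₁) (τ := σ.bind as₀ as) fun n hn =>
        Subst.bind_congr fun _ => LP.eq_on_agent (hP.1.trans hXY) (Or.inl hn),
      Agent.subst_congr (P := Q₁) (τ := σ.bind [x₀] [x]) fun n hn =>
        Subst.bind_congr fun _ => LQ.eq_on_agent ((hP.2.trans hXY).trans hYZ) (Or.inl hn),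
      subst_congr_supp (x := N₀) (τ := σ.bind as₀ as) fun n hn =>
        Subst.bind_congr fun _ => LP.eq_on_agent (hP.1.trans hXY) (Or.inr hn), ← e]
    -- A silent action has no subject, so the solution is `σ` itself: both symbolic subjects have
    -- been eliminated.
    exact ⟨.tau, _, _, σ, .tau (.comL Ψs P₀ Q₀ k1 k2 LP.trans LQ.trans k3 k4 k5 k6
      (fun h => hz.2.1 h.symm) has₀) k7⟩
  · have hnQ : n ∈ Q₀.fn := (LQ.trans.names.1 n hn).resolve_right (by simpa [Action.bnList] using hx)
    refine ⟨fun h => has₀ n h hnQ, LQ.bn_notMem_subst x (List.mem_singleton_self x) n (Or.inl hn)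
      (by simpa [Action.bnList] using hx), fun a ha h => has a ha ?_⟩
    rw [Agent.fn_subst]
    exact Subst.mem_image.2 ⟨n, hnQ, h⟩

theorem HasLifts.comR {X : Set Name} (hX : X.Finite) {Ψ : 𝔓.Assn} {P Q : Agent 𝔓}
    {bP bQ : List Name} {ΨP ΨQ : 𝔓.Assn} {M K N : 𝔓.Term} {as : List Name} {x : Name}
    {P' Q' : Agent 𝔓} (hfP : (bP, ΨP) ∈ P.frame) (hfQ : (bQ, ΨQ) ∈ Q.frame) (hdP : bP.Nodup)
    (hdQ : bQ.Nodup) (hPX : ∀ b ∈ bP, b ∉ X) (hQX : ∀ b ∈ bQ, b ∉ X)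
    (hbP : ∀ b ∈ bP, b ∉ bQ ∧ b ∉ supp K) (hbQ : ∀ b ∈ bQ, b ∉ supp M)
    (ihP : ∀ Y : Set Name, Y.Finite → HasLifts Y (𝔓.comp ΨQ Ψ) P (.inp K x) P')
    (ihQ : ∀ Y : Set Name, Y.Finite → HasLifts Y (𝔓.comp ΨP Ψ) Q (.out M as N) Q')
    (hent : 𝔓.entails (𝔓.comp (𝔓.comp Ψ ΨP) ΨQ) (𝔓.chanEq M K)) (has : ∀ a ∈ as, a ∉ P.fn) :
    HasLifts X Ψ (P.par Q) .tau (Agent.resList as ((P'.subst1 N x).par Q')) := by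
  intro Ψs σ Ψ₀ P₀ hΨs hσ hΨ hP hW he hc
  obtain ⟨P₀, Q₀, rfl, rfl, rfl⟩ := Agent.subst_eq_par he.symm
  rw [Agent.fn_par, Set.union_subset_iff] at hP
  rw [Agent.wf_par] at hW
  obtain ⟨ΦP, hΦP, rfl⟩ := Agent.exists_of_mem_frame_subst hfP hdP fun b h =>
    ⟨fun h' => hPX b h (hP.1 h'), fun h' => hPX b h (hσ h')⟩
  obtain ⟨ΦQ, hΦQ, rfl⟩ := Agent.exists_of_mem_frame_subst hfQ hdQ fun b h =>
    ⟨fun h' => hQX b h (hP.2 h'), fun h' => hQX b h (hσ h')⟩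
  obtain ⟨Y, hYfin, hXY, hYP, hYQ, hYbP, hYbQ⟩ : ∃ Y : Set Name, Y.Finite ∧ X ⊆ Y ∧
      supp ΦP ⊆ Y ∧ supp ΦQ ⊆ Y ∧ (∀ n ∈ bP, n ∈ Y) ∧ ∀ n ∈ bQ, n ∈ Y := by
    refine ⟨X ∪ (supp ΦP ∪ (supp ΦQ ∪ ({n | n ∈ bP} ∪ {n | n ∈ bQ}))), hX.union
      ((supp_finite _).union ((supp_finite _).union (bP.finite_toSet.union bQ.finite_toSet))),
      ?_, ?_, ?_, ?_, ?_⟩ <;> intro n hn <;> simp [hn]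
  obtain ⟨βs, CQ, Q₁, σQ, LQ⟩ := ihQ Y hYfin (𝔓.comp Ψs ΦP) σ Ψ₀ Q₀
    ((supp_comp_subset _ _).trans (Set.union_subset (hΨs.trans hXY) hYP)) (hσ.trans hXY)
    (hΨ.trans hXY) (hP.2.trans hXY) hW.2 rfl
    (by simp only [assnClass_comp, hc, 𝔓.subst_comp, mul_comm, mul_assoc])
  obtain ⟨y, as₀, N₀, rfl, rfl, hN⟩ := Action.inst_eq_out LQ.action_eq
  replace hN : N = subst N₀ (σQ.bind as₀ as) := hN
  have hYZ : Y ⊆ Y ∪ ({y} ∪ ({n | n ∈ as₀} ∪ supp N₀)) := Set.subset_union_left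
  obtain ⟨αs, CP, P₁, σP, LP⟩ := ihP (Y ∪ ({y} ∪ ({n | n ∈ as₀} ∪ supp N₀)))
    (hYfin.union ((Set.finite_singleton y).union (as₀.finite_toSet.union (supp_finite N₀))))
    (𝔓.comp Ψs ΦQ) σ Ψ₀ P₀
    ((supp_comp_subset _ _).trans (Set.union_subset ((hΨs.trans hXY).trans hYZ)
      (Set.Subset.trans hYQ hYZ))) ((hσ.trans hXY).trans hYZ) ((hΨ.trans hXY).trans hYZ)
    ((hP.1.trans hXY).trans hYZ) hW.1 rfl
    (by simp only [assnClass_comp, hc, 𝔓.subst_comp, mul_comm, mul_assoc])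
  obtain ⟨z, x₀, rfl, rfl⟩ := Action.inst_eq_inp LP.action_eq
  have hy := LQ.subj_notMem y rfl
  have hz := (LP.subj_notMem z rfl).1
  simp only [Set.mem_union, not_or, Set.mem_singleton_iff, Set.mem_ofPred_eq] at hz
  obtain ⟨dP, dQ, cP, cQ, Ψ₁, Ψ₂, MP, MQ, CP', CQ', k1, k2, rfl, rfl, k3, k4, k5, k6, k7⟩ :=
    LP.com (as := as₀) (N := N₀) LQ hW.1 hW.2 rfl rfl hΦP hΦQ hdP hdQ hX hΨs hσ hΨ hP.1 hP.2
    (fun b hb => ⟨hPX b hb, hbP b hb⟩) (fun b hb => ⟨hQX b hb, hbQ b hb⟩)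
    ⟨fun h => hz.1 (hXY h), fun h => hz.1 (hYbP z h), fun h => hz.1 (hYbQ z h), hz.2.2⟩
    ⟨fun h => hy.1 (hXY h), fun h => hy.1 (hYbP y h), fun h => hy.1 (hYbQ y h), hy.2, fun h =>
      (LQ.trans.names.2.1 y h).elim (fun h => hy.1 (hXY (hP.2 h))) hy.2⟩ hc (𝔓.chan_symm _ _ _ hent)
  have has₀ : ∀ a ∈ as₀, a ∉ P₀.fn := fun a ha h => LQ.bn_notMem a ha (hXY (hP.1 h))
  have e := (Agent.subst_com (P := Q₁) (Q := P₁) (σ := σ) (as₀ := as₀) (as := as) (N := N₀)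
    (x₀ := x₀) (x := x) LQ.length_eq LQ.nodup (fun n hn hn' a ha => LQ.bn_notMem_subst a ha n hn hn')
    fun n hn hx => ?_).2
  · rw [LP.agent_eq, LQ.agent_eq, hN]
    simp only [Action.bnList]
    rw [Agent.subst_congr (P := Q₁) (τ := σ.bind as₀ as) fun n hn =>
        Subst.bind_congr fun _ => LQ.eq_on_agent (hP.2.trans hXY) (Or.inl hn),
      Agent.subst_congr (P := P₁) (τ := σ.bind [x₀] [x]) fun n hn =>
        Subst.bind_congr fun _ => LP.eq_on_agent ((hP.1.trans hXY).trans hYZ) (Or.inl hn),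
      subst_congr_supp (x := N₀) (τ := σ.bind as₀ as) fun n hn =>
        Subst.bind_congr fun _ => LQ.eq_on_agent (hP.2.trans hXY) (Or.inr hn), ← e]
    exact ⟨.tau, _, _, σ, .tau (.comR Ψs P₀ Q₀ k1 k2 LP.trans LQ.trans k3 k4 k5 k6
      (fun h => hz.2.1 h.symm) has₀) k7⟩
  · have hnP : n ∈ P₀.fn := (LP.trans.names.1 n hn).resolve_right (by simpa [Action.bnList] using hx)
    refine ⟨fun h => has₀ n h hnP, LP.bn_notMem_subst x (List.mem_singleton_self x) n (Or.inl hn)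
      (by simpa [Action.bnList] using hx), fun a ha h => has a ha ?_⟩
    rw [Agent.fn_subst]
    exact Subst.mem_image.2 ⟨n, hnP, h⟩

theorem Trans.hasLifts {Ψ : 𝔓.Assn} {P P' : Agent 𝔓} {α : Action 𝔓.Term 𝔓.Term}
    (h : Trans Ψ P α P') {X : Set Name} (hX : X.Finite) : HasLifts X Ψ P α P' := by
  refine Trans.strong_induction (Claim := HasLifts) (fun hX _ _ _ _ _ h => .inp hX h)
    (fun hX _ _ _ _ _ h => .out hX h) (fun hX _ _ _ _ _ _ _ ih h => .case hX ih h)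
    (fun hX _ _ _ _ _ _ _ _ _ _ _ _ _ _ h1 h2 h3 h4 h5 h6 h7 h8 h9 h10 h11 h12 =>
      .comL hX h1 h2 h3 h4 h5 h6 h7 h8 h9 h10 h11 h12)
    (fun hX _ _ _ _ _ _ _ _ _ _ _ _ _ _ h1 h2 h3 h4 h5 h6 h7 h8 h9 h10 h11 h12 =>
      .comR hX h1 h2 h3 h4 h5 h6 h7 h8 h9 h10 h11 h12)
    (fun hX _ _ _ _ _ _ _ h1 h2 h3 h4 h5 => .parL hX h1 h2 h3 h4 h5)
    (fun hX _ _ _ _ _ _ _ h1 h2 h3 h4 h5 => .parR hX h1 h2 h3 h4 h5)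
    (fun hX _ _ _ _ _ h1 h2 h3 => .scope hX h1 h2 h3)
    (fun hX _ _ _ _ _ _ _ _ h1 h2 h3 h4 h5 => .opn hX h1 h2 h3 h4 h5)
    (fun {X} hX _ _ _ _ ih => .rep (ih X hX))
    (fun _ _ _ _ _ _ _ _ _ h1 h2 h3 h4 h5 => .alphaOut h1 h2 h3 h4 h5)
    (fun _ _ _ _ _ _ _ h1 h2 => .alphaInp h1 h2) h hX

/-! ## Soundness -/

/-- Exchanges the bound names of an output one at a time: `pre` holds those already replaced, and
`e` is turned into `as`. The names `as` avoid all current ones, so every single renaming is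
legitimate. -/
theorem Trans.rename_out {Ψ : 𝔓.Assn} {P P₁ : Agent 𝔓} {M N : 𝔓.Term} {σ : Subst 𝔓.Term}
    {as₀ : List Name} : ∀ pre e as : List Name, as.length = e.length →
    (pre ++ e).length = as₀.length → (pre ++ e).Nodup → as.Nodup → (∀ c ∈ as, c ∉ pre ++ e) →
    (∀ m, m ∈ pre ++ e ∨ m ∈ as → ∀ n, n ∈ P₁.fn ∨ n ∈ supp N → n ∉ as₀ → m ∉ supp (σ n)) →
    Trans Ψ P (.out M (pre ++ e) (subst N (σ.bind as₀ (pre ++ e))))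
      (P₁.subst (σ.bind as₀ (pre ++ e))) →
    Trans Ψ P (.out M (pre ++ as) (subst N (σ.bind as₀ (pre ++ as))))
      (P₁.subst (σ.bind as₀ (pre ++ as)))
  | pre, [], [], _, _, _, _, _, _, t => t
  | pre, a :: e, [], hl, _, _, _, _, _, _ => by simp at hl
  | pre, [], c :: as, hl, _, _, _, _, _, _ => by simp at hl
  | pre, a :: e, c :: as, hl, hl', hd, hd', hc, hσ, t => by
    have hcl := hc c List.mem_cons_self
    have hal : a ∈ pre ++ a :: e := by simp
    have hmap : (pre ++ a :: e).map (Equiv.swap a c) = pre ++ [c] ++ e := by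
      have h1 : ∀ l : List Name, a ∉ l → c ∉ l → l.map (Equiv.swap a c) = l := fun l h h' =>
        (List.map_congr_left fun n hn => Equiv.swap_apply_of_ne_of_ne (fun h'' : n = a => h (h'' ▸ hn))
          fun h'' : n = c => h' (h'' ▸ hn)).trans (List.map_id l)
      rw [List.nodup_middle, List.nodup_cons, List.mem_append, not_or] at hd
      simp only [List.mem_append, List.mem_cons, not_or] at hcl
      rw [List.map_append, List.map_cons, h1 _ hd.1.1 hcl.1, h1 _ hd.1.2 hcl.2.2,
        Equiv.swap_apply_left, List.append_assoc, List.singleton_append]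
    have hτ : ∀ n, n ∈ P₁.fn ∨ n ∈ supp N → σ.bind as₀ (pre ++ [c] ++ e) n =
        Equiv.swap a c • σ.bind as₀ (pre ++ a :: e) n := fun n hn => by
      rw [← hmap]
      exact Subst.bind_map_right σ hl' fun hn' =>
        ⟨hσ a (Or.inl hal) n hn hn', hσ c (Or.inr List.mem_cons_self) n hn hn'⟩
    have hcs : ∀ n, n ∈ P₁.fn ∨ n ∈ supp N → c ∉ supp (σ.bind as₀ (pre ++ a :: e) n) := by
      intro n hn h'
      by_cases hna : n ∈ as₀
      · rw [Subst.bind_of_mem _ hna, supp_ofName] at h'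
        obtain rfl : c = _ := h'
        exact hcl (listMap_mem hna hl')
      · rw [Subst.bind_of_notMem _ hna] at h'
        exact hσ c (Or.inr List.mem_cons_self) n hn hna h'
    have t' := t.alphaOut a c hal hcl
      (fun h => by
        rw [supp_subst] at h
        obtain ⟨n, hn, h⟩ := Subst.mem_image.1 h
        exact hcs n (Or.inr hn) h)
      (fun h => by
        rw [Agent.fn_subst] at h
        obtain ⟨n, hn, h⟩ := Subst.mem_image.1 h
        exact hcs n (Or.inl hn) h)
    rw [hmap, smul_subst_eq fun n hn => hτ n (Or.inr hn),
      Agent.perm_subst fun n hn => hτ n (Or.inl hn)] at t'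
    have := rename_out (pre ++ [c]) e as (by simpa using hl) (by simpa using hl')
      (hmap ▸ hd.map (Equiv.injective _)) (List.nodup_cons.1 hd').2 (fun m hm h => ?_)
      (fun m hm => hσ m ?_) t'
    · simpa using this
    · have h1 := hc m (List.mem_cons_of_mem _ hm)
      have h2 : m ≠ c := fun h => (List.nodup_cons.1 hd').1 (h ▸ hm)
      simp only [List.mem_append, List.mem_cons, not_or, List.not_mem_nil, or_false] at h h1
      tauto
    · simp only [List.mem_append, List.mem_cons, List.not_mem_nil, or_false] at hm ⊢
      tauto

/-- Instances of symbolic transitions, with arbitrary bound names that are fresh for the agent. -/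
theorem SymTrans.exists_trans {Ψ : 𝔓.Assn} {P P₁ : Agent 𝔓} {α : Action Name 𝔓.Term}
    {C : TransConstraint 𝔓} {σ : Subst 𝔓.Term} (h : SymTrans 𝔓.unit P α C P₁) (hC : C.Sat σ Ψ)
    {as : List Name} (hl : as.length = α.bnList.length) (hd : as.Nodup)
    (has : ∀ a ∈ as, a ∉ (P.subst σ).fn) :
    Trans Ψ (P.subst σ) (α.inst σ as) (P₁.subst (σ.bind α.bnList as)) := by
  have hX : (P.fn ∪ α.symSubj).Finite := P.fn_finite.union (by
    cases α with
    | out y as N => exact Set.finite_singleton y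
    | inp y x => exact Set.finite_singleton y
    | tau => exact Set.finite_empty)
  -- The given bound names may clash with the environment or the subject, which the instantiation
  -- theorem excludes. It is applied to fresh names `e`, disjoint from the given ones, which are
  -- then renamed.
  obtain ⟨e, e1, e2, e3⟩ := exists_fresh_list ((supp_finite Ψ).union ((σ.image_finite hX).union
    as.finite_toSet)) α.bnList.length
  simp only [Set.mem_union, not_or, Set.mem_ofPred_eq] at e3
  have he : ∀ a ∈ e, ∀ n, n ∈ P.fn ∨ n ∈ α.symSubj → a ∉ supp (σ n) := fun a ha n hn h' =>
    (e3 a ha).2.1 (Subst.mem_image.2 ⟨n, hn, h'⟩)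
  have t := h.instantiable (σ := σ) (Ψ := Ψ) (Ψc := Ψ) (e := e)
    (by rw [assnClass_comp, 𝔓.subst_unit, assnClass_unit, one_mul]) hC e1 e2 fun a ha =>
      ⟨(e3 a ha).1, (e3 a ha).1, fun n hn => he a ha n (hn.resolve_left (by simp [supp_unit]))⟩
  have hfresh : ∀ m, m ∈ e ∨ m ∈ as → ∀ n ∈ P.fn, m ∉ supp (σ n) := by
    rintro m (hm | hm) n hn
    · exact he m hm n (Or.inl hn)
    · intro h'
      refine has m hm ?_
      rw [Agent.fn_subst]
      exact Subst.mem_image.2 ⟨n, hn, h'⟩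
  cases α with
  | out y as₀ N =>
    refine Trans.rename_out [] e as (hl.trans e1.symm) e1 e2 hd (fun c hc hc' => (e3 c hc').2.2 hc)
      (fun m hm n hn hn' => hfresh m hm n ?_) t
    exact hn.elim (fun hn => (h.names.1 n hn).resolve_right hn')
      fun hn => (h.names.2.1 n hn).resolve_right hn'
  | inp y x₀ =>
    obtain ⟨x, rfl⟩ := List.length_eq_one_iff.1 hl
    obtain ⟨x', rfl⟩ := List.length_eq_one_iff.1 e1
    have hnames : ∀ n ∈ P₁.fn, n ∉ [x₀] → n ∈ P.fn := fun n hn hn' =>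
      (h.names.1 n hn).resolve_right hn'
    have t' := t.alphaInp (c := x) fun h' => by
      rw [Agent.fn_subst] at h'
      obtain ⟨n, hn, h'⟩ := Subst.mem_image.1 h'
      by_cases hnx : n ∈ [x₀]
      · simp only [Action.bnList] at h'
        rw [Subst.bind_of_mem _ hnx, supp_ofName] at h'
        obtain rfl : x = _ := h'
        exact (e3 _ (listMap_mem hnx rfl)).2.2 (List.mem_singleton_self _)
      · simp only [Action.bnList] at h'
        rw [Subst.bind_of_notMem _ hnx] at h'
        exact hfresh x (Or.inr (List.mem_singleton_self x)) n (hnames n hn hnx) h'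
    simp only [Action.bnList] at t'
    rw [Agent.perm_subst fun n hn => Subst.bind_map_right (c := [x₀]) (e := [x']) (b := x) σ rfl
      fun hn' => ⟨hfresh _ (Or.inl ?_) n (hnames n hn hn'),
        hfresh _ (Or.inr (List.mem_singleton_self x)) n (hnames n hn hn')⟩] at t'
    · simpa [Action.inst, Action.bnList, listMap] using t'
    · simp [listMap]
  | tau =>
    obtain rfl := List.length_eq_zero_iff.1 e1
    obtain rfl := List.length_eq_zero_iff.1 hl
    exact t

/-- Matching transitions of symbolically bisimilar agents, for the solutions of the matched
constraint that instantiate the bound names of the symbolic action in an arbitrary way. -/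
theorem IsSymbolicBisimulation.exists_match
    {S : Constraint 𝔓 → Agent 𝔓 → Agent 𝔓 → Prop} (hS : IsSymbolicBisimulation S)
    {C : Constraint 𝔓} {P Q P'' : Agent 𝔓} (hPQ : S C P Q) {σ : Subst 𝔓.Term} {Ψ : 𝔓.Assn}
    (hC : C.Sat σ Ψ) {α : Action 𝔓.Term 𝔓.Term} (ht : Trans Ψ (P.subst σ) α P'')
    (hα : ∀ a ∈ α.bnList, a ∉ (Q.subst σ).fn) :
    ∃ (αs : Action Name 𝔓.Term) (P₁ : Agent 𝔓) (σ' : Subst 𝔓.Term),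
      α.bnList.length = αs.bnList.length ∧ α = αs.inst σ' α.bnList ∧
      P'' = P₁.subst (σ'.bind αs.bnList α.bnList) ∧
      (∀ n ∈ P₁.fn, n ∉ αs.bnList → ∀ a ∈ α.bnList, a ∉ supp (σ' n)) ∧
      ∀ σ'', (∀ n ∉ αs.bnList, σ'' n = σ' n) →
        ((∀ y x, αs ≠ .inp y x) → σ'' = σ'.bind αs.bnList α.bnList) →
        ∃ D Q₁, D.Sat σ'' Ψ ∧ S D P₁ Q₁ ∧
          (∀ n ∈ Q₁.fn, n ∉ αs.bnList → ∀ a ∈ α.bnList, a ∉ supp (σ' n)) ∧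
          Trans Ψ (Q.subst σ) α (Q₁.subst (σ'.bind αs.bnList α.bnList)) := by
  obtain ⟨hP, -, -, -, hsim⟩ := hS C P Q hPQ
  have hXfin : (P.fn ∪ (Q.fn ∪ (C.fn ∪ (σ.support ∪ supp Ψ)))).Finite := P.fn_finite.union
    (Q.fn_finite.union (C.fn_finite.union (σ.support_finite.union (supp_finite Ψ))))
  obtain ⟨X, hXfin, hPX, hQX, hCX, hσX, hΨX⟩ : ∃ X : Set Name, X.Finite ∧ P.fn ⊆ X ∧ Q.fn ⊆ X ∧
      C.fn ⊆ X ∧ σ.support ⊆ X ∧ supp Ψ ⊆ X := by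
    refine ⟨_, hXfin, ?_, ?_, ?_, ?_, ?_⟩ <;> intro n hn <;> simp [hn]
  obtain ⟨αs, CP, P₁, σ', L⟩ := ht.hasLifts hXfin 𝔓.unit σ Ψ P (by simp [supp_unit]) hσX hΨX hPX hP
    rfl (by rw [assnClass_comp, 𝔓.subst_unit, assnClass_unit, one_mul])
  have hfix : ∀ n ∈ X, σ' n = σ n := fun n hn =>
    L.eq_of_notMem n fun h => (L.subj_notMem n h).1 hn
  have hbnX : ∀ n ∈ X, n ∉ αs.bnList := fun n hn h => L.bn_notMem n h hn
  have hsubj : ∀ a ∈ αs.bnList, αs.symSubj.Nonempty := by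
    intro a ha
    cases αs with
    | out y as N => exact ⟨y, rfl⟩
    | inp y x => exact ⟨y, rfl⟩
    | tau => exact absurd ha List.not_mem_nil
  -- The symbolic bound names occur in neither transition constraint, so solutions may be changed at
  -- them. An action with bound names has a subject, so the description of the constraint's names
  -- applies.
  have hconstr : ∀ {R R' : Agent 𝔓} {β : Action Name 𝔓.Term} {D : TransConstraint 𝔓},
      SymTrans 𝔓.unit R β D R' → R.fn ⊆ X → β.symSubj = αs.symSubj → ∀ a ∈ αs.bnList,
      a ∉ (Constraint.ofTrans D).fn := by
    intro R R' β D h hR hβ a ha h'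
    obtain ⟨y, hy⟩ := hsubj a ha
    obtain ⟨A, B, rfl, h1, h2⟩ := h.fn_constraint (hβ ▸ hy)
    obtain ⟨A', hA', h3⟩ := Constraint.mem_fn_ofTrans.1 h'
    rw [supp_unit] at h1 h2
    rcases List.mem_cons.1 hA' with rfl | hA'
    · rcases h1 a h3 with rfl | h3 | h3
      exacts [(L.subj_notMem a hy).2 ha, h3, L.bn_notMem a ha (hR h3)]
    · exact (h2 A' hA' a h3).elim id fun h3 => L.bn_notMem a ha (hR h3)
  obtain ⟨Ds, hDs, hmatch⟩ := hsim αs CP P₁ L.trans (fun a ha => by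
      rw [Action.mem_bn] at ha
      exact ⟨fun h => L.bn_notMem a ha (hPX h), fun h => L.bn_notMem a ha (hQX h),
        fun h => L.bn_notMem a ha (hCX h), hconstr L.trans hPX rfl a ha,
        fun h => (L.subj_notMem a h).2 ha⟩) fun y hy =>
      ⟨fun h => (L.subj_notMem y hy).1 (hPX h), fun h => (L.subj_notMem y hy).1 (hQX h),
        fun h => (L.subj_notMem y hy).1 (hCX h)⟩
  refine ⟨αs, P₁, σ', L.length_eq, L.action_eq, L.agent_eq, fun n hn hn' a ha => ?_,
    fun σ'' hσ'' hσα => ?_⟩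
  · rw [L.eq_on_agent hPX (Or.inl hn)]
    exact L.bn_notMem_subst a ha n (Or.inl hn) hn'
  have hfix'' : ∀ n ∈ X, σ'' n = σ n := fun n hn => (hσ'' n (hbnX n hn)).trans (hfix n hn)
  -- The disjunct is selected by the solution that already fixes the instances of the bound names,
  -- for an input the received term; this makes the matching early.
  obtain ⟨D, hD, hDsat⟩ := hDs σ'' Ψ (Constraint.sat_append.2
    ⟨(Constraint.sat_congr fun n hn => hfix'' n (hCX hn)).1 hC,
      (Constraint.sat_congr fun n hn => hσ'' n fun h => hconstr L.trans hPX rfl n h hn).1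
        (Constraint.sat_ofTrans.2 L.sat)⟩)
  obtain ⟨Q₁, β, CQ, hQ, hDQ, hβ⟩ := hmatch D hD
  have hQfix : Q.subst σ' = Q.subst σ := Agent.subst_congr fun n hn => hfix n (hQX hn)
  have key : β.symSubj = αs.symSubj → β.bnList = αs.bnList →
      Trans Ψ (Q.subst σ) (β.inst σ' α.bnList) (Q₁.subst (σ'.bind αs.bnList α.bnList)) ∧
      ∀ n ∈ Q₁.fn, n ∉ αs.bnList → ∀ a ∈ α.bnList, a ∉ supp (σ' n) := by
    intro h1 h2
    refine ⟨?_, fun n hn hn' a ha h' => hα a ha ?_⟩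
    -- The constraint of `Q` is solved by `σ''` through `D`, hence also by `σ'`, which keeps the
    -- input name uninstantiated in the transition.
    · have := hQ.exists_trans (σ := σ') (Ψ := Ψ) (as := α.bnList)
        (Constraint.sat_ofTrans.1 ((Constraint.sat_congr fun n hn =>
          hσ'' n fun h => hconstr hQ hQX h1 n h hn).2 (hDQ σ'' Ψ hDsat)))
        (h2 ▸ L.length_eq) L.nodup (hQfix ▸ hα)
      rwa [hQfix, h2] at this
    · rw [← hQfix, Agent.fn_subst]
      exact Subst.mem_image.2 ⟨n, (hQ.names.1 n hn).resolve_right (h2 ▸ hn'), h'⟩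
  cases αs with
  | out y as₀ N =>
    obtain ⟨N', rfl, hNN', hS'⟩ := hβ
    obtain ⟨k1, k2⟩ := key rfl rfl
    have hσ₂ : σ'' = σ'.bind as₀ α.bnList := hσα fun _ _ h => by simp at h
    refine ⟨_, Q₁, Constraint.sat_append.2 ⟨hDsat, fun B hB => ?_⟩, hS', k2, ?_⟩
    -- The added freshness constraints concern the symbolic bound names, not their instances. These
    -- names avoid the agents and `σ`, so they do not occur in the instances of the agents.
    · have hfr : ∀ {R : Agent 𝔓}, R.fn ⊆ X → ∀ a ∈ as₀, a ∉ (R.subst σ'').fn := by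
        intro R hR a ha h'
        rw [Agent.fn_subst] at h'
        obtain ⟨n, hn, h'⟩ := Subst.mem_image.1 h'
        rw [hfix'' n (hR hn)] at h'
        exact L.bn_notMem a ha
          (hR (Subst.eq_of_mem_supp (fun h => L.bn_notMem a ha (hσX h)) h' ▸ hn))
      obtain ⟨a, ha, hB⟩ := List.mem_flatMap.1 hB
      rcases List.mem_cons.1 hB with rfl | hB
      · exact hfr hPX a ha
      · obtain rfl := List.mem_singleton.1 hB
        exact hfr hQX a ha
    -- As `σ''` sends the symbolic bound names to the concrete ones, the equality constraint
    -- identifies the two instantiated objects, so `Q` performs exactly the given action.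
    · have h1 : subst N σ'' = subst N' σ'' := hNN' σ'' Ψ hDsat _ (List.mem_singleton_self _)
      have h2 : α = (Action.out y as₀ N').inst σ' α.bnList := L.action_eq.trans (by
        rw [hσ₂] at h1
        simp only [Action.inst, h1])
      rw [← h2] at k1
      exact k1
  | inp y x =>
    obtain ⟨rfl, hS'⟩ := hβ
    obtain ⟨k1, k2⟩ := key rfl rfl
    exact ⟨D, Q₁, hDsat, hS', k2, by rw [← L.action_eq] at k1; exact k1⟩
  | tau =>
    obtain ⟨rfl, hS'⟩ := hβ
    obtain ⟨k1, k2⟩ := key rfl rfl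
    exact ⟨D, Q₁, hDsat, hS', k2, by rw [← L.action_eq] at k1; exact k1⟩

theorem Agent.subst_bind_singleton_subst1 {P : Agent 𝔓} {σ : Subst 𝔓.Term} {x₀ x : Name}
    {L : 𝔓.Term} (h : ∀ n ∈ P.fn, n ∉ [x₀] → x ∉ supp (σ n)) :
    (P.subst (σ.bind [x₀] [x])).subst1 L x = P.subst (σ.update x₀ L) := by
  refine subst_subst fun n hn => ?_
  rw [Subst.bind_singleton]
  by_cases hnx : n = x₀
  · subst hnx
    rw [Subst.update_same, Subst.update_same, 𝔓.subst_ofName, Subst.single_same]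
  · rw [Subst.update_of_ne _ _ hnx, Subst.update_of_ne _ _ hnx]
    exact (SymPsi.subst_eq_self fun k hk => Subst.single_of_ne _ fun h' : k = x =>
      h n hn (by simpa using hnx) (h' ▸ hk)).symm

theorem IsSymbolicBisimulation.isBisimulation
    {S : Constraint 𝔓 → Agent 𝔓 → Agent 𝔓 → Prop} (hS : IsSymbolicBisimulation S) :
    IsBisimulation (fun (Ψ : 𝔓.Assn) (P' Q' : Agent 𝔓) =>
      ∃ (C : Constraint 𝔓) (σ : Subst 𝔓.Term) (P Q : Agent 𝔓),
        C.Sat σ Ψ ∧ S C P Q ∧ P' = P.subst σ ∧ Q' = Q.subst σ) := by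
  rintro Ψ _ _ ⟨C, σ, P, Q, hC, hPQ, rfl, rfl⟩
  obtain ⟨hP, hQ, hstat, hsymm, -⟩ := hS C P Q hPQ
  refine ⟨Agent.wf_subst.2 hP, Agent.wf_subst.2 hQ, ?_, ⟨C, σ, Q, P, hC, hsymm, rfl, rfl⟩,
    fun Ψ' => ⟨C, σ, P, Q, hC.weaken Ψ', hPQ, rfl, rfl⟩, fun α P'' hα ht => ?_⟩
  · rw [Agent.frame_subst, Agent.frame_subst]
    exact hstat σ Ψ hC
  obtain ⟨αs, P₁, σ', h1, h2, h3, h4, h5⟩ := hS.exists_match hPQ hC ht fun a ha =>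
    (hα a (Action.mem_bn.2 ha)).2
  cases α with
  | out M as N =>
    obtain ⟨D, Q₁, k1, k2, -, k4⟩ := h5 (σ'.bind αs.bnList as)
      (fun n hn => Subst.bind_of_notMem _ hn) fun _ => rfl
    exact ⟨_, k4, D, _, P₁, Q₁, k1, k2, h3, rfl⟩
  | inp M x =>
    obtain ⟨y, x₀, rfl, -⟩ := Action.inst_eq_inp h2
    intro T
    -- The received term is put in for the symbolic input name directly; since the concrete name `x`
    -- is fresh, replacing it by `T` in either derivative gives the same agent.
    obtain ⟨D, Q₁, k1, k2, k3, k4⟩ := h5 (σ'.update x₀ T)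
      (fun n hn => Subst.update_of_ne _ _ (by simpa [Action.bnList] using hn))
      fun h => absurd rfl (h y x₀)
    refine ⟨_, k4, D, _, P₁, Q₁, k1, k2, ?_, ?_⟩
    · rw [h3]
      exact Agent.subst_bind_singleton_subst1 fun n hn hn' => h4 n hn hn' x (List.mem_singleton_self x)
    · exact Agent.subst_bind_singleton_subst1 fun n hn hn' => k3 n hn hn' x (List.mem_singleton_self x)
  | tau =>
    obtain ⟨D, Q₁, k1, k2, -, k4⟩ := h5 (σ'.bind αs.bnList [])
      (fun n hn => Subst.bind_of_notMem _ hn) fun _ => rfl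
    exact ⟨_, k4, D, _, P₁, Q₁, k1, k2, h3, rfl⟩

end SymPsi

theorem mainTheorem2 (𝔓 : SymPsi.PsiCalculus.{u})
    (S : SymPsi.Constraint 𝔓 → SymPsi.Agent 𝔓 → SymPsi.Agent 𝔓 → Prop)
    (hS : SymPsi.IsSymbolicBisimulation S) :
    SymPsi.IsBisimulation (fun (Ψ : 𝔓.Assn) (P' Q' : SymPsi.Agent 𝔓) =>
      ∃ (C : SymPsi.Constraint 𝔓) (σ : SymPsi.Subst 𝔓.Term) (P Q : SymPsi.Agent 𝔓),
        C.Sat σ Ψ ∧ S C P Q ∧ P' = P.subst σ ∧ Q' = Q.subst σ) := by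
  exact hS.isBisimulation
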